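/- **Setting.** Let $\mathcal G\subseteq\mathbb R^n$ be open, $\delta,\sigma\in(0,1]$. For $U\subseteq\mathbb R^n$ and $\rho,\tau>0$ let $U_\rho=\bigcup_{I\in U}\{\hat I\in\mathbb C^n:\max_j|\hat I_j-I_j|<\rho\}$, $R_\tau=\{w\in\mathbb C:|\mathrm{Im}\,w|<\tau\}$, $\mathbb T^n_\tau=\{\varphi\in\mathbb C^n:|\mathrm{Im}\,\varphi_j|<\tau\ \forall j\}$ (functions of $\varphi$ being $2\pi$-periodic in each $\varphi_j$). Let $h(I)$ and $f(I,\varphi,\xi)$ be holomorphic and bounded on $\mathcal G_\delta$ and on $\mathcal G_\delta\times\mathbb T^n_{2\sigma}\times R_{2\sigma}$, let $C_f$ be the supremum of $|f|$ there, and for $\varepsilon,\mu\ge 0$ put $$H(I,\eta,\varphi,\xi)=h(I)+\mu\eta+\varepsilon f(I,\varphi,\xi),\qquad \tilde{\mathcal F}=C_f\Big(\frac{1+e^{-\sigma/2}}{1-e^{-\sigma/2}}\Big)^n,\qquad \lambda_{\varepsilon,\mu}=\mu+e\tilde{\mathcal F}\varepsilon .$$ Let $|k|=|k_1|+\dots+|k_n|$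 for $k\in\mathbb Z^n$. Let $\mathcal M\subseteq\mathbb Z^n$ be a resonance module, i.e. $\mathrm{span}_{\mathbb R}(\mathcal M)\cap\mathbb Z^n=\mathcal M$, let $r,K\in\mathbb N$, $\alpha>0$, and let $\mathcal V\subseteq\mathcal G$ be a non-resonance domain of type $(\mathcal M,\alpha,\delta,rK)$, i.e. $|\langle\partial_Ih(I),k\rangle|>\alpha$ for all $I\in\mathcal V_\delta$ and all $k\in\mathbb Z^n\setminus\mathcal M$ with $|k|<rK$. Write $\tilde{\mathcal D}_{a(\delta,\sigma)}=\mathcal V_{a\delta}\times R_{a\delta}\times\mathbb T^n_{a\sigma}\times R_{a\sigma}$ for points $z=(I,\eta,\varphi,\xi)$, and for a function $F(I,\varphi,\xi)$ with Fourier coefficients $F_k(I,\xi)$ let $\|F\|_{a(\delta,\sigma)}=\sum_{k\in\mathbb Z^n}\sup_{\mathcal V_{a\delta}\times R_{a\sigma}}|F_k|\,e^{|k|a\sigma}$. **Theorem (existence of a normal form).** Assume $e^{-K\sigma/2}\ge(8+3e^2)^{-1}$. There is a constant $c$, not depending on $\varepsilon,\mu$, such that for all $\varepsilon,\mu\ge0$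 with $$\Delta:=\frac{2^8r}{\alpha\delta\sigma}\lambda_{\varepsilon,\mu}+4e^{-K\sigma/2}\le\frac12$$ there is an analytic map $\mathcal C_r$ on $\tilde{\mathcal D}_{\frac34(\delta,\sigma)}$ with an analytic inverse $\mathcal C_r^{-1}$ that is also defined on $\tilde{\mathcal D}_{\frac34(\delta,\sigma)}$ (that is, $\mathcal C_r$ extends to the points $\mathcal C_r^{-1}(z)$, $\mathcal C_r^{-1}$ to the points $\mathcal C_r(z)$, and $\mathcal C_r(\mathcal C_r^{-1}(z))=z=\mathcal C_r^{-1}(\mathcal C_r(z))$ for $z\in\tilde{\mathcal D}_{\frac34(\delta,\sigma)}$), with the following properties. 1. $\mathcal C_r$ and $\mathcal C_r^{-1}$ preserve $\sum_j dI_j\wedge d\varphi_j+d\eta\wedge d\xi$, commute with the translations of $\varphi$ by $2\pi\mathbb Z^n$, satisfy $\|\mathcal C_r^{\pm1}(z)-z\|_\infty\le c\,\varepsilon$ on $\tilde{\mathcal D}_{\frac34(\delta,\sigma)}$, and map real points to real points if $h$ and $f$ are real on $\mathcal G$ and on $\mathcal G\times\mathbb R^n\times\mathbb R$ respectively. 2.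 $\tilde{\mathcal D}_{\frac58(\delta,\sigma)}\subseteq\mathcal C_r\tilde{\mathcal D}_{\frac34(\delta,\sigma)}\subseteq\tilde{\mathcal D}_{\frac78(\delta,\sigma)}$ and $\tilde{\mathcal D}_{\frac58(\delta,\sigma)}\subseteq\mathcal C_r^{-1}\tilde{\mathcal D}_{\frac34(\delta,\sigma)}\subseteq\tilde{\mathcal D}_{\frac78(\delta,\sigma)}$. 3. $\mathcal C_r$ is a Lie transform: there are $\chi_s=\sum_{|k|<sK}c^{(s)}_k(I,\xi)e^{ik\cdot\varphi}$, $1\le s\le r$, with holomorphic coefficients, and $\chi_s=0$ for $s>r$, such that $\mathcal C_r(z)=\sum_{s\ge0}(E_s\,\mathrm{id})(z)$ on $\tilde{\mathcal D}_{\frac34(\delta,\sigma)}$, where $E_0$ is the identity, $E_s=\frac1s\sum_{j=1}^s j\,\mathcal L_{\chi_j}E_{s-j}$, and $\mathcal L_\chi g=\{g,\chi\}=\sum_i(\partial_{\varphi_i}g\,\partial_{I_i}\chi-\partial_{I_i}g\,\partial_{\varphi_i}\chi)+\partial_\xi g\,\partial_\eta\chi-\partial_\eta g\,\partial_\xi\chi$.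 4. On $\tilde{\mathcal D}_{\frac34(\delta,\sigma)}$ $$H(\mathcal C_r(z))=h(I)+\mu\eta+Z^{(r)}(I,\varphi,\xi)+\mathcal R^{(r+1)}(I,\varphi,\xi),$$ where $Z^{(r)}=\sum_{k\in\mathcal M,\ |k|\le rK}z_k(I,\xi)e^{ik\cdot\varphi}$ with holomorphic $z_k$, and $\mathcal R^{(r+1)}$ is holomorphic with $$\|\mathcal R^{(r+1)}\|_{\frac34(\delta,\sigma)}\le 8\,\varepsilon\,\tilde{\mathcal F}\,\Delta^r .$$ -/

import Mathlib

open scoped ENNReal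

noncomputable section

namespace AperiodicNormalForm

variable {n : ℕ}

/-- Points `(I, η, φ, ξ)` of the complexified extended phase space; angles are taken on the
universal cover, so functions of the angles are required to be `2π`-periodic below. -/
abbrev Phase (n : ℕ) : Type := (Fin n → ℂ) × ℂ × (Fin n → ℂ) × ℂ

/-- Triples `(I, φ, ξ)`: arguments of the functions that do not depend on `η`. -/
abbrev Reduced (n : ℕ) : Type := (Fin n → ℂ) × (Fin n → ℂ) × ℂ

/-- Forget `η`. -/
def reduce (z : Phase n) : Reduced n := (z.1, z.2.2.1, z.2.2.2)

/-- Real vectors as complex vectors. -/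
def ofRealVec (x : Fin n → ℝ) : Fin n → ℂ := fun i => (x i : ℂ)

/-- `|k| = |k₁| + … + |kₙ|`. -/
def absSum (k : Fin n → ℤ) : ℕ := ∑ i, (k i).natAbs

/-- The character `exp (i k·φ)`. -/
def character (k : Fin n → ℤ) (φ : Fin n → ℂ) : ℂ :=
  Complex.exp (Complex.I * ∑ i, (k i : ℂ) * φ i)

/-! ### Complex domains -/

/-- The union over `I ∈ U` of the complex polydiscs of radius `ρ` centred at `I`
(`Fin n → ℂ` carries the maximum norm). -/
def actionNhd (U : Set (Fin n → ℝ)) (ρ : ℝ) : Set (Fin n → ℂ) :=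
  ⋃ I ∈ U, Metric.ball (ofRealVec I) ρ

/-- The strip `|Im w| < τ`. -/
def strip (τ : ℝ) : Set ℂ := {w | |w.im| < τ}

/-- The complexified torus `|Im φⱼ| < τ`, on the universal cover. -/
def angleStrip (n : ℕ) (τ : ℝ) : Set (Fin n → ℂ) := {φ | ∀ j, φ j ∈ strip τ}

/-- `U_ρ × R_ρ × T_τ × R_τ` in the variables `(I, η, φ, ξ)`. -/
def domain (U : Set (Fin n → ℝ)) (ρ τ : ℝ) : Set (Phase n) :=
  actionNhd U ρ ×ˢ strip ρ ×ˢ angleStrip n τ ×ˢ strip τ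

/-- `U_ρ × T_τ × R_τ` in the variables `(I, φ, ξ)`. -/
def reducedDomain (U : Set (Fin n → ℝ)) (ρ τ : ℝ) : Set (Reduced n) :=
  actionNhd U ρ ×ˢ angleStrip n τ ×ˢ strip τ

/-! ### Fourier expansions -/

/-- The Fourier coefficient `F_k(I, ξ) = (2π)⁻ⁿ ∫_{[0,2π]ⁿ} F(I, φ, ξ) exp (-i k·φ) dφ`. -/
def fourierCoefficient (F : Reduced n → ℂ) (k : Fin n → ℤ) (p : (Fin n → ℂ) × ℂ) : ℂ :=
  ((2 * Real.pi : ℝ) : ℂ)⁻¹ ^ n *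
    ∫ φ in Set.Icc (0 : Fin n → ℝ) (fun _ => 2 * Real.pi),
      F (p.1, ofRealVec φ, p.2) * character (-k) (ofRealVec φ)

/-- The Fourier norm `∑_k sup_{U_ρ × R_τ} |F_k| · exp (|k| τ)`, possibly infinite. -/
def fourierNorm (U : Set (Fin n → ℝ)) (ρ τ : ℝ) (F : Reduced n → ℂ) : ℝ≥0∞ :=
  ∑' k : Fin n → ℤ,
    (⨆ p ∈ actionNhd U ρ ×ˢ strip τ, ‖fourierCoefficient F k p‖ₑ) *
      ENNReal.ofReal (Real.exp (absSum k * τ))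

/-- `F = ∑_{k ∈ S} c_k(I, ξ) exp (i k·φ)` with holomorphic coefficients `c_k`. -/
def HasHarmonicsIn (S : Set (Fin n → ℤ)) (U : Set (Fin n → ℝ)) (ρ τ : ℝ)
    (F : Reduced n → ℂ) : Prop :=
  ∃ c : (Fin n → ℤ) → (Fin n → ℂ) × ℂ → ℂ,
    (∀ k ∈ S, AnalyticOnNhd ℂ (c k) (actionNhd U ρ ×ˢ strip τ)) ∧
    ∀ p ∈ reducedDomain U ρ τ,
      HasSum (fun k : S => c k (p.1, p.2.2) * character k p.2.1) (F p)

/-! ### The Hamiltonian and its parameters -/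

/-- Regularity of `h(I) + ε f(I, φ, ξ)`: both functions are holomorphic and bounded on the complex
neighbourhood with parameters `δ, 2σ`, and `f` is `2π`-periodic in every angle. -/
structure IsRegular (G : Set (Fin n → ℝ)) (δ σ : ℝ) (h : (Fin n → ℂ) → ℂ)
    (f : Reduced n → ℂ) : Prop where
  analytic_h : AnalyticOnNhd ℂ h (actionNhd G δ)
  bounded_h : ∃ B : ℝ, ∀ I ∈ actionNhd G δ, ‖h I‖ ≤ B
  analytic_f : AnalyticOnNhd ℂ f (reducedDomain G δ (2 * σ))
  bounded_f : ∃ B : ℝ, ∀ p ∈ reducedDomain G δ (2 * σ), ‖f p‖ ≤ B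
  periodic_f : ∀ p ∈ reducedDomain G δ (2 * σ), ∀ k : Fin n → ℤ,
    f (p.1, (fun j => p.2.1 j + 2 * Real.pi * k j), p.2.2) = f p

/-- `C_f`, the supremum of `|f|` on the complex neighbourhood with parameters `δ, 2σ`. -/
def supNorm (G : Set (Fin n → ℝ)) (δ σ : ℝ) (f : Reduced n → ℂ) : ℝ :=
  sSup ((fun p => ‖f p‖) '' reducedDomain G δ (2 * σ))

/-- `C_f ((1 + exp (-σ/2)) / (1 - exp (-σ/2)))ⁿ`. -/
def fTilde (G : Set (Fin n → ℝ)) (δ σ : ℝ) (f : Reduced n → ℂ) : ℝ :=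
  supNorm G δ σ f * ((1 + Real.exp (-σ / 2)) / (1 - Real.exp (-σ / 2))) ^ n

/-- `λ = μ + e F ε`. -/
def lambdaParam (F ε μ : ℝ) : ℝ := μ + Real.exp 1 * F * ε

/-- `Δ = 2⁸ r λ / (α δ σ) + 4 exp (-K σ / 2)`. -/
def deltaParam (r K : ℕ) (α δ σ lam : ℝ) : ℝ :=
  2 ^ 8 * r / (α * δ * σ) * lam + 4 * Real.exp (-(K * (σ / 2)))

/-- The extended Hamiltonian `h(I) + μ η + ε f(I, φ, ξ)`. -/
def hamiltonian (h : (Fin n → ℂ) → ℂ) (f : Reduced n → ℂ) (ε μ : ℝ) (z : Phase n) : ℂ :=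
  h z.1 + μ * z.2.1 + ε * f (reduce z)

/-! ### Resonances -/

/-- A set of integer vectors containing every integer vector of its real span. -/
def IsResonanceModule (M : Set (Fin n → ℤ)) : Prop :=
  {k : Fin n → ℤ | (fun i => (k i : ℝ)) ∈
    Submodule.span ℝ ((fun (k : Fin n → ℤ) (i : Fin n) => (k i : ℝ)) '' M)} = M

/-- The frequencies `ω = ∂h/∂I`. -/
def frequency (h : (Fin n → ℂ) → ℂ) (I : Fin n → ℂ) : Fin n → ℂ :=
  fun i => fderiv ℂ h I (Pi.single i 1)

/-- `V` is a non-resonance domain of type `(M, α, δ, N)` for the frequencies of `h`. -/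
def IsNonResonanceDomain (h : (Fin n → ℂ) → ℂ) (V : Set (Fin n → ℝ)) (M : Set (Fin n → ℤ))
    (α δ : ℝ) (N : ℕ) : Prop :=
  ∀ k : Fin n → ℤ, k ∉ M → absSum k < N →
    ∀ I ∈ actionNhd V δ, α < ‖∑ i, frequency h I i * (k i : ℂ)‖

/-! ### Canonical transformations -/

/-- The symplectic form `∑ dIᵢ ∧ dφᵢ + dη ∧ dξ`. -/
def symplecticForm (u v : Phase n) : ℂ :=
  (∑ i, (u.1 i * v.2.2.1 i - u.2.2.1 i * v.1 i)) + (u.2.1 * v.2.2.2 - u.2.2.2 * v.2.1)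

/-- Translation of the angles by `2π k`. -/
def angleShift (k : Fin n → ℤ) : Phase n := (0, 0, (fun j => 2 * Real.pi * k j), 0)

/-- An analytic symplectic map on `D`, compatible with the `2π`-periodicity of the angles. -/
structure IsCanonical (D : Set (Phase n)) (C : Phase n → Phase n) : Prop where
  analytic : AnalyticOnNhd ℂ C D
  symplectic : ∀ z ∈ D, ∀ u v : Phase n,
    symplecticForm (fderiv ℂ C z u) (fderiv ℂ C z v) = symplecticForm u v
  periodic : ∀ z ∈ D, ∀ k : Fin n → ℤ, C (z + angleShift k) = C z + angleShift k

/-- All coordinates of `z` are real. -/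
def IsRealPoint (z : Phase n) : Prop :=
  (∀ i, (z.1 i).im = 0) ∧ z.2.1.im = 0 ∧ (∀ i, (z.2.2.1 i).im = 0) ∧ z.2.2.2.im = 0

/-- The vector field `(İ, η̇, φ̇, ξ̇) = (-∂χ/∂φ, -∂χ/∂ξ, ∂χ/∂I, ∂χ/∂η)`. -/
def hamiltonianField (χ : Phase n → ℂ) (z : Phase n) : Phase n :=
  (fun i => -fderiv ℂ χ z (0, 0, Pi.single i 1, 0),
    -fderiv ℂ χ z (0, 0, 0, 1),
    fun i => fderiv ℂ χ z (Pi.single i 1, 0, 0, 0),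
    fderiv ℂ χ z (0, 1, 0, 0))

/-- The Lie derivative `L_χ g = {g, χ}`, where
`{g, χ} = ∑ᵢ (∂g/∂φᵢ ∂χ/∂Iᵢ - ∂g/∂Iᵢ ∂χ/∂φᵢ) + ∂g/∂ξ ∂χ/∂η - ∂g/∂η ∂χ/∂ξ`,
written as the derivative of `g` along the vector field of `χ`, and hence also
available (componentwise) for vector-valued `g`. -/
def lieDerivative {W : Type*} [NormedAddCommGroup W] [NormedSpace ℂ W]
    (χ : Phase n → ℂ) (g : Phase n → W) (z : Phase n) : W :=
  fderiv ℂ g z (hamiltonianField χ z)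

/-- The operators `E₀ = id`, `E_s = (1/s) ∑_{j=1}^s j L_{χ_j} E_{s-j}` (with `j = i + 1` in
the code). -/
def lieOperator {W : Type*} [NormedAddCommGroup W] [NormedSpace ℂ W]
    (χ : ℕ → Phase n → ℂ) (g : Phase n → W) : ℕ → Phase n → W
  | 0 => g
  | s + 1 => fun z => ((s : ℂ) + 1)⁻¹ • ∑ i : Fin (s + 1),
      ((i : ℂ) + 1) • lieDerivative (χ (i + 1)) (lieOperator χ g (s - i)) z
  decreasing_by omega

/-- On `D`, the map `C` is the Lie transform `∑_{s ≥ 0} E_s` of the coordinates, for the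
generating sequence `χ` of functions of `(I, φ, ξ)`. -/
def IsLieTransform (D : Set (Phase n)) (χ : ℕ → Reduced n → ℂ) (C : Phase n → Phase n) : Prop :=
  ∀ z ∈ D, HasSum (fun s => lieOperator (fun j w => χ j (reduce w)) id s z) (C z)

end AperiodicNormalForm

end

/-!
The map is the Lie transform of a finite generating sequence `χ_1, …, χ_r`, obtained by solving one
homological equation per order, and the whole argument is a bookkeeping of weighted Fourier norms.

*Orders.* The perturbation is split into shells `φ_l = ε ∑_{(l-1)K ≤ |k| < lK} f_k exp (i k·φ)`, and
`φ_l` is counted as a term of order `l`. The decay of the Fourier coefficients of `f`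
(`norm_fourierCoefficient_le`, by a shift of the contour of integration) makes `φ_l` of the size of
`exp (-3K(l-1)σ/10)`, up to the factor contained in `F`, so that `∑_l θ^l ‖φ_l‖` is at most `ε θ F` for the weight `θ = Δ⁻¹`
(`shell_estimate`, `weight_bounds`). The transform of order `s` of `μ η` is counted as a term of order
`s + 1`. Collecting terms of equal order gives `orderTerm`. At order `s` it contains `χ_s` only
through `{h, χ_s}`, so the harmonics outside the module can be removed by dividing the others by
`i ⟨∂h/∂I, k⟩` (`homological_equation`); the remaining harmonics lie in the module. Only harmonics
with `|k| < sK` occur at order `s`.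

*Estimates of the generating functions.* Domains are shrunk continuously from the level `0` (widths
`δ` and `6σ/5`) to the level `1` (widths `3δ/4` and `3σ/4`); the Cauchy inequality bounds a bracket by
the product of the norms over the product of the losses (`isFourierAt_reducedBracket`). With `χ_s`
estimated at the level `√((s-1)/r)/2`, the loss in a bracket of the orders `i`, `j`, together with the
factor `j/(i+j)` of the Lie recursion, is of order `r` uniformly in `i` and `j`
(`weighted_loss_le`). The recursion for the norms thereby becomes a convolution inequality with a
small constant, and `∑_s θ^s ‖χ_s‖ ≤ (7/5) ε θ F / α` follows (`sum_obstruction_le`,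
`exists_normalForm_generators`).

*The transform.* Beyond order `r` nothing is solved, and the Lie recursion is a sum over chains of
nested brackets. A chain of `p` brackets is estimated with suitably distributed losses, which costs
a factor `p^p / p!` per chain; the recursion has a majorant of exponential type, which is what makes
the sum over all chains converge (`iterated_majorant`, `chain_estimate`). Hence
`∑_s θ^s ‖orderTerm s‖ ≤ 8 ε θ F` at the level `1`, and the orders `s > r`, which make up the remainder,
contribute at most `8 ε F Δ^r` (`isFourierAt_orderTerm_one`, `exists_remainder`). Applied to the
coordinates, the same estimate gives the convergence of the Lie series and the size of the
displacement (`flow_estimate`).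

*Properties of the map.* With a parameter `t`, the series `v(t, z) = ∑_s t^s E_s g (z)` solves the linear
transport equation `∂_t v = ∑_j j t^(j-1) L_{χ_j} v`, and the power series in `t` of a solution is determined
by the recursion defining `E_s`. Transported functions are stable under composition
(`IsTransported.comp`), whence `g ∘ C = ∑_s E_s g`; they are stable under passage to the tangent
map, whence `C` is symplectic (`IsTransported.preserves_bilinear`). The inverse is found by
contraction on a slightly larger domain (`exists_analytic_inverse`); it inherits symplecticity from
the chain rule, and periodicity and reality from uniqueness.
-/

set_option linter.unusedSectionVars false

noncomputable section

namespace AperiodicNormalForm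

variable {n : ℕ}


/-! ### Holomorphic functions of several variables -/

section Holomorphic

open Metric Set Filter Topology

variable {E F : Type*} [NormedAddCommGroup E] [NormedSpace ℂ E] [NormedAddCommGroup F]
  [NormedSpace ℂ F]

/-- Cauchy's inequality on a complex line. -/
theorem norm_fderiv_apply_le {f : E → F} {z v : E} {R M : ℝ} (hR : 0 < R)
    (hf : ∀ t : ℂ, ‖t‖ < R → DifferentiableAt ℂ f (z + t • v))
    (hM : ∀ t : ℂ, ‖t‖ < R → ‖f (z + t • v)‖ ≤ M) : ‖fderiv ℂ f z v‖ ≤ M / R := by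
  have hline : ∀ t : ℂ, ‖t‖ < R → HasDerivAt (fun t : ℂ => f (z + t • v))
      (fderiv ℂ f (z + t • v) v) t := by
    intro t ht
    have h1 : HasDerivAt (fun t : ℂ => z + t • v) v t := by
      simpa using ((hasDerivAt_id t).smul_const v).const_add z
    exact (hf t ht).hasFDerivAt.comp_hasDerivAt t h1
  have h0 : deriv (fun t : ℂ => f (z + t • v)) 0 = fderiv ℂ f z v := by
    have := (hline 0 (by simpa using hR)).deriv
    simpa using this
  have key : ∀ r, 0 < r → r < R → ‖fderiv ℂ f z v‖ * r ≤ M := by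
    intro r hr hrR
    rw [← h0, ← le_div_iff₀ hr]
    refine Complex.norm_deriv_le_of_forall_mem_sphere_norm_le hr ?_ ?_
    · refine DifferentiableOn.diffContOnCl fun t ht => ?_
      rw [closure_ball _ hr.ne', mem_closedBall_zero_iff] at ht
      exact (hline t (ht.trans_lt hrR)).differentiableAt.differentiableWithinAt
    · intro t ht
      rw [mem_sphere_zero_iff_norm] at ht
      exact hM t (ht ▸ hrR)
  rw [le_div_iff₀ hR]
  refine le_of_tendsto (f := fun r => ‖fderiv ℂ f z v‖ * r) (x := 𝓝[<] R) ?_ ?_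
  · exact ((continuous_const.mul continuous_id).tendsto R).mono_left nhdsWithin_le_nhds
  · filter_upwards [Ioo_mem_nhdsLT hR] with r hr using key r hr.1 hr.2

/-- Cauchy's inequality for the full derivative. -/
theorem norm_fderiv_le_of_ball {f : E → F} {z : E} {R M : ℝ} (hR : 0 < R)
    (hf : DifferentiableOn ℂ f (ball z R)) (hM : ∀ w ∈ ball z R, ‖f w‖ ≤ M) :
    ‖fderiv ℂ f z‖ ≤ M / R := by
  have hM0 : 0 ≤ M := (norm_nonneg _).trans (hM z (mem_ball_self hR))
  refine ContinuousLinearMap.opNorm_le_bound _ (by positivity) fun v => ?_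
  rcases eq_or_ne v 0 with rfl | hv
  · simp
  have hv' : 0 < ‖v‖ := norm_pos_iff.2 hv
  have hmem : ∀ t : ℂ, ‖t‖ < R / ‖v‖ → z + t • v ∈ ball z R := by
    intro t ht
    rw [mem_ball_iff_norm, add_sub_cancel_left, norm_smul]
    exact (lt_div_iff₀ hv').1 ht
  have := norm_fderiv_apply_le (f := f) (z := z) (v := v) (R := R / ‖v‖) (M := M) (by positivity)
    (fun t ht => (hf.differentiableAt (isOpen_ball.mem_nhds (hmem t ht))))
    (fun t ht => hM _ (hmem t ht))
  rwa [div_div_eq_mul_div, mul_div_right_comm] at this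

/-- Weierstrass' theorem for a normally convergent series of holomorphic functions. -/
theorem hasSum_fderiv_of_summable {ι : Type*} [CompleteSpace F] {U : Set E} (hU : IsOpen U)
    {f : ι → E → F} {g : E → F} {u : ι → ℝ} (hf : ∀ i, DifferentiableOn ℂ (f i) U)
    (hu : Summable u) (hfu : ∀ i, ∀ x ∈ U, ‖f i x‖ ≤ u i)
    (hg : ∀ x ∈ U, HasSum (fun i => f i x) (g x)) :
    DifferentiableOn ℂ g U ∧
      ∀ x ∈ U, HasSum (fun i => fderiv ℂ (f i) x) (fderiv ℂ g x) := by
  have key : ∀ x ∈ U, ∃ g' : E →L[ℂ] F, HasFDerivAt g g' x ∧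
      HasSum (fun i => fderiv ℂ (f i) x) g' := by
    intro x hx
    obtain ⟨R, hR, hRU⟩ := Metric.isOpen_iff.1 hU x hx
    have hsub : ∀ y ∈ ball x (R / 2), ball y (R / 2) ⊆ ball x R := fun y hy w hw => by
      rw [mem_ball] at *
      linarith [dist_triangle w y x]
    have hxx : x ∈ ball x (R / 2) := mem_ball_self (by positivity)
    have hd : ∀ i, ∀ y ∈ ball x (R / 2), HasFDerivAt (f i) (fderiv ℂ (f i) y) y := fun i y hy =>
      ((hf i).differentiableAt (hU.mem_nhds (hRU (ball_subset_ball (by linarith) hy)))).hasFDerivAt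
    have hb : ∀ i, ∀ y ∈ ball x (R / 2), ‖fderiv ℂ (f i) y‖ ≤ u i / (R / 2) := fun i y hy =>
      norm_fderiv_le_of_ball (by positivity) ((hf i).mono ((hsub y hy).trans hRU))
        fun w hw => hfu i w (hRU (hsub y hy hw))
    have hu' : Summable fun i => u i / (R / 2) := hu.div_const _
    let _ : NormedSpace ℝ E := NormedSpace.restrictScalars ℝ ℂ E
    have h1 := hasFDerivAt_tsum_of_isPreconnected hu' isOpen_ball
      ((convex_ball x (R / 2)).isPreconnected) hd hb hxx (hg x hx).summable hxx
    refine ⟨_, h1.congr_of_eventuallyEq ?_, ?_⟩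
    · filter_upwards [hU.mem_nhds hx] with y hy using (hg y hy).tsum_eq.symm
    · exact (Summable.of_norm_bounded hu' fun i => hb i x hxx).hasSum
  refine ⟨fun x hx => ?_, fun x hx => ?_⟩
  · obtain ⟨g', h, -⟩ := key x hx
    exact h.differentiableAt.differentiableWithinAt
  · obtain ⟨g', h, h'⟩ := key x hx
    rwa [h.fderiv]

/-- The first-order Taylor remainder of a bounded holomorphic function of one variable. -/
theorem norm_sub_sub_smul_deriv_le {g : ℂ → F} {R M : ℝ} (hR : 0 < R)
    [CompleteSpace F] (hg : DifferentiableOn ℂ g (ball 0 R)) (hM : ∀ t ∈ ball (0 : ℂ) R, ‖g t‖ ≤ M)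
    {t : ℂ} (ht : ‖t‖ < R / 2) :
    ‖g t - g 0 - t • deriv g 0‖ ≤ 8 * M / R ^ 2 * ‖t‖ ^ 2 := by
  have hM0 : 0 ≤ M := (norm_nonneg _).trans (hM 0 (mem_ball_self hR))
  have hdg : ∀ s ∈ ball (0 : ℂ) (R / 2), ‖deriv g s‖ ≤ M / (R / 2) := by
    intro s hs
    have hsub : ball s (R / 2) ⊆ ball 0 R := fun w hw => by
      rw [mem_ball] at *
      linarith [dist_triangle w s 0]
    rw [← fderiv_apply_one_eq_deriv]
    refine (ContinuousLinearMap.le_opNorm _ _).trans ?_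
    rw [norm_one, mul_one]
    exact norm_fderiv_le_of_ball (by positivity) (hg.mono hsub) fun w hw => hM w (hsub hw)
  have hdiff : DifferentiableOn ℂ (deriv g) (ball 0 (R / 2)) :=
    (hg.deriv isOpen_ball).mono (ball_subset_ball (by linarith))
  have hlip : ∀ s ∈ ball (0 : ℂ) (R / 2), ‖deriv g s - deriv g 0‖ ≤ 8 * M / R ^ 2 * ‖s‖ := by
    intro s hs
    have := Complex.dist_le_div_mul_dist_of_mapsTo_ball (R₂ := 4 * M / R) hdiff (fun w hw => ?_) hs
    · rw [dist_eq_norm, dist_zero_right] at this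
      refine this.trans (le_of_eq ?_)
      field_simp
      ring
    · rw [mem_closedBall, dist_eq_norm]
      refine (norm_sub_le _ _).trans ((add_le_add (hdg w hw)
        (hdg 0 (mem_ball_self (by positivity)))).trans (le_of_eq ?_))
      field_simp
      ring
  have hconv := Convex.norm_image_sub_le_of_norm_hasDerivWithin_le
    (f := fun s => g s - s • deriv g 0) (f' := fun s => deriv g s - deriv g 0)
    (s := closedBall 0 ‖t‖) (C := 8 * M / R ^ 2 * ‖t‖) (x := 0) (y := t) ?_ ?_
    (convex_closedBall _ _) (by simp) (by simp)
  · simp only [zero_smul, sub_zero] at hconv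
    calc _ = ‖g t - t • deriv g 0 - g 0‖ := by congr 1; abel
      _ ≤ _ := hconv
      _ = _ := by ring
  · intro s hs
    rw [mem_closedBall_zero_iff] at hs
    have h1 : HasDerivAt g (deriv g s) s := (hg.differentiableAt (isOpen_ball.mem_nhds
      (mem_ball_zero_iff.2 (by linarith)))).hasDerivAt
    have h2 := (hasDerivAt_id s).smul_const (deriv g 0)
    rw [one_smul] at h2
    exact (h1.sub h2).hasDerivWithinAt
  · intro s hs
    rw [mem_closedBall_zero_iff] at hs
    refine (hlip s (mem_ball_zero_iff.2 (by linarith))).trans ?_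
    gcongr

variable [CompleteSpace F]

/-- Directional derivatives of holomorphic functions are holomorphic: the difference quotients
with increments `2⁻ᵏ` converge locally uniformly. -/
theorem differentiableOn_fderiv_apply {U : Set E} (hU : IsOpen U) {f : E → F}
    (hf : DifferentiableOn ℂ f U) (v : E) : DifferentiableOn ℂ (fun x => fderiv ℂ f x v) U := by
  intro x hx
  obtain ⟨R₁, hR₁, hRU⟩ := Metric.isOpen_iff.1 hU x hx
  obtain ⟨R₂, hR₂, hfR⟩ := Metric.continuousAt_iff.1
    (hf.continuousOn.continuousAt (hU.mem_nhds hx)) 1 one_pos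
  set M : ℝ := ‖f x‖ + 1
  set r : ℝ := min R₁ R₂ / 2
  have hr : 0 < r := by positivity
  set S : ℝ := r / (‖v‖ + 1)
  have hS : 0 < S := by positivity
  have hline : ∀ y ∈ ball x r, ∀ t : ℂ, ‖t‖ < S → y + t • v ∈ ball x (min R₁ R₂) := by
    intro y hy t ht
    rw [mem_ball_iff_norm] at *
    have h1 : ‖t • v‖ ≤ r := by
      rw [norm_smul]
      have := (lt_div_iff₀ (by positivity)).1 ht
      nlinarith [norm_nonneg t, norm_nonneg v]
    calc ‖y + t • v - x‖ = ‖(y - x) + t • v‖ := by congr 1; abel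
      _ ≤ _ := norm_add_le _ _
      _ < r + r := add_lt_add_of_lt_of_le hy h1
      _ = _ := by simp [r]
  have hM : ∀ y ∈ ball x (min R₁ R₂), ‖f y‖ ≤ M := by
    intro y hy
    have := hfR (lt_of_lt_of_le (mem_ball.1 hy) (min_le_right _ _))
    rw [dist_eq_norm] at this
    linarith [norm_le_norm_add_norm_sub' (f y) (f x)]
  have hUb : ball x (min R₁ R₂) ⊆ U := (ball_subset_ball (min_le_left _ _)).trans hRU
  have hdiffline : ∀ y ∈ ball x r, ∀ t : ℂ, ‖t‖ < S →
      HasDerivAt (fun t : ℂ => f (y + t • v)) (fderiv ℂ f (y + t • v) v) t := by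
    intro y hy t ht
    have h1 : HasDerivAt (fun t : ℂ => y + t • v) v t := by
      simpa using ((hasDerivAt_id t).smul_const v).const_add y
    exact (hf.differentiableAt (hU.mem_nhds (hUb (hline y hy t ht)))).hasFDerivAt.comp_hasDerivAt t h1
  -- difference quotients along `S / 4 * 2⁻ᵏ`
  set a : ℕ → ℂ := fun k => ((S / 4 * (1 / 2) ^ k : ℝ) : ℂ)
  have ha : ∀ k, ‖a k‖ = S / 4 * (1 / 2) ^ k := fun k => by
    rw [Complex.norm_real, Real.norm_of_nonneg (by positivity)]
  have ha' : ∀ k, ‖a k‖ < S / 2 := fun k => by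
    rw [ha]
    have : ((1 : ℝ) / 2) ^ k ≤ 1 := pow_le_one₀ (by norm_num) (by norm_num)
    nlinarith
  have ha0 : ∀ k, a k ≠ 0 := fun k => by
    rw [← norm_pos_iff, ha]; positivity
  set Q : ℕ → E → F := fun k y => (a k)⁻¹ • (f (y + a k • v) - f y)
  have hQd : ∀ k, DifferentiableOn ℂ (Q k) (ball x r) := by
    intro k y hy
    have h1 : DifferentiableAt ℂ f (y + a k • v) :=
      hf.differentiableAt (hU.mem_nhds (hUb (hline y hy _ ((ha' k).trans (by linarith)))))
    have h2 : DifferentiableAt ℂ f y := by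
      simpa using hf.differentiableAt (hU.mem_nhds (hUb (hline y hy 0 (by simpa using hS))))
    have h3 : DifferentiableAt ℂ (fun y => f (y + a k • v)) y :=
      h1.comp y (differentiableAt_id.add_const _)
    exact ((h3.sub h2).const_smul _).differentiableWithinAt
  have hQ : ∀ k, ∀ y ∈ ball x r, ‖Q k y - fderiv ℂ f y v‖ ≤ 2 * M / S * (1 / 2) ^ k := by
    intro k y hy
    have h := norm_sub_sub_smul_deriv_le (g := fun t : ℂ => f (y + t • v)) (R := S) (M := M) hS
      (fun t ht => (hdiffline y hy t (by simpa using ht)).differentiableAt.differentiableWithinAt)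
      (fun t ht => hM _ (hline y hy t (by simpa using ht))) (ha' k)
    have h0 : deriv (fun t : ℂ => f (y + t • v)) 0 = fderiv ℂ f y v := by
      simpa using (hdiffline y hy 0 (by simpa using hS)).deriv
    rw [h0] at h
    simp only [zero_smul, add_zero] at h
    have h4 : Q k y - fderiv ℂ f y v
        = (a k)⁻¹ • (f (y + a k • v) - f y - a k • fderiv ℂ f y v) := by
      simp only [Q, smul_sub, smul_smul, inv_mul_cancel₀ (ha0 k), one_smul]
    rw [h4, norm_smul, norm_inv]
    have hpos : 0 < ‖a k‖ := norm_pos_iff.2 (ha0 k)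
    calc _ ≤ ‖a k‖⁻¹ * (8 * M / S ^ 2 * ‖a k‖ ^ 2) := by gcongr
      _ = 8 * M / S ^ 2 * ‖a k‖ := by field_simp
      _ = _ := by rw [ha]; field_simp; ring
  have hx' : x ∈ ball x r := mem_ball_self hr
  have hgeo : Summable fun k : ℕ => 4 * M / S * (1 / 2 : ℝ) ^ k :=
    (summable_geometric_of_lt_one (by norm_num) (by norm_num)).mul_left _
  have hM0 : 0 ≤ M := by positivity
  have hstep : ∀ k, ∀ y ∈ ball x r, ‖Q (k + 1) y - Q k y‖ ≤ 4 * M / S * (1 / 2) ^ k := by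
    intro k y hy
    calc _ = ‖(Q (k + 1) y - fderiv ℂ f y v) - (Q k y - fderiv ℂ f y v)‖ := by congr 1; abel
      _ ≤ 2 * M / S * (1 / 2) ^ (k + 1) + 2 * M / S * (1 / 2) ^ k :=
        (norm_sub_le _ _).trans (add_le_add (hQ _ y hy) (hQ _ y hy))
      _ ≤ _ := by
        rw [pow_succ]
        have : 0 ≤ M / S * (1 / 2) ^ k := by positivity
        have e1 : 2 * M / S * ((1 / 2) ^ k * (1 / 2)) = M / S * (1 / 2) ^ k := by ring
        have e2 : 2 * M / S * (1 / 2) ^ k = 2 * (M / S * (1 / 2) ^ k) := by ring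
        have e3 : 4 * M / S * (1 / 2) ^ k = 4 * (M / S * (1 / 2) ^ k) := by ring
        rw [e1, e2, e3]; linarith
  have hsum : ∀ y ∈ ball x r,
      HasSum (fun k => Q (k + 1) y - Q k y) (fderiv ℂ f y v - Q 0 y) := by
    intro y hy
    have hs : Summable fun k => Q (k + 1) y - Q k y :=
      Summable.of_norm_bounded hgeo fun k => hstep k y hy
    have ht : Tendsto (fun k => Q k y) atTop (𝓝 (fderiv ℂ f y v)) := by
      rw [tendsto_iff_norm_sub_tendsto_zero]
      refine squeeze_zero (fun _ => norm_nonneg _) (fun k => hQ k y hy) ?_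
      simpa using (tendsto_pow_atTop_nhds_zero_of_lt_one (r := (1 / 2 : ℝ)) (by norm_num)
        (by norm_num)).const_mul (2 * M / S)
    have ht' := hs.hasSum.tendsto_sum_nat
    simp only [Finset.sum_range_sub (fun k => Q k y)] at ht'
    have := tendsto_nhds_unique ht' (ht.sub_const (Q 0 y))
    rw [← this]
    exact hs.hasSum
  have h5 := (hasSum_fderiv_of_summable isOpen_ball
    (fun k => (hQd (k + 1)).sub (hQd k)) hgeo hstep hsum).1
  have h6 : DifferentiableOn ℂ (fun y => fderiv ℂ f y v) (ball x r) := by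
    have := h5.add (hQd 0)
    exact this.congr fun y _ => by simp
  exact (h6.differentiableAt (isOpen_ball.mem_nhds hx')).differentiableWithinAt

variable [FiniteDimensional ℂ E]

theorem differentiableOn_fderiv {U : Set E} (hU : IsOpen U) {f : E → F}
    (hf : DifferentiableOn ℂ f U) : DifferentiableOn ℂ (fderiv ℂ f) U := by
  let b := Module.finBasis ℂ E
  have key : ∀ x, fderiv ℂ f x = ∑ i,
      (LinearMap.toContinuousLinearMap (b.coord i)).smulRight (fderiv ℂ f x (b i)) := by
    intro x
    ext w
    calc fderiv ℂ f x w = fderiv ℂ f x (∑ i, b.repr w i • b i) := by rw [b.sum_repr]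
      _ = _ := by rw [map_sum]; simp [-Module.Basis.sum_repr]
  have h : DifferentiableOn ℂ (fun x => ∑ i,
      (LinearMap.toContinuousLinearMap (b.coord i)).smulRight (fderiv ℂ f x (b i))) U := by
    refine DifferentiableOn.fun_sum fun i _ => ?_
    exact (ContinuousLinearMap.smulRightL ℂ E F
      (LinearMap.toContinuousLinearMap (b.coord i))).differentiable.comp_differentiableOn
      (differentiableOn_fderiv_apply hU hf (b i))
  exact h.congr fun x _ => key x

end Holomorphic

section Osgood

open Metric Set Filter Topology

universe u

theorem contDiffOn_nat_of_differentiableOn {E : Type u} [NormedAddCommGroup E] [NormedSpace ℂ E]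
    [FiniteDimensional ℂ E] {U : Set E} (hU : IsOpen U) (m : ℕ) :
    ∀ {F : Type u} [NormedAddCommGroup F] [NormedSpace ℂ F] [CompleteSpace F] {f : E → F},
      DifferentiableOn ℂ f U → ContDiffOn ℂ m f U := by
  induction m with
  | zero => intro F _ _ _ f hf; exact contDiffOn_zero.2 hf.continuousOn
  | succ m ih =>
    intro F _ _ _ f hf
    rw [Nat.cast_succ, contDiffOn_succ_iff_fderiv_of_isOpen hU]
    exact ⟨hf, by simp, ih (differentiableOn_fderiv hU hf)⟩

variable {E F : Type u} [NormedAddCommGroup E] [NormedSpace ℂ E]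
    [FiniteDimensional ℂ E] [NormedAddCommGroup F] [NormedSpace ℂ F] [CompleteSpace F]

theorem differentiableAt_iteratedFDeriv {U : Set E} (hU : IsOpen U) {f : E → F}
    (hf : DifferentiableOn ℂ f U) (m : ℕ) {x : E} (hx : x ∈ U) :
    DifferentiableAt ℂ (iteratedFDeriv ℂ m f) x := by
  have h1 : ContDiffAt ℂ ((m + 1 : ℕ)) f x :=
    (contDiffOn_nat_of_differentiableOn hU (m + 1) hf).contDiffAt (hU.mem_nhds hx)
  exact h1.differentiableAt_iteratedFDeriv (by exact_mod_cast Nat.lt_succ_self m)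

/-- Cauchy's inequalities for the higher derivatives, by iteration on shrinking balls. -/
theorem norm_iteratedFDeriv_le_of_ball {x₀ : E} {R M ρ : ℝ} (hρ : 0 < ρ) {f : E → F}
    (hf : DifferentiableOn ℂ f (ball x₀ R)) (hM : ∀ x ∈ ball x₀ R, ‖f x‖ ≤ M) (m : ℕ) :
    ∀ x ∈ ball x₀ (R - m * ρ), ‖iteratedFDeriv ℂ m f x‖ ≤ M / ρ ^ m := by
  induction m with
  | zero => intro x hx; simpa using hM x (by simpa using hx)
  | succ m ih =>
    intro x hx
    rw [← norm_fderiv_iteratedFDeriv, pow_succ, ← div_div]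
    have hsub : ball x ρ ⊆ ball x₀ (R - m * ρ) := fun w hw => by
      rw [mem_ball] at *
      push_cast at hx
      linarith [dist_triangle w x x₀]
    refine norm_fderiv_le_of_ball hρ (fun w hw => ?_) fun w hw => ih w (hsub hw)
    refine (differentiableAt_iteratedFDeriv isOpen_ball hf m ?_).differentiableWithinAt
    exact ball_subset_ball (by nlinarith [Nat.cast_nonneg (α := ℝ) m]) (hsub hw)

theorem iteratedDeriv_line {U : Set E} (hU : IsOpen U) {f : E → F} (hf : DifferentiableOn ℂ f U)
    (x y : E) (m : ℕ) : ∀ t : ℂ, x + t • y ∈ U →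
      iteratedDeriv m (fun t : ℂ => f (x + t • y)) t =
        iteratedFDeriv ℂ m f (x + t • y) fun _ => y := by
  induction m with
  | zero => intro t _; simp
  | succ m ih =>
    intro t ht
    have hline : ∀ t : ℂ, HasDerivAt (fun t : ℂ => x + t • y) y t := fun t => by
      simpa using ((hasDerivAt_id t).smul_const y).const_add x
    have hopen : (fun t : ℂ => x + t • y) ⁻¹' U ∈ 𝓝 t :=
      (hline t).continuousAt.preimage_mem_nhds (hU.mem_nhds ht)
    have heq : iteratedDeriv m (fun t : ℂ => f (x + t • y)) =ᶠ[𝓝 t]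
        fun t => iteratedFDeriv ℂ m f (x + t • y) fun _ => y := by
      filter_upwards [hopen] with s hs using ih s hs
    rw [iteratedDeriv_succ, heq.deriv_eq, iteratedFDeriv_succ_apply_left]
    have h1 := (differentiableAt_iteratedFDeriv hU hf m ht).hasFDerivAt.comp_hasDerivAt t (hline t)
    have h2 := ((ContinuousMultilinearMap.apply ℂ (fun _ : Fin m => E) F
      (fun _ => y)).hasFDerivAt.comp_hasDerivAt t h1).deriv
    exact h2

/-- Osgood's lemma: a complex differentiable function on an open subset of a finite-dimensional
space is analytic. -/
theorem analyticOnNhd_of_differentiableOn {U : Set E} (hU : IsOpen U) {f : E → F}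
    (hf : DifferentiableOn ℂ f U) : AnalyticOnNhd ℂ f U := by
  intro x hx
  obtain ⟨R₁, hR₁, hRU⟩ := Metric.isOpen_iff.1 hU x hx
  obtain ⟨R₂, hR₂, hfR⟩ := Metric.continuousAt_iff.1
    (hf.continuousOn.continuousAt (hU.mem_nhds hx)) 1 one_pos
  set M : ℝ := ‖f x‖ + 1
  set R : ℝ := min R₁ R₂
  have hR : 0 < R := by positivity
  have hM0 : 0 ≤ M := by positivity
  have hM : ∀ y ∈ ball x R, ‖f y‖ ≤ M := by
    intro y hy
    have := hfR (lt_of_lt_of_le (mem_ball.1 hy) (min_le_right _ _))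
    rw [dist_eq_norm] at this
    linarith [norm_le_norm_add_norm_sub' (f y) (f x)]
  have hUb : ball x R ⊆ U := (ball_subset_ball (min_le_left _ _)).trans hRU
  have hfb := hf.mono hUb
  have hbound : ∀ m : ℕ, ‖iteratedFDeriv ℂ m f x‖ ≤ M * m.factorial * (2 * Real.exp 1 / R) ^ m := by
    intro m
    rcases Nat.eq_zero_or_pos m with rfl | hm
    · simpa using hM x (mem_ball_self hR)
    have hm' : (0 : ℝ) < m := by exact_mod_cast hm
    have h1 := norm_iteratedFDeriv_le_of_ball (ρ := R / (2 * m)) (by positivity) hfb hM m x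
      (mem_ball_self (by
        have : (m : ℝ) * (R / (2 * m)) = R / 2 := by field_simp
        linarith))
    refine h1.trans ?_
    have h2 : (m : ℝ) ^ m ≤ m.factorial * Real.exp 1 ^ m := by
      have := Real.pow_div_factorial_le_exp (m : ℝ) hm'.le m
      rw [div_le_iff₀ (by positivity)] at this
      rw [← Real.exp_nat_mul, mul_one]
      linarith
    calc M / (R / (2 * m)) ^ m = M * ((m : ℝ) ^ m * (2 / R) ^ m) := by
          rw [div_pow, mul_pow, div_pow]; field_simp
      _ ≤ M * ((m.factorial * Real.exp 1 ^ m) * (2 / R) ^ m) := by gcongr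
      _ = _ := by rw [mul_div_right_comm, mul_pow]; ring
  set p : FormalMultilinearSeries ℂ E F := fun m =>
    ((m.factorial : ℂ)⁻¹) • iteratedFDeriv ℂ m f x
  set r : ℝ := min (R / (2 * Real.exp 1)) R
  have hr : 0 < r := by positivity
  refine (HasFPowerSeriesOnBall.mk (p := p) (r := ENNReal.ofReal r) ?_ (by simpa using hr)
    ?_).analyticAt
  · refine p.le_radius_of_bound M (r := Real.toNNReal r) fun m => ?_
    have h3 : ‖p m‖ ≤ M * (2 * Real.exp 1 / R) ^ m := by
      simp only [p]
      rw [norm_smul, norm_inv, Complex.norm_natCast, inv_mul_le_iff₀ (by positivity)]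
      refine (hbound m).trans (le_of_eq (by ring))
    calc ‖p m‖ * (Real.toNNReal r : ℝ) ^ m ≤ M * (2 * Real.exp 1 / R) ^ m * r ^ m := by
          rw [Real.coe_toNNReal _ hr.le]; gcongr
      _ = M * (2 * Real.exp 1 / R * r) ^ m := by rw [mul_pow]; ring
      _ ≤ M * 1 := by
        gcongr
        refine pow_le_one₀ (by positivity) ?_
        rw [div_mul_eq_mul_div, div_le_one hR]
        have : r ≤ R / (2 * Real.exp 1) := min_le_left _ _
        rw [le_div_iff₀ (by positivity)] at this
        linarith
      _ = M := mul_one M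
  · intro y hy
    have hy' : ‖y‖ < R := by
      rw [Metric.eball_ofReal, mem_ball_zero_iff] at hy
      exact hy.trans_le (min_le_right _ _)
    obtain ⟨S, hS1, hS⟩ : ∃ S : ℝ, 1 < S ∧ S * ‖y‖ < R := by
      rcases eq_or_ne y 0 with rfl | h0
      · exact ⟨2, by norm_num, by simpa using hR⟩
      have h0' : 0 < ‖y‖ := norm_pos_iff.2 h0
      obtain ⟨S, h1, h2⟩ := exists_between ((one_lt_div h0').2 hy')
      exact ⟨S, h1, (lt_div_iff₀ h0').1 h2⟩
    have hmem : ∀ t ∈ ball (0 : ℂ) S, x + t • y ∈ ball x R := by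
      intro t ht
      rw [mem_ball_iff_norm, add_sub_cancel_left, norm_smul]
      rw [mem_ball_zero_iff] at ht
      nlinarith [norm_nonneg y]
    have hd : DifferentiableOn ℂ (fun t : ℂ => f (x + t • y)) (ball 0 S) := by
      intro t ht
      have h1 : DifferentiableAt ℂ f (x + t • y) :=
        hfb.differentiableAt (isOpen_ball.mem_nhds (hmem t ht))
      have h2 : DifferentiableAt ℂ (fun t : ℂ => x + t • y) t := by fun_prop
      exact (h1.comp t h2).differentiableWithinAt
    have h3 := Complex.hasSum_taylorSeries_on_ball hd (z := 1) (by simpa using hS1)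
    simp only [sub_zero, one_pow, one_smul] at h3
    refine h3.congr_fun ?_
    intro m
    rw [iteratedDeriv_line isOpen_ball hfb x y m 0 (by simpa using hR)]
    simp [p]

end Osgood

/-! ### The transport equation of a Lie transform -/

section Transport

open Metric Set Filter Topology

variable {E W W' : Type} [NormedAddCommGroup E] [NormedSpace ℂ E]
  [NormedAddCommGroup W] [NormedSpace ℂ W] [NormedAddCommGroup W'] [NormedSpace ℂ W']

/-- The recursion of `lieOperator` for a sequence of arbitrary vector fields `X₁, X₂, …`. -/
def fieldOperator (X : ℕ → E → E) (g : E → W) : ℕ → E → W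
  | 0 => g
  | s + 1 => fun z => ((s : ℂ) + 1)⁻¹ • ∑ i : Fin (s + 1),
      ((i : ℂ) + 1) • fderiv ℂ (fieldOperator X g (s - i)) z (X (i + 1) z)
  decreasing_by omega

theorem fieldOperator_zero (X : ℕ → E → E) (g : E → W) : fieldOperator X g 0 = g := by
  rw [fieldOperator]

theorem succ_smul_fieldOperator (X : ℕ → E → E) (g : E → W) (s : ℕ) (z : E) :
    ((s : ℂ) + 1) • fieldOperator X g (s + 1) z = ∑ i ∈ Finset.range (s + 1),
      ((i : ℂ) + 1) • fderiv ℂ (fieldOperator X g (s - i)) z (X (i + 1) z) := by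
  rw [fieldOperator, smul_smul, mul_inv_cancel₀ (Nat.cast_add_one_ne_zero s), one_smul,
    Finset.sum_range]

theorem lieOperator_eq_fieldOperator (χ : ℕ → Phase n → ℂ) {V : Type} [NormedAddCommGroup V]
    [NormedSpace ℂ V] (g : Phase n → V) (s : ℕ) :
    lieOperator χ g s = fieldOperator (fun j => hamiltonianField (χ j)) g s := by
  induction s using Nat.strong_induction_on with
  | _ s ih =>
    cases s with
    | zero => rw [lieOperator, fieldOperator]
    | succ s =>
      rw [lieOperator, fieldOperator]
      funext z
      congr 1
      refine Finset.sum_congr rfl fun i _ => ?_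
      rw [lieDerivative, ih (s - i) (by omega)]

/-- `v (t, z)` is holomorphic on `{|t| < ρ} × D` and satisfies the transport equation
`∂ₜ v = ∑_{j=1}^r j t^{j-1} X_j v`. The index is `i = j - 1`. -/
structure IsTransported (X : ℕ → E → E) (r : ℕ) (ρ : ℝ) (D : Set E) (v : ℂ × E → W) : Prop where
  differentiableOn : DifferentiableOn ℂ v (ball 0 ρ ×ˢ D)
  equation : ∀ t ∈ ball (0 : ℂ) ρ, ∀ z ∈ D, fderiv ℂ v (t, z) (1, 0) =
    ∑ i ∈ Finset.range r, ((i : ℂ) + 1) • t ^ i • fderiv ℂ v (t, z) (0, X (i + 1) z)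

theorem sum_range_succ_eq_sum_ite {A : Type*} [AddCommMonoid A] {r : ℕ} {b : ℕ → ℕ → A}
    (hb : ∀ i, r ≤ i → ∀ s, b i s = 0) (s : ℕ) : ∑ i ∈ Finset.range (s + 1), b i (s - i) =
      ∑ i ∈ Finset.range r, if i ≤ s then b i (s - i) else 0 := by
  rw [← Finset.sum_filter]
  have h1 : (Finset.range r).filter (· ≤ s) ⊆ Finset.range (s + 1) := fun i hi => by
    simp only [Finset.mem_filter, Finset.mem_range] at *; omega
  refine (Finset.sum_subset h1 fun i hi hi' => hb i ?_ _).symm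
  simp only [Finset.mem_filter, Finset.mem_range, not_and, not_le] at *
  by_contra h
  have := hi' (by omega)
  omega

theorem hasSum_ite_le_sub {A : Type*} [AddCommMonoid A] [TopologicalSpace A] {a : ℕ → A} {w : A}
    (h : HasSum a w) (i : ℕ) :
    HasSum (fun s => if i ≤ s then a (s - i) else 0) w := by
  refine ((add_left_injective i).hasSum_iff (f := fun s => if i ≤ s then a (s - i) else 0)
    fun s hs => ?_).1 ?_
  · rw [if_neg]
    intro hle
    exact hs ⟨s - i, by simp; omega⟩
  · refine h.congr_fun fun m => ?_
    simp

/-- Multiplication of a power series by the polynomial `∑ (i + 1) tⁱ`. -/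
theorem hasSum_sum_range_pow_smul {r : ℕ} {b : ℕ → ℕ → W} {B : ℕ → W} {t : ℂ}
    (hb : ∀ i, r ≤ i → ∀ s, b i s = 0) (h : ∀ i, HasSum (fun s => t ^ s • b i s) (B i)) :
    HasSum (fun s => t ^ s • ∑ i ∈ Finset.range (s + 1), ((i : ℂ) + 1) • b i (s - i))
      (∑ i ∈ Finset.range r, ((i : ℂ) + 1) • t ^ i • B i) := by
  have h1 : ∀ i : ℕ, HasSum (fun s => if i ≤ s then ((i : ℂ) + 1) • t ^ s • b i (s - i) else 0)
      (((i : ℂ) + 1) • t ^ i • B i) := by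
    intro i
    have := hasSum_ite_le_sub (((h i).const_smul (t ^ i)).const_smul ((i : ℂ) + 1)) i
    refine this.congr_fun fun s => ?_
    split_ifs with hs
    · rw [smul_smul (t ^ i), ← pow_add, Nat.add_sub_cancel' hs]
    · rfl
  refine (hasSum_sum fun i (_ : i ∈ Finset.range r) => h1 i).congr_fun fun s => ?_
  rw [sum_range_succ_eq_sum_ite (b := fun i m => ((i : ℂ) + 1) • b i m)
    (fun i hi m => by simp [hb i hi]), Finset.smul_sum]
  refine Finset.sum_congr rfl fun i _ => ?_
  split_ifs
  · rw [smul_comm]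
  · simp

theorem powerSeries_coeff_unique {a b : ℕ → W} {g : ℂ → W} {ρ : ℝ} (hρ : 0 < ρ)
    (ha : ∀ t ∈ ball (0 : ℂ) ρ, HasSum (fun s => t ^ s • a s) (g t))
    (hb : ∀ t ∈ ball (0 : ℂ) ρ, HasSum (fun s => t ^ s • b s) (g t)) : a = b := by
  have key : ∀ c : ℕ → W, (∀ t ∈ ball (0 : ℂ) ρ, HasSum (fun s => t ^ s • c s) (g t)) →
      HasFPowerSeriesAt g (show FormalMultilinearSeries ℂ ℂ W from
        fun s => ContinuousMultilinearMap.mkPiRing ℂ (Fin s) (c s)) 0 := by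
    intro c hc
    rw [hasFPowerSeriesAt_iff]
    filter_upwards [ball_mem_nhds (0 : ℂ) hρ] with t ht
    simpa [FormalMultilinearSeries.coeff] using hc t ht
  have := (key a ha).eq_formalMultilinearSeries (key b hb)
  funext s
  have h1 := congrArg (fun p : FormalMultilinearSeries ℂ ℂ W => p s 1) this
  simpa using h1

variable [CompleteSpace W] [CompleteSpace W'] [FiniteDimensional ℂ E]

theorem isSymmSndFDerivAt_of_differentiableOn {U : Set E} (hU : IsOpen U) {w : E → W}
    (hw : DifferentiableOn ℂ w U) {p : E} (hp : p ∈ U) : IsSymmSndFDerivAt ℂ w p := by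
  have h3 : ContDiffAt ℂ 2 w p :=
    (contDiffOn_nat_of_differentiableOn hU 2 hw).contDiffAt (hU.mem_nhds hp)
  exact h3.isSymmSndFDerivAt (by simp)

theorem fderiv_fderiv_apply_comm {U : Set (ℂ × E)} (hU : IsOpen U) {w : ℂ × E → W}
    (hw : DifferentiableOn ℂ w U) {p : ℂ × E} (hp : p ∈ U) (x y : ℂ × E) :
    fderiv ℂ (fun q => fderiv ℂ w q x) p y = fderiv ℂ (fun q => fderiv ℂ w q y) p x := by
  have h1 : DifferentiableAt ℂ (fderiv ℂ w) p :=
    (differentiableOn_fderiv hU hw).differentiableAt (hU.mem_nhds hp)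
  have h2 := isSymmSndFDerivAt_of_differentiableOn hU hw hp
  rw [fderiv_clm_apply h1 (differentiableAt_const _), fderiv_clm_apply h1 (differentiableAt_const _)]
  simpa using h2 y x

/-- The `t`-derivatives of `v`. -/
def timeDeriv (v : ℂ × E → W) : ℕ → ℂ × E → W
  | 0 => v
  | s + 1 => fun p => fderiv ℂ (timeDeriv v s) p (1, 0)

theorem differentiableOn_timeDeriv {U : Set (ℂ × E)} (hU : IsOpen U) {v : ℂ × E → W}
    (hv : DifferentiableOn ℂ v U) (s : ℕ) : DifferentiableOn ℂ (timeDeriv v s) U := by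
  induction s with
  | zero => exact hv
  | succ s ih => exact differentiableOn_fderiv_apply hU ih (1, 0)

theorem timeDeriv_comp_succ (v : ℂ × E → W) (s : ℕ) :
    timeDeriv (fun p => fderiv ℂ v p (1, 0)) s = timeDeriv v (s + 1) := by
  induction s with
  | zero => rfl
  | succ s ih => rw [timeDeriv, ih]; rfl

theorem timeDeriv_fderiv_apply {U : Set (ℂ × E)} (hU : IsOpen U) {v : ℂ × E → W}
    (hv : DifferentiableOn ℂ v U) (x : ℂ × E) (s : ℕ) : ∀ p ∈ U,
      timeDeriv (fun q => fderiv ℂ v q x) s p = fderiv ℂ (timeDeriv v s) p x := by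
  induction s with
  | zero => intro p _; rfl
  | succ s ih =>
    intro p hp
    have heq : timeDeriv (fun q => fderiv ℂ v q x) s =ᶠ[𝓝 p]
        fun q => fderiv ℂ (timeDeriv v s) q x := by
      filter_upwards [hU.mem_nhds hp] with q hq using ih q hq
    simp only [timeDeriv]
    rw [heq.fderiv_eq]
    exact fderiv_fderiv_apply_comm hU (differentiableOn_timeDeriv hU hv s) hp x (1, 0)

theorem iteratedDeriv_eq_timeDeriv {U : Set (ℂ × E)} (hU : IsOpen U) {v : ℂ × E → W}
    (hv : DifferentiableOn ℂ v U) (z : E) (s : ℕ) : ∀ t : ℂ, (t, z) ∈ U →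
      iteratedDeriv s (fun t => v (t, z)) t = timeDeriv v s (t, z) := by
  induction s with
  | zero => intro t _; simp [timeDeriv]
  | succ s ih =>
    intro t ht
    have hline : HasDerivAt (fun t : ℂ => (t, z)) ((1 : ℂ), (0 : E)) t :=
      (hasDerivAt_id t).prodMk (hasDerivAt_const t z)
    have heq : iteratedDeriv s (fun t => v (t, z)) =ᶠ[𝓝 t] fun t => timeDeriv v s (t, z) := by
      filter_upwards [hline.continuousAt.preimage_mem_nhds (hU.mem_nhds ht)] with q hq using ih q hq
    rw [iteratedDeriv_succ, heq.deriv_eq]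
    exact (((differentiableOn_timeDeriv hU hv s).differentiableAt
      (hU.mem_nhds ht)).hasFDerivAt.comp_hasDerivAt t hline).deriv

theorem hasSum_timeDeriv {D : Set E} (hD : IsOpen D) {ρ : ℝ} {v : ℂ × E → W}
    (hv : DifferentiableOn ℂ v (ball 0 ρ ×ˢ D)) {z : E} (hz : z ∈ D) {t : ℂ}
    (ht : t ∈ ball (0 : ℂ) ρ) :
    HasSum (fun s => t ^ s • (s.factorial : ℂ)⁻¹ • timeDeriv v s (0, z)) (v (t, z)) := by
  have hU : IsOpen (ball (0 : ℂ) ρ ×ˢ D) := isOpen_ball.prod hD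
  have h0 : (0 : ℂ) ∈ ball (0 : ℂ) ρ := mem_ball_self (pos_of_mem_ball ht)
  have hd : DifferentiableOn ℂ (fun t : ℂ => v (t, z)) (ball 0 ρ) := fun s hs =>
    ((hv.differentiableAt (hU.mem_nhds ⟨hs, hz⟩)).comp s
      (differentiableAt_id.prodMk (differentiableAt_const z))).differentiableWithinAt
  refine (Complex.hasSum_taylorSeries_on_ball hd ht).congr_fun fun s => ?_
  rw [iteratedDeriv_eq_timeDeriv hU hv z s 0 ⟨h0, hz⟩, sub_zero, smul_comm]

theorem fderiv_slice {v : ℂ × E → W} {t : ℂ} {z : E} (hv : DifferentiableAt ℂ v (t, z)) :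
    HasFDerivAt (fun z => v (t, z)) ((fderiv ℂ v (t, z)).comp (.inr ℂ ℂ E)) z :=
  hv.hasFDerivAt.comp z ((hasFDerivAt_const t z).prodMk (hasFDerivAt_id z))

/-- A transported function is the Lie transform of its initial value: comparing the powers of `t`
in the transport equation gives the recursion of the operators `E_s`. -/
theorem IsTransported.hasSum {X : ℕ → E → E} {r : ℕ} {ρ : ℝ} {D : Set E} {v : ℂ × E → W}
    (hv : IsTransported X r ρ D v) (hD : IsOpen D) (hX : ∀ j, r < j → ∀ z ∈ D, X j z = 0)
    {g : E → W} (hg : ∀ z ∈ D, v (0, z) = g z) {z : E} (hz : z ∈ D) {t : ℂ}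
    (ht : t ∈ ball (0 : ℂ) ρ) :
    HasSum (fun s => t ^ s • fieldOperator X g s z) (v (t, z)) := by
  have hU : IsOpen (ball (0 : ℂ) ρ ×ˢ D) := isOpen_ball.prod hD
  have hρ := pos_of_mem_ball ht
  have h0 : (0 : ℂ) ∈ ball (0 : ℂ) ρ := mem_ball_self hρ
  set a : ℕ → E → W := fun s z => (s.factorial : ℂ)⁻¹ • timeDeriv v s (0, z)
  have hda : ∀ s, ∀ z ∈ D, ∀ x, fderiv ℂ (a s) z x =
      (s.factorial : ℂ)⁻¹ • fderiv ℂ (timeDeriv v s) (0, z) (0, x) := by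
    intro s z hz x
    have h1 := (fderiv_slice ((differentiableOn_timeDeriv hU hv.differentiableOn s).differentiableAt
      (hU.mem_nhds ⟨h0, hz⟩))).const_smul ((s.factorial : ℂ)⁻¹)
    have h2 := h1.fderiv
    change fderiv ℂ (a s) z = _ at h2
    rw [h2]
    simp
  have hrec : ∀ s : ℕ, ∀ z ∈ D, ((s : ℂ) + 1) • a (s + 1) z = ∑ i ∈ Finset.range (s + 1),
      ((i : ℂ) + 1) • fderiv ℂ (a (s - i)) z (X (i + 1) z) := by
    intro s z hz
    have hL : ∀ t ∈ ball (0 : ℂ) ρ, HasSum (fun s : ℕ => t ^ s • ((s : ℂ) + 1) • a (s + 1) z)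
        (fderiv ℂ v (t, z) (1, 0)) := by
      intro t ht
      have := hasSum_timeDeriv hD (differentiableOn_fderiv_apply hU hv.differentiableOn (1, 0)) hz ht
      refine this.congr_fun fun s => ?_
      rw [timeDeriv_comp_succ]
      simp only [a]
      rw [smul_smul ((s : ℂ) + 1), Nat.factorial_succ]
      congr 2
      have : (s : ℂ) + 1 ≠ 0 := Nat.cast_add_one_ne_zero s
      push_cast
      field_simp
    have hR : ∀ t ∈ ball (0 : ℂ) ρ, HasSum (fun s => t ^ s • ∑ i ∈ Finset.range (s + 1),
        ((i : ℂ) + 1) • fderiv ℂ (a (s - i)) z (X (i + 1) z)) (fderiv ℂ v (t, z) (1, 0)) := by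
      intro t ht
      rw [hv.equation t ht z hz]
      refine hasSum_sum_range_pow_smul (b := fun i s => fderiv ℂ (a s) z (X (i + 1) z))
        (fun i hi s => by simp [hX (i + 1) (by omega) z hz]) fun i => ?_
      have := hasSum_timeDeriv hD
        (differentiableOn_fderiv_apply hU hv.differentiableOn (0, X (i + 1) z)) hz ht
      refine this.congr_fun fun s => ?_
      rw [timeDeriv_fderiv_apply hU hv.differentiableOn _ s _ ⟨h0, hz⟩, hda s z hz]
    exact congrFun (powerSeries_coeff_unique hρ hL hR) s
  have hmain : ∀ s, ∀ z ∈ D, a s z = fieldOperator X g s z := by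
    intro s
    induction s using Nat.strong_induction_on with
    | _ s ih =>
      intro z hz
      cases s with
      | zero => rw [fieldOperator]; simpa [a, timeDeriv] using hg z hz
      | succ s =>
        have h1 := hrec s z hz
        have h2 : ∀ i ∈ Finset.range (s + 1),
            fderiv ℂ (a (s - i)) z = fderiv ℂ (fieldOperator X g (s - i)) z := by
          intro i _
          refine Filter.EventuallyEq.fderiv_eq ?_
          filter_upwards [hD.mem_nhds hz] with w hw using ih (s - i) (by omega) w hw
        rw [Finset.sum_congr rfl fun i hi => by rw [h2 i hi], ← succ_smul_fieldOperator] at h1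
        exact smul_right_injective W (Nat.cast_add_one_ne_zero (R := ℂ) s) h1
  refine (hasSum_timeDeriv hD hv.differentiableOn hz ht).congr_fun fun s => ?_
  rw [← hmain s z hz]

/-- A normally convergent Lie transform solves the transport equation. -/
theorem isTransported_of_hasSum {X : ℕ → E → E} {r : ℕ} {ρ : ℝ} {D : Set E} (hD : IsOpen D)
    (hX : ∀ j, r < j → ∀ z ∈ D, X j z = 0) {g : E → W} {v : ℂ × E → W} {m : ℕ → ℝ}
    (hd : ∀ s, DifferentiableOn ℂ (fieldOperator X g s) D) (hm : Summable m)
    (hb : ∀ s, ∀ z ∈ D, ρ ^ s * ‖fieldOperator X g s z‖ ≤ m s)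
    (hv : ∀ t ∈ ball (0 : ℂ) ρ, ∀ z ∈ D,
      HasSum (fun s => t ^ s • fieldOperator X g s z) (v (t, z))) :
    IsTransported X r ρ D v := by
  have hU : IsOpen (ball (0 : ℂ) ρ ×ˢ D) := isOpen_ball.prod hD
  have hterm : ∀ s, ∀ p ∈ ball (0 : ℂ) ρ ×ˢ D,
      HasFDerivAt (fun p : ℂ × E => p.1 ^ s • fieldOperator X g s p.2)
        (p.1 ^ s • (fderiv ℂ (fieldOperator X g s) p.2).comp (.snd ℂ ℂ E) +
          ((s * p.1 ^ (s - 1) : ℂ) • ContinuousLinearMap.fst ℂ ℂ E).smulRight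
            (fieldOperator X g s p.2)) p := by
    intro s p hp
    have h1 : HasFDerivAt (fun p : ℂ × E => p.1 ^ s)
        ((s * p.1 ^ (s - 1) : ℂ) • ContinuousLinearMap.fst ℂ ℂ E) p := by
      have := (hasDerivAt_pow s p.1).comp_hasFDerivAt p (hasFDerivAt_fst (𝕜 := ℂ) (p := p))
      exact this
    have h2 : HasFDerivAt (fun p : ℂ × E => fieldOperator X g s p.2)
        ((fderiv ℂ (fieldOperator X g s) p.2).comp (.snd ℂ ℂ E)) p :=
      ((hd s).differentiableAt (hD.mem_nhds hp.2)).hasFDerivAt.comp p hasFDerivAt_snd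
    exact h1.smul h2
  obtain ⟨hdv, hsum⟩ := hasSum_fderiv_of_summable (f := fun s (p : ℂ × E) =>
    p.1 ^ s • fieldOperator X g s p.2) (g := v) hU
    (fun s p hp => (hterm s p hp).differentiableAt.differentiableWithinAt) hm
    (fun s p hp => by
      refine le_trans ?_ (hb s p.2 hp.2)
      rw [norm_smul, norm_pow]
      have := mem_ball_zero_iff.1 hp.1
      gcongr) (fun p hp => hv p.1 hp.1 p.2 hp.2)
  refine ⟨hdv, fun t ht z hz => ?_⟩
  have hs : ∀ x : ℂ × E, HasSum (fun s : ℕ => t ^ s • fderiv ℂ (fieldOperator X g s) z x.2 +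
      (s * t ^ (s - 1) * x.1 : ℂ) • fieldOperator X g s z) (fderiv ℂ v (t, z) x) := by
    intro x
    have := (ContinuousLinearMap.apply ℂ W x).hasSum (hsum (t, z) ⟨ht, hz⟩)
    refine this.congr_fun fun s => ?_
    rw [ContinuousLinearMap.apply_apply, (hterm s (t, z) ⟨ht, hz⟩).fderiv]
    simp
  have hA : HasSum (fun s : ℕ => t ^ s • ((s : ℂ) + 1) • fieldOperator X g (s + 1) z)
      (fderiv ℂ v (t, z) (1, 0)) := by
    have h1 := hs (1, 0)
    rw [← hasSum_nat_add_iff' 1] at h1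
    simp only [Finset.range_one, Finset.sum_singleton] at h1
    convert h1 using 1
    · funext s
      simp [smul_smul, mul_comm]
    · simp
  have hB : ∀ i : ℕ, HasSum (fun s => t ^ s • fderiv ℂ (fieldOperator X g s) z (X (i + 1) z))
      (fderiv ℂ v (t, z) (0, X (i + 1) z)) := by
    intro i
    refine (hs (0, X (i + 1) z)).congr_fun fun s => ?_
    simp
  have hC := hasSum_sum_range_pow_smul
    (b := fun i s => fderiv ℂ (fieldOperator X g s) z (X (i + 1) z)) (r := r)
    (fun i hi s => by simp [hX (i + 1) (by omega) z hz]) hB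
  refine hA.unique (hC.congr_fun fun s => ?_)
  rw [succ_smul_fieldOperator]

theorem IsTransported.comp {X : ℕ → E → E} {r : ℕ} {ρ : ℝ} {D : Set E} (hD : IsOpen D)
    {v : ℂ × E → W} (hv : IsTransported X r ρ D v) {Ω : Set W} (hΩ : IsOpen Ω) {g : W → W'}
    (hg : DifferentiableOn ℂ g Ω) (hmaps : ∀ t ∈ ball (0 : ℂ) ρ, ∀ z ∈ D, v (t, z) ∈ Ω) :
    IsTransported X r ρ D fun p => g (v p) := by
  have hU : IsOpen (ball (0 : ℂ) ρ ×ˢ D) := isOpen_ball.prod hD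
  have hc : ∀ t ∈ ball (0 : ℂ) ρ, ∀ z ∈ D, HasFDerivAt (fun p => g (v p))
      ((fderiv ℂ g (v (t, z))).comp (fderiv ℂ v (t, z))) (t, z) := fun t ht z hz =>
    (hg.differentiableAt (hΩ.mem_nhds (hmaps t ht z hz))).hasFDerivAt.comp _
      (hv.differentiableOn.differentiableAt (hU.mem_nhds ⟨ht, hz⟩)).hasFDerivAt
  refine ⟨fun p hp => (hc p.1 hp.1 p.2 hp.2).differentiableAt.differentiableWithinAt,
    fun t ht z hz => ?_⟩
  simp only [(hc t ht z hz).fderiv, ContinuousLinearMap.comp_apply, hv.equation t ht z hz, map_sum,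
    map_smul]

variable {E₁ : Type} [NormedAddCommGroup E₁] [NormedSpace ℂ E₁]

theorem IsTransported.pullback {X : ℕ → E → E} {r : ℕ} {ρ : ℝ} {D : Set E} (hD : IsOpen D)
    {v : ℂ × E → W} (hv : IsTransported X r ρ D v) (π : E₁ →L[ℂ] E) {Y : ℕ → E₁ → E₁}
    {D₁ : Set E₁} (hmaps : ∀ z ∈ D₁, π z ∈ D) (hY : ∀ j, ∀ z ∈ D₁, π (Y j z) = X j (π z)) :
    IsTransported Y r ρ D₁ fun p => v (p.1, π p.2) := by
  have hU : IsOpen (ball (0 : ℂ) ρ ×ˢ D) := isOpen_ball.prod hD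
  have hc : ∀ t ∈ ball (0 : ℂ) ρ, ∀ z ∈ D₁, HasFDerivAt (fun p : ℂ × E₁ => v (p.1, π p.2))
      ((fderiv ℂ v (t, π z)).comp ((ContinuousLinearMap.fst ℂ ℂ E₁).prod
        (π.comp (ContinuousLinearMap.snd ℂ ℂ E₁)))) (t, z) := by
    intro t ht z hz
    have h1 : HasFDerivAt v (fderiv ℂ v (t, π z)) (t, π z) :=
      (hv.differentiableOn.differentiableAt (hU.mem_nhds ⟨ht, hmaps z hz⟩)).hasFDerivAt
    exact HasFDerivAt.comp (f := fun p : ℂ × E₁ => (p.1, π p.2)) (t, z) h1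
      (hasFDerivAt_fst.prodMk (π.hasFDerivAt.comp _ hasFDerivAt_snd))
  refine ⟨fun p hp => (hc p.1 hp.1 p.2 hp.2).differentiableAt.differentiableWithinAt,
    fun t ht z hz => ?_⟩
  simp [(hc t ht z hz).fderiv, hv.equation t ht _ (hmaps z hz), hY _ z hz]

theorem IsTransported.prodMk {X : ℕ → E → E} {r : ℕ} {ρ : ℝ} {D : Set E} (hD : IsOpen D)
    {v : ℂ × E → W} {w : ℂ × E → W'} (hv : IsTransported X r ρ D v)
    (hw : IsTransported X r ρ D w) : IsTransported X r ρ D fun p => (v p, w p) := by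
  have hU : IsOpen (ball (0 : ℂ) ρ ×ˢ D) := isOpen_ball.prod hD
  have hc : ∀ t ∈ ball (0 : ℂ) ρ, ∀ z ∈ D, HasFDerivAt (fun p => (v p, w p))
      ((fderiv ℂ v (t, z)).prod (fderiv ℂ w (t, z))) (t, z) := fun t ht z hz =>
    (hv.differentiableOn.differentiableAt (hU.mem_nhds ⟨ht, hz⟩)).hasFDerivAt.prodMk
      (hw.differentiableOn.differentiableAt (hU.mem_nhds ⟨ht, hz⟩)).hasFDerivAt
  refine ⟨fun p hp => (hc p.1 hp.1 p.2 hp.2).differentiableAt.differentiableWithinAt,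
    fun t ht z hz => ?_⟩
  simp only [(hc t ht z hz).fderiv, ContinuousLinearMap.prod_apply, hv.equation t ht z hz,
    hw.equation t ht z hz]
  ext <;> simp [Prod.fst_sum, Prod.snd_sum]

/-- The spatial derivative of a transported function is transported by the tangent fields. -/
theorem IsTransported.tangent {X : ℕ → E → E} {r : ℕ} {ρ : ℝ} {D : Set E} (hD : IsOpen D)
    {v : ℂ × E → W} (hv : IsTransported X r ρ D v) (hX : ∀ j, DifferentiableOn ℂ (X j) D) :
    IsTransported (fun j p => (X j p.1, fderiv ℂ (X j) p.1 p.2)) r ρ (D ×ˢ univ)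
      fun p : ℂ × (E × E) => fderiv ℂ v (p.1, p.2.1) (0, p.2.2) := by
  have hU : IsOpen (ball (0 : ℂ) ρ ×ˢ D) := isOpen_ball.prod hD
  have hdd := differentiableOn_fderiv hU hv.differentiableOn
  have hc : ∀ t ∈ ball (0 : ℂ) ρ, ∀ z ∈ D, ∀ u τ a b, HasFDerivAt
      (fun p : ℂ × (E × E) => fderiv ℂ v (p.1, p.2.1) (0, p.2.2))
      (fderiv ℂ (fun p : ℂ × (E × E) => fderiv ℂ v (p.1, p.2.1) (0, p.2.2)) (t, (z, u)))
        (t, (z, u)) ∧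
      fderiv ℂ (fun p : ℂ × (E × E) => fderiv ℂ v (p.1, p.2.1) (0, p.2.2)) (t, (z, u))
        (τ, (a, b)) = fderiv ℂ (fderiv ℂ v) (t, z) (τ, a) (0, u) + fderiv ℂ v (t, z) (0, b) := by
    intro t ht z hz u τ a b
    have h1 : HasFDerivAt (fderiv ℂ v) (fderiv ℂ (fderiv ℂ v) (t, z)) (t, z) :=
      (hdd.differentiableAt (hU.mem_nhds ⟨ht, hz⟩)).hasFDerivAt
    have h2 := HasFDerivAt.comp (f := fun p : ℂ × (E × E) => (p.1, p.2.1)) (t, (z, u)) h1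
      (hasFDerivAt_fst.prodMk (hasFDerivAt_fst.comp _ hasFDerivAt_snd))
    have h3 : HasFDerivAt (fun p : ℂ × (E × E) => ((0 : ℂ), p.2.2))
        ((0 : ℂ × (E × E) →L[ℂ] ℂ).prod ((ContinuousLinearMap.snd ℂ E E).comp
          (ContinuousLinearMap.snd ℂ ℂ (E × E)))) (t, (z, u)) :=
      (hasFDerivAt_const (0 : ℂ) _).prodMk (hasFDerivAt_snd.comp _ hasFDerivAt_snd)
    have h4 := h2.clm_apply h3
    simp only [Function.comp_def] at h4
    refine ⟨h4.differentiableAt.hasFDerivAt, ?_⟩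
    rw [h4.fderiv]
    simp [add_comm]
  refine ⟨fun p hp => (hc p.1 hp.1 p.2.1 hp.2.1 p.2.2 0 0 0).1.differentiableAt.differentiableWithinAt,
    fun t ht p hp => ?_⟩
  obtain ⟨z, u⟩ := p
  have hz : z ∈ D := hp.1
  have hsymm := isSymmSndFDerivAt_of_differentiableOn hU hv.differentiableOn (p := (t, z)) ⟨ht, hz⟩
  rw [show ((1 : ℂ), (0 : E × E)) = (1, (0, 0)) from rfl, (hc t ht z hz u 1 0 0).2]
  simp only [(hc t ht z hz u 0 _ _).2]
  rw [Prod.mk_zero_zero, map_zero, add_zero, hsymm]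
  -- differentiate the transport equation at time `t` in the direction `u`
  have hsl : HasFDerivAt (fun z : E => (t, z)) (ContinuousLinearMap.inr ℂ ℂ E) z :=
    (hasFDerivAt_const t z).prodMk (hasFDerivAt_id z)
  have hd1 : HasFDerivAt (fun z : E => fderiv ℂ v (t, z))
      ((fderiv ℂ (fderiv ℂ v) (t, z)).comp (ContinuousLinearMap.inr ℂ ℂ E)) z :=
    HasFDerivAt.comp z (hdd.differentiableAt (hU.mem_nhds ⟨ht, hz⟩)).hasFDerivAt hsl
  have hL := (hd1.clm_apply (hasFDerivAt_const ((1 : ℂ), (0 : E)) z)).fderiv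
  have hR : HasFDerivAt (fun z => ∑ i ∈ Finset.range r,
      ((i : ℂ) + 1) • t ^ i • fderiv ℂ v (t, z) (0, X (i + 1) z)) _ z :=
    HasFDerivAt.fun_sum fun i _ => ((hd1.clm_apply ((hasFDerivAt_const (0 : ℂ) z).prodMk
      ((hX (i + 1)).differentiableAt (hD.mem_nhds hz)).hasFDerivAt)).const_smul
        (t ^ i)).const_smul ((i : ℂ) + 1)
  have heq : (fun z : E => fderiv ℂ v (t, z) (1, 0)) =ᶠ[𝓝 z] fun z => ∑ i ∈ Finset.range r,
      ((i : ℂ) + 1) • t ^ i • fderiv ℂ v (t, z) (0, X (i + 1) z) := by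
    filter_upwards [hD.mem_nhds hz] with w hw using hv.equation t ht w hw
  rw [heq.fderiv_eq, hR.fderiv] at hL
  have hL' := congrArg (fun A : E →L[ℂ] W => A u) hL
  simp only [sum_apply, smul_apply,
    add_apply, ContinuousLinearMap.comp_apply,
    ContinuousLinearMap.flip_apply, ContinuousLinearMap.inr_apply,
    ContinuousLinearMap.prod_apply, zero_apply, map_zero, zero_add] at hL'
  rw [← hL']
  refine Finset.sum_congr rfl fun i _ => ?_
  rw [hsymm (0, u), add_comm (fderiv ℂ v (t, z) _)]

/-- A bilinear form `B` whose Lie derivative along every field vanishes is preserved by the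
transported maps. -/
theorem IsTransported.preserves_bilinear {X : ℕ → E → E} {r : ℕ} {ρ : ℝ} {D : Set E}
    (hD : IsOpen D) {v : ℂ × E → E} (hv : IsTransported X r ρ D v)
    [CompleteSpace E] (hX : ∀ j, DifferentiableOn ℂ (X j) D) (hXr : ∀ j, r < j → X j = 0)
    (hv0 : ∀ z ∈ D, v (0, z) = z) (B : E →L[ℂ] E →L[ℂ] ℂ)
    (hB : ∀ j, ∀ z ∈ D, ∀ u w, B (fderiv ℂ (X j) z u) w + B u (fderiv ℂ (X j) z w) = 0)
    {t : ℂ} (ht : t ∈ ball (0 : ℂ) ρ) {z : E} (hz : z ∈ D) (u w : E) :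
    B (fderiv ℂ v (t, z) (0, u)) (fderiv ℂ v (t, z) (0, w)) = B u w := by
  set Y : ℕ → E × (E × E) → E × (E × E) := fun j p =>
    (X j p.1, (fderiv ℂ (X j) p.1 p.2.1, fderiv ℂ (X j) p.1 p.2.2))
  have hDu : IsOpen (D ×ˢ (univ : Set E)) := hD.prod isOpen_univ
  have hD' : IsOpen (D ×ˢ (univ : Set (E × E))) := hD.prod isOpen_univ
  have hT := hv.tangent hD hX
  have h1 := hT.pullback hDu (Y := Y) (D₁ := D ×ˢ univ)
    ((ContinuousLinearMap.fst ℂ E (E × E)).prod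
      ((ContinuousLinearMap.fst ℂ E E).comp (ContinuousLinearMap.snd ℂ E (E × E))))
    (fun p hp => ⟨hp.1, trivial⟩) (fun j p _ => rfl)
  have h2 := hT.pullback hDu (Y := Y) (D₁ := D ×ˢ univ)
    ((ContinuousLinearMap.fst ℂ E (E × E)).prod
      ((ContinuousLinearMap.snd ℂ E E).comp (ContinuousLinearMap.snd ℂ E (E × E))))
    (fun p hp => ⟨hp.1, trivial⟩) (fun j p _ => rfl)
  have hBd : DifferentiableOn ℂ (fun q : E × E => B q.1 q.2) univ := by
    intro q _
    exact ((B.differentiable.comp differentiable_fst).clm_apply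
      differentiable_snd).differentiableAt.differentiableWithinAt
  have h3 := (h1.prodMk hD' h2).comp hD' isOpen_univ hBd fun _ _ _ _ => trivial
  set g : E × (E × E) → ℂ := fun p => B p.2.1 p.2.2
  have hgd : ∀ p q : E × (E × E), fderiv ℂ g p q = B q.2.1 p.2.2 + B p.2.1 q.2.2 := by
    intro p q
    have e1 : HasFDerivAt (fun p : E × (E × E) => B p.2.1) (B.comp
        ((ContinuousLinearMap.fst ℂ E E).comp (ContinuousLinearMap.snd ℂ E (E × E)))) p :=
      B.hasFDerivAt.comp p (hasFDerivAt_fst.comp p hasFDerivAt_snd)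
    have e2 : HasFDerivAt (fun p : E × (E × E) => p.2.2)
        ((ContinuousLinearMap.snd ℂ E E).comp (ContinuousLinearMap.snd ℂ E (E × E))) p :=
      hasFDerivAt_snd.comp p hasFDerivAt_snd
    rw [(e1.clm_apply e2).fderiv]
    simp [add_comm]
  have hzero : ∀ s, 0 < s → ∀ p ∈ D ×ˢ (univ : Set (E × E)), fieldOperator Y g s p = 0 := by
    intro s
    induction s using Nat.strong_induction_on with
    | _ s ih =>
      intro hs p hp
      obtain ⟨s, rfl⟩ := Nat.exists_eq_succ_of_ne_zero hs.ne'
      have h4 := succ_smul_fieldOperator Y g s p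
      rw [Finset.sum_eq_zero, smul_eq_zero_iff_right (Nat.cast_add_one_ne_zero (R := ℂ) s)] at h4
      · exact h4
      intro i hi
      rw [Finset.mem_range] at hi
      rcases Nat.eq_zero_or_pos (s - i) with h0 | h0
      · rw [h0, fieldOperator_zero, hgd]
        simp [Y, hB (i + 1) p.1 hp.1]
      · have : fieldOperator Y g (s - i) =ᶠ[𝓝 p] fun _ => 0 := by
          filter_upwards [hD'.mem_nhds hp] with q hq using ih (s - i) (by omega) h0 q hq
        rw [this.fderiv_eq]
        simp
  have hmem : (z, (u, w)) ∈ D ×ˢ (univ : Set (E × E)) := ⟨hz, trivial⟩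
  have h5 := h3.hasSum hD' (fun j hj p _ => by simp [Y, hXr j hj, fderiv_zero]) (g := g)
    (fun p hp => by
      have h0 : (0 : ℂ) ∈ ball (0 : ℂ) ρ := mem_ball_self (pos_of_mem_ball ht)
      have hid : HasFDerivAt (fun z => v (0, z)) (ContinuousLinearMap.id ℂ E) p.1 :=
        (hasFDerivAt_id p.1).congr_of_eventuallyEq (by
          filter_upwards [hD.mem_nhds hp.1] with q hq using hv0 q hq)
      have hsl := (fderiv_slice (hv.differentiableOn.differentiableAt
        ((isOpen_ball.prod hD).mem_nhds ⟨h0, hp.1⟩))).unique hid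
      have hsl' : ∀ x, fderiv ℂ v (0, p.1) (0, x) = x := fun x =>
        congrArg (fun A : E →L[ℂ] E => A x) hsl
      simp [g, hsl']) hmem ht
  have h6 := h5.unique (hasSum_single 0 fun s hs => by
    rw [hzero s (Nat.pos_of_ne_zero hs) _ hmem, smul_zero])
  simpa [fieldOperator_zero, g] using h6

end Transport

/-! ### Functions with a convergent Fourier expansion -/

section FourierSeries

open Metric Set Filter Topology MeasureTheory

variable {V : Set (Fin n → ℝ)} {ρ ρ' τ τ' : ℝ}

theorem isOpen_strip (τ : ℝ) : IsOpen (strip τ) :=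
  isOpen_lt (continuous_abs.comp Complex.continuous_im) continuous_const

theorem isOpen_angleStrip (n : ℕ) (τ : ℝ) : IsOpen (angleStrip n τ) := by
  simp only [angleStrip, ofPred_forall]
  exact isOpen_iInter_of_finite fun j => (isOpen_strip τ).preimage (continuous_apply j)

theorem isOpen_actionNhd (V : Set (Fin n → ℝ)) (ρ : ℝ) : IsOpen (actionNhd V ρ) :=
  isOpen_biUnion fun _ _ => isOpen_ball

theorem isOpen_reducedDomain (V : Set (Fin n → ℝ)) (ρ τ : ℝ) : IsOpen (reducedDomain V ρ τ) :=
  (isOpen_actionNhd V ρ).prod ((isOpen_angleStrip n τ).prod (isOpen_strip τ))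

theorem isOpen_domain (V : Set (Fin n → ℝ)) (ρ τ : ℝ) : IsOpen (domain V ρ τ) :=
  (isOpen_actionNhd V ρ).prod
    ((isOpen_strip ρ).prod ((isOpen_angleStrip n τ).prod (isOpen_strip τ)))

theorem actionNhd_mono (V : Set (Fin n → ℝ)) (h : ρ' ≤ ρ) : actionNhd V ρ' ⊆ actionNhd V ρ :=
  iUnion₂_mono fun _ _ => ball_subset_ball h

theorem actionNhd_subset {V G : Set (Fin n → ℝ)} (hV : V ⊆ G) (ρ : ℝ) :
    actionNhd V ρ ⊆ actionNhd G ρ :=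
  biUnion_subset_biUnion_left hV

theorem strip_mono (h : τ' ≤ τ) : strip τ' ⊆ strip τ := fun _ hw => lt_of_lt_of_le hw h

theorem angleStrip_mono (h : τ' ≤ τ) : angleStrip n τ' ⊆ angleStrip n τ :=
  fun _ hw j => strip_mono h (hw j)

theorem reducedDomain_mono (V : Set (Fin n → ℝ)) (hρ : ρ' ≤ ρ) (hτ : τ' ≤ τ) :
    reducedDomain V ρ' τ' ⊆ reducedDomain V ρ τ :=
  prod_mono (actionNhd_mono V hρ) (prod_mono (angleStrip_mono hτ) (strip_mono hτ))

theorem add_mem_actionNhd {I v : Fin n → ℂ} (hI : I ∈ actionNhd V ρ') (hv : ‖v‖ ≤ ρ - ρ') :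
    I + v ∈ actionNhd V ρ := by
  simp only [actionNhd, mem_iUnion₂] at *
  obtain ⟨J, hJ, h⟩ := hI
  refine ⟨J, hJ, ?_⟩
  rw [mem_ball_iff_norm] at *
  calc ‖I + v - ofRealVec J‖ = ‖(I - ofRealVec J) + v‖ := by congr 1; abel
    _ ≤ ‖I - ofRealVec J‖ + ‖v‖ := norm_add_le _ _
    _ < ρ := by linarith

theorem add_mem_strip {w v : ℂ} (hw : w ∈ strip τ') (hv : ‖v‖ ≤ τ - τ') : w + v ∈ strip τ := by
  simp only [strip, mem_ofPred_eq, Complex.add_im] at *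
  have := (Complex.abs_im_le_norm v).trans hv
  linarith [abs_add_le w.im v.im]

theorem ofReal_mem_strip (hτ : 0 < τ) (x : ℝ) : (x : ℂ) ∈ strip τ := by simpa [strip] using hτ

theorem ofRealVec_mem_angleStrip (hτ : 0 < τ) (φ : Fin n → ℝ) : ofRealVec φ ∈ angleStrip n τ :=
  fun j => ofReal_mem_strip hτ (φ j)

theorem continuous_ofRealVec : Continuous (ofRealVec : (Fin n → ℝ) → Fin n → ℂ) :=
  continuous_pi fun i => Complex.continuous_ofReal.comp (continuous_apply i)

theorem character_add (k l : Fin n → ℤ) (φ : Fin n → ℂ) :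
    character (k + l) φ = character k φ * character l φ := by
  rw [character, character, character, ← Complex.exp_add, ← mul_add, ← Finset.sum_add_distrib]
  simp [add_mul]

theorem character_zero (φ : Fin n → ℂ) : character 0 φ = 1 := by simp [character]

theorem character_neg_mul (k : Fin n → ℤ) (φ : Fin n → ℂ) :
    character (-k) φ * character k φ = 1 := by
  rw [← character_add, neg_add_cancel, character_zero]

theorem hasFDerivAt_character (k : Fin n → ℤ) (φ : Fin n → ℂ) :
    HasFDerivAt (character k) (character k φ • Complex.I • ∑ i, (k i : ℂ) •
      (ContinuousLinearMap.proj i : (Fin n → ℂ) →L[ℂ] ℂ)) φ := by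
  have h1 : HasFDerivAt (fun φ : Fin n → ℂ => Complex.I * ∑ i, (k i : ℂ) * φ i)
      (Complex.I • ∑ i, (k i : ℂ) • (ContinuousLinearMap.proj i : (Fin n → ℂ) →L[ℂ] ℂ)) φ := by
    have := (Complex.I • ∑ i, (k i : ℂ) •
      (ContinuousLinearMap.proj i : (Fin n → ℂ) →L[ℂ] ℂ)).hasFDerivAt (x := φ)
    refine this.congr_of_eventuallyEq (Eventually.of_forall fun ψ => ?_)
    simp
  exact h1.cexp

theorem continuous_character (k : Fin n → ℤ) : Continuous (character k) :=
  continuous_iff_continuousAt.2 fun φ => (hasFDerivAt_character k φ).continuousAt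

theorem abs_sum_mul_le_absSum (k : Fin n → ℤ) {y : Fin n → ℝ} {b : ℝ} (hy : ∀ i, |y i| ≤ b) :
    |∑ i, (k i : ℝ) * y i| ≤ absSum k * b := by
  refine (Finset.abs_sum_le_sum_abs _ _).trans ?_
  rw [absSum, Nat.cast_sum, Finset.sum_mul]
  refine Finset.sum_le_sum fun i _ => ?_
  rw [abs_mul, Nat.cast_natAbs, Int.cast_abs]
  exact mul_le_mul_of_nonneg_left (hy i) (abs_nonneg _)

theorem norm_character (k : Fin n → ℤ) (φ : Fin n → ℂ) :
    ‖character k φ‖ = Real.exp (-∑ i, (k i : ℝ) * (φ i).im) := by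
  rw [character, Complex.norm_exp]
  congr 1
  simp [Complex.mul_re, Complex.im_sum]

theorem norm_character_le (k : Fin n → ℤ) {φ : Fin n → ℂ} (hφ : φ ∈ angleStrip n τ) :
    ‖character k φ‖ ≤ Real.exp (absSum k * τ) := by
  rw [norm_character, Real.exp_le_exp]
  exact (neg_le_abs _).trans (abs_sum_mul_le_absSum k fun i => (hφ i).le)

theorem norm_character_ofRealVec (k : Fin n → ℤ) (φ : Fin n → ℝ) :
    ‖character k (ofRealVec φ)‖ = 1 := by
  simp [norm_character, ofRealVec]

theorem absSum_add_le (k l : Fin n → ℤ) : absSum (k + l) ≤ absSum k + absSum l := by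
  rw [absSum, absSum, absSum, ← Finset.sum_add_distrib]
  exact Finset.sum_le_sum fun i _ => Int.natAbs_add_le _ _

theorem absSum_neg (k : Fin n → ℤ) : absSum (-k) = absSum k := by simp [absSum]

/-- Orthogonality of the characters. -/
theorem integral_character (k : Fin n → ℤ) :
    ∫ φ in Set.Icc (0 : Fin n → ℝ) (fun _ => 2 * Real.pi), character k (ofRealVec φ) =
      if k = 0 then ((2 * Real.pi : ℝ) : ℂ) ^ n else 0 := by
  have h1 : ∀ m : ℤ, ∫ x in Set.Icc (0 : ℝ) (2 * Real.pi), Complex.exp (Complex.I * m * x) =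
      if m = 0 then ((2 * Real.pi : ℝ) : ℂ) else 0 := by
    intro m
    rw [integral_Icc_eq_integral_Ioc, ← intervalIntegral.integral_of_le Real.two_pi_pos.le]
    split_ifs with hm
    · subst hm; simp
    · have hm' : Complex.I * (m : ℂ) ≠ 0 := mul_ne_zero Complex.I_ne_zero (by exact_mod_cast hm)
      rw [integral_exp_mul_complex hm']
      have : Complex.I * (m : ℂ) * ((2 * Real.pi : ℝ) : ℂ) = m * (2 * Real.pi * Complex.I) := by
        push_cast; ring
      rw [this, Complex.exp_int_mul_two_pi_mul_I]
      simp
  have h2 : ∀ φ : Fin n → ℝ, character k (ofRealVec φ) =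
      ∏ i, Complex.exp (Complex.I * (k i : ℂ) * (φ i : ℂ)) := by
    intro φ
    rw [character, ← Complex.exp_sum, Finset.mul_sum]
    simp [ofRealVec, mul_assoc]
  have h3 : Set.Icc (0 : Fin n → ℝ) (fun _ => 2 * Real.pi) =
      Set.pi univ fun _ => Set.Icc (0 : ℝ) (2 * Real.pi) := (Set.pi_univ_Icc _ _).symm
  simp_rw [h2]
  rw [h3, volume_pi, Measure.restrict_pi_pi,
    integral_fintype_prod_eq_prod (𝕜 := ℂ) (fun i (x : ℝ) => Complex.exp (Complex.I * (k i : ℂ) * (x : ℂ)))]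
  simp_rw [h1]
  split_ifs with hk
  · subst hk; simp
  · obtain ⟨i, hi⟩ := Function.ne_iff.1 hk
    exact Finset.prod_eq_zero (Finset.mem_univ i) (if_neg hi)

/-- The norm of a family of Fourier coefficients. -/
def coeffNorm (V : Set (Fin n → ℝ)) (ρ τ : ℝ) (c : (Fin n → ℤ) → (Fin n → ℂ) × ℂ → ℂ) : ℝ≥0∞ :=
  ∑' k, (⨆ p ∈ actionNhd V ρ ×ˢ strip τ, ‖c k p‖ₑ) * ENNReal.ofReal (Real.exp (absSum k * τ))

/-- A bound of the `k`-th term of the Fourier series on `reducedDomain V ρ τ`. -/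
def termBound (V : Set (Fin n → ℝ)) (ρ τ : ℝ) (c : (Fin n → ℤ) → (Fin n → ℂ) × ℂ → ℂ)
    (k : Fin n → ℤ) : ℝ :=
  ((⨆ p ∈ actionNhd V ρ ×ˢ strip τ, ‖c k p‖ₑ) * ENNReal.ofReal (Real.exp (absSum k * τ))).toReal

theorem summable_termBound {c : (Fin n → ℤ) → (Fin n → ℂ) × ℂ → ℂ} (h : coeffNorm V ρ τ c ≠ ⊤) :
    Summable (termBound V ρ τ c) := ENNReal.summable_toReal h

theorem norm_mul_exp_le_termBound {c : (Fin n → ℤ) → (Fin n → ℂ) × ℂ → ℂ}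
    (h : coeffNorm V ρ τ c ≠ ⊤) {p : (Fin n → ℂ) × ℂ} (hp : p ∈ actionNhd V ρ ×ˢ strip τ)
    (k : Fin n → ℤ) : ‖c k p‖ * Real.exp (absSum k * τ) ≤ termBound V ρ τ c k := by
  have h1 := ENNReal.ne_top_of_tsum_ne_top h k
  have h2 : ‖c k p‖ₑ * ENNReal.ofReal (Real.exp (absSum k * τ)) ≤
      (⨆ p ∈ actionNhd V ρ ×ˢ strip τ, ‖c k p‖ₑ) * ENNReal.ofReal (Real.exp (absSum k * τ)) := by
    gcongr
    exact le_iSup₂_of_le p hp le_rfl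
  have h3 := ENNReal.toReal_mono h1 h2
  rwa [ENNReal.toReal_mul, toReal_enorm, ENNReal.toReal_ofReal (Real.exp_pos _).le] at h3

theorem norm_term_le {c : (Fin n → ℤ) → (Fin n → ℂ) × ℂ → ℂ}
    (h : coeffNorm V ρ τ c ≠ ⊤) {p : Reduced n} (hp : p ∈ reducedDomain V ρ τ)
    (k : Fin n → ℤ) : ‖c k (p.1, p.2.2) * character k p.2.1‖ ≤ termBound V ρ τ c k := by
  rw [norm_mul]
  refine le_trans ?_ (norm_mul_exp_le_termBound h (p := (p.1, p.2.2)) ⟨hp.1, hp.2.2⟩ k)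
  gcongr
  exact norm_character_le k hp.2.1

/-- `F` is the sum of a Fourier series with holomorphic coefficients and finite norm. -/
structure IsFourier (V : Set (Fin n → ℝ)) (ρ τ : ℝ) (F : Reduced n → ℂ) : Prop where
  coeff : ∀ k, DifferentiableOn ℂ (fourierCoefficient F k) (actionNhd V ρ ×ˢ strip τ)
  norm_ne_top : fourierNorm V ρ τ F ≠ ⊤
  hasSum : ∀ p ∈ reducedDomain V ρ τ,
    HasSum (fun k => fourierCoefficient F k (p.1, p.2.2) * character k p.2.1) (F p)

theorem coeffNorm_congr {c c' : (Fin n → ℤ) → (Fin n → ℂ) × ℂ → ℂ}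
    (h : ∀ k, ∀ p ∈ actionNhd V ρ ×ˢ strip τ, c k p = c' k p) :
    coeffNorm V ρ τ c = coeffNorm V ρ τ c' := by
  refine tsum_congr fun k => ?_
  congr 1
  exact biSup_congr fun p hp => by rw [h k p hp]

/-- The coefficients of a convergent expansion are the Fourier coefficients of its sum. -/
theorem fourierCoefficient_eq (hτ : 0 < τ) {F : Reduced n → ℂ}
    {c : (Fin n → ℤ) → (Fin n → ℂ) × ℂ → ℂ} (hn : coeffNorm V ρ τ c ≠ ⊤)
    (hs : ∀ p ∈ reducedDomain V ρ τ,
      HasSum (fun k => c k (p.1, p.2.2) * character k p.2.1) (F p))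
    (k : Fin n → ℤ) (p : (Fin n → ℂ) × ℂ) (hp : p ∈ actionNhd V ρ ×ˢ strip τ) :
    fourierCoefficient F k p = c k p := by
  set μ : Measure (Fin n → ℝ) := volume.restrict (Set.Icc (0 : Fin n → ℝ) fun _ => 2 * Real.pi)
  have : IsFiniteMeasure μ := ⟨by
    rw [Measure.restrict_apply_univ]; exact isCompact_Icc.measure_lt_top⟩
  have hmem : ∀ φ : Fin n → ℝ, (p.1, ofRealVec φ, p.2) ∈ reducedDomain V ρ τ := fun φ =>
    ⟨hp.1, ofRealVec_mem_angleStrip hτ φ, hp.2⟩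
  have hsum : ∀ φ : Fin n → ℝ, HasSum (fun l => c l p * character (l + -k) (ofRealVec φ))
      (F (p.1, ofRealVec φ, p.2) * character (-k) (ofRealVec φ)) := by
    intro φ
    refine ((hs _ (hmem φ)).mul_right (character (-k) (ofRealVec φ))).congr_fun fun l => ?_
    rw [character_add, mul_assoc]
  have hint : ∀ l, Integrable (fun φ => c l p * character (l + -k) (ofRealVec φ)) μ := by
    intro l
    refine Integrable.const_mul ?_ _
    exact ((continuous_character _).comp continuous_ofRealVec).continuousOn.integrableOn_compact
      isCompact_Icc
  have hnorm : ∀ l, ∫ φ, ‖c l p * character (l + -k) (ofRealVec φ)‖ ∂μ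
      = μ.real univ * ‖c l p‖ := by
    intro l
    simp [norm_character_ofRealVec]
  have hsn : Summable fun l => ‖c l p‖ := by
    refine Summable.of_nonneg_of_le (fun _ => norm_nonneg _) (fun l => ?_) (summable_termBound hn)
    refine le_trans ?_ (norm_mul_exp_le_termBound hn hp l)
    exact le_mul_of_one_le_right (norm_nonneg _) (Real.one_le_exp (by positivity))
  have h1 := hasSum_integral_of_summable_integral_norm hint (by
    simp_rw [hnorm]; exact hsn.mul_left _)
  have h2 : ∫ φ, ∑' l, c l p * character (l + -k) (ofRealVec φ) ∂μ =
      ∫ φ, F (p.1, ofRealVec φ, p.2) * character (-k) (ofRealVec φ) ∂μ :=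
    integral_congr_ae (Eventually.of_forall fun φ => (hsum φ).tsum_eq)
  rw [h2] at h1
  have h3 : HasSum (fun l => ∫ φ, c l p * character (l + -k) (ofRealVec φ) ∂μ)
      (c k p * ((2 * Real.pi : ℝ) : ℂ) ^ n) := by
    have := hasSum_ite_eq k (c k p * ((2 * Real.pi : ℝ) : ℂ) ^ n)
    refine this.congr_fun fun l => ?_
    rw [integral_const_mul, integral_character]
    rcases eq_or_ne l k with rfl | hl
    · simp
    · rw [if_neg hl, if_neg (by rwa [← sub_eq_add_neg, sub_eq_zero]), mul_zero]
  have hpi : ((2 * Real.pi : ℝ) : ℂ) ≠ 0 := by exact_mod_cast Real.two_pi_pos.ne'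
  rw [fourierCoefficient, h1.unique h3, mul_left_comm, ← mul_pow, inv_mul_cancel₀ hpi, one_pow,
    mul_one]

theorem isFourier_of_coeff (hτ : 0 < τ) {F : Reduced n → ℂ}
    {c : (Fin n → ℤ) → (Fin n → ℂ) × ℂ → ℂ}
    (hc : ∀ k, DifferentiableOn ℂ (c k) (actionNhd V ρ ×ˢ strip τ))
    (hn : coeffNorm V ρ τ c ≠ ⊤)
    (hs : ∀ p ∈ reducedDomain V ρ τ,
      HasSum (fun k => c k (p.1, p.2.2) * character k p.2.1) (F p)) :
    IsFourier V ρ τ F ∧ fourierNorm V ρ τ F = coeffNorm V ρ τ c := by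
  have h := fourierCoefficient_eq hτ hn hs
  have hN : fourierNorm V ρ τ F = coeffNorm V ρ τ c := coeffNorm_congr h
  refine ⟨⟨fun k => (hc k).congr (h k), hN ▸ hn, fun p hp => ?_⟩, hN⟩
  refine (hs p hp).congr_fun fun k => ?_
  rw [h k (p.1, p.2.2) ⟨hp.1, hp.2.2⟩]

theorem IsFourier.congr (hτ : 0 < τ) {F G : Reduced n → ℂ} (hF : IsFourier V ρ τ F)
    (h : ∀ p ∈ reducedDomain V ρ τ, G p = F p) :
    IsFourier V ρ τ G ∧ fourierNorm V ρ τ G = fourierNorm V ρ τ F :=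
  isFourier_of_coeff hτ hF.coeff hF.norm_ne_top fun p hp => by rw [h p hp]; exact hF.hasSum p hp

theorem coeffNorm_mono (hρ : ρ' ≤ ρ) (hτ : τ' ≤ τ) (c : (Fin n → ℤ) → (Fin n → ℂ) × ℂ → ℂ) :
    coeffNorm V ρ' τ' c ≤ coeffNorm V ρ τ c := by
  refine ENNReal.tsum_le_tsum fun k => ?_
  gcongr ?_ * ENNReal.ofReal (Real.exp (_ * ?_))
  exact biSup_mono (prod_mono (actionNhd_mono V hρ) (strip_mono hτ))

theorem fourierNorm_mono (hρ : ρ' ≤ ρ) (hτ : τ' ≤ τ) (F : Reduced n → ℂ) :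
    fourierNorm V ρ' τ' F ≤ fourierNorm V ρ τ F := coeffNorm_mono hρ hτ _

theorem IsFourier.mono {F : Reduced n → ℂ} (hF : IsFourier V ρ τ F) (hρ : ρ' ≤ ρ) (hτ : τ' ≤ τ) :
    IsFourier V ρ' τ' F :=
  ⟨fun k => (hF.coeff k).mono (prod_mono (actionNhd_mono V hρ) (strip_mono hτ)),
    ne_top_of_le_ne_top hF.norm_ne_top (fourierNorm_mono hρ hτ F),
    fun p hp => hF.hasSum p (reducedDomain_mono V hρ hτ hp)⟩

theorem IsFourier.enorm_le {F : Reduced n → ℂ} (hF : IsFourier V ρ τ F) {p : Reduced n}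
    (hp : p ∈ reducedDomain V ρ τ) : ‖F p‖ₑ ≤ fourierNorm V ρ τ F := by
  rw [← (hF.hasSum p hp).tsum_eq]
  refine enorm_tsum_le_tsum_enorm.trans (ENNReal.tsum_le_tsum fun k => ?_)
  rw [enorm_mul]
  gcongr
  · exact le_iSup₂_of_le (p.1, p.2.2) ⟨hp.1, hp.2.2⟩ le_rfl
  · rw [← ofReal_norm]
    exact ENNReal.ofReal_le_ofReal (norm_character_le k hp.2.1)

theorem IsFourier.norm_le {F : Reduced n → ℂ} (hF : IsFourier V ρ τ F) {p : Reduced n}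
    (hp : p ∈ reducedDomain V ρ τ) : ‖F p‖ ≤ (fourierNorm V ρ τ F).toReal := by
  have := ENNReal.toReal_mono hF.norm_ne_top (hF.enorm_le hp)
  rwa [toReal_enorm] at this

end FourierSeries

section FourierAlgebra

open Metric Set Filter Topology MeasureTheory

variable {V : Set (Fin n → ℝ)} {ρ ρ' τ τ' : ℝ}

theorem summable_norm_of_coeffNorm {c : (Fin n → ℤ) → (Fin n → ℂ) × ℂ → ℂ}
    (h : coeffNorm V ρ τ c ≠ ⊤) {p : Reduced n} (hp : p ∈ reducedDomain V ρ τ) :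
    Summable fun k => ‖c k (p.1, p.2.2) * character k p.2.1‖ :=
  Summable.of_nonneg_of_le (fun _ => norm_nonneg _) (norm_term_le h hp) (summable_termBound h)

/-- Normally convergent series of functions with a Fourier expansion. -/
theorem isFourier_of_hasSum {ι : Type*} [Countable ι] (hτ : 0 < τ) {F : ι → Reduced n → ℂ}
    {G : Reduced n → ℂ} (hF : ∀ s, IsFourier V ρ τ (F s)) (hn : ∑' s, fourierNorm V ρ τ (F s) ≠ ⊤)
    (hG : ∀ p ∈ reducedDomain V ρ τ, HasSum (fun s => F s p) (G p)) :
    IsFourier V ρ τ G ∧ fourierNorm V ρ τ G ≤ ∑' s, fourierNorm V ρ τ (F s) := by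
  set S : Set ((Fin n → ℂ) × ℂ) := actionNhd V ρ ×ˢ strip τ
  have hS : IsOpen S := (isOpen_actionNhd V ρ).prod (isOpen_strip τ)
  set c : (Fin n → ℤ) → (Fin n → ℂ) × ℂ → ℂ := fun k p => ∑' s, fourierCoefficient (F s) k p
  set M : ι → (Fin n → ℤ) → ℝ≥0∞ := fun s k =>
    (⨆ p ∈ S, ‖fourierCoefficient (F s) k p‖ₑ) * ENNReal.ofReal (Real.exp (absSum k * τ))
  have hM : ∑' k, ∑' s, M s k ≠ ⊤ := by rw [ENNReal.tsum_comm]; exact hn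
  have hexp : ∀ k : Fin n → ℤ, 1 ≤ ENNReal.ofReal (Real.exp (absSum k * τ)) := fun k => by
    rw [← ENNReal.ofReal_one]
    exact ENNReal.ofReal_le_ofReal (Real.one_le_exp (by positivity))
  have hle : ∀ s k, ∀ p ∈ S, ‖fourierCoefficient (F s) k p‖ₑ ≤ M s k := fun s k p hp =>
    (le_iSup₂_of_le p hp le_rfl).trans (le_mul_of_one_le_right' (hexp k))
  have hMk : ∀ k, ∑' s, M s k ≠ ⊤ := fun k => ENNReal.ne_top_of_tsum_ne_top hM k
  have hMsk : ∀ k s, M s k ≠ ⊤ := fun k s => ENNReal.ne_top_of_tsum_ne_top (hMk k) s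
  have hler : ∀ s k, ∀ p ∈ S, ‖fourierCoefficient (F s) k p‖ ≤ (M s k).toReal := fun s k p hp => by
    have := ENNReal.toReal_mono (hMsk k s) (hle s k p hp)
    rwa [toReal_enorm] at this
  have hsk : ∀ k, ∀ p ∈ S, HasSum (fun s => fourierCoefficient (F s) k p) (c k p) := fun k p hp =>
    (Summable.of_norm_bounded (ENNReal.summable_toReal (hMk k)) fun s => hler s k p hp).hasSum
  have hc : ∀ k, DifferentiableOn ℂ (c k) S := fun k =>
    (hasSum_fderiv_of_summable hS (fun s => (hF s).coeff k) (ENNReal.summable_toReal (hMk k))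
      (fun s p hp => hler s k p hp) (hsk k)).1
  have hcn : coeffNorm V ρ τ c ≤ ∑' s, fourierNorm V ρ τ (F s) := by
    change coeffNorm V ρ τ c ≤ ∑' s, ∑' k, M s k
    rw [ENNReal.tsum_comm]
    refine ENNReal.tsum_le_tsum fun k => ?_
    rw [ENNReal.tsum_mul_right]
    gcongr
    refine iSup₂_le fun p hp => enorm_tsum_le_tsum_enorm.trans (ENNReal.tsum_le_tsum fun s => ?_)
    exact le_iSup₂_of_le p hp le_rfl
  have hsum : ∀ p ∈ reducedDomain V ρ τ,
      HasSum (fun k => c k (p.1, p.2.2) * character k p.2.1) (G p) := by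
    intro p hp
    have hpS : (p.1, p.2.2) ∈ S := ⟨hp.1, hp.2.2⟩
    set a : ι × (Fin n → ℤ) → ℂ := fun q =>
      fourierCoefficient (F q.1) q.2 (p.1, p.2.2) * character q.2 p.2.1
    have ha : Summable a := by
      have h1 : ∑' q : ι × (Fin n → ℤ), M q.1 q.2 ≠ ⊤ := by rw [ENNReal.tsum_prod']; exact hn
      refine Summable.of_norm_bounded (ENNReal.summable_toReal h1) fun q => ?_
      refine le_trans ?_ (norm_term_le (hF q.1).norm_ne_top hp q.2)
      rfl
    have h1 : HasSum (fun s => F s p) (∑' q, a q) :=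
      ha.hasSum.prod_fiberwise fun s => (hF s).hasSum p hp
    have h2 : ∑' q, a q = G p := h1.unique (hG p hp)
    rw [← h2]
    have h3 : HasSum (fun q : (Fin n → ℤ) × ι => a (q.2, q.1)) (∑' q, a q) :=
      (Equiv.prodComm (Fin n → ℤ) ι).hasSum_iff.2 ha.hasSum
    have h4 : ∀ k, HasSum (fun s => a (s, k)) (c k (p.1, p.2.2) * character k p.2.1) :=
      fun k => (hsk k (p.1, p.2.2) hpS).mul_right (character k p.2.1)
    clear_value a c
    exact h3.prod_fiberwise h4
  obtain ⟨h1, h2⟩ := isFourier_of_coeff hτ hc (ne_top_of_le_ne_top hn hcn) hsum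
  exact ⟨h1, h2.le.trans hcn⟩

theorem isFourier_finset_sum {ι : Type*} (hτ : 0 < τ) (s : Finset ι) {F : ι → Reduced n → ℂ}
    (hF : ∀ i ∈ s, IsFourier V ρ τ (F i)) :
    IsFourier V ρ τ (fun p => ∑ i ∈ s, F i p) ∧
      fourierNorm V ρ τ (fun p => ∑ i ∈ s, F i p) ≤ ∑ i ∈ s, fourierNorm V ρ τ (F i) := by
  have hn : ∑' i : s, fourierNorm V ρ τ (F i) ≠ ⊤ := by
    rw [tsum_fintype]
    exact ENNReal.sum_ne_top.2 fun i _ => (hF i i.2).norm_ne_top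
  have h := isFourier_of_hasSum (F := fun i : s => F i) (G := fun p => ∑ i ∈ s, F i p) hτ
    (fun i => hF i i.2) hn (fun p _ => by
      rw [← Finset.sum_coe_sort s fun i => F i p]
      exact hasSum_fintype _)
  rwa [tsum_fintype, Finset.sum_coe_sort s fun i => fourierNorm V ρ τ (F i)] at h

theorem isFourier_add (hτ : 0 < τ) {F G : Reduced n → ℂ} (hF : IsFourier V ρ τ F)
    (hG : IsFourier V ρ τ G) : IsFourier V ρ τ (fun p => F p + G p) ∧
      fourierNorm V ρ τ (fun p => F p + G p) ≤ fourierNorm V ρ τ F + fourierNorm V ρ τ G := by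
  have := isFourier_finset_sum (F := fun b : Bool => cond b F G) hτ Finset.univ
    (fun b _ => by cases b <;> assumption)
  simpa using this

theorem isFourier_const_mul (hτ : 0 < τ) {F : Reduced n → ℂ} (hF : IsFourier V ρ τ F) (a : ℂ) :
    IsFourier V ρ τ (fun p => a * F p) ∧
      fourierNorm V ρ τ (fun p => a * F p) ≤ ‖a‖ₑ * fourierNorm V ρ τ F := by
  have hle : coeffNorm V ρ τ (fun k p => a * fourierCoefficient F k p) ≤
      ‖a‖ₑ * fourierNorm V ρ τ F := by
    rw [fourierNorm, ← ENNReal.tsum_mul_left]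
    refine ENNReal.tsum_le_tsum fun k => ?_
    rw [← mul_assoc]
    gcongr
    refine iSup₂_le fun p hp => ?_
    rw [enorm_mul]
    gcongr
    exact le_iSup₂_of_le p hp le_rfl
  obtain ⟨h1, h2⟩ := isFourier_of_coeff (F := fun p => a * F p) hτ
    (fun k => (hF.coeff k).const_mul a)
    (ne_top_of_le_ne_top (ENNReal.mul_ne_top enorm_ne_top hF.norm_ne_top) hle)
    (fun p hp => by simpa only [mul_assoc] using (hF.hasSum p hp).mul_left a)
  exact ⟨h1, h2.le.trans hle⟩

theorem isFourier_neg (hτ : 0 < τ) {F : Reduced n → ℂ} (hF : IsFourier V ρ τ F) :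
    IsFourier V ρ τ (fun p => -F p) ∧
      fourierNorm V ρ τ (fun p => -F p) ≤ fourierNorm V ρ τ F := by
  simpa using isFourier_const_mul hτ hF (-1)

theorem isFourier_zero (hτ : 0 < τ) : IsFourier V ρ τ (fun _ => 0) ∧
    fourierNorm V ρ τ (fun _ => 0) = 0 := by
  have h := isFourier_finset_sum (V := V) (ρ := ρ) hτ (∅ : Finset ℕ) (F := fun _ _ => 0) (by simp)
  simpa using h

/-- The Fourier norm is submultiplicative. -/
theorem isFourier_mul (hτ : 0 < τ) {F G : Reduced n → ℂ} (hF : IsFourier V ρ τ F)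
    (hG : IsFourier V ρ τ G) : IsFourier V ρ τ (fun p => F p * G p) ∧
      fourierNorm V ρ τ (fun p => F p * G p) ≤ fourierNorm V ρ τ F * fourierNorm V ρ τ G := by
  set S : Set ((Fin n → ℂ) × ℂ) := actionNhd V ρ ×ˢ strip τ
  -- multiplication by a single harmonic shifts the coefficients
  have hterm : ∀ l : Fin n → ℤ,
      IsFourier V ρ τ (fun p => fourierCoefficient F l (p.1, p.2.2) * character l p.2.1 * G p) ∧
      fourierNorm V ρ τ (fun p => fourierCoefficient F l (p.1, p.2.2) * character l p.2.1 * G p) ≤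
        (⨆ p ∈ S, ‖fourierCoefficient F l p‖ₑ) * ENNReal.ofReal (Real.exp (absSum l * τ)) *
          fourierNorm V ρ τ G := by
    intro l
    set A : ℝ≥0∞ := (⨆ p ∈ S, ‖fourierCoefficient F l p‖ₑ) *
      ENNReal.ofReal (Real.exp (absSum l * τ))
    have hA : A ≠ ⊤ := ENNReal.ne_top_of_tsum_ne_top hF.norm_ne_top l
    set c : (Fin n → ℤ) → (Fin n → ℂ) × ℂ → ℂ := fun k p =>
      fourierCoefficient F l p * fourierCoefficient G (k - l) p
    have hle : coeffNorm V ρ τ c ≤ A * fourierNorm V ρ τ G := by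
      rw [coeffNorm, ← (Equiv.addRight l).tsum_eq, fourierNorm, ← ENNReal.tsum_mul_left]
      refine ENNReal.tsum_le_tsum fun k => ?_
      have h1 : (⨆ p ∈ S, ‖c (k + l) p‖ₑ) ≤ (⨆ p ∈ S, ‖fourierCoefficient F l p‖ₑ) *
          ⨆ p ∈ S, ‖fourierCoefficient G k p‖ₑ := by
        refine iSup₂_le fun p hp => ?_
        simp only [c, add_sub_cancel_right, enorm_mul]
        gcongr
        · exact le_iSup₂_of_le p hp le_rfl
        · exact le_iSup₂_of_le p hp le_rfl
      have h2 : ENNReal.ofReal (Real.exp (absSum (k + l) * τ)) ≤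
          ENNReal.ofReal (Real.exp (absSum l * τ)) * ENNReal.ofReal (Real.exp (absSum k * τ)) := by
        rw [← ENNReal.ofReal_mul (Real.exp_pos _).le, ← Real.exp_add, ← add_mul]
        refine ENNReal.ofReal_le_ofReal (Real.exp_le_exp.2 ?_)
        have : (absSum (k + l) : ℝ) ≤ absSum l + absSum k := by
          rw [add_comm (absSum l : ℝ)]; exact_mod_cast absSum_add_le k l
        gcongr
      calc _ ≤ ((⨆ p ∈ S, ‖fourierCoefficient F l p‖ₑ) * ⨆ p ∈ S, ‖fourierCoefficient G k p‖ₑ) *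
            (ENNReal.ofReal (Real.exp (absSum l * τ)) *
              ENNReal.ofReal (Real.exp (absSum k * τ))) := mul_le_mul' h1 h2
        _ = _ := by simp only [A, S]; ring
    obtain ⟨h1, h2⟩ := isFourier_of_coeff (c := c) (F := fun p =>
        fourierCoefficient F l (p.1, p.2.2) * character l p.2.1 * G p) hτ
      (fun k => (hF.coeff l).mul (hG.coeff (k - l)))
      (ne_top_of_le_ne_top (ENNReal.mul_ne_top hA hG.norm_ne_top) hle)
      (fun p hp => by
        have h3 := ((hG.hasSum p hp).mul_left
          (fourierCoefficient F l (p.1, p.2.2) * character l p.2.1))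
        rw [← (Equiv.subRight l).hasSum_iff] at h3
        refine h3.congr_fun fun k => ?_
        have : character k p.2.1 = character l p.2.1 * character (k - l) p.2.1 := by
          rw [← character_add, add_sub_cancel]
        simp only [c, Function.comp, Equiv.subRight_apply, this]
        ring)
    exact ⟨h1, h2.le.trans hle⟩
  have hn : ∑' l, fourierNorm V ρ τ
      (fun p => fourierCoefficient F l (p.1, p.2.2) * character l p.2.1 * G p) ≤
      fourierNorm V ρ τ F * fourierNorm V ρ τ G := by
    rw [fourierNorm.eq_def V ρ τ F, ← ENNReal.tsum_mul_right]
    exact ENNReal.tsum_le_tsum fun l => (hterm l).2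
  obtain ⟨h1, h2⟩ := isFourier_of_hasSum (G := fun p => F p * G p) hτ (fun l => (hterm l).1)
    (ne_top_of_le_ne_top (ENNReal.mul_ne_top hF.norm_ne_top hG.norm_ne_top) hn)
    (fun p hp => (hF.hasSum p hp).mul_right (G p))
  exact ⟨h1, h2.trans hn⟩

/-! ### Derivatives of Fourier expansions -/

theorem hasFDerivAt_term {c : (Fin n → ℂ) × ℂ → ℂ} {S : Set ((Fin n → ℂ) × ℂ)} (hS : IsOpen S)
    (hc : DifferentiableOn ℂ c S) (k : Fin n → ℤ) {p : Reduced n} (hp : (p.1, p.2.2) ∈ S) :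
    DifferentiableAt ℂ (fun p : Reduced n => c (p.1, p.2.2) * character k p.2.1) p ∧
    ∀ v : Reduced n, fderiv ℂ (fun p : Reduced n => c (p.1, p.2.2) * character k p.2.1) p v =
      (fderiv ℂ c (p.1, p.2.2) (v.1, v.2.2) +
        Complex.I * (∑ i, (k i : ℂ) * v.2.1 i) * c (p.1, p.2.2)) * character k p.2.1 := by
  have h1 : HasFDerivAt (fun p : Reduced n => (p.1, p.2.2))
      ((ContinuousLinearMap.fst ℂ (Fin n → ℂ) ((Fin n → ℂ) × ℂ)).prod
        ((ContinuousLinearMap.snd ℂ (Fin n → ℂ) ℂ).comp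
          (ContinuousLinearMap.snd ℂ (Fin n → ℂ) ((Fin n → ℂ) × ℂ)))) p :=
    hasFDerivAt_fst.prodMk (hasFDerivAt_snd.comp p hasFDerivAt_snd)
  have h2 : HasFDerivAt (fun p : Reduced n => p.2.1)
      ((ContinuousLinearMap.fst ℂ (Fin n → ℂ) ℂ).comp
          (ContinuousLinearMap.snd ℂ (Fin n → ℂ) ((Fin n → ℂ) × ℂ))) p :=
    hasFDerivAt_fst.comp p hasFDerivAt_snd
  have h3 := HasFDerivAt.comp (f := fun p : Reduced n => (p.1, p.2.2)) p
    (hc.differentiableAt (hS.mem_nhds hp)).hasFDerivAt h1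
  have h4 := HasFDerivAt.comp (f := fun p : Reduced n => p.2.1) p
    (hasFDerivAt_character k p.2.1) h2
  have h5 := h3.mul h4
  refine ⟨h5.differentiableAt, fun v => ?_⟩
  have h6 := h5.fderiv
  change fderiv ℂ (fun p : Reduced n => c (p.1, p.2.2) * character k p.2.1) p = _ at h6
  rw [h6]
  simp
  ring

theorem IsFourier.hasSum_fderiv {F : Reduced n → ℂ} (hF : IsFourier V ρ τ F) :
    DifferentiableOn ℂ F (reducedDomain V ρ τ) ∧ ∀ p ∈ reducedDomain V ρ τ, ∀ v : Reduced n,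
      HasSum (fun k => (fderiv ℂ (fourierCoefficient F k) (p.1, p.2.2) (v.1, v.2.2) +
        Complex.I * (∑ i, (k i : ℂ) * v.2.1 i) * fourierCoefficient F k (p.1, p.2.2)) *
          character k p.2.1) (fderiv ℂ F p v) := by
  have hS : IsOpen (actionNhd V ρ ×ˢ strip τ) := (isOpen_actionNhd V ρ).prod (isOpen_strip τ)
  obtain ⟨h1, h2⟩ := hasSum_fderiv_of_summable (isOpen_reducedDomain V ρ τ) (f := fun k (p : Reduced n) =>
      fourierCoefficient F k (p.1, p.2.2) * character k p.2.1) (g := F)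
    (fun k p hp => (hasFDerivAt_term hS (hF.coeff k) k ⟨hp.1, hp.2.2⟩).1.differentiableWithinAt)
    (summable_termBound hF.norm_ne_top) (fun k p hp => norm_term_le hF.norm_ne_top hp k) hF.hasSum
  refine ⟨h1, fun p hp v => ?_⟩
  refine ((ContinuousLinearMap.apply ℂ ℂ v).hasSum (h2 p hp)).congr_fun fun k => ?_
  rw [ContinuousLinearMap.apply_apply, (hasFDerivAt_term hS (hF.coeff k) k ⟨hp.1, hp.2.2⟩).2]

theorem IsFourier.differentiableOn {F : Reduced n → ℂ} (hF : IsFourier V ρ τ F) :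
    DifferentiableOn ℂ F (reducedDomain V ρ τ) := hF.hasSum_fderiv.1

/-- Cauchy's inequality for derivatives in the variables `(I, ξ)`. -/
theorem IsFourier.fderiv_apply {F : Reduced n → ℂ} (hF : IsFourier V ρ τ F) (hτ' : 0 < τ')
    (hρρ : ρ' ≤ ρ) (hττ : τ' ≤ τ) {R : ℝ} (hR : 0 < R) (v : (Fin n → ℂ) × ℂ)
    (hv : ∀ p ∈ actionNhd V ρ' ×ˢ strip τ', ∀ t : ℂ, ‖t‖ < R → p + t • v ∈ actionNhd V ρ ×ˢ strip τ) :
    IsFourier V ρ' τ' (fun p => fderiv ℂ F p (v.1, 0, v.2)) ∧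
      fourierNorm V ρ' τ' (fun p => fderiv ℂ F p (v.1, 0, v.2)) ≤
        ENNReal.ofReal (1 / R) * fourierNorm V ρ τ F := by
  have hS : IsOpen (actionNhd V ρ ×ˢ strip τ) := (isOpen_actionNhd V ρ).prod (isOpen_strip τ)
  have hsub : actionNhd V ρ' ×ˢ strip τ' ⊆ actionNhd V ρ ×ˢ strip τ :=
    prod_mono (actionNhd_mono V hρρ) (strip_mono hττ)
  set c : (Fin n → ℤ) → (Fin n → ℂ) × ℂ → ℂ := fun k p => fderiv ℂ (fourierCoefficient F k) p v
  have hfin : ∀ k, (⨆ p ∈ actionNhd V ρ ×ˢ strip τ, ‖fourierCoefficient F k p‖ₑ) ≠ ⊤ := by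
    intro k h
    refine ENNReal.ne_top_of_tsum_ne_top hF.norm_ne_top k ?_
    rw [h, ENNReal.top_mul]
    simpa using Real.exp_pos _
  have hsup : ∀ k, (⨆ p ∈ actionNhd V ρ' ×ˢ strip τ', ‖c k p‖ₑ) ≤ ENNReal.ofReal (1 / R) *
      ⨆ p ∈ actionNhd V ρ ×ˢ strip τ, ‖fourierCoefficient F k p‖ₑ := by
    intro k
    set M := ⨆ p ∈ actionNhd V ρ ×ˢ strip τ, ‖fourierCoefficient F k p‖ₑ
    refine iSup₂_le fun p hp => ?_
    have h1 : ‖c k p‖ ≤ M.toReal / R := by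
      refine norm_fderiv_apply_le hR (fun t ht => ?_) fun t ht => ?_
      · exact (hF.coeff k).differentiableAt (hS.mem_nhds (hv p hp t ht))
      · have h2 : ‖fourierCoefficient F k (p + t • v)‖ₑ ≤ M := le_iSup₂_of_le _ (hv p hp t ht) le_rfl
        have h3 := ENNReal.toReal_mono (hfin k) h2
        rwa [toReal_enorm] at h3
    calc ‖c k p‖ₑ = ENNReal.ofReal ‖c k p‖ := (ofReal_norm _).symm
      _ ≤ ENNReal.ofReal (1 / R * M.toReal) :=
        ENNReal.ofReal_le_ofReal (h1.trans (le_of_eq (by ring)))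
      _ = _ := by rw [ENNReal.ofReal_mul (by positivity), ENNReal.ofReal_toReal (hfin k)]
  have hle : coeffNorm V ρ' τ' c ≤ ENNReal.ofReal (1 / R) * fourierNorm V ρ τ F := by
    rw [fourierNorm, ← ENNReal.tsum_mul_left]
    refine ENNReal.tsum_le_tsum fun k => ?_
    rw [← mul_assoc]
    gcongr
    exact hsup k
  obtain ⟨h1, h2⟩ := isFourier_of_coeff (c := c) (F := fun p => fderiv ℂ F p (v.1, 0, v.2)) hτ'
    (fun k => (differentiableOn_fderiv_apply hS (hF.coeff k) v).mono hsub)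
    (ne_top_of_le_ne_top (ENNReal.mul_ne_top ENNReal.ofReal_ne_top hF.norm_ne_top) hle)
    (fun p hp => by
      refine (hF.hasSum_fderiv.2 p (reducedDomain_mono V hρρ hττ hp) (v.1, 0, v.2)).congr_fun
        fun k => ?_
      simp [c])
  exact ⟨h1, h2.le.trans hle⟩

/-- `x e^{-x}` is at most `e⁻¹`. -/
theorem mul_exp_le_exp {x a b : ℝ} (hab : a < b) :
    x * Real.exp (x * a) ≤ 1 / (Real.exp 1 * (b - a)) * Real.exp (x * b) := by
  have h1 := Real.add_one_le_exp (x * (b - a) - 1)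
  have h2 : 0 < b - a := sub_pos.2 hab
  have h3 : x * (b - a) ≤ Real.exp (x * (b - a)) * (Real.exp 1)⁻¹ := by
    rw [← Real.exp_neg, ← Real.exp_add, ← sub_eq_add_neg]; linarith
  have h4 : x ≤ 1 / (Real.exp 1 * (b - a)) * Real.exp (x * (b - a)) := by
    rw [div_mul_eq_mul_div, one_mul, le_div_iff₀ (by positivity)]
    calc x * (Real.exp 1 * (b - a)) = Real.exp 1 * (x * (b - a)) := by ring
      _ ≤ Real.exp 1 * (Real.exp (x * (b - a)) * (Real.exp 1)⁻¹) := by gcongr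
      _ = _ := by field_simp
  calc x * Real.exp (x * a) ≤ 1 / (Real.exp 1 * (b - a)) * Real.exp (x * (b - a)) *
        Real.exp (x * a) := by gcongr
    _ = _ := by rw [mul_assoc, ← Real.exp_add]; ring_nf

/-- Cauchy's inequality for the derivatives in the angles; the sum over all angles costs no more
than a single one. -/
theorem IsFourier.fderiv_angle {F : Reduced n → ℂ} (hF : IsFourier V ρ τ F) (hτ' : 0 < τ')
    (hττ : τ' < τ) :
    (∀ i, IsFourier V ρ τ' (fun p => fderiv ℂ F p (0, Pi.single i 1, 0))) ∧
      ∑ i, fourierNorm V ρ τ' (fun p => fderiv ℂ F p (0, Pi.single i 1, 0)) ≤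
        ENNReal.ofReal (1 / (Real.exp 1 * (τ - τ'))) * fourierNorm V ρ τ F := by
  set c : Fin n → (Fin n → ℤ) → (Fin n → ℂ) × ℂ → ℂ := fun i k p =>
    Complex.I * k i * fourierCoefficient F k p
  have hsup : ∀ i k, (⨆ p ∈ actionNhd V ρ ×ˢ strip τ', ‖c i k p‖ₑ) ≤
      ENNReal.ofReal ((k i).natAbs : ℝ) *
        ⨆ p ∈ actionNhd V ρ ×ˢ strip τ, ‖fourierCoefficient F k p‖ₑ := by
    intro i k
    refine iSup₂_le fun p hp => ?_
    simp only [c]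
    rw [enorm_mul]
    gcongr
    · rw [← ofReal_norm]
      refine ENNReal.ofReal_le_ofReal (le_of_eq ?_)
      rw [norm_mul, Complex.norm_I, one_mul, Complex.norm_intCast, Nat.cast_natAbs, Int.cast_abs]
    · exact le_iSup₂_of_le p ⟨hp.1, strip_mono hττ.le hp.2⟩ le_rfl
  have hle : ∑ i, coeffNorm V ρ τ' (c i) ≤
      ENNReal.ofReal (1 / (Real.exp 1 * (τ - τ'))) * fourierNorm V ρ τ F := by
    simp only [coeffNorm]
    rw [← Summable.tsum_finsetSum fun i _ => ENNReal.summable, fourierNorm, ← ENNReal.tsum_mul_left]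
    refine ENNReal.tsum_le_tsum fun k => ?_
    set M := ⨆ p ∈ actionNhd V ρ ×ˢ strip τ, ‖fourierCoefficient F k p‖ₑ
    calc _ ≤ ∑ i, (ENNReal.ofReal ((k i).natAbs : ℝ) * M) *
          ENNReal.ofReal (Real.exp (absSum k * τ')) :=
          Finset.sum_le_sum fun i _ => by gcongr; exact hsup i k
      _ = ENNReal.ofReal (absSum k * Real.exp (absSum k * τ')) * M := by
          rw [← Finset.sum_mul, ← Finset.sum_mul, ← ENNReal.ofReal_sum_of_nonneg (by simp),
            mul_right_comm, ← ENNReal.ofReal_mul (by positivity)]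
          simp [absSum]
      _ ≤ ENNReal.ofReal (1 / (Real.exp 1 * (τ - τ')) * Real.exp (absSum k * τ)) * M := by
          exact mul_le_mul' (ENNReal.ofReal_le_ofReal (mul_exp_le_exp hττ)) le_rfl
      _ = _ := by
          have : 0 < τ - τ' := sub_pos.2 hττ
          rw [ENNReal.ofReal_mul (by positivity)]
          ring
  have hfin : ∀ i, coeffNorm V ρ τ' (c i) ≠ ⊤ := fun i =>
    ne_top_of_le_ne_top (ENNReal.mul_ne_top ENNReal.ofReal_ne_top hF.norm_ne_top)
      ((Finset.single_le_sum (f := fun i => coeffNorm V ρ τ' (c i)) (fun _ _ => zero_le)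
        (Finset.mem_univ i)).trans hle)
  have key : ∀ i, _ := fun i => isFourier_of_coeff (c := c i)
    (F := fun p => fderiv ℂ F p (0, Pi.single i 1, 0)) hτ'
    (fun k => ((hF.coeff k).const_mul _).mono (prod_mono subset_rfl (strip_mono hττ.le)))
    (hfin i) (fun p hp => by
      refine (hF.hasSum_fderiv.2 p (reducedDomain_mono V le_rfl hττ.le hp)
        (0, Pi.single i 1, 0)).congr_fun fun k => ?_
      simp [c, Pi.single_apply, ← Prod.zero_eq_mk])
  refine ⟨fun i => (key i).1, ?_⟩
  rw [Finset.sum_congr rfl fun i _ => (key i).2]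
  exact hle

theorem IsFourier.fderiv_action {F : Reduced n → ℂ} (hF : IsFourier V ρ τ F) (hτ : 0 < τ)
    (hρρ : ρ' < ρ) (i : Fin n) :
    IsFourier V ρ' τ (fun p => fderiv ℂ F p (Pi.single i 1, 0, 0)) ∧
      fourierNorm V ρ' τ (fun p => fderiv ℂ F p (Pi.single i 1, 0, 0)) ≤
        ENNReal.ofReal (1 / (ρ - ρ')) * fourierNorm V ρ τ F := by
  refine hF.fderiv_apply hτ hρρ.le le_rfl (sub_pos.2 hρρ) (Pi.single i 1, 0) fun p hp t ht => ?_
  refine ⟨add_mem_actionNhd hp.1 ?_, by simpa using hp.2⟩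
  change ‖t • (Pi.single i 1 : Fin n → ℂ)‖ ≤ _
  rw [norm_smul, Pi.norm_single, norm_one, mul_one]
  exact ht.le

theorem IsFourier.fderiv_time {F : Reduced n → ℂ} (hF : IsFourier V ρ τ F) (hτ' : 0 < τ')
    (hττ : τ' < τ) :
    IsFourier V ρ τ' (fun p => fderiv ℂ F p (0, 0, 1)) ∧
      fourierNorm V ρ τ' (fun p => fderiv ℂ F p (0, 0, 1)) ≤
        ENNReal.ofReal (1 / (τ - τ')) * fourierNorm V ρ τ F := by
  refine hF.fderiv_apply hτ' le_rfl hττ.le (sub_pos.2 hττ) (0, 1) fun p hp t ht => ?_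
  refine ⟨by simpa using hp.1, add_mem_strip hp.2 ?_⟩
  simpa using ht.le

end FourierAlgebra

/-! ### The Poisson bracket of functions of `(I, φ, ξ)` -/

section Bracket

open Metric Set Filter Topology MeasureTheory

variable {V : Set (Fin n → ℝ)} {ρ ρ' τ τ' δ σ : ℝ}

/-- The bracket `{F, χ}` of functions that do not depend on `η`. -/
def reducedBracket (χ F : Reduced n → ℂ) (p : Reduced n) : ℂ :=
  ∑ i, (fderiv ℂ F p (0, Pi.single i 1, 0) * fderiv ℂ χ p (Pi.single i 1, 0, 0) +
    -(fderiv ℂ F p (Pi.single i 1, 0, 0) * fderiv ℂ χ p (0, Pi.single i 1, 0)))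

theorem reducedBracket_zero_left (F : Reduced n → ℂ) : reducedBracket 0 F = 0 := by
  funext p
  simp [reducedBracket]

theorem reducedBracket_zero_right (χ : Reduced n → ℂ) : reducedBracket χ 0 = 0 := by
  funext p
  simp [reducedBracket]

/-- Forgetting `η`, as a linear map. -/
def reduceCLM (n : ℕ) : Phase n →L[ℂ] Reduced n :=
  (ContinuousLinearMap.fst ℂ (Fin n → ℂ) (ℂ × (Fin n → ℂ) × ℂ)).prod
    ((ContinuousLinearMap.snd ℂ ℂ ((Fin n → ℂ) × ℂ)).comp
      (ContinuousLinearMap.snd ℂ (Fin n → ℂ) (ℂ × (Fin n → ℂ) × ℂ)))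

theorem reduce_mem {ρ₀ : ℝ} {z : Phase n} (hz : z ∈ domain V ρ₀ τ) :
    reduce z ∈ reducedDomain V ρ₀ τ := ⟨hz.1, hz.2.2⟩

theorem fderiv_comp_reduce {F : Reduced n → ℂ} {z : Phase n}
    (hF : DifferentiableAt ℂ F (reduce z)) (v : Phase n) :
    fderiv ℂ (fun w => F (reduce w)) z v = fderiv ℂ F (reduce z) (reduce v) := by
  have h := HasFDerivAt.comp (f := fun w : Phase n => reduce w) z hF.hasFDerivAt
    (reduceCLM n).hasFDerivAt
  have h2 := h.fderiv
  change fderiv ℂ (fun w => F (reduce w)) z = _ at h2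
  rw [h2]
  rfl

/-- The Hamiltonian field of a function of `(I, φ, ξ)`. -/
theorem hamiltonianField_comp_reduce {χ : Reduced n → ℂ} {z : Phase n}
    (hχ : DifferentiableAt ℂ χ (reduce z)) :
    hamiltonianField (fun w => χ (reduce w)) z =
      (fun i => -fderiv ℂ χ (reduce z) (0, Pi.single i 1, 0),
        -fderiv ℂ χ (reduce z) (0, 0, 1),
        fun i => fderiv ℂ χ (reduce z) (Pi.single i 1, 0, 0), 0) := by
  simp only [hamiltonianField, fderiv_comp_reduce hχ]
  simp [reduce, ← Prod.zero_eq_mk]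

theorem reduced_eq_sum (v : Reduced n) : v =
    (∑ i, v.1 i • ((Pi.single i 1, 0, 0) : Reduced n)) +
      (∑ i, v.2.1 i • ((0, Pi.single i 1, 0) : Reduced n)) +
      v.2.2 • ((0, 0, 1) : Reduced n) := by
  refine Prod.ext ?_ (Prod.ext ?_ ?_)
  · funext j
    simp [Prod.fst_sum, Finset.sum_apply, Pi.single_apply]
  · funext j
    simp [Prod.fst_sum, Prod.snd_sum, Finset.sum_apply, Pi.single_apply]
  · simp [Prod.snd_sum]

theorem fderiv_hamiltonianField_reduce {χ F : Reduced n → ℂ} {z : Phase n}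
    (hχ : DifferentiableAt ℂ χ (reduce z)) (hF : DifferentiableAt ℂ F (reduce z)) :
    fderiv ℂ (fun w => F (reduce w)) z (hamiltonianField (fun w => χ (reduce w)) z) =
      reducedBracket χ F (reduce z) := by
  have key : ∀ v : Reduced n, fderiv ℂ F (reduce z) v =
      (∑ i, v.1 i * fderiv ℂ F (reduce z) (Pi.single i 1, 0, 0)) +
      (∑ i, v.2.1 i * fderiv ℂ F (reduce z) (0, Pi.single i 1, 0)) +
      v.2.2 * fderiv ℂ F (reduce z) (0, 0, 1) := by
    intro v
    conv_lhs => rw [reduced_eq_sum v]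
    simp only [map_add, map_sum, map_smul, smul_eq_mul]
  rw [fderiv_comp_reduce hF, hamiltonianField_comp_reduce hχ, key, reducedBracket,
    ← Finset.sum_add_distrib]
  change _ + 0 * _ = _
  rw [zero_mul, add_zero]
  refine Finset.sum_congr rfl fun i _ => ?_
  simp only [reduce]
  ring

/-- Cauchy's inequalities for the bracket. In each product one factor is differentiated in an
action and the other one in an angle, and the angular derivatives are summable over the angles at
no cost. -/
theorem isFourier_reducedBracket {ρ₁ ρ₂ τ₁ τ₂ : ℝ} {χ F : Reduced n → ℂ} (hτ : 0 < τ)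
    (hχ : IsFourier V ρ₁ τ₁ χ) (hF : IsFourier V ρ₂ τ₂ F) (h1 : ρ < ρ₁) (h2 : ρ < ρ₂)
    (h3 : τ < τ₁) (h4 : τ < τ₂) :
    IsFourier V ρ τ (reducedBracket χ F) ∧ fourierNorm V ρ τ (reducedBracket χ F) ≤
      ENNReal.ofReal (1 / (Real.exp 1 * (τ₂ - τ) * (ρ₁ - ρ)) +
        1 / (Real.exp 1 * (τ₁ - τ) * (ρ₂ - ρ))) *
        (fourierNorm V ρ₁ τ₁ χ * fourierNorm V ρ₂ τ₂ F) := by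
  have hχI := fun i => (hχ.mono le_rfl h3.le).fderiv_action hτ h1 i
  have hFI := fun i => (hF.mono le_rfl h4.le).fderiv_action hτ h2 i
  obtain ⟨hχφ, hχφn⟩ := (hχ.mono h1.le le_rfl).fderiv_angle hτ h3
  obtain ⟨hFφ, hFφn⟩ := (hF.mono h2.le le_rfl).fderiv_angle hτ h4
  have hterm : ∀ i : Fin n, _ := fun i => isFourier_add hτ (isFourier_mul hτ (hFφ i) (hχI i).1).1
    (isFourier_neg hτ (isFourier_mul hτ (hFI i).1 (hχφ i)).1).1
  obtain ⟨ha, hb⟩ := isFourier_finset_sum hτ Finset.univ fun i _ => (hterm i).1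
  refine ⟨ha, hb.trans ?_⟩
  set Nχ := fourierNorm V ρ₁ τ₁ χ
  set NF := fourierNorm V ρ₂ τ₂ F
  have p1 : 0 < ρ₁ - ρ := sub_pos.2 h1
  have p2 : 0 < ρ₂ - ρ := sub_pos.2 h2
  have p3 : 0 < τ₁ - τ := sub_pos.2 h3
  have p4 : 0 < τ₂ - τ := sub_pos.2 h4
  have hbound : ∀ i : Fin n, fourierNorm V ρ τ (fun p =>
        fderiv ℂ F p (0, Pi.single i 1, 0) * fderiv ℂ χ p (Pi.single i 1, 0, 0) +
          -(fderiv ℂ F p (Pi.single i 1, 0, 0) * fderiv ℂ χ p (0, Pi.single i 1, 0))) ≤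
      fourierNorm V ρ τ (fun p => fderiv ℂ F p (0, Pi.single i 1, 0)) *
        (ENNReal.ofReal (1 / (ρ₁ - ρ)) * Nχ) +
      ENNReal.ofReal (1 / (ρ₂ - ρ)) * NF *
        fourierNorm V ρ τ (fun p => fderiv ℂ χ p (0, Pi.single i 1, 0)) := by
    intro i
    refine (hterm i).2.trans (add_le_add ?_ ?_)
    · refine (isFourier_mul hτ (hFφ i) (hχI i).1).2.trans (mul_le_mul' le_rfl ?_)
      exact (hχI i).2.trans (mul_le_mul' le_rfl (fourierNorm_mono le_rfl h3.le _))
    · refine (isFourier_neg hτ (isFourier_mul hτ (hFI i).1 (hχφ i)).1).2.trans ?_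
      refine (isFourier_mul hτ (hFI i).1 (hχφ i)).2.trans (mul_le_mul' ?_ le_rfl)
      exact (hFI i).2.trans (mul_le_mul' le_rfl (fourierNorm_mono le_rfl h4.le _))
  refine (Finset.sum_le_sum fun i _ => hbound i).trans ?_
  rw [Finset.sum_add_distrib, ← Finset.sum_mul, ← Finset.mul_sum]
  have hFφn' := hFφn.trans (mul_le_mul' le_rfl (fourierNorm_mono h2.le le_rfl F))
  have hχφn' := hχφn.trans (mul_le_mul' le_rfl (fourierNorm_mono h1.le le_rfl χ))
  calc _ ≤ ENNReal.ofReal (1 / (Real.exp 1 * (τ₂ - τ))) * NF *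
          (ENNReal.ofReal (1 / (ρ₁ - ρ)) * Nχ) + ENNReal.ofReal (1 / (ρ₂ - ρ)) * NF *
          (ENNReal.ofReal (1 / (Real.exp 1 * (τ₁ - τ))) * Nχ) :=
        add_le_add (mul_le_mul' hFφn' le_rfl) (mul_le_mul' le_rfl hχφn')
    _ = (ENNReal.ofReal (1 / (Real.exp 1 * (τ₂ - τ))) * ENNReal.ofReal (1 / (ρ₁ - ρ)) +
          ENNReal.ofReal (1 / (Real.exp 1 * (τ₁ - τ))) * ENNReal.ofReal (1 / (ρ₂ - ρ))) *
          (Nχ * NF) := by ring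
    _ = _ := by
        rw [← ENNReal.ofReal_mul (by positivity), ← ENNReal.ofReal_mul (by positivity),
          ← ENNReal.ofReal_add (by positivity) (by positivity), div_mul_div_comm,
          div_mul_div_comm, one_mul]

/-! ### The scale of domains -/

/-- The width in the actions at level `u`; it decreases from `δ` at `u = 0` to `3δ/4` at
`u = 1`. -/
def actionWidth (δ u : ℝ) : ℝ := δ * (1 - u / 4)

/-- The width in the angles and in `ξ` at level `u`; it decreases from `6σ/5` at `u = 0` to
`3σ/4` at `u = 1`. -/
def angleWidth (σ u : ℝ) : ℝ := σ * (6 / 5 - 9 / 20 * u)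

/-- The Fourier norm at level `u`. -/
def levelNorm (V : Set (Fin n → ℝ)) (δ σ u : ℝ) (F : Reduced n → ℂ) : ℝ≥0∞ :=
  fourierNorm V (actionWidth δ u) (angleWidth σ u) F

/-- `F` is the sum of a normally convergent Fourier series at level `u`. -/
abbrev IsFourierAt (V : Set (Fin n → ℝ)) (δ σ u : ℝ) (F : Reduced n → ℂ) : Prop :=
  IsFourier V (actionWidth δ u) (angleWidth σ u) F

/-- The constant in the estimate of the bracket on the scale of domains. -/
def bracketConst (δ σ : ℝ) : ℝ := 2 / (Real.exp 1 * (δ / 4) * (9 / 20 * σ))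

theorem bracketConst_pos (hδ : 0 < δ) (hσ : 0 < σ) : 0 < bracketConst δ σ := by
  unfold bracketConst; positivity

theorem angleWidth_pos (hσ : 0 < σ) {u : ℝ} (hu : u ≤ 1) : 0 < angleWidth σ u := by
  unfold angleWidth
  have : 0 < 6 / 5 - 9 / 20 * u := by linarith
  positivity

theorem actionWidth_anti (hδ : 0 < δ) {u w : ℝ} (h : u ≤ w) : actionWidth δ w ≤ actionWidth δ u := by
  unfold actionWidth
  gcongr

theorem angleWidth_anti (hσ : 0 < σ) {u w : ℝ} (h : u ≤ w) : angleWidth σ w ≤ angleWidth σ u := by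
  unfold angleWidth
  gcongr

theorem actionWidth_sub (δ u w : ℝ) : actionWidth δ u - actionWidth δ w = δ / 4 * (w - u) := by
  unfold actionWidth; ring

theorem angleWidth_sub (σ u w : ℝ) : angleWidth σ u - angleWidth σ w = 9 / 20 * σ * (w - u) := by
  unfold angleWidth; ring

theorem levelNorm_anti (hδ : 0 < δ) (hσ : 0 < σ) {u w : ℝ} (h : u ≤ w) (F : Reduced n → ℂ) :
    levelNorm V δ σ w F ≤ levelNorm V δ σ u F :=
  fourierNorm_mono (actionWidth_anti hδ h) (angleWidth_anti hσ h) F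

theorem IsFourierAt.anti (hδ : 0 < δ) (hσ : 0 < σ) {u w : ℝ} {F : Reduced n → ℂ}
    (hF : IsFourierAt V δ σ u F) (h : u ≤ w) : IsFourierAt V δ σ w F :=
  hF.mono (actionWidth_anti hδ h) (angleWidth_anti hσ h)

theorem isFourierAt_reducedBracket (hδ : 0 < δ) (hσ : 0 < σ) {u₁ u₂ u : ℝ} {χ F : Reduced n → ℂ}
    (hχ : IsFourierAt V δ σ u₁ χ) (hF : IsFourierAt V δ σ u₂ F) (h1 : u₁ < u) (h2 : u₂ < u)
    (hu : u ≤ 1) :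
    IsFourierAt V δ σ u (reducedBracket χ F) ∧ levelNorm V δ σ u (reducedBracket χ F) ≤
      ENNReal.ofReal (bracketConst δ σ / ((u - u₁) * (u - u₂))) *
        (levelNorm V δ σ u₁ χ * levelNorm V δ σ u₂ F) := by
  have p1 : 0 < u - u₁ := sub_pos.2 h1
  have p2 : 0 < u - u₂ := sub_pos.2 h2
  have q1 : 0 < actionWidth δ u₁ - actionWidth δ u := by rw [actionWidth_sub]; positivity
  have q2 : 0 < actionWidth δ u₂ - actionWidth δ u := by rw [actionWidth_sub]; positivity
  have q3 : 0 < angleWidth σ u₁ - angleWidth σ u := by rw [angleWidth_sub]; positivity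
  have q4 : 0 < angleWidth σ u₂ - angleWidth σ u := by rw [angleWidth_sub]; positivity
  obtain ⟨ha, hb⟩ := isFourier_reducedBracket (angleWidth_pos hσ hu) hχ hF (sub_pos.1 q1)
    (sub_pos.1 q2) (sub_pos.1 q3) (sub_pos.1 q4)
  refine ⟨ha, hb.trans (le_of_eq ?_)⟩
  simp only [actionWidth_sub, angleWidth_sub, levelNorm]
  congr 2
  rw [bracketConst]
  field_simp
  ring

/-- The derivatives that occur as components of a Hamiltonian field; the three bounds are stated in
the units of the scale of domains. -/
theorem isFourierAt_fderiv (hδ : 0 < δ) (hσ : 0 < σ) {u₁ u : ℝ} {χ : Reduced n → ℂ}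
    (hχ : IsFourierAt V δ σ u₁ χ) (h1 : u₁ < u) (hu : u ≤ 1) :
    (∀ i, IsFourierAt V δ σ u (fun p => fderiv ℂ χ p (Pi.single i 1, 0, 0)) ∧
      levelNorm V δ σ u (fun p => fderiv ℂ χ p (Pi.single i 1, 0, 0)) ≤
        ENNReal.ofReal (1 / (δ / 4 * (u - u₁))) * levelNorm V δ σ u₁ χ) ∧
    (∀ i, IsFourierAt V δ σ u (fun p => fderiv ℂ χ p (0, Pi.single i 1, 0)) ∧
      levelNorm V δ σ u (fun p => fderiv ℂ χ p (0, Pi.single i 1, 0)) ≤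
        ENNReal.ofReal (1 / (9 / 20 * σ * (u - u₁))) * levelNorm V δ σ u₁ χ) ∧
    IsFourierAt V δ σ u (fun p => fderiv ℂ χ p (0, 0, 1)) ∧
      levelNorm V δ σ u (fun p => fderiv ℂ χ p (0, 0, 1)) ≤
        ENNReal.ofReal (1 / (9 / 20 * σ * (u - u₁))) * levelNorm V δ σ u₁ χ := by
  have p1 : 0 < u - u₁ := sub_pos.2 h1
  have q1 : 0 < actionWidth δ u₁ - actionWidth δ u := by rw [actionWidth_sub]; positivity
  have q3 : 0 < angleWidth σ u₁ - angleWidth σ u := by rw [angleWidth_sub]; positivity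
  have hτ := angleWidth_pos hσ hu
  refine ⟨fun i => ?_, fun i => ?_, ?_⟩
  · obtain ⟨ha, hb⟩ := (hχ.mono le_rfl (sub_pos.1 q3).le).fderiv_action hτ (sub_pos.1 q1) i
    refine ⟨ha, hb.trans ?_⟩
    rw [actionWidth_sub]
    exact mul_le_mul' le_rfl (fourierNorm_mono le_rfl (sub_pos.1 q3).le _)
  · obtain ⟨ha, hb⟩ := (hχ.mono (sub_pos.1 q1).le le_rfl).fderiv_angle hτ (sub_pos.1 q3)
    refine ⟨ha i, ((Finset.single_le_sum (f := fun i => fourierNorm V (actionWidth δ u)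
      (angleWidth σ u) (fun p => fderiv ℂ χ p (0, Pi.single i 1, 0))) (fun _ _ => zero_le)
      (Finset.mem_univ i)).trans hb).trans ?_⟩
    refine mul_le_mul' (ENNReal.ofReal_le_ofReal ?_) (fourierNorm_mono (sub_pos.1 q1).le le_rfl _)
    rw [angleWidth_sub]
    refine one_div_le_one_div_of_le (by positivity) (le_mul_of_one_le_left (by positivity) ?_)
    exact Real.one_le_exp zero_le_one
  · obtain ⟨ha, hb⟩ := (hχ.mono (sub_pos.1 q1).le le_rfl).fderiv_time hτ (sub_pos.1 q3)
    refine ⟨ha, hb.trans ?_⟩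
    rw [angleWidth_sub]
    exact mul_le_mul' le_rfl (fourierNorm_mono (sub_pos.1 q1).le le_rfl _)

/-! ### Trigonometric polynomials -/

/-- `F` is a trigonometric polynomial with harmonics `|k| < N` and holomorphic coefficients. The
terms are indexed by an arbitrary finite type, and harmonics may be repeated. -/
def IsTrigPolynomial (V : Set (Fin n → ℝ)) (ρ τ : ℝ) (N : ℕ) (F : Reduced n → ℂ) : Prop :=
  ∃ (ι : Type) (_ : Fintype ι) (k : ι → Fin n → ℤ) (c : ι → (Fin n → ℂ) × ℂ → ℂ),
    (∀ i, absSum (k i) < N) ∧ (∀ i, DifferentiableOn ℂ (c i) (actionNhd V ρ ×ˢ strip τ)) ∧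
    ∀ p ∈ reducedDomain V ρ τ, F p = ∑ i, c i (p.1, p.2.2) * character (k i) p.2.1

variable {N N' : ℕ} {F G : Reduced n → ℂ}

theorem IsTrigPolynomial.mono (hF : IsTrigPolynomial V ρ τ N F) (hρ : ρ' ≤ ρ) (hτ : τ' ≤ τ)
    (hN : N ≤ N') : IsTrigPolynomial V ρ' τ' N' F := by
  obtain ⟨ι, _, k, c, hk, hc, h⟩ := hF
  exact ⟨ι, inferInstance, k, c, fun i => (hk i).trans_le hN,
    fun i => (hc i).mono (prod_mono (actionNhd_mono V hρ) (strip_mono hτ)),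
    fun p hp => h p (reducedDomain_mono V hρ hτ hp)⟩

theorem IsTrigPolynomial.congr (hF : IsTrigPolynomial V ρ τ N F)
    (h : ∀ p ∈ reducedDomain V ρ τ, G p = F p) : IsTrigPolynomial V ρ τ N G := by
  obtain ⟨ι, _, k, c, hk, hc, h'⟩ := hF
  exact ⟨ι, inferInstance, k, c, hk, hc, fun p hp => by rw [h p hp, h' p hp]⟩

theorem isTrigPolynomial_zero : IsTrigPolynomial V ρ τ N fun _ : Reduced n => 0 :=
  ⟨Empty, inferInstance, fun e => e.elim, fun e => e.elim, fun e => e.elim, fun e => e.elim,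
    fun p _ => by simp⟩

theorem IsTrigPolynomial.add (hF : IsTrigPolynomial V ρ τ N F) (hG : IsTrigPolynomial V ρ τ N G) :
    IsTrigPolynomial V ρ τ N fun p => F p + G p := by
  obtain ⟨ι, _, k, c, hk, hc, h⟩ := hF
  obtain ⟨ι', _, k', c', hk', hc', h'⟩ := hG
  refine ⟨ι ⊕ ι', inferInstance, Sum.elim k k', Sum.elim c c', ?_, ?_, fun p hp => ?_⟩
  · rintro (i | i)
    exacts [hk i, hk' i]
  · rintro (i | i)
    exacts [hc i, hc' i]
  · simp [Fintype.sum_sum_type, h p hp, h' p hp]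

theorem IsTrigPolynomial.sum {κ : Type*} (s : Finset κ) {F : κ → Reduced n → ℂ}
    (hF : ∀ a ∈ s, IsTrigPolynomial V ρ τ N (F a)) :
    IsTrigPolynomial V ρ τ N fun p => ∑ a ∈ s, F a p := by
  classical
  induction s using Finset.induction_on with
  | empty => simpa using isTrigPolynomial_zero
  | insert a s ha ih =>
    simp only [Finset.sum_insert ha]
    exact (hF a (Finset.mem_insert_self a s)).add
      (ih fun b hb => hF b (Finset.mem_insert_of_mem hb))

theorem IsTrigPolynomial.mul {N₁ N₂ : ℕ} (hF : IsTrigPolynomial V ρ τ N₁ F)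
    (hG : IsTrigPolynomial V ρ τ N₂ G) : IsTrigPolynomial V ρ τ (N₁ + N₂) fun p => F p * G p := by
  obtain ⟨ι, _, k, c, hk, hc, h⟩ := hF
  obtain ⟨ι', _, k', c', hk', hc', h'⟩ := hG
  refine ⟨ι × ι', inferInstance, fun a => k a.1 + k' a.2, fun a p => c a.1 p * c' a.2 p, fun a => ?_,
    fun a => (hc a.1).mul (hc' a.2), fun p hp => ?_⟩
  · exact (absSum_add_le _ _).trans_lt (add_lt_add (hk _) (hk' _))
  · simp only
    rw [h p hp, h' p hp, Finset.sum_mul_sum, Fintype.sum_prod_type]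
    refine Finset.sum_congr rfl fun i _ => Finset.sum_congr rfl fun j _ => ?_
    rw [character_add]
    ring

theorem IsTrigPolynomial.const_mul (hF : IsTrigPolynomial V ρ τ N F) (a : ℂ) :
    IsTrigPolynomial V ρ τ N fun p => a * F p := by
  obtain ⟨ι, _, k, c, hk, hc, h⟩ := hF
  refine ⟨ι, inferInstance, k, fun i p => a * c i p, hk, fun i => (hc i).const_mul a, fun p hp => ?_⟩
  simp only
  rw [h p hp, Finset.mul_sum]
  exact Finset.sum_congr rfl fun i _ => by ring

theorem IsTrigPolynomial.neg (hF : IsTrigPolynomial V ρ τ N F) :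
    IsTrigPolynomial V ρ τ N fun p => -F p := by
  simpa using hF.const_mul (-1)

theorem IsTrigPolynomial.fderiv (hF : IsTrigPolynomial V ρ τ N F) (v : Reduced n) :
    IsTrigPolynomial V ρ τ N fun p => fderiv ℂ F p v := by
  obtain ⟨ι, _, k, c, hk, hc, h⟩ := hF
  have hS : IsOpen (actionNhd V ρ ×ˢ strip τ) := (isOpen_actionNhd V ρ).prod (isOpen_strip τ)
  refine ⟨ι, inferInstance, k, fun i q => _root_.fderiv ℂ (c i) q (v.1, v.2.2) +
    Complex.I * (∑ j, (k i j : ℂ) * v.2.1 j) * c i q, hk, fun i =>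
      (differentiableOn_fderiv_apply hS (hc i) _).add ((hc i).const_mul _), fun p hp => ?_⟩
  have heq : F =ᶠ[𝓝 p] fun p => ∑ i, c i (p.1, p.2.2) * character (k i) p.2.1 := by
    filter_upwards [(isOpen_reducedDomain V ρ τ).mem_nhds hp] with q hq using h q hq
  have hd := fun i => hasFDerivAt_term hS (hc i) (k i) (p := p) ⟨hp.1, hp.2.2⟩
  simp only
  rw [heq.fderiv_eq, fderiv_fun_sum fun i _ => (hd i).1, _root_.sum_apply]
  exact Finset.sum_congr rfl fun i _ => (hd i).2 v

theorem IsTrigPolynomial.reducedBracket {N₁ N₂ : ℕ} {χ : Reduced n → ℂ}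
    (hχ : IsTrigPolynomial V ρ τ N₁ χ) (hF : IsTrigPolynomial V ρ τ N₂ F) :
    IsTrigPolynomial V ρ τ (N₁ + N₂) (reducedBracket χ F) :=
  IsTrigPolynomial.sum _ fun _ _ =>
    (((hF.fderiv _).mul (hχ.fderiv _)).mono le_rfl le_rfl (add_comm N₂ N₁).le).add
      (((hF.fderiv _).mul (hχ.fderiv _)).mono le_rfl le_rfl (add_comm N₂ N₁).le).neg

theorem IsTrigPolynomial.fourierCoefficient_eq_zero (hτ : 0 < τ) (hF : IsTrigPolynomial V ρ τ N F)
    {k : Fin n → ℤ} (hk : N ≤ absSum k) {p : (Fin n → ℂ) × ℂ}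
    (hp : p ∈ actionNhd V ρ ×ˢ strip τ) : fourierCoefficient F k p = 0 := by
  obtain ⟨ι, _, l, c, hl, hc, h⟩ := hF
  have h1 : ∀ φ : Fin n → ℝ, F (p.1, ofRealVec φ, p.2) * character (-k) (ofRealVec φ) =
      ∑ i, c i p * character (l i - k) (ofRealVec φ) := by
    intro φ
    rw [h _ ⟨hp.1, ofRealVec_mem_angleStrip hτ φ, hp.2⟩, Finset.sum_mul]
    refine Finset.sum_congr rfl fun i _ => ?_
    rw [sub_eq_add_neg, character_add, mul_assoc]
  rw [fourierCoefficient]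
  simp only [h1]
  rw [integral_finsetSum _ fun _ _ => ?_]
  · rw [Finset.sum_eq_zero fun i _ => ?_, mul_zero]
    rw [integral_const_mul, integral_character, if_neg, mul_zero]
    intro h0
    have := hl i
    rw [sub_eq_zero.1 h0] at this
    omega
  · refine (Continuous.integrableOn_Icc ?_)
    exact continuous_const.mul ((continuous_character _).comp continuous_ofRealVec)

end Bracket

/-! ### Fourier expansion of bounded holomorphic functions on a complexified torus -/

section Expansion

open Metric Set Filter Topology MeasureTheory

/-- A continuous `2π`-periodic function of `n` variables as a function on the torus. -/
theorem exists_torus_function {G : (Fin n → ℝ) → ℂ} (hG : Continuous G)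
    (hper : ∀ φ (k : Fin n → ℤ), G (fun i => φ i + 2 * Real.pi * k i) = G φ) :
    ∃ g : C(UnitAddTorus (Fin n), ℂ), ∀ y : Fin n → ℝ,
      g (fun i => (y i : UnitAddCircle)) = G fun i => 2 * Real.pi * y i := by
  have hq : IsOpenQuotientMap
      (Pi.map fun _ : Fin n => ((↑) : ℝ → UnitAddCircle)) :=
    IsOpenQuotientMap.piMap fun _ => QuotientAddGroup.isOpenQuotientMap_mk
  choose rep hrep using hq.surjective
  set g : UnitAddTorus (Fin n) → ℂ := fun x => G fun i => 2 * Real.pi * rep x i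
  have hg : ∀ y : Fin n → ℝ, g (fun i => (y i : UnitAddCircle)) = G fun i => 2 * Real.pi * y i := by
    intro y
    have h1 : ∀ i, ∃ k : ℤ, rep (fun i => (y i : UnitAddCircle)) i = y i + k := by
      intro i
      have h2 : ((rep (fun i => (y i : UnitAddCircle)) i : ℝ) : UnitAddCircle) = (y i : ℝ) :=
        congrFun (hrep fun i => (y i : UnitAddCircle)) i
      obtain ⟨k, hk⟩ := (QuotientAddGroup.eq_iff_sub_mem.1 h2)
      refine ⟨k, ?_⟩
      have hk' : (k : ℝ) = rep (fun i => (y i : UnitAddCircle)) i - y i := by simpa using hk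
      linarith
    choose k hk using h1
    simp only [g]
    rw [← hper (fun i => 2 * Real.pi * y i) k]
    congr 1
    funext i
    rw [hk]
    ring
  have hc : Continuous g := by
    refine hq.isQuotientMap.continuous_iff.2 ?_
    have h1 : g ∘ Pi.map (fun _ : Fin n => ((↑) : ℝ → UnitAddCircle)) =
        fun y => G fun i => 2 * Real.pi * y i := funext hg
    rw [h1]
    fun_prop
  exact ⟨⟨g, hc⟩, hg⟩

theorem mFourier_coe (k : Fin n → ℤ) (y : Fin n → ℝ) :
    UnitAddTorus.mFourier k (fun i => (y i : UnitAddCircle)) =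
      character k (ofRealVec fun i => 2 * Real.pi * y i) := by
  rw [UnitAddTorus.mFourier, ContinuousMap.coe_mk, character, Finset.mul_sum, Complex.exp_sum]
  refine Finset.prod_congr rfl fun i _ => ?_
  rw [fourier_coe_apply]
  congr 1
  simp [ofRealVec]
  ring

open scoped Pointwise in
theorem mFourierCoeff_eq_integral_Icc {G : (Fin n → ℝ) → ℂ} {g : C(UnitAddTorus (Fin n), ℂ)}
    (hg : ∀ y : Fin n → ℝ, g (fun i => (y i : UnitAddCircle)) = G fun i => 2 * Real.pi * y i)
    (k : Fin n → ℤ) (a : Fin n → ℝ) :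
    UnitAddTorus.mFourierCoeff g k = ((2 * Real.pi : ℝ) : ℂ)⁻¹ ^ n *
      ∫ φ in Set.Icc a (fun i => a i + 2 * Real.pi), G φ * character (-k) (ofRealVec φ) := by
  have hπ : 0 < 2 * Real.pi := Real.two_pi_pos
  rw [UnitAddTorus.mFourierCoeff_eq_integral g k fun i => a i / (2 * Real.pi)]
  have h1 : ∀ x : Fin n → ℝ, UnitAddTorus.mFourier (-k) (fun i => (x i : UnitAddCircle)) •
      g (fun i => (x i : UnitAddCircle)) =
      (fun φ => G φ * character (-k) (ofRealVec φ)) ((2 * Real.pi) • x) := by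
    intro x
    rw [mFourier_coe, hg, smul_eq_mul, mul_comm]
    rfl
  rw [integral_congr_ae (Eventually.of_forall h1),
    Measure.setIntegral_comp_smul_of_pos volume (fun φ => G φ * character (-k) (ofRealVec φ)) _ hπ]
  have h2 : {x : Fin n → ℝ | ∀ i, x i ∈ Ioc (a i / (2 * Real.pi)) (a i / (2 * Real.pi) + 1)} =
      Set.pi univ fun i => Ioc (a i / (2 * Real.pi)) (a i / (2 * Real.pi) + 1) := by
    ext x; simp
  have h3 : (2 * Real.pi) • {x : Fin n → ℝ | ∀ i, x i ∈
      Ioc (a i / (2 * Real.pi)) (a i / (2 * Real.pi) + 1)} =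
      Set.pi univ fun i => Ioc (a i) (a i + 2 * Real.pi) := by
    rw [h2, smul_pi₀ _ _ hπ.ne']
    congr 1
    funext i
    simp only [Pi.smul_apply]
    rw [LinearOrderedField.smul_Ioc hπ]
    congr 1 <;> field_simp
  have h4 : (Set.pi univ fun i => Ioc (a i) (a i + 2 * Real.pi)) =ᵐ[volume]
      Set.Icc a fun i => a i + 2 * Real.pi := Measure.univ_pi_Ioc_ae_eq_Icc
  rw [h3, setIntegral_congr_set h4, Complex.real_smul, inv_pow]
  simp

theorem setIntegral_translate {G : (Fin n → ℝ) → ℂ} (hG : Continuous G)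
    (hper : ∀ φ (k : Fin n → ℤ), G (fun i => φ i + 2 * Real.pi * k i) = G φ) (a : Fin n → ℝ) :
    ∫ φ in Set.Icc (0 : Fin n → ℝ) (fun _ => 2 * Real.pi), G (φ + a) =
      ∫ φ in Set.Icc (0 : Fin n → ℝ) (fun _ => 2 * Real.pi), G φ := by
  obtain ⟨g, hg⟩ := exists_torus_function hG hper
  have h1 := mFourierCoeff_eq_integral_Icc hg 0 a
  rw [mFourierCoeff_eq_integral_Icc hg 0 0] at h1
  have hπ : ((2 * Real.pi : ℝ) : ℂ)⁻¹ ^ n ≠ 0 := by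
    simp [Real.pi_ne_zero]
  simp only [neg_zero, character_zero, mul_one, Pi.zero_apply, zero_add] at h1
  have h2 := mul_left_cancel₀ hπ h1
  have h3 := (measurePreserving_add_right (volume : Measure (Fin n → ℝ)) a).setIntegral_preimage_emb
    (MeasurableEquiv.addRight a).measurableEmbedding G
    (Set.Icc a (fun i => a i + 2 * Real.pi))
  rw [h2, ← h3]
  congr 2
  ext x
  simp [Pi.le_def, add_comm]

/-- Fourier inversion under absolute convergence. -/
theorem hasSum_character_of_summable {G : (Fin n → ℝ) → ℂ} (hG : Continuous G)
    (hper : ∀ φ (k : Fin n → ℤ), G (fun i => φ i + 2 * Real.pi * k i) = G φ)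
    {c : (Fin n → ℤ) → ℂ} (hc : ∀ k, c k = ((2 * Real.pi : ℝ) : ℂ)⁻¹ ^ n *
      ∫ φ in Set.Icc (0 : Fin n → ℝ) (fun _ => 2 * Real.pi), G φ * character (-k) (ofRealVec φ))
    (hs : Summable c) (φ : Fin n → ℝ) :
    HasSum (fun k => c k * character k (ofRealVec φ)) (G φ) := by
  obtain ⟨g, hg⟩ := exists_torus_function hG hper
  have h1 : UnitAddTorus.mFourierCoeff g = c := by
    funext k
    rw [mFourierCoeff_eq_integral_Icc hg k 0, hc]
    simp
  have hφ : (fun i => 2 * Real.pi * (φ i / (2 * Real.pi))) = φ := by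
    funext i
    field_simp
  have h2 := UnitAddTorus.hasSum_mFourier_series_apply_of_summable (f := g) (by rwa [h1])
    (fun i => ((φ i / (2 * Real.pi) : ℝ) : UnitAddCircle))
  rw [h1, hg, hφ] at h2
  refine h2.congr_fun fun k => ?_
  rw [mFourier_coe, hφ, smul_eq_mul]

variable {E W : Type} [NormedAddCommGroup E] [NormedSpace ℂ E]
  [NormedAddCommGroup W] [NormedSpace ℂ W] [FiniteDimensional ℂ W]

/-- Differentiation under the integral sign for bounded holomorphic integrands. -/
theorem differentiableOn_setIntegral {U : Set E} (hU : IsOpen U) {Ω : Set W} (hΩ : IsOpen Ω)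
    {Q : W → ℂ} (hQ : DifferentiableOn ℂ Q Ω) {M : ℝ} (hM : ∀ w ∈ Ω, ‖Q w‖ ≤ M) (L : E →L[ℂ] W)
    {m : (Fin n → ℝ) → W} (hm : Continuous m) (hmaps : ∀ x ∈ U, ∀ φ, L x + m φ ∈ Ω) :
    DifferentiableOn ℂ
      (fun x => ∫ φ in Set.Icc (0 : Fin n → ℝ) (fun _ => 2 * Real.pi), Q (L x + m φ)) U := by
  intro x₀ hx₀
  obtain ⟨R, hR, hRU⟩ := Metric.isOpen_iff.1 hU x₀ hx₀
  have hd : ∀ φ, ∀ x ∈ U, HasFDerivAt (fun x => Q (L x + m φ))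
      ((fderiv ℂ Q (L x + m φ)).comp L) x := fun φ x hx =>
    HasFDerivAt.comp (f := fun x => L x + m φ) x
      (hQ.differentiableAt (hΩ.mem_nhds (hmaps x hx φ))).hasFDerivAt
      (L.hasFDerivAt.add_const _)
  have hcont : ∀ x ∈ U, Continuous fun φ => Q (L x + m φ) := fun x hx =>
    hQ.continuousOn.comp_continuous (by fun_prop) (hmaps x hx)
  have hcont' : Continuous fun φ => (fderiv ℂ Q (L x₀ + m φ)).comp L := by
    have h1 : Continuous fun φ => fderiv ℂ Q (L x₀ + m φ) :=
      (differentiableOn_fderiv hΩ hQ).continuousOn.comp_continuous (by fun_prop) (hmaps x₀ hx₀)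
    fun_prop
  have hb : ∀ φ, ∀ x ∈ ball x₀ (R / 2), ‖(fderiv ℂ Q (L x + m φ)).comp L‖ ≤ M / (R / 2) := by
    intro φ x hx
    have hxU : ball x (R / 2) ⊆ U := fun w hw => hRU <| by
      rw [mem_ball] at *
      linarith [dist_triangle w x x₀]
    rw [← (hd φ x (hxU (mem_ball_self (by positivity)))).fderiv]
    exact norm_fderiv_le_of_ball (by positivity)
      (fun w hw => (hd φ w (hxU hw)).differentiableAt.differentiableWithinAt)
      fun w hw => hM _ (hmaps w (hxU hw) φ)
  refine (hasFDerivAt_integral_of_dominated_of_fderiv_le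
    (F' := fun x φ => (fderiv ℂ Q (L x + m φ)).comp L) (bound := fun _ => M / (R / 2))
    (ball_mem_nhds x₀ (half_pos hR)) ?_ ?_ ?_ ?_ ?_ ?_).differentiableAt.differentiableWithinAt
  · filter_upwards [hU.mem_nhds hx₀] with x hx using (hcont x hx).aestronglyMeasurable
  · exact (hcont x₀ hx₀).integrableOn_Icc
  · exact hcont'.aestronglyMeasurable
  · exact Eventually.of_forall fun φ x hx => hb φ x hx
  · exact (continuous_const (y := M / (R / 2))).integrableOn_Icc
  · refine Eventually.of_forall fun φ x hx => hd φ x (hRU ?_)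
    exact ball_subset_ball (by linarith) hx

theorem frequently_of_eventually_real {P : ℂ → Prop} (h : ∀ᶠ x : ℝ in 𝓝 0, P x) :
    ∃ᶠ z in 𝓝[≠] (0 : ℂ), P z := by
  have h1 : Tendsto (fun x : ℝ => (x : ℂ)) (𝓝[≠] 0) (𝓝[≠] 0) := by
    refine tendsto_nhdsWithin_of_tendsto_nhds_of_eventually_within _ ?_ ?_
    · exact (Complex.continuous_ofReal.tendsto' 0 0 Complex.ofReal_zero).mono_left nhdsWithin_le_nhds
    · filter_upwards [self_mem_nhdsWithin] with x hx
      simpa using hx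
  exact h1.frequently (h.filter_mono nhdsWithin_le_nhds).frequently

/-- The mean value of a periodic holomorphic function does not change under imaginary translations:
it does not under real ones, and it is a holomorphic function of the translation. -/
theorem setIntegral_contour_shift {Q : (Fin n → ℂ) → ℂ} {b M : ℝ} (hb : 0 < b)
    (hQ : DifferentiableOn ℂ Q (angleStrip n b)) (hM : ∀ φ ∈ angleStrip n b, ‖Q φ‖ ≤ M)
    (hper : ∀ φ ∈ angleStrip n b, ∀ k : Fin n → ℤ, Q (fun i => φ i + 2 * Real.pi * k i) = Q φ)
    {y : Fin n → ℝ} (hy : ∀ i, |y i| < b) :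
    ∫ φ in Set.Icc (0 : Fin n → ℝ) (fun _ => 2 * Real.pi),
        Q (ofRealVec φ + Complex.I • ofRealVec y) =
      ∫ φ in Set.Icc (0 : Fin n → ℝ) (fun _ => 2 * Real.pi), Q (ofRealVec φ) := by
  set U : Set ℂ := {s | ∀ i, |s.im * y i| < b}
  have hU : IsOpen U := by
    simp only [U, ofPred_forall]
    exact isOpen_iInter_of_finite fun i => isOpen_lt (by fun_prop) continuous_const
  have hUc : Convex ℝ U := by
    have h1 : U = ⋂ i, {s : ℂ | s.im * y i ∈ Ioo (-b) b} := by
      ext s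
      simp only [U, mem_ofPred_eq, mem_iInter, mem_Ioo, abs_lt]
    rw [h1]
    refine convex_iInter fun i => ?_
    exact (convex_Ioo (-b) b).is_linear_preimage
      (f := fun s : ℂ => s.im * y i) ⟨fun s t => by simp [add_mul], fun c s => by simp [mul_assoc]⟩
  have hmem : ∀ s ∈ U, ∀ φ : Fin n → ℝ, s • ofRealVec y + ofRealVec φ ∈ angleStrip n b := by
    intro s hs φ j
    have := hs j
    simpa [strip, ofRealVec] using this
  set J : ℂ → ℂ := fun s => ∫ φ in Set.Icc (0 : Fin n → ℝ) (fun _ => 2 * Real.pi),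
    Q (s • ofRealVec y + ofRealVec φ)
  have hJ : DifferentiableOn ℂ J U :=
    differentiableOn_setIntegral hU (isOpen_angleStrip n b) hQ hM
      ((ContinuousLinearMap.id ℂ ℂ).smulRight (ofRealVec y)) continuous_ofRealVec hmem
  have h0 : (0 : ℂ) ∈ U := fun i => by simpa using hb
  have hreal : ∀ x : ℝ, J x = J 0 := by
    intro x
    have hG : Continuous fun φ => Q (ofRealVec φ) :=
      hQ.continuousOn.comp_continuous continuous_ofRealVec fun φ => ofRealVec_mem_angleStrip hb φ
    have h1 := setIntegral_translate hG (fun φ k => by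
      rw [← hper _ (ofRealVec_mem_angleStrip hb φ) k]
      congr 1
      funext i
      simp [ofRealVec]) (x • y)
    simp only [J, zero_smul, zero_add]
    rw [← h1]
    congr 1
    funext φ
    congr 1
    funext i
    simp [ofRealVec, add_comm]
  have h1 := ((analyticOnNhd_of_differentiableOn hU hJ).eqOn_of_preconnected_of_frequently_eq
    (analyticOnNhd_const (v := J 0)) hUc.isPreconnected h0
    (frequently_of_eventually_real (Eventually.of_forall fun x => hreal x)))
    (show Complex.I ∈ U from fun i => by simpa using hy i)
  simp only [J, zero_smul, zero_add] at h1
  rw [← h1]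
  simp only [add_comm]

/-! ### Geometric series over the integer lattice -/

theorem tsum_int_exp_abs {c : ℝ} (hc : 0 < c) :
    ∑' m : ℤ, ENNReal.ofReal (Real.exp (-(c * m.natAbs))) =
      ENNReal.ofReal ((1 + Real.exp (-c)) / (1 - Real.exp (-c))) := by
  set q : ℝ := Real.exp (-c)
  have hq0 : 0 ≤ q := (Real.exp_pos _).le
  have hq1 : q < 1 := Real.exp_lt_one_iff.2 (by linarith)
  have hpow : ∀ m : ℕ, Real.exp (-(c * m)) = q ^ m := fun m => by
    rw [← Real.exp_nat_mul]; congr 1; ring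
  have h1 := hasSum_geometric_of_lt_one hq0 hq1
  have h2 : HasSum (fun m : ℤ => Real.exp (-(c * m.natAbs))) ((1 - q)⁻¹ + (1 - q)⁻¹ * q) := by
    refine HasSum.of_nat_of_neg_add_one ?_ ?_
    · refine h1.congr_fun fun m => ?_
      rw [Int.natAbs_natCast, hpow]
    · refine (h1.mul_right q).congr_fun fun m => ?_
      have : (-((m : ℤ) + 1)).natAbs = m + 1 := by omega
      rw [this, hpow, pow_succ]
  rw [← ENNReal.ofReal_tsum_of_nonneg (fun m => (Real.exp_pos _).le) h2.summable, h2.tsum_eq]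
  congr 1
  have : 1 - q ≠ 0 := by linarith
  field_simp

theorem tsum_prod_pi (g : ℤ → ℝ≥0∞) (n : ℕ) :
    ∑' k : Fin n → ℤ, ∏ i, g (k i) = (∑' m, g m) ^ n := by
  induction n with
  | zero => simp
  | succ n ih =>
    rw [← (Fin.consEquiv fun _ : Fin (n + 1) => ℤ).tsum_eq, ENNReal.tsum_prod', pow_succ', ← ih,
      ← ENNReal.tsum_mul_right]
    refine tsum_congr fun a => ?_
    rw [← ENNReal.tsum_mul_left]
    refine tsum_congr fun k => ?_
    simp [Fin.consEquiv, Fin.prod_univ_succ]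

theorem tsum_exp_absSum (n : ℕ) {c : ℝ} (hc : 0 < c) :
    ∑' k : Fin n → ℤ, ENNReal.ofReal (Real.exp (-(c * absSum k))) =
      ENNReal.ofReal (((1 + Real.exp (-c)) / (1 - Real.exp (-c))) ^ n) := by
  have hq1 : Real.exp (-c) < 1 := Real.exp_lt_one_iff.2 (by linarith)
  have h0 : 0 ≤ (1 + Real.exp (-c)) / (1 - Real.exp (-c)) :=
    div_nonneg (by positivity) (by linarith)
  rw [ENNReal.ofReal_pow h0, ← tsum_int_exp_abs hc, ← tsum_prod_pi]
  refine tsum_congr fun k => ?_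
  rw [← ENNReal.ofReal_prod_of_nonneg fun i _ => (Real.exp_pos _).le, ← Real.exp_sum]
  congr 2
  rw [absSum, Nat.cast_sum, Finset.mul_sum, Finset.sum_neg_distrib]

theorem summable_exp_absSum (n : ℕ) {c : ℝ} (hc : 0 < c) :
    Summable fun k : Fin n → ℤ => Real.exp (-(c * absSum k)) := by
  have h := ENNReal.summable_toReal (f := fun k : Fin n → ℤ =>
    ENNReal.ofReal (Real.exp (-(c * absSum k)))) (by
      rw [tsum_exp_absSum n hc]; exact ENNReal.ofReal_ne_top)
  refine h.congr fun k => ?_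
  rw [ENNReal.toReal_ofReal (Real.exp_pos _).le]

/-! ### Decay of the Fourier coefficients -/

section Decay

variable {V : Set (Fin n → ℝ)} {ρ b M : ℝ} {f : Reduced n → ℂ}

theorem differentiableOn_fourierCoefficient (hb : 0 < b)
    (hf : DifferentiableOn ℂ f (reducedDomain V ρ b))
    (hM : ∀ p ∈ reducedDomain V ρ b, ‖f p‖ ≤ M) (k : Fin n → ℤ) :
    DifferentiableOn ℂ (fourierCoefficient f k) (actionNhd V ρ ×ˢ strip b) := by
  have hQ : DifferentiableOn ℂ (fun p : Reduced n => f p * character (-k) p.2.1)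
      (reducedDomain V ρ b) := by
    refine hf.mul fun p _ => ?_
    have h1 : DifferentiableAt ℂ (fun p : Reduced n => p.2.1) p :=
      differentiableAt_snd.fst
    exact ((hasFDerivAt_character (-k) p.2.1).differentiableAt.comp (f := fun p : Reduced n => p.2.1)
      p h1).differentiableWithinAt
  have hbd : ∀ p ∈ reducedDomain V ρ b, ‖f p * character (-k) p.2.1‖ ≤
      M * Real.exp (absSum (-k) * b) := fun p hp => by
    rw [norm_mul]
    have := (norm_nonneg _).trans (hM p hp)
    exact mul_le_mul (hM p hp) (norm_character_le _ hp.2.1) (norm_nonneg _) this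
  have h := differentiableOn_setIntegral (n := n)
    ((isOpen_actionNhd V ρ).prod (isOpen_strip b)) (isOpen_reducedDomain V ρ b) hQ hbd
    ((ContinuousLinearMap.fst ℂ (Fin n → ℂ) ℂ).prod
      ((0 : (Fin n → ℂ) × ℂ →L[ℂ] (Fin n → ℂ)).prod (ContinuousLinearMap.snd ℂ (Fin n → ℂ) ℂ)))
    (m := fun φ => (0, ofRealVec φ, 0))
    (continuous_const.prodMk (continuous_ofRealVec.prodMk continuous_const))
    (fun p hp φ => by
      refine ⟨by simpa using hp.1, ?_, by simpa using hp.2⟩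
      simpa using ofRealVec_mem_angleStrip hb φ)
  refine (h.const_mul (((2 * Real.pi : ℝ) : ℂ)⁻¹ ^ n)).congr fun p _ => ?_
  simp [fourierCoefficient]

theorem character_add_two_pi (k l : Fin n → ℤ) (φ : Fin n → ℂ) :
    character k (fun i => φ i + 2 * Real.pi * l i) = character k φ := by
  rw [character, character, ← Complex.exp_periodic.int_mul (∑ i, k i * l i)
    (Complex.I * ∑ i, (k i : ℂ) * φ i)]
  congr 1
  push_cast
  rw [Finset.mul_sum, Finset.mul_sum, Finset.sum_mul, ← Finset.sum_add_distrib]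
  refine Finset.sum_congr rfl fun i _ => ?_
  ring

/-- The Fourier coefficient as an integral over a translated torus. -/
theorem fourierCoefficient_eq_shift (hb : 0 < b)
    (hf : DifferentiableOn ℂ f (reducedDomain V ρ b))
    (hM : ∀ p ∈ reducedDomain V ρ b, ‖f p‖ ≤ M)
    (hper : ∀ p ∈ reducedDomain V ρ b, ∀ k : Fin n → ℤ,
      f (p.1, (fun j => p.2.1 j + 2 * Real.pi * k j), p.2.2) = f p)
    (k : Fin n → ℤ) {p : (Fin n → ℂ) × ℂ} (hp : p ∈ actionNhd V ρ ×ˢ strip b)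
    {y : Fin n → ℝ} (hy : ∀ i, |y i| < b) :
    fourierCoefficient f k p = ((2 * Real.pi : ℝ) : ℂ)⁻¹ ^ n *
      ∫ φ in Set.Icc (0 : Fin n → ℝ) (fun _ => 2 * Real.pi),
        f (p.1, ofRealVec φ + Complex.I • ofRealVec y, p.2) *
          character (-k) (ofRealVec φ + Complex.I • ofRealVec y) := by
  have hmem : ∀ φ ∈ angleStrip n b, (p.1, φ, p.2) ∈ reducedDomain V ρ b :=
    fun φ hφ => ⟨hp.1, hφ, hp.2⟩
  have h := setIntegral_contour_shift (Q := fun φ => f (p.1, φ, p.2) * character (-k) φ)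
    (M := M * Real.exp (absSum (-k) * b)) hb
    (DifferentiableOn.mul (hf.comp (by fun_prop) hmem) fun φ _ =>
      (hasFDerivAt_character (-k) φ).differentiableAt.differentiableWithinAt)
    (fun φ hφ => by
      rw [norm_mul]
      have := (norm_nonneg _).trans (hM _ (hmem φ hφ))
      exact mul_le_mul (hM _ (hmem φ hφ)) (norm_character_le _ hφ) (norm_nonneg _) this)
    (fun φ hφ l => by
      rw [character_add_two_pi]
      exact congrArg (· * _) (hper _ (hmem φ hφ) l)) hy
  rw [h]
  rfl

/-- The Fourier coefficients decay like `exp (-b|k|)`: the contour of integration is shifted by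
almost `b` in the imaginary direction in which the character decays. -/
theorem norm_fourierCoefficient_le (hb : 0 < b)
    (hf : DifferentiableOn ℂ f (reducedDomain V ρ b))
    (hM : ∀ p ∈ reducedDomain V ρ b, ‖f p‖ ≤ M)
    (hper : ∀ p ∈ reducedDomain V ρ b, ∀ k : Fin n → ℤ,
      f (p.1, (fun j => p.2.1 j + 2 * Real.pi * k j), p.2.2) = f p)
    (k : Fin n → ℤ) {p : (Fin n → ℂ) × ℂ} (hp : p ∈ actionNhd V ρ ×ˢ strip b) :
    ‖fourierCoefficient f k p‖ ≤ M * Real.exp (-(b * absSum k)) := by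
  have hlt : ∀ t ∈ Ioo 0 b, ‖fourierCoefficient f k p‖ ≤ M * Real.exp (-(t * absSum k)) := by
    intro t ht
    -- the direction of the shift in which the character decays
    set y : Fin n → ℝ := fun i => -((k i).sign : ℝ) * t
    have hy : ∀ i, |y i| < b := by
      intro i
      have h1 : |((k i).sign : ℝ)| ≤ 1 := by
        rcases Int.sign_trichotomy (k i) with h | h | h <;> simp [h]
      calc |y i| = |((k i).sign : ℝ)| * t := by
            simp only [y]; rw [abs_mul, abs_neg, abs_of_pos ht.1]
        _ ≤ 1 * t := by gcongr; exact ht.1.le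
        _ < b := by linarith [ht.2]
    have hsum : ∑ i, (k i : ℝ) * y i = -(t * absSum k) := by
      rw [absSum, Nat.cast_sum, Finset.mul_sum, ← Finset.sum_neg_distrib]
      refine Finset.sum_congr rfl fun i _ => ?_
      have h1 : ((k i).natAbs : ℝ) = (k i : ℝ) * ((k i).sign : ℝ) := by
        rw [Nat.cast_natAbs]
        exact_mod_cast (Int.mul_sign_self (k i)).symm
      rw [h1]
      simp only [y]
      ring
    rw [fourierCoefficient_eq_shift hb hf hM hper k hp hy, norm_mul]
    have hpt : ∀ φ ∈ Set.Icc (0 : Fin n → ℝ) (fun _ => 2 * Real.pi),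
        ‖f (p.1, ofRealVec φ + Complex.I • ofRealVec y, p.2) *
          character (-k) (ofRealVec φ + Complex.I • ofRealVec y)‖ ≤
        M * Real.exp (-(t * absSum k)) := by
      intro φ _
      have hmem : ofRealVec φ + Complex.I • ofRealVec y ∈ angleStrip n b := fun i => by
        simpa [strip, ofRealVec] using hy i
      rw [norm_mul, norm_character]
      have h1 : -∑ i, (((-k) i : ℤ) : ℝ) * ((ofRealVec φ + Complex.I • ofRealVec y) i).im =
          -(t * absSum k) := by
        rw [← hsum, ← Finset.sum_neg_distrib]
        refine Finset.sum_congr rfl fun i _ => ?_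
        simp [ofRealVec]
      rw [h1]
      gcongr
      exact hM _ ⟨hp.1, hmem, hp.2⟩
    have h2 := norm_setIntegral_le_of_norm_le_const (μ := volume)
      (by rw [Real.volume_Icc_pi]; exact ENNReal.prod_lt_top fun i _ => ENNReal.ofReal_lt_top) hpt
    have hvol : (volume : Measure (Fin n → ℝ)).real
        (Set.Icc (0 : Fin n → ℝ) (fun _ => 2 * Real.pi)) = (2 * Real.pi) ^ n := by
      rw [measureReal_def, Real.volume_Icc_pi_toReal (a := 0) (fun _ => Real.two_pi_pos.le)]
      simp
    rw [hvol] at h2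
    have hπ : 0 < 2 * Real.pi := Real.two_pi_pos
    calc _ ≤ ‖((2 * Real.pi : ℝ) : ℂ)⁻¹ ^ n‖ *
          (M * Real.exp (-(t * absSum k)) * (2 * Real.pi) ^ n) := by gcongr
      _ = M * Real.exp (-(t * absSum k)) := by
          rw [norm_pow, norm_inv, Complex.norm_real, Real.norm_of_nonneg hπ.le, inv_pow]
          field_simp
  have hlim : Tendsto (fun t => M * Real.exp (-(t * absSum k))) (𝓝[<] b)
      (𝓝 (M * Real.exp (-(b * absSum k)))) :=
    (Continuous.tendsto (by fun_prop) b).mono_left nhdsWithin_le_nhds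
  refine ge_of_tendsto hlim ?_
  filter_upwards [Ioo_mem_nhdsLT hb] with t ht using hlt t ht

theorem hasSum_fourierCoefficient (hb : 0 < b)
    (hf : DifferentiableOn ℂ f (reducedDomain V ρ b))
    (hM : ∀ p ∈ reducedDomain V ρ b, ‖f p‖ ≤ M)
    (hper : ∀ p ∈ reducedDomain V ρ b, ∀ k : Fin n → ℤ,
      f (p.1, (fun j => p.2.1 j + 2 * Real.pi * k j), p.2.2) = f p)
    {b' : ℝ} (hbb : b' < b) {p : Reduced n} (hp : p ∈ reducedDomain V ρ b') :
    HasSum (fun k => fourierCoefficient f k (p.1, p.2.2) * character k p.2.1) (f p) := by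
  have hpb : p ∈ reducedDomain V ρ b := reducedDomain_mono V le_rfl hbb.le hp
  set x : Fin n → ℝ := fun i => (p.2.1 i).re
  set y : Fin n → ℝ := fun i => (p.2.1 i).im
  have hxy : ofRealVec x + Complex.I • ofRealVec y = p.2.1 := by
    funext i
    simp only [ofRealVec, Pi.add_apply, Pi.smul_apply, smul_eq_mul, x, y]
    rw [mul_comm, Complex.re_add_im]
  have hmem : ∀ φ : Fin n → ℝ, (p.1, ofRealVec φ + Complex.I • ofRealVec y, p.2.2) ∈
      reducedDomain V ρ b := fun φ => ⟨hpb.1, fun i => by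
    simpa [strip, ofRealVec] using hpb.2.1 i, hpb.2.2⟩
  have hsplit : ∀ (k : Fin n → ℤ) (φ : Fin n → ℝ),
      character k (ofRealVec φ + Complex.I • ofRealVec y) =
        character k (ofRealVec φ) * character k (Complex.I • ofRealVec y) := by
    intro k φ
    simp only [character, ← Complex.exp_add, ← mul_add, ← Finset.sum_add_distrib, Pi.add_apply]
  set G : (Fin n → ℝ) → ℂ := fun φ => f (p.1, ofRealVec φ + Complex.I • ofRealVec y, p.2.2)
  have hG : Continuous G := hf.continuousOn.comp_continuous
    (continuous_const.prodMk ((continuous_ofRealVec.add continuous_const).prodMk continuous_const))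
    hmem
  have hGper : ∀ φ (k : Fin n → ℤ), G (fun i => φ i + 2 * Real.pi * k i) = G φ := by
    intro φ k
    simp only [G]
    rw [← hper _ (hmem φ) k]
    congr 3
    funext i
    simp [ofRealVec]
    ring
  have hc : ∀ k, fourierCoefficient f k (p.1, p.2.2) * character k (Complex.I • ofRealVec y) =
      ((2 * Real.pi : ℝ) : ℂ)⁻¹ ^ n * ∫ φ in Set.Icc (0 : Fin n → ℝ) (fun _ => 2 * Real.pi),
        G φ * character (-k) (ofRealVec φ) := by
    intro k
    rw [fourierCoefficient_eq_shift hb hf hM hper k (p := (p.1, p.2.2)) ⟨hpb.1, hpb.2.2⟩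
      (y := y) hpb.2.1, mul_assoc, ← integral_mul_const]
    congr 2
    funext φ
    rw [hsplit, mul_assoc, mul_assoc, character_neg_mul, mul_one]
  have hsum : Summable fun k =>
      fourierCoefficient f k (p.1, p.2.2) * character k (Complex.I • ofRealVec y) := by
    refine Summable.of_norm_bounded
      ((summable_exp_absSum n (sub_pos.2 hbb)).mul_left M) fun k => ?_
    rw [norm_mul]
    have h1 := norm_fourierCoefficient_le hb hf hM hper k (p := (p.1, p.2.2)) ⟨hpb.1, hpb.2.2⟩
    have h2 : ‖character k (Complex.I • ofRealVec y)‖ ≤ Real.exp (absSum k * b') :=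
      norm_character_le k fun i => by simpa [strip, ofRealVec] using hp.2.1 i
    calc _ ≤ M * Real.exp (-(b * absSum k)) * Real.exp (absSum k * b') :=
          mul_le_mul h1 h2 (norm_nonneg _) ((norm_nonneg _).trans h1)
      _ = _ := by
          rw [mul_assoc, ← Real.exp_add]
          congr 2
          ring
  have h := hasSum_character_of_summable hG hGper hc hsum x
  simp only [G, hxy] at h
  refine h.congr_fun fun k => ?_
  rw [mul_assoc, mul_comm (character k (Complex.I • _)), ← hsplit, hxy]

end Decay

end Expansion

/-! ### Fourier multipliers and the homological equation -/

section Multiplier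

open Metric Set Filter Topology MeasureTheory

variable {V : Set (Fin n → ℝ)} {ρ ρ' τ τ' δ σ : ℝ}

/-- The function with given Fourier coefficients. -/
def fourierSum (c : (Fin n → ℤ) → (Fin n → ℂ) × ℂ → ℂ) (p : Reduced n) : ℂ :=
  ∑' k, c k (p.1, p.2.2) * character k p.2.1

theorem isFourier_fourierSum (hτ : 0 < τ) {c : (Fin n → ℤ) → (Fin n → ℂ) × ℂ → ℂ}
    (hc : ∀ k, DifferentiableOn ℂ (c k) (actionNhd V ρ ×ˢ strip τ))
    (hn : coeffNorm V ρ τ c ≠ ⊤) :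
    IsFourier V ρ τ (fourierSum c) ∧ fourierNorm V ρ τ (fourierSum c) = coeffNorm V ρ τ c ∧
      ∀ k, ∀ p ∈ actionNhd V ρ ×ˢ strip τ, fourierCoefficient (fourierSum c) k p = c k p := by
  have hs : ∀ p ∈ reducedDomain V ρ τ,
      HasSum (fun k => c k (p.1, p.2.2) * character k p.2.1) (fourierSum c p) := fun p hp =>
    (summable_norm_of_coeffNorm hn hp).of_norm.hasSum
  exact ⟨(isFourier_of_coeff hτ hc hn hs).1, (isFourier_of_coeff hτ hc hn hs).2,
    fourierCoefficient_eq hτ hn hs⟩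

/-- The Fourier multiplier with symbol `m_k(I)`. -/
def multiplier (m : (Fin n → ℤ) → (Fin n → ℂ) → ℂ) (F : Reduced n → ℂ) : Reduced n → ℂ :=
  fourierSum fun k p => m k p.1 * fourierCoefficient F k p

theorem isFourier_multiplier (hτ : 0 < τ) {m : (Fin n → ℤ) → (Fin n → ℂ) → ℂ}
    {F : Reduced n → ℂ} (hF : IsFourier V ρ τ F)
    (hm : ∀ k, DifferentiableOn ℂ (m k) (actionNhd V ρ)) {C : ℝ}
    (hC : ∀ k, ∀ I ∈ actionNhd V ρ, ‖m k I‖ ≤ C) :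
    IsFourier V ρ τ (multiplier m F) ∧
      fourierNorm V ρ τ (multiplier m F) ≤ ENNReal.ofReal C * fourierNorm V ρ τ F ∧
      ∀ k, ∀ p ∈ actionNhd V ρ ×ˢ strip τ,
        fourierCoefficient (multiplier m F) k p = m k p.1 * fourierCoefficient F k p := by
  have hle : coeffNorm V ρ τ (fun k p => m k p.1 * fourierCoefficient F k p) ≤
      ENNReal.ofReal C * fourierNorm V ρ τ F := by
    rw [fourierNorm, ← ENNReal.tsum_mul_left]
    refine ENNReal.tsum_le_tsum fun k => ?_
    rw [← mul_assoc]
    gcongr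
    refine iSup₂_le fun p hp => ?_
    rw [enorm_mul]
    refine mul_le_mul' ?_ (le_iSup₂_of_le p hp le_rfl)
    rw [← ofReal_norm]
    exact ENNReal.ofReal_le_ofReal (hC k p.1 hp.1)
  obtain ⟨h1, h2, h3⟩ := isFourier_fourierSum hτ
    (c := fun k p => m k p.1 * fourierCoefficient F k p)
    (fun k => ((hm k).comp differentiableOn_fst fun p hp => hp.1).mul (hF.coeff k))
    (ne_top_of_le_ne_top (ENNReal.mul_ne_top ENNReal.ofReal_ne_top hF.norm_ne_top) hle)
  exact ⟨h1, h2.le.trans hle, h3⟩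

theorem finite_absSum_lt (n N : ℕ) : {k : Fin n → ℤ | absSum k < N}.Finite := by
  refine (Set.Finite.pi' (t := fun _ : Fin n => Set.Icc (-(N : ℤ)) N)
    fun _ => Set.finite_Icc _ _).subset fun k hk i => ?_
  have h1 : (k i).natAbs ≤ absSum k :=
    Finset.single_le_sum (f := fun i => (k i).natAbs) (fun _ _ => Nat.zero_le _) (Finset.mem_univ i)
  have h2 : absSum k < N := hk
  simp only [Set.mem_Icc]
  omega

theorem IsFourier.isTrigPolynomial {F : Reduced n → ℂ} (hF : IsFourier V ρ τ F) {N : ℕ}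
    (hN : ∀ k, N ≤ absSum k → ∀ p ∈ actionNhd V ρ ×ˢ strip τ, fourierCoefficient F k p = 0) :
    IsTrigPolynomial V ρ τ N F := by
  have : Fintype {k : Fin n → ℤ | absSum k < N} := (finite_absSum_lt n N).fintype
  refine ⟨{k : Fin n → ℤ | absSum k < N}, this, fun k => k, fun k => fourierCoefficient F k,
    fun k => k.2, fun k => hF.coeff k, fun p hp => ?_⟩
  have h1 : HasSum (fun k : {k : Fin n → ℤ | absSum k < N} =>
      fourierCoefficient F k (p.1, p.2.2) * character k p.2.1) (F p) := by
    refine (hasSum_subtype_iff_of_support_subset fun k hk => ?_).2 (hF.hasSum p hp)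
    by_contra h
    exact hk (by simp only; rw [hN k (not_lt.1 h) (p.1, p.2.2) ⟨hp.1, hp.2.2⟩, zero_mul])
  exact h1.unique (hasSum_fintype _)

theorem IsFourier.hasHarmonicsIn {F : Reduced n → ℂ} (hF : IsFourier V ρ τ F)
    {S : Set (Fin n → ℤ)}
    (hS : ∀ k, k ∉ S → ∀ p ∈ actionNhd V ρ ×ˢ strip τ, fourierCoefficient F k p = 0) :
    HasHarmonicsIn S V ρ τ F := by
  refine ⟨fourierCoefficient F, fun k _ => analyticOnNhd_of_differentiableOn
    ((isOpen_actionNhd V ρ).prod (isOpen_strip τ)) (hF.coeff k), fun p hp => ?_⟩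
  refine (hasSum_subtype_iff_of_support_subset fun k hk => ?_).2 (hF.hasSum p hp)
  by_contra h
  exact hk (by simp only; rw [hS k h (p.1, p.2.2) ⟨hp.1, hp.2.2⟩, zero_mul])

theorem differentiableOn_frequency {h : (Fin n → ℂ) → ℂ}
    (hh : DifferentiableOn ℂ h (actionNhd V ρ)) (i : Fin n) :
    DifferentiableOn ℂ (fun I => frequency h I i) (actionNhd V ρ) :=
  differentiableOn_fderiv_apply (isOpen_actionNhd V ρ) hh _

theorem reducedBracket_integrable {h : (Fin n → ℂ) → ℂ} {χ : Reduced n → ℂ} {p : Reduced n}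
    (hh : DifferentiableAt ℂ h p.1) :
    reducedBracket χ (fun q => h q.1) p = -fderiv ℂ χ p (0, frequency h p.1, 0) := by
  have h1 : ∀ v : Reduced n, fderiv ℂ (fun q : Reduced n => h q.1) p v = fderiv ℂ h p.1 v.1 := by
    intro v
    have := (HasFDerivAt.comp (f := fun q : Reduced n => q.1) p hh.hasFDerivAt
      hasFDerivAt_fst).fderiv
    change fderiv ℂ (fun q : Reduced n => h q.1) p = _ at this
    rw [this]
    rfl
  have h2 : ((0, frequency h p.1, 0) : Reduced n) =
      ∑ i, frequency h p.1 i • ((0, Pi.single i 1, 0) : Reduced n) := by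
    refine Prod.ext ?_ (Prod.ext ?_ ?_)
    · simp [Prod.fst_sum]
    · funext j
      simp [Prod.fst_sum, Prod.snd_sum, Finset.sum_apply, Pi.single_apply]
    · simp [Prod.snd_sum]
  rw [h2, map_sum, reducedBracket, ← Finset.sum_neg_distrib]
  refine Finset.sum_congr rfl fun i _ => ?_
  rw [h1, h1, map_zero, zero_mul, zero_add, map_smul, smul_eq_mul]
  rfl

open Classical in
/-- The symbol of the solution operator of the homological equation: the inverse of the small
divisor `i k·ω` off the resonances. -/
def solveSymbol (h : (Fin n → ℂ) → ℂ) (M : Set (Fin n → ℤ)) (N : ℕ) (k : Fin n → ℤ)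
    (I : Fin n → ℂ) : ℂ :=
  if k ∉ M ∧ absSum k < N then (Complex.I * ∑ i, frequency h I i * (k i : ℂ))⁻¹ else 0

open Classical in
/-- The symbol of the projection onto the harmonics in `M`. -/
def resonantSymbol (M : Set (Fin n → ℤ)) (k : Fin n → ℤ) (_ : Fin n → ℂ) : ℂ :=
  if k ∈ M then 1 else 0

variable {h : (Fin n → ℂ) → ℂ} {M : Set (Fin n → ℤ)} {N : ℕ} {α : ℝ}

theorem isFourier_solve (hτ : 0 < τ) (hα : 0 < α) (hh : DifferentiableOn ℂ h (actionNhd V ρ))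
    (hres : ∀ k : Fin n → ℤ, k ∉ M → absSum k < N → ∀ I ∈ actionNhd V ρ,
      α < ‖∑ i, frequency h I i * (k i : ℂ)‖) {F : Reduced n → ℂ} (hF : IsFourier V ρ τ F) :
    IsFourier V ρ τ (multiplier (solveSymbol h M N) F) ∧
      fourierNorm V ρ τ (multiplier (solveSymbol h M N) F) ≤
        ENNReal.ofReal (1 / α) * fourierNorm V ρ τ F ∧
      ∀ k, ∀ p ∈ actionNhd V ρ ×ˢ strip τ, fourierCoefficient (multiplier (solveSymbol h M N) F) k p =
        solveSymbol h M N k p.1 * fourierCoefficient F k p := by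
  classical
  refine isFourier_multiplier hτ hF (fun k => ?_) fun k I hI => ?_
  · by_cases hk : k ∉ M ∧ absSum k < N
    · have h1 : solveSymbol h M N k = fun I => (Complex.I * ∑ i, frequency h I i * (k i : ℂ))⁻¹ := by
        funext I; rw [solveSymbol, if_pos hk]
      rw [h1]
      refine DifferentiableOn.inv ?_ fun I hI => mul_ne_zero Complex.I_ne_zero fun h0 => ?_
      · exact (DifferentiableOn.fun_sum fun i _ =>
          (differentiableOn_frequency hh i).mul_const _).const_mul _
      · have := hres k hk.1 hk.2 I hI
        rw [h0, norm_zero] at this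
        exact absurd this (not_lt.2 hα.le)
    · have h1 : solveSymbol h M N k = fun _ => 0 := by funext I; rw [solveSymbol, if_neg hk]
      rw [h1]
      exact differentiableOn_const _
  · rw [solveSymbol]
    split_ifs with hk
    · rw [norm_inv, norm_mul, Complex.norm_I, one_mul, ← one_div]
      exact one_div_le_one_div_of_le hα (hres k hk.1 hk.2 I hI).le
    · rw [norm_zero]; positivity

theorem isFourier_resonant (hτ : 0 < τ) {F : Reduced n → ℂ} (hF : IsFourier V ρ τ F) :
    IsFourier V ρ τ (multiplier (resonantSymbol M) F) ∧
      fourierNorm V ρ τ (multiplier (resonantSymbol M) F) ≤ fourierNorm V ρ τ F ∧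
      ∀ k, ∀ p ∈ actionNhd V ρ ×ˢ strip τ, fourierCoefficient (multiplier (resonantSymbol M) F) k p =
        resonantSymbol M k p.1 * fourierCoefficient F k p := by
  classical
  have := isFourier_multiplier hτ hF (m := resonantSymbol M) (C := 1)
    (fun k => by unfold resonantSymbol; exact differentiableOn_const _)
    (fun k I _ => by rw [resonantSymbol]; split_ifs <;> simp)
  rwa [ENNReal.ofReal_one, one_mul] at this

/-- The homological equation: the solution operator removes the nonresonant part. -/
theorem homological_equation (hτ : 0 < τ) (hα : 0 < α)
    (hh : DifferentiableOn ℂ h (actionNhd V ρ))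
    (hres : ∀ k : Fin n → ℤ, k ∉ M → absSum k < N → ∀ I ∈ actionNhd V ρ,
      α < ‖∑ i, frequency h I i * (k i : ℂ)‖) {F : Reduced n → ℂ} (hF : IsFourier V ρ τ F)
    (hFN : IsTrigPolynomial V ρ τ N F) :
    (∀ p ∈ reducedDomain V ρ τ,
      F p + reducedBracket (multiplier (solveSymbol h M N) F) (fun q => h q.1) p =
        multiplier (resonantSymbol M) F p) ∧
    IsFourier V ρ τ (reducedBracket (multiplier (solveSymbol h M N) F) fun q => h q.1) ∧
      fourierNorm V ρ τ (reducedBracket (multiplier (solveSymbol h M N) F) fun q => h q.1) ≤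
        fourierNorm V ρ τ F := by
  classical
  obtain ⟨hs1, -, hs3⟩ := isFourier_solve hτ hα hh hres hF
  obtain ⟨hr1, -, hr3⟩ := isFourier_resonant (M := M) hτ hF
  set χ := multiplier (solveSymbol h M N) F
  have hsum : ∀ p ∈ reducedDomain V ρ τ, HasSum
      (fun k => (resonantSymbol M k p.1 - 1) * fourierCoefficient F k (p.1, p.2.2) *
        character k p.2.1) (reducedBracket χ (fun q => h q.1) p) := by
    intro p hp
    have hq : (p.1, p.2.2) ∈ actionNhd V ρ ×ˢ strip τ := ⟨hp.1, hp.2.2⟩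
    rw [reducedBracket_integrable (hh.differentiableAt ((isOpen_actionNhd V ρ).mem_nhds hp.1))]
    refine (hs1.hasSum_fderiv.2 p hp (0, frequency h p.1, 0)).neg.congr_fun fun k => ?_
    rw [hs3 k _ hq, ← Prod.zero_eq_mk, map_zero, zero_add, ← neg_mul]
    congr 1
    simp only [solveSymbol, resonantSymbol]
    have hcomm : ∑ i, (k i : ℂ) * frequency h p.1 i = ∑ i, frequency h p.1 i * (k i : ℂ) :=
      Finset.sum_congr rfl fun i _ => mul_comm _ _
    rw [hcomm]
    by_cases hN : absSum k < N
    · by_cases hM : k ∈ M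
      · simp [hM]
      · have h1 := hres k hM hN p.1 hp.1
        have h2 : ∑ i, frequency h p.1 i * (k i : ℂ) ≠ 0 := fun h0 => by
          rw [h0, norm_zero] at h1
          exact absurd h1 (not_lt.2 hα.le)
        rw [if_neg hM, if_pos ⟨hM, hN⟩, ← mul_assoc,
          mul_inv_cancel₀ (mul_ne_zero Complex.I_ne_zero h2)]
        ring
    · rw [hFN.fourierCoefficient_eq_zero hτ (not_lt.1 hN) hq]
      simp
  obtain ⟨hd1, hd2, hd3⟩ := isFourier_multiplier hτ hF
    (m := fun k I => resonantSymbol M k I - 1) (C := 1)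
    (fun k => by unfold resonantSymbol; exact differentiableOn_const _)
    (fun k I _ => by simp only [resonantSymbol]; split_ifs <;> simp)
  have heq : ∀ p ∈ reducedDomain V ρ τ, reducedBracket χ (fun q => h q.1) p =
      multiplier (fun k I => resonantSymbol M k I - 1) F p := fun p hp =>
    (hsum p hp).unique ((hd1.hasSum p hp).congr_fun fun k => by
      rw [hd3 k (p.1, p.2.2) ⟨hp.1, hp.2.2⟩])
  refine ⟨fun p hp => ?_, (hd1.congr hτ heq).1, (hd1.congr hτ heq).2.le.trans ?_⟩
  · refine ((hF.hasSum p hp).add (hsum p hp)).unique ((hr1.hasSum p hp).congr_fun fun k => ?_)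
    rw [hr3 k (p.1, p.2.2) ⟨hp.1, hp.2.2⟩]
    ring
  · rwa [ENNReal.ofReal_one, one_mul] at hd2

/-! ### Decomposition of the perturbation into shells of harmonics -/

/-- The part of `f` with the harmonics `(s - 1) K ≤ |k| < s K`. -/
def shell (K : ℕ) (f : Reduced n → ℂ) (s : ℕ) : Reduced n → ℂ :=
  fourierSum fun k p => if absSum k / K + 1 = s then fourierCoefficient f k p else 0

theorem norm_le_supNorm {G : Set (Fin n → ℝ)} {f : Reduced n → ℂ} (hreg : IsRegular G δ σ h f)
    {p : Reduced n} (hp : p ∈ reducedDomain G δ (2 * σ)) : ‖f p‖ ≤ supNorm G δ σ f := by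
  obtain ⟨B, hB⟩ := hreg.bounded_f
  refine le_csSup ⟨B, ?_⟩ ⟨p, hp, rfl⟩
  rintro _ ⟨q, hq, rfl⟩
  exact hB q hq

theorem supNorm_nonneg (G : Set (Fin n → ℝ)) (δ σ : ℝ) (f : Reduced n → ℂ) :
    0 ≤ supNorm G δ σ f :=
  Real.sSup_nonneg (by rintro _ ⟨q, _, rfl⟩; exact norm_nonneg _)

theorem fTilde_nonneg (G : Set (Fin n → ℝ)) (δ : ℝ) (hσ : 0 < σ) (f : Reduced n → ℂ) :
    0 ≤ fTilde G δ σ f := by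
  have h1 : Real.exp (-σ / 2) < 1 := Real.exp_lt_one_iff.2 (by linarith)
  have h2 : 0 ≤ (1 + Real.exp (-σ / 2)) / (1 - Real.exp (-σ / 2)) :=
    div_nonneg (by positivity) (by linarith)
  exact mul_nonneg (supNorm_nonneg G δ σ f) (pow_nonneg h2 n)

/-- The exponential decay of the Fourier coefficients pays for the weights `θ^s` of the shells: of
the width `2σ`, the amount `6σ/5` is kept, `3σ/10` absorbs the weights, and `σ/2` makes the sum
over the lattice converge. -/
theorem shell_estimate {G : Set (Fin n → ℝ)} {f : Reduced n → ℂ} (hσ : 0 < σ)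
    (hreg : IsRegular G δ σ h f) (hVG : V ⊆ G) {K : ℕ} (hK : 0 < K) {θ : ℝ} (hθ : 1 ≤ θ)
    (hθK : θ ≤ Real.exp (3 / 10 * K * σ)) :
    (∀ s, IsFourierAt V δ σ 0 (shell K f s)) ∧
    (∀ s, IsTrigPolynomial V (actionWidth δ 0) (angleWidth σ 0) (s * K) (shell K f s)) ∧
    ∑' s, ENNReal.ofReal (θ ^ s) * levelNorm V δ σ 0 (shell K f s) ≤
      ENNReal.ofReal (θ * fTilde G δ σ f) ∧
    ∀ p ∈ reducedDomain V (actionWidth δ 0) (angleWidth σ 0),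
      HasSum (fun s => shell K f s p) (f p) := by
  have hρ0 : actionWidth δ 0 = δ := by simp [actionWidth]
  have hτ0 : angleWidth σ 0 = 6 / 5 * σ := by simp [angleWidth]; ring
  have hb : 0 < 2 * σ := by positivity
  have hτ : 0 < 6 / 5 * σ := by positivity
  have hlt : 6 / 5 * σ < 2 * σ := by linarith
  simp only [IsFourierAt, levelNorm, hρ0, hτ0]
  have hsub : reducedDomain V δ (2 * σ) ⊆ reducedDomain G δ (2 * σ) :=
    prod_mono (actionNhd_subset hVG δ) subset_rfl
  have hf : DifferentiableOn ℂ f (reducedDomain V δ (2 * σ)) :=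
    hreg.analytic_f.differentiableOn.mono hsub
  have hM : ∀ p ∈ reducedDomain V δ (2 * σ), ‖f p‖ ≤ supNorm G δ σ f :=
    fun p hp => norm_le_supNorm hreg (hsub hp)
  have hper : ∀ p ∈ reducedDomain V δ (2 * σ), ∀ k : Fin n → ℤ,
      f (p.1, (fun j => p.2.1 j + 2 * Real.pi * k j), p.2.2) = f p :=
    fun p hp => hreg.periodic_f p (hsub hp)
  set C := supNorm G δ σ f
  have hC : 0 ≤ C := supNorm_nonneg G δ σ f
  set N : (Fin n → ℤ) → ℝ≥0∞ := fun k =>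
    (⨆ p ∈ actionNhd V δ ×ˢ strip (6 / 5 * σ), ‖fourierCoefficient f k p‖ₑ) *
      ENNReal.ofReal (Real.exp (absSum k * (6 / 5 * σ)))
  have hNk : ∀ k, ENNReal.ofReal (θ ^ (absSum k / K + 1)) * N k ≤
      ENNReal.ofReal (θ * C) * ENNReal.ofReal (Real.exp (-(σ / 2 * absSum k))) := by
    intro k
    have h1 : (⨆ p ∈ actionNhd V δ ×ˢ strip (6 / 5 * σ), ‖fourierCoefficient f k p‖ₑ) ≤
        ENNReal.ofReal (C * Real.exp (-(2 * σ * absSum k))) := by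
      refine iSup₂_le fun p hp => ?_
      rw [← ofReal_norm]
      exact ENNReal.ofReal_le_ofReal (norm_fourierCoefficient_le hb hf hM hper k
        ⟨hp.1, strip_mono hlt.le hp.2⟩)
    have h2 : θ ^ (absSum k / K + 1) ≤ θ * Real.exp (3 / 10 * σ * absSum k) := by
      rw [pow_succ', ]
      gcongr
      calc θ ^ (absSum k / K) ≤ Real.exp (3 / 10 * K * σ) ^ (absSum k / K) := by gcongr
        _ = Real.exp (3 / 10 * σ * ((absSum k / K : ℕ) * K)) := by
            rw [← Real.exp_nat_mul]; congr 1; ring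
        _ ≤ _ := by
            gcongr
            exact_mod_cast Nat.div_mul_le_self (absSum k) K
    calc _ ≤ ENNReal.ofReal (θ * Real.exp (3 / 10 * σ * absSum k)) *
          (ENNReal.ofReal (C * Real.exp (-(2 * σ * absSum k))) *
            ENNReal.ofReal (Real.exp (absSum k * (6 / 5 * σ)))) :=
          mul_le_mul' (ENNReal.ofReal_le_ofReal h2) (mul_le_mul' h1 le_rfl)
      _ = _ := by
          rw [← ENNReal.ofReal_mul (by positivity), ← ENNReal.ofReal_mul (by positivity),
            ← ENNReal.ofReal_mul (by positivity)]
          congr 1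
          have : Real.exp (-(σ / 2 * absSum k)) = Real.exp (3 / 10 * σ * absSum k) *
              (Real.exp (-(2 * σ * absSum k)) * Real.exp (absSum k * (6 / 5 * σ))) := by
            rw [← Real.exp_add, ← Real.exp_add]; congr 1; ring
          rw [this]
          ring
  have hcn : ∀ s, coeffNorm V δ (6 / 5 * σ)
      (fun k p => if absSum k / K + 1 = s then fourierCoefficient f k p else 0) =
      ∑' k, if absSum k / K + 1 = s then N k else 0 := by
    intro s
    refine tsum_congr fun k => ?_
    split_ifs with hk
    · simp only [hk, if_true, N]
    · simp [hk]
  have htotal : ∑' s, ENNReal.ofReal (θ ^ s) * coeffNorm V δ (6 / 5 * σ)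
      (fun k p => if absSum k / K + 1 = s then fourierCoefficient f k p else 0) ≤
      ENNReal.ofReal (θ * fTilde G δ σ f) := by
    calc _ = ∑' k, ∑' s, ENNReal.ofReal (θ ^ s) * (if absSum k / K + 1 = s then N k else 0) := by
          rw [ENNReal.tsum_comm]
          exact tsum_congr fun s => by rw [hcn, ENNReal.tsum_mul_left]
      _ = ∑' k, ENNReal.ofReal (θ ^ (absSum k / K + 1)) * N k := by
          refine tsum_congr fun k => ?_
          rw [tsum_eq_single (absSum k / K + 1) fun s hs => by rw [if_neg (Ne.symm hs), mul_zero],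
            if_pos rfl]
      _ ≤ ∑' k : Fin n → ℤ, ENNReal.ofReal (θ * C) *
            ENNReal.ofReal (Real.exp (-(σ / 2 * absSum k))) := ENNReal.tsum_le_tsum hNk
      _ = _ := by
          rw [ENNReal.tsum_mul_left, tsum_exp_absSum n (half_pos hσ),
            ← ENNReal.ofReal_mul (by positivity), fTilde, neg_div, mul_assoc]
  have hfin : ∀ s, coeffNorm V δ (6 / 5 * σ)
      (fun k p => if absSum k / K + 1 = s then fourierCoefficient f k p else 0) ≠ ⊤ := by
    intro s h0
    have h1 := ENNReal.ne_top_of_tsum_ne_top (ne_top_of_le_ne_top ENNReal.ofReal_ne_top htotal) s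
    rw [h0, ENNReal.mul_top] at h1
    · exact h1 rfl
    · have : 0 < θ := by linarith
      simpa using by positivity
  have hshell := fun s => isFourier_fourierSum hτ (fun k => by
    split_ifs
    · exact (differentiableOn_fourierCoefficient hb hf hM k).mono
        (prod_mono subset_rfl (strip_mono hlt.le))
    · exact differentiableOn_const _) (hfin s)
  refine ⟨fun s => (hshell s).1, fun s => (hshell s).1.isTrigPolynomial fun k hk p hp => ?_, ?_,
    fun p hp => ?_⟩
  · rw [(hshell s).2.2 k p hp, if_neg]
    rintro rfl
    have := Nat.lt_div_mul_add (a := absSum k) hK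
    have h2 : (absSum k / K + 1) * K = absSum k / K * K + K := by ring
    omega
  · calc _ = _ := tsum_congr fun s => by rw [shell, (hshell s).2.1]
      _ ≤ _ := htotal
  · have h1 := (hasSum_fourierCoefficient hb hf hM hper hlt hp).tsum_fiberwise
      fun k => absSum k / K + 1
    refine h1.congr_fun fun s => ?_
    rw [shell, fourierSum, tsum_subtype
      ((fun k : Fin n → ℤ => absSum k / K + 1) ⁻¹' {s})
      (fun k => fourierCoefficient f k (p.1, p.2.2) * character k p.2.1)]
    refine tsum_congr fun k => ?_
    simp only [Set.indicator, Set.mem_preimage, Set.mem_singleton_iff]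
    split_ifs <;> simp

end Multiplier

/-! ### A majorant for iterated brackets -/

section Majorant

open PowerSeries

theorem tsum_coeff_mul (F G : PowerSeries ℝ≥0∞) :
    ∑' s, coeff s (F * G) = (∑' s, coeff s F) * ∑' s, coeff s G := by
  calc ∑' s, coeff s (F * G) = ∑' s, ∑' q : Finset.HasAntidiagonal.antidiagonal s,
        coeff q.1.1 F * coeff q.1.2 G := by
        refine tsum_congr fun s => ?_
        rw [coeff_mul, Finset.tsum_subtype (Finset.HasAntidiagonal.antidiagonal s)
          fun q : ℕ × ℕ => coeff q.1 F * coeff q.2 G]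
    _ = ∑' q : (Σ s : ℕ, Finset.HasAntidiagonal.antidiagonal s),
        coeff q.2.1.1 F * coeff q.2.1.2 G :=
      (ENNReal.tsum_sigma' fun q : (Σ s : ℕ, Finset.HasAntidiagonal.antidiagonal s) =>
        coeff q.2.1.1 F * coeff q.2.1.2 G).symm
    _ = ∑' q : ℕ × ℕ, coeff q.1 F * coeff q.2 G :=
      Finset.HasAntidiagonal.sigmaAntidiagonalEquivProd.tsum_eq
        fun q : ℕ × ℕ => coeff q.1 F * coeff q.2 G
    _ = _ := by
      rw [ENNReal.tsum_prod', ← ENNReal.tsum_mul_right]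
      refine tsum_congr fun a => ?_
      simp only
      exact ENNReal.tsum_mul_left

theorem tsum_coeff_pow (F : PowerSeries ℝ≥0∞) (p : ℕ) :
    ∑' s, coeff s (F ^ p) = (∑' s, coeff s F) ^ p := by
  induction p with
  | zero =>
    rw [pow_zero, pow_zero, tsum_eq_single 0 fun s hs => by rw [coeff_one, if_neg hs], coeff_one,
      if_pos rfl]
  | succ p ih => rw [pow_succ, pow_succ, tsum_coeff_mul, ih]

/-- Iterated brackets are majorized by the coefficients of `cⁱ xⁱ g / i!`. The factorial comes from
the weights `j / s` in the recursion: with the generating functions, the sum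
`∑ j x_j a_{s-j}` is the product `x' a`, and `x' xⁱ` is the derivative of `xⁱ⁺¹ / (i + 1)`. -/
theorem iterated_majorant {p : ℕ} {x g : ℕ → ℝ≥0∞} {c : ℝ≥0∞} {a : ℕ → ℕ → ℝ≥0∞}
    (h0 : ∀ s, a 0 s ≤ g s) (hz : ∀ i < p, a (i + 1) 0 = 0)
    (hs : ∀ i < p, ∀ s : ℕ, ((s : ℝ≥0∞) + 1) * a (i + 1) (s + 1) ≤
      c * ∑ j ∈ Finset.range (s + 1), ((j : ℝ≥0∞) + 1) * x (j + 1) * a i (s - j)) :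
    ∀ i ≤ p, ∀ s, a i s ≤ c ^ i * (i.factorial : ℝ≥0∞)⁻¹ * coeff s (mk x ^ i * mk g) := by
  intro i
  induction i with
  | zero => intro _ s; simpa using h0 s
  | succ i ih =>
    intro hi s
    cases s with
    | zero => rw [hz i hi]; exact zero_le
    | succ s =>
      have hs0 : (s : ℝ≥0∞) + 1 ≠ 0 := by simp
      have hst : (s : ℝ≥0∞) + 1 ≠ ⊤ := by simp
      rw [← ENNReal.mul_le_mul_iff_right hs0 hst]
      have h1 : ∑ j ∈ Finset.range (s + 1), ((j : ℝ≥0∞) + 1) * x (j + 1) * a i (s - j) ≤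
          c ^ i * (i.factorial : ℝ≥0∞)⁻¹ * coeff s (d⁄dX ℝ≥0∞ (mk x) * (mk x ^ i * mk g)) := by
        rw [coeff_mul, Finset.Nat.sum_antidiagonal_eq_sum_range_succ_mk, Finset.mul_sum]
        refine Finset.sum_le_sum fun j _ => ?_
        rw [coeff_derivative, coeff_mk]
        calc _ ≤ ((j : ℝ≥0∞) + 1) * x (j + 1) * (c ^ i * (i.factorial : ℝ≥0∞)⁻¹ *
              coeff (s - j) (mk x ^ i * mk g)) := mul_le_mul' le_rfl (ih (by omega) (s - j))
          _ = _ := by ring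
      have h2 : ((i : ℝ≥0∞) + 1) * coeff s (d⁄dX ℝ≥0∞ (mk x) * (mk x ^ i * mk g)) ≤
          ((s : ℝ≥0∞) + 1) * coeff (s + 1) (mk x ^ (i + 1) * mk g) := by
        calc _ = coeff s (d⁄dX ℝ≥0∞ (mk x ^ (i + 1)) * mk g) := by
              rw [derivative_pow, Nat.add_sub_cancel, ← map_natCast (C (R := ℝ≥0∞)), mul_assoc,
                mul_assoc, coeff_C_mul]
              push_cast
              congr 2
              ring
          _ ≤ coeff s (d⁄dX ℝ≥0∞ (mk x ^ (i + 1) * mk g)) := by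
              rw [Derivation.leibniz, map_add, smul_eq_mul, smul_eq_mul,
                mul_comm (mk g)]
              exact le_add_self
          _ = _ := by rw [coeff_derivative, mul_comm]
      have hfac : (i.factorial : ℝ≥0∞)⁻¹ = ((i : ℝ≥0∞) + 1) * ((i + 1).factorial : ℝ≥0∞)⁻¹ := by
        have hi0 : (i : ℝ≥0∞) + 1 ≠ 0 := by simp
        have hit : (i : ℝ≥0∞) + 1 ≠ ⊤ := by simp
        rw [Nat.factorial_succ, Nat.cast_mul, Nat.cast_add_one,
          ENNReal.mul_inv (Or.inl hi0) (Or.inl hit), ← mul_assoc, ENNReal.mul_inv_cancel hi0 hit,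
          one_mul]
      calc _ ≤ c * ∑ j ∈ Finset.range (s + 1), ((j : ℝ≥0∞) + 1) * x (j + 1) * a i (s - j) :=
            hs i hi s
        _ ≤ c * (c ^ i * (i.factorial : ℝ≥0∞)⁻¹ *
            coeff s (d⁄dX ℝ≥0∞ (mk x) * (mk x ^ i * mk g))) := mul_le_mul' le_rfl h1
        _ = c ^ (i + 1) * ((i + 1).factorial : ℝ≥0∞)⁻¹ *
            (((i : ℝ≥0∞) + 1) * coeff s (d⁄dX ℝ≥0∞ (mk x) * (mk x ^ i * mk g))) := by
            rw [hfac]; ring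
        _ ≤ c ^ (i + 1) * ((i + 1).factorial : ℝ≥0∞)⁻¹ *
            (((s : ℝ≥0∞) + 1) * coeff (s + 1) (mk x ^ (i + 1) * mk g)) := mul_le_mul' le_rfl h2
        _ = _ := by ring

theorem tsum_iterated_le {p : ℕ} {x g : ℕ → ℝ≥0∞} {c : ℝ≥0∞} {a : ℕ → ℝ≥0∞}
    (h : ∀ s, a s ≤ c ^ p * (p.factorial : ℝ≥0∞)⁻¹ * coeff s (mk x ^ p * mk g)) :
    ∑' s, a s ≤ (p.factorial : ℝ≥0∞)⁻¹ * (c * ∑' j, x j) ^ p * ∑' s, g s := by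
  calc _ ≤ ∑' s, c ^ p * (p.factorial : ℝ≥0∞)⁻¹ * coeff s (mk x ^ p * mk g) :=
        ENNReal.tsum_le_tsum h
    _ = _ := by
        rw [ENNReal.tsum_mul_left, tsum_coeff_mul, tsum_coeff_pow]
        simp only [coeff_mk]
        ring

/-- `(1 + 1/m)ᵐ ≤ e`, iterated. -/
theorem succ_pow_le_exp_mul_factorial (p : ℕ) :
    ((p : ℝ) + 1) ^ p ≤ Real.exp p * p.factorial := by
  induction p with
  | zero => simp
  | succ p ih =>
    have h1 : (((p + 1 : ℕ) : ℝ) + 1) ^ (p + 1) ≤ Real.exp 1 * ((p : ℝ) + 1) ^ (p + 1) := by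
      have h2 : (((p + 1 : ℕ) : ℝ) + 1) = (1 / ((p : ℝ) + 1) + 1) * ((p : ℝ) + 1) := by
        push_cast; field_simp; ring
      rw [h2, mul_pow]
      gcongr
      calc (1 / ((p : ℝ) + 1) + 1) ^ (p + 1) ≤ Real.exp (1 / ((p : ℝ) + 1)) ^ (p + 1) := by
            gcongr
            exact Real.add_one_le_exp _
        _ = Real.exp 1 := by
            rw [← Real.exp_nat_mul]; congr 1; push_cast; field_simp
    calc _ ≤ Real.exp 1 * (((p : ℝ) + 1) ^ p * ((p : ℝ) + 1)) := by rw [← pow_succ]; exact h1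
      _ ≤ Real.exp 1 * ((Real.exp p * p.factorial) * ((p : ℝ) + 1)) := by gcongr
      _ = _ := by
        rw [Nat.factorial_succ]; push_cast; rw [Real.exp_add]; ring

/-- The sum `∑ pᵖ xᵖ / p!` for small `x`. -/
theorem tsum_pow_div_factorial_le {y : ℝ≥0∞} (hy : y ≤ ENNReal.ofReal (5 / 24)) :
    ∑' p : ℕ, (p.factorial : ℝ≥0∞)⁻¹ * ((p : ℝ≥0∞) * y) ^ p ≤ ENNReal.ofReal (3 / 2) := by
  have he := Real.exp_one_lt_d9
  have hr0 : (0 : ℝ) ≤ Real.exp 1 * (5 / 24) := by positivity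
  have hr1 : Real.exp 1 * (5 / 24) < 1 := by linarith
  have hterm : ∀ p : ℕ, ((p + 1).factorial : ℝ≥0∞)⁻¹ * (((p + 1 : ℕ) : ℝ≥0∞) * y) ^ (p + 1) ≤
      ENNReal.ofReal (5 / 24 * (Real.exp 1 * (5 / 24)) ^ p) := by
    intro p
    have h1 : ((p + 1).factorial : ℝ≥0∞)⁻¹ = ENNReal.ofReal (((p + 1).factorial : ℝ)⁻¹) := by
      rw [ENNReal.ofReal_inv_of_pos (by positivity), ENNReal.ofReal_natCast]
    have h2 : ((p + 1 : ℕ) : ℝ≥0∞) = ENNReal.ofReal ((p : ℝ) + 1) := by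
      rw [← ENNReal.ofReal_natCast]; push_cast; rfl
    calc _ ≤ ENNReal.ofReal (((p + 1).factorial : ℝ)⁻¹) *
          (ENNReal.ofReal ((p : ℝ) + 1) * ENNReal.ofReal (5 / 24)) ^ (p + 1) := by
          rw [h1, h2]; gcongr
      _ = ENNReal.ofReal (((p + 1).factorial : ℝ)⁻¹ * (((p : ℝ) + 1) * (5 / 24)) ^ (p + 1)) := by
          rw [← ENNReal.ofReal_mul (by positivity), ← ENNReal.ofReal_pow (by positivity),
            ← ENNReal.ofReal_mul (by positivity)]
      _ ≤ _ := by
          refine ENNReal.ofReal_le_ofReal ?_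
          have h3 := succ_pow_le_exp_mul_factorial p
          rw [Nat.factorial_succ, Nat.cast_mul, Nat.cast_add_one]
          have hp : (0 : ℝ) < p.factorial := by positivity
          calc _ = ((p : ℝ) + 1) ^ p / p.factorial * (5 / 24) ^ (p + 1) := by
                rw [mul_pow, pow_succ ((p : ℝ) + 1)]
                field_simp
            _ ≤ Real.exp p * (5 / 24) ^ (p + 1) := by
                gcongr
                rwa [div_le_iff₀ hp]
            _ = _ := by
                rw [mul_pow, ← Real.exp_nat_mul]; ring_nf
  have hg := (hasSum_geometric_of_lt_one hr0 hr1).mul_left (5 / 24)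
  rw [tsum_eq_zero_add' ENNReal.summable]
  calc _ ≤ 1 + ∑' p : ℕ, ENNReal.ofReal (5 / 24 * (Real.exp 1 * (5 / 24)) ^ p) :=
        add_le_add (by simp) (ENNReal.tsum_le_tsum hterm)
    _ = ENNReal.ofReal (1 + 5 / 24 * (1 - Real.exp 1 * (5 / 24))⁻¹) := by
        rw [← ENNReal.ofReal_tsum_of_nonneg (fun p => by positivity) hg.summable, hg.tsum_eq,
          ENNReal.ofReal_add zero_le_one
            (mul_nonneg (by norm_num) (inv_nonneg.2 (by linarith))), ENNReal.ofReal_one]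
    _ ≤ _ := by
        refine ENNReal.ofReal_le_ofReal ?_
        have h1 : 5 / 24 * (1 - Real.exp 1 * (5 / 24))⁻¹ ≤ 1 / 2 := by
          rw [← div_eq_mul_inv, div_le_iff₀ (by linarith)]
          linarith
        linarith

end Majorant

/-! ### Sums of iterated brackets -/

section Chain

open Metric Set Filter Topology

variable {V : Set (Fin n → ℝ)} {δ σ : ℝ} {χ χ' G G' : ℕ → Reduced n → ℂ}

/-- The part of degree `p` in the generating functions `χ` of the solution `w` of the recursion
`w_s = G_s + (1/s) ∑_{j=1}^s j {w_{s-j}, χ_j}`. -/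
def chainTerm (χ G : ℕ → Reduced n → ℂ) : ℕ → ℕ → Reduced n → ℂ
  | 0, s => G s
  | _ + 1, 0 => 0
  | p + 1, s + 1 => fun z => ((s : ℂ) + 1)⁻¹ * ∑ i ∈ Finset.range (s + 1),
      ((i : ℂ) + 1) * reducedBracket (χ (i + 1)) (chainTerm χ G p (s - i)) z

/-- The solution `w` of the recursion `w_s = G_s + (1/s) ∑_{j=1}^s j {w_{s-j}, χ_j}`, `w_0 = G_0`. -/
def chain (χ G : ℕ → Reduced n → ℂ) (s : ℕ) (z : Reduced n) : ℂ :=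
  ∑ p ∈ Finset.range (s + 1), chainTerm χ G p s z

theorem chainTerm_succ_succ (χ G : ℕ → Reduced n → ℂ) (p s : ℕ) (z : Reduced n) :
    chainTerm χ G (p + 1) (s + 1) z = ((s : ℂ) + 1)⁻¹ * ∑ i ∈ Finset.range (s + 1),
      ((i : ℂ) + 1) * reducedBracket (χ (i + 1)) (chainTerm χ G p (s - i)) z := rfl

theorem chainTerm_eq_zero (χ G : ℕ → Reduced n → ℂ) (p : ℕ) :
    ∀ s, s < p → chainTerm χ G p s = 0 := by
  induction p with
  | zero => intro s hs; omega
  | succ p ih =>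
    intro s hs
    cases s with
    | zero => rfl
    | succ s =>
      funext z
      rw [chainTerm_succ_succ, Finset.sum_eq_zero fun i _ => ?_, mul_zero, Pi.zero_apply]
      rw [ih (s - i) (by omega), reducedBracket_zero_right, Pi.zero_apply, mul_zero]

theorem chain_zero (χ G : ℕ → Reduced n → ℂ) : chain χ G 0 = G 0 := by
  funext z
  simp [chain, chainTerm]

theorem chainTerm_congr (p : ℕ) : ∀ s, (∀ j ≤ s, χ j = χ' j) → (∀ j ≤ s, G j = G' j) →
    chainTerm χ G p s = chainTerm χ' G' p s := by
  induction p with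
  | zero => intro s _ h; exact h s le_rfl
  | succ p ih =>
    intro s hχ hG
    cases s with
    | zero => rfl
    | succ s =>
      funext z
      rw [chainTerm_succ_succ, chainTerm_succ_succ]
      refine congrArg (((s : ℂ) + 1)⁻¹ * ·) (Finset.sum_congr rfl fun i hi => ?_)
      rw [Finset.mem_range] at hi
      rw [hχ (i + 1) (by omega), ih (s - i) (fun j hj => hχ j (by omega))
        fun j hj => hG j (by omega)]

theorem chain_congr (s : ℕ) (hχ : ∀ j ≤ s, χ j = χ' j) (hG : ∀ j ≤ s, G j = G' j) :
    chain χ G s = chain χ' G' s := by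
  funext z
  exact Finset.sum_congr rfl fun p _ => by rw [chainTerm_congr p s hχ hG]

/-- If the source starts at order one, then `w_s - G_s` depends on the orders below `s` only. -/
theorem chain_sub_congr (s : ℕ) (h0 : G 0 = 0) (h0' : G' 0 = 0) (hχ : ∀ j < s, χ j = χ' j)
    (hG : ∀ j < s, G j = G' j) (z : Reduced n) :
    chain χ G s z - G s z = chain χ' G' s z - G' s z := by
  have key : ∀ p, chainTerm χ G (p + 1) s = chainTerm χ' G' (p + 1) s := by
    intro p
    cases s with
    | zero => rfl
    | succ s =>
      have hz : ∀ (χ G : ℕ → Reduced n → ℂ), G 0 = 0 → chainTerm χ G p 0 = 0 := by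
        intro χ G hG
        cases p with
        | zero => exact hG
        | succ p => rfl
      funext z
      rw [chainTerm_succ_succ, chainTerm_succ_succ]
      refine congrArg (((s : ℂ) + 1)⁻¹ * ·) (Finset.sum_congr rfl fun i hi => ?_)
      rw [Finset.mem_range] at hi
      rcases Nat.lt_succ_iff_lt_or_eq.1 hi with hi | rfl
      · rw [hχ (i + 1) (by omega), chainTerm_congr p (s - i) (fun j hj => hχ j (by omega))
          fun j hj => hG j (by omega)]
      · rw [Nat.sub_self, hz χ G h0, hz χ' G' h0', reducedBracket_zero_right,
          reducedBracket_zero_right]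
  rw [chain, chain, Finset.sum_range_succ', Finset.sum_range_succ']
  simp only [key, chainTerm, add_sub_cancel_right]

theorem differentiableOn_reducedBracket {D : Set (Reduced n)} (hD : IsOpen D)
    {χ F : Reduced n → ℂ} (hχ : DifferentiableOn ℂ χ D) (hF : DifferentiableOn ℂ F D) :
    DifferentiableOn ℂ (reducedBracket χ F) D := by
  unfold reducedBracket
  refine DifferentiableOn.fun_sum fun i _ => ?_
  exact ((differentiableOn_fderiv_apply hD hF _).mul (differentiableOn_fderiv_apply hD hχ _)).add
    ((differentiableOn_fderiv_apply hD hF _).mul (differentiableOn_fderiv_apply hD hχ _)).neg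

theorem differentiableOn_chainTerm {D : Set (Reduced n)} (hD : IsOpen D)
    {N : ℕ}
    (hχ : ∀ j ≤ N, DifferentiableOn ℂ (χ j) D) (hG : ∀ j ≤ N, DifferentiableOn ℂ (G j) D) (p : ℕ) :
    ∀ s ≤ N, DifferentiableOn ℂ (chainTerm χ G p s) D := by
  induction p with
  | zero => exact hG
  | succ p ih =>
    intro s hs
    cases s with
    | zero => exact differentiableOn_const 0
    | succ s =>
      refine DifferentiableOn.const_mul (DifferentiableOn.fun_sum fun i hi => ?_) _
      rw [Finset.mem_range] at hi
      exact (differentiableOn_reducedBracket hD (hχ _ (by omega)) (ih _ (by omega))).const_mul _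

theorem differentiableOn_chain {D : Set (Reduced n)} (hD : IsOpen D)
    {N : ℕ}
    (hχ : ∀ j ≤ N, DifferentiableOn ℂ (χ j) D) (hG : ∀ j ≤ N, DifferentiableOn ℂ (G j) D) {s : ℕ} (hs : s ≤ N) :
    DifferentiableOn ℂ (chain χ G s) D :=
  DifferentiableOn.fun_sum fun p _ => differentiableOn_chainTerm hD hχ hG p s hs

theorem chain_succ {D : Set (Reduced n)} (hD : IsOpen D)
    {N : ℕ}
    (hχ : ∀ j ≤ N, DifferentiableOn ℂ (χ j) D) (hG : ∀ j ≤ N, DifferentiableOn ℂ (G j) D) {s : ℕ}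
    (hs : s + 1 ≤ N) {z : Reduced n} (hz : z ∈ D) :
    chain χ G (s + 1) z = G (s + 1) z + ((s : ℂ) + 1)⁻¹ * ∑ i ∈ Finset.range (s + 1),
      ((i : ℂ) + 1) * reducedBracket (χ (i + 1)) (chain χ G (s - i)) z := by
  rw [chain, Finset.sum_range_succ', add_comm]
  congr 1
  simp only [chainTerm]
  rw [← Finset.mul_sum, Finset.sum_comm]
  congr 1
  refine Finset.sum_congr rfl fun i _ => ?_
  rw [← Finset.mul_sum]
  congr 1
  have hd : ∀ p, DifferentiableAt ℂ (chainTerm χ G p (s - i)) z := fun p =>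
    (differentiableOn_chainTerm hD hχ hG p _ (by omega)).differentiableAt (hD.mem_nhds hz)
  have h1 : chain χ G (s - i) = fun z => ∑ p ∈ Finset.range (s + 1), chainTerm χ G p (s - i) z := by
    funext w
    rw [chain]
    refine Finset.sum_subset (fun p hp => ?_) fun p _ hp => ?_
    · rw [Finset.mem_range] at *; omega
    · rw [Finset.mem_range] at hp
      rw [chainTerm_eq_zero χ G p (s - i) (by omega)]
      rfl
  simp only [reducedBracket]
  rw [Finset.sum_comm]
  refine Finset.sum_congr rfl fun j _ => ?_
  rw [h1, fderiv_fun_sum fun p _ => hd p, _root_.sum_apply, _root_.sum_apply, Finset.sum_mul,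
    Finset.sum_mul, ← Finset.sum_neg_distrib, ← Finset.sum_add_distrib]

theorem isTrigPolynomial_chainTerm {ρ τ : ℝ} {K d N : ℕ}
    (hχ : ∀ j ≤ N, IsTrigPolynomial V ρ τ (j * K) (χ j))
    (hG : ∀ s ≤ N, IsTrigPolynomial V ρ τ ((s + d) * K) (G s)) (p : ℕ) :
    ∀ s ≤ N, IsTrigPolynomial V ρ τ ((s + d) * K) (chainTerm χ G p s) := by
  induction p with
  | zero => exact hG
  | succ p ih =>
    intro s hs
    cases s with
    | zero => exact isTrigPolynomial_zero
    | succ s =>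
      refine (IsTrigPolynomial.sum _ fun i hi => ?_).const_mul _
      rw [Finset.mem_range] at hi
      refine (((hχ (i + 1) (by omega)).reducedBracket (ih (s - i) (by omega))).mono le_rfl le_rfl ?_).const_mul _
      rw [← add_mul]
      exact Nat.mul_le_mul_right K (by omega)

theorem isTrigPolynomial_chain {ρ τ : ℝ} {K d N : ℕ}
    (hχ : ∀ j ≤ N, IsTrigPolynomial V ρ τ (j * K) (χ j))
    (hG : ∀ s ≤ N, IsTrigPolynomial V ρ τ ((s + d) * K) (G s)) {s : ℕ} (hs : s ≤ N) :
    IsTrigPolynomial V ρ τ ((s + d) * K) (chain χ G s) :=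
  IsTrigPolynomial.sum _ fun p _ => isTrigPolynomial_chainTerm hχ hG p s hs

/-- On equidistant squares `i / p` the product of the two losses of width is bounded below. -/
theorem sqrt_step {p i : ℕ} (hp : 0 < p) :
    1 / (2 * p) ≤ √(((i + 1 : ℕ) : ℝ) / p) * (√(((i + 1 : ℕ) : ℝ) / p) - √((i : ℝ) / p)) := by
  have h1 : √(((i + 1 : ℕ) : ℝ) / p) ^ 2 = ((i + 1 : ℕ) : ℝ) / p := Real.sq_sqrt (by positivity)
  have h2 : √((i : ℝ) / p) ^ 2 = (i : ℝ) / p := Real.sq_sqrt (by positivity)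
  have h3 : √((i : ℝ) / p) ≤ √(((i + 1 : ℕ) : ℝ) / p) := by
    apply Real.sqrt_le_sqrt
    gcongr
    simp
  have h4 : ((i + 1 : ℕ) : ℝ) / p - (i : ℝ) / p = 2 * (1 / (2 * p)) := by
    push_cast; field_simp; ring
  nlinarith [sq_nonneg (√(((i + 1 : ℕ) : ℝ) / p) - √((i : ℝ) / p))]

theorem enorm_natCast_complex (m : ℕ) : ‖(m : ℂ)‖ₑ = m := by
  rw [← ofReal_norm, Complex.norm_natCast, ENNReal.ofReal_natCast]

/-- The norms of iterated brackets: the `p`-fold ones are estimated on the levels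
`b + L √(i / p)`, `i = 0, …, p`. -/
theorem chain_estimate (hδ : 0 < δ) (hσ : 0 < σ) {b L : ℝ} (hL : 0 < L) (hbL : b + L ≤ 1)
    (w : ℝ≥0∞) (hχ : ∀ j, IsFourierAt V δ σ b (χ j)) (hG : ∀ s, IsFourierAt V δ σ b (G s))
    (hS : ENNReal.ofReal (2 * bracketConst δ σ / L ^ 2) *
      ∑' j, w ^ j * levelNorm V δ σ b (χ j) ≤ ENNReal.ofReal (5 / 24)) :
    (∀ s, IsFourierAt V δ σ (b + L) (chain χ G s)) ∧
      ∑' s, w ^ s * levelNorm V δ σ (b + L) (chain χ G s) ≤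
        ENNReal.ofReal (3 / 2) * ∑' s, w ^ s * levelNorm V δ σ b (G s) := by
  have hB := bracketConst_pos hδ hσ
  set x : ℕ → ℝ≥0∞ := fun j => w ^ j * levelNorm V δ σ b (χ j)
  set g : ℕ → ℝ≥0∞ := fun s => w ^ s * levelNorm V δ σ b (G s)
  have hτ : ∀ u ≤ b + L, 0 < angleWidth σ u := fun u hu => angleWidth_pos hσ (hu.trans hbL)
  have key : ∀ p, (∀ s, IsFourierAt V δ σ (b + L) (chainTerm χ G p s)) ∧
      ∑' s, w ^ s * levelNorm V δ σ (b + L) (chainTerm χ G p s) ≤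
        (p.factorial : ℝ≥0∞)⁻¹ * ((p : ℝ≥0∞) * (ENNReal.ofReal (2 * bracketConst δ σ / L ^ 2) *
          ∑' j, x j)) ^ p * ∑' s, g s := by
    intro p
    rcases Nat.eq_zero_or_pos p with rfl | hp
    · refine ⟨fun s => (hG s).anti hδ hσ (by linarith), ?_⟩
      simp only [chainTerm, Nat.factorial_zero, Nat.cast_one, inv_one, pow_zero, one_mul]
      exact ENNReal.tsum_le_tsum fun s => mul_le_mul' le_rfl (levelNorm_anti hδ hσ (by linarith) _)
    set u : ℕ → ℝ := fun i => b + L * √((i : ℝ) / p)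
    have hp' : (0 : ℝ) < p := by exact_mod_cast hp
    have hup : u p = b + L := by
      simp only [u]
      rw [div_self hp'.ne', Real.sqrt_one, mul_one]
    have hu0 : u 0 = b := by simp [u]
    have hule : ∀ i ≤ p, u i ≤ b + L := by
      intro i hi
      have h1 : √((i : ℝ) / p) ≤ 1 := by
        rw [Real.sqrt_le_one, div_le_one hp']
        exact_mod_cast hi
      simp only [u]
      nlinarith
    have hub : ∀ i, b < u (i + 1) := by
      intro i
      have : 0 < √(((i + 1 : ℕ) : ℝ) / p) := Real.sqrt_pos.2 (by positivity)
      simp only [u]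
      nlinarith
    have hus : ∀ i, u i < u (i + 1) := by
      intro i
      have : √((i : ℝ) / p) < √(((i + 1 : ℕ) : ℝ) / p) := by
        apply Real.sqrt_lt_sqrt (by positivity)
        gcongr
        simp
      simp only [u]
      nlinarith
    set c : ℝ := 2 * bracketConst δ σ / L ^ 2 * p
    have hc : 0 ≤ c := by positivity
    have hcu : ∀ i, bracketConst δ σ / ((u (i + 1) - b) * (u (i + 1) - u i)) ≤ c := by
      intro i
      have h1 := sub_pos.2 (hub i)
      have h2 := sub_pos.2 (hus i)
      rw [div_le_iff₀ (by positivity)]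
      have h3 : (u (i + 1) - b) * (u (i + 1) - u i) = L ^ 2 *
          (√(((i + 1 : ℕ) : ℝ) / p) * (√(((i + 1 : ℕ) : ℝ) / p) - √((i : ℝ) / p))) := by
        simp only [u]; ring
      rw [h3]
      have h4 := sqrt_step (i := i) hp
      calc bracketConst δ σ = c * (L ^ 2 * (1 / (2 * p))) := by
            simp only [c]; field_simp
        _ ≤ _ := by gcongr
    have hind : ∀ i ≤ p, ∀ s, IsFourierAt V δ σ (u i) (chainTerm χ G i s) := by
      intro i
      induction i with
      | zero => intro _ s; rw [hu0]; exact hG s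
      | succ i ih =>
        intro hi s
        cases s with
        | zero => exact (isFourier_zero (hτ _ (hule _ hi))).1
        | succ s =>
          refine (isFourier_const_mul (hτ _ (hule _ hi)) (isFourier_finset_sum
            (hτ _ (hule _ hi)) _ fun j _ => ?_).1 _).1
          exact (isFourier_const_mul (hτ _ (hule _ hi)) (isFourierAt_reducedBracket hδ hσ
            (hχ (j + 1)) (ih (by omega) (s - j)) (hub i) (hus i)
            ((hule _ hi).trans hbL)).1 _).1
    set a : ℕ → ℕ → ℝ≥0∞ := fun i s => w ^ s * levelNorm V δ σ (u i) (chainTerm χ G i s)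
    have hstep : ∀ i < p, ∀ s : ℕ, ((s : ℝ≥0∞) + 1) * a (i + 1) (s + 1) ≤
        ENNReal.ofReal c * ∑ j ∈ Finset.range (s + 1),
          ((j : ℝ≥0∞) + 1) * x (j + 1) * a i (s - j) := by
      intro i hi s
      have hτ' := hτ _ (hule (i + 1) hi)
      have hbr := fun j => isFourierAt_reducedBracket hδ hσ
        (hχ (j + 1)) (hind i hi.le (s - j)) (hub i) (hus i) ((hule _ hi).trans hbL)
      have h1 : levelNorm V δ σ (u (i + 1)) (chainTerm χ G (i + 1) (s + 1)) ≤
          ((s : ℝ≥0∞) + 1)⁻¹ * ∑ j ∈ Finset.range (s + 1), ((j : ℝ≥0∞) + 1) *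
            (ENNReal.ofReal c * (levelNorm V δ σ b (χ (j + 1)) *
              levelNorm V δ σ (u i) (chainTerm χ G i (s - j)))) := by
        refine (isFourier_const_mul hτ' (isFourier_finset_sum hτ' _ fun j _ =>
          (isFourier_const_mul hτ' (hbr j).1 _).1).1 _).2.trans ?_
        refine mul_le_mul' (le_of_eq ?_) ((isFourier_finset_sum hτ' _ fun j _ =>
          (isFourier_const_mul hτ' (hbr j).1 _).1).2.trans (Finset.sum_le_sum fun j _ =>
          (isFourier_const_mul hτ' (hbr j).1 _).2.trans (mul_le_mul' (le_of_eq ?_)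
            ((hbr j).2.trans (mul_le_mul' (ENNReal.ofReal_le_ofReal (hcu i)) le_rfl)))))
        · rw [enorm_inv (by exact_mod_cast Nat.succ_ne_zero s)]
          congr 1
          exact_mod_cast enorm_natCast_complex (s + 1)
        · exact_mod_cast enorm_natCast_complex (j + 1)
      have hs0 : (s : ℝ≥0∞) + 1 ≠ 0 := by simp
      have hst : (s : ℝ≥0∞) + 1 ≠ ⊤ := by simp
      calc ((s : ℝ≥0∞) + 1) * a (i + 1) (s + 1) ≤ ((s : ℝ≥0∞) + 1) * (w ^ (s + 1) *
            (((s : ℝ≥0∞) + 1)⁻¹ * ∑ j ∈ Finset.range (s + 1), ((j : ℝ≥0∞) + 1) *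
            (ENNReal.ofReal c * (levelNorm V δ σ b (χ (j + 1)) *
              levelNorm V δ σ (u i) (chainTerm χ G i (s - j)))))) :=
            mul_le_mul' le_rfl (mul_le_mul' le_rfl h1)
        _ = (((s : ℝ≥0∞) + 1) * ((s : ℝ≥0∞) + 1)⁻¹) * (w ^ (s + 1) *
            ∑ j ∈ Finset.range (s + 1), ((j : ℝ≥0∞) + 1) *
            (ENNReal.ofReal c * (levelNorm V δ σ b (χ (j + 1)) *
              levelNorm V δ σ (u i) (chainTerm χ G i (s - j))))) := by ring
        _ = _ := by
            rw [ENNReal.mul_inv_cancel hs0 hst, one_mul, Finset.mul_sum, Finset.mul_sum]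
            refine Finset.sum_congr rfl fun j hj => ?_
            rw [Finset.mem_range] at hj
            have hw : w ^ (s + 1) = w ^ (j + 1) * w ^ (s - j) := by
              rw [← pow_add]; congr 1; omega
            simp only [x, a]
            rw [hw]
            ring
    have hz : ∀ i < p, a (i + 1) 0 = 0 := by
      intro i hi
      simp only [a, chainTerm]
      have := (isFourier_zero (V := V) (ρ := actionWidth δ (u (i + 1))) (hτ _ (hule (i + 1) hi))).2
      rw [levelNorm]
      exact (congrArg (w ^ 0 * ·) this).trans (mul_zero _)
    have h0 : ∀ s, a 0 s ≤ g s := fun s => by simp only [a, g, hu0, chainTerm]; exact le_rfl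
    refine ⟨fun s => by rw [← hup]; exact hind p le_rfl s, ?_⟩
    have hfin := tsum_iterated_le (iterated_majorant h0 hz hstep p le_rfl)
    simp only [a, hup] at hfin
    refine hfin.trans (le_of_eq ?_)
    congr 3
    simp only [c]
    rw [ENNReal.ofReal_mul (by positivity), ENNReal.ofReal_natCast]
    ring
  have hsum := fun s => isFourier_finset_sum (hτ _ le_rfl) (Finset.range (s + 1))
    fun p _ => (key p).1 s
  refine ⟨fun s => (hsum s).1, ?_⟩
  calc _ ≤ ∑' s, ∑' p, w ^ s * levelNorm V δ σ (b + L) (chainTerm χ G p s) := by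
        refine ENNReal.tsum_le_tsum fun s => ?_
        rw [ENNReal.tsum_mul_left]
        exact mul_le_mul' le_rfl ((hsum s).2.trans (ENNReal.sum_le_tsum _))
    _ = ∑' p, ∑' s, w ^ s * levelNorm V δ σ (b + L) (chainTerm χ G p s) := ENNReal.tsum_comm
    _ ≤ ∑' p : ℕ, (p.factorial : ℝ≥0∞)⁻¹ * ((p : ℝ≥0∞) *
          (ENNReal.ofReal (2 * bracketConst δ σ / L ^ 2) * ∑' j, x j)) ^ p * ∑' s, g s :=
        ENNReal.tsum_le_tsum fun p => (key p).2
    _ ≤ _ := by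
        rw [ENNReal.tsum_mul_right]
        exact mul_le_mul' (tsum_pow_div_factorial_le hS) le_rfl

end Chain

/-! ### Levels of width for the generating functions -/

section Levels

open Metric Set Filter Topology

/-- The loss of width at which the generating function of order `s` is estimated. The square root
makes the loss in a bracket of orders `j` and `i` of size `j i / (r (i + j))`. -/
def level (r s : ℕ) : ℝ := 1 / 2 * √(((s : ℝ) - 1) / r)

theorem level_nonneg (r s : ℕ) : 0 ≤ level r s := by unfold level; positivity

theorem level_mono (r : ℕ) {s t : ℕ} (h : s ≤ t) : level r s ≤ level r t := by
  unfold level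
  gcongr

theorem level_le_half {r s : ℕ} (h : s ≤ r) : level r s ≤ 1 / 2 := by
  have h1 : √(((s : ℝ) - 1) / r) ≤ 1 := by
    rw [Real.sqrt_le_one]
    rcases Nat.eq_zero_or_pos r with rfl | hr
    · simp
    · have hr' : (0 : ℝ) < r := by exact_mod_cast hr
      rw [div_le_one hr']
      have : (s : ℝ) ≤ r := by exact_mod_cast h
      linarith
  unfold level
  linarith

theorem level_sq {r s : ℕ} (hs : 1 ≤ s) : level r s ^ 2 = ((s : ℝ) - 1) / (4 * r) := by
  have h : (1 : ℝ) ≤ s := by exact_mod_cast hs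
  rw [level, mul_pow, Real.sq_sqrt (div_nonneg (by linarith) (Nat.cast_nonneg r))]
  rw [mul_comm (4 : ℝ), ← div_div]
  ring

theorem level_lt {r s t : ℕ} (hr : 0 < r) (hs : 1 ≤ s) (h : s < t) : level r s < level r t := by
  have hr' : (0 : ℝ) < r := by exact_mod_cast hr
  refine lt_of_pow_lt_pow_left₀ 2 (level_nonneg r t) ?_
  rw [level_sq hs, level_sq (by omega)]
  gcongr

theorem level_succ_sub {r m : ℕ} (hr : 0 < r) (hm : 1 ≤ m) (h : m + 1 ≤ r) :
    1 / (4 * r) ≤ level r (m + 1) - level r m := by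
  have hr' : (0 : ℝ) < r := by exact_mod_cast hr
  have h1 := level_le_half h
  have h2 := level_le_half (show m ≤ r by omega)
  have h3 : (level r (m + 1) - level r m) * (level r (m + 1) + level r m) = 1 / (4 * r) := by
    have e1 := level_sq (r := r) hm
    have e2 := level_sq (r := r) (show 1 ≤ m + 1 by omega)
    push_cast at e2
    calc _ = level r (m + 1) ^ 2 - level r m ^ 2 := by ring
      _ = _ := by rw [e1, e2]; ring
  have h4 := sub_nonneg.2 (level_mono r (Nat.le_succ m))
  calc _ = _ := h3.symm
    _ ≤ (level r (m + 1) - level r m) * 1 := by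
        gcongr
        linarith
    _ = _ := mul_one _

theorem level_self_le {r : ℕ} (hr : 0 < r) : level r r ≤ 1 / 2 - 1 / (4 * r) := by
  have hr' : (1 : ℝ) ≤ r := by exact_mod_cast hr
  have h0 : (0 : ℝ) ≤ 1 / 2 - 1 / (4 * r) := by
    rw [sub_nonneg, div_le_div_iff₀ (by positivity) (by norm_num)]
    linarith
  refine le_of_sq_le_sq ?_ h0
  rw [level_sq hr]
  have h1 : (1 / 2 - 1 / (4 * (r : ℝ))) ^ 2 = ((r : ℝ) - 1) / (4 * r) + (1 / (4 * r)) ^ 2 := by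
    field_simp
    ring
  rw [h1]
  have : (0 : ℝ) ≤ (1 / (4 * (r : ℝ))) ^ 2 := by positivity
  linarith

/-- The choice of levels as square roots makes the product of the two losses of a bracket of the
orders `j`, `i` comparable with `ij / (r(i+j))`. -/
theorem level_product {r j i : ℕ} (hr : 0 < r) (hj : 1 ≤ j) (hi : 1 ≤ i) :
    (j : ℝ) * i / (12 * r * ((j : ℝ) + i - 1)) ≤
      (level r (j + i) - level r j) * (level r (j + i) - level r i) := by
  have hr' : (0 : ℝ) < r := by exact_mod_cast hr
  have hj' : (1 : ℝ) ≤ j := by exact_mod_cast hj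
  have hi' : (1 : ℝ) ≤ i := by exact_mod_cast hi
  set A := level r (j + i)
  set B := level r j
  set C := level r i
  have hA : A ^ 2 = ((j : ℝ) + i - 1) / (4 * r) := by
    rw [level_sq (by omega)]; push_cast; rfl
  have hB : B ^ 2 = ((j : ℝ) - 1) / (4 * r) := level_sq hj
  have hC : C ^ 2 = ((i : ℝ) - 1) / (4 * r) := level_sq hi
  have hA0 : 0 < A := (level_nonneg r j).trans_lt (level_lt hr hj (by omega))
  have hB0 : 0 ≤ B := level_nonneg r j
  have hC0 : 0 ≤ C := level_nonneg r i
  have hAB : A ^ 2 - B ^ 2 = (i : ℝ) / (4 * r) := by rw [hA, hB]; ring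
  have hAC : A ^ 2 - C ^ 2 = (j : ℝ) / (4 * r) := by rw [hA, hC]; ring
  have hBC : B ^ 2 + C ^ 2 ≤ A ^ 2 := by
    have : A ^ 2 - (B ^ 2 + C ^ 2) = 1 / (4 * r) := by rw [hA, hB, hC]; ring
    have : (0 : ℝ) < 1 / (4 * r) := by positivity
    linarith
  -- `(1 + b) (1 + c) ≤ (1 + 1 / √2) ^ 2 < 3` whenever `b ^ 2 + c ^ 2 ≤ 1`
  have h3 : (A + B) * (A + C) ≤ 3 * A ^ 2 := by
    nlinarith [sq_nonneg (B - C), sq_nonneg (7 * A - 5 * (B + C))]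
  have h4 : ((A - B) * (A - C)) * ((A + B) * (A + C)) = (j : ℝ) * i / (4 * r) ^ 2 := by
    calc _ = (A ^ 2 - B ^ 2) * (A ^ 2 - C ^ 2) := by ring
      _ = _ := by rw [hAB, hAC]; field_simp
  have h5 : 0 ≤ (A - B) * (A - C) :=
    mul_nonneg (sub_nonneg.2 (level_mono r (by omega))) (sub_nonneg.2 (level_mono r (by omega)))
  have h6 : (j : ℝ) * i / (4 * r) ^ 2 ≤ ((A - B) * (A - C)) * (3 * A ^ 2) := by
    rw [← h4]
    gcongr
  have h7 : (0 : ℝ) < (j : ℝ) + i - 1 := by linarith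
  rw [hA] at h6
  rw [div_le_iff₀ (by positivity)]
  rw [div_le_iff₀ (by positivity)] at h6
  calc (j : ℝ) * i ≤ _ := h6
    _ = _ := by field_simp; ring

/-- The loss in a bracket, together with the weight `j / m` of the recursion, is of the order `r`
uniformly in all orders. -/
theorem weighted_loss_le {r i m l : ℕ} (hr : 0 < r) (him : i < m) (h : i + 1 < m + l) {B : ℝ}
    (hB : 0 < B) : ((i : ℝ) + 1) / m * (B / ((level r (m + l) - level r (i + 1)) *
      (level r (m + l) - level r (m - 1 - i + l)))) ≤ 12 * r * B := by
  have hr' : (0 : ℝ) < r := by exact_mod_cast hr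
  obtain ⟨k, hk⟩ : ∃ k, k = m - 1 - i + l := ⟨_, rfl⟩
  have hk1 : 1 ≤ k := by omega
  have hsum : m + l = (i + 1) + k := by omega
  have hkl : l ≤ k := by omega
  have hm : (1 : ℝ) ≤ m := by exact_mod_cast (show 1 ≤ m by omega)
  have hk1' : (1 : ℝ) ≤ k := by exact_mod_cast hk1
  have hkl' : (l : ℝ) ≤ k := by exact_mod_cast hkl
  have hsum' : (m : ℝ) + l = (i + 1) + k := by exact_mod_cast hsum
  have hi : (0 : ℝ) ≤ i := Nat.cast_nonneg i
  rw [← hk, hsum]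
  have hp := level_product (i := k) hr (show 1 ≤ i + 1 by omega) hk1
  push_cast at hp
  have h1 : (0 : ℝ) < (i : ℝ) + 1 + k - 1 := by linarith
  have h2 : (0 : ℝ) < ((i : ℝ) + 1) * k / (12 * r * ((i : ℝ) + 1 + k - 1)) := by positivity
  calc _ ≤ ((i : ℝ) + 1) / m * (B / (((i : ℝ) + 1) * k / (12 * r * ((i : ℝ) + 1 + k - 1)))) := by
        gcongr
    _ = (12 * r * B) * (((i : ℝ) + 1 + k - 1) / (m * k)) := by field_simp
    _ ≤ (12 * r * B) * 1 := by
        gcongr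
        rw [div_le_one (by positivity)]
        nlinarith
    _ = _ := mul_one _

variable {V : Set (Fin n → ℝ)} {δ σ : ℝ} {χ G : ℕ → Reduced n → ℂ}

theorem enorm_ofReal_complex {x : ℝ} (hx : 0 ≤ x) : ‖(x : ℂ)‖ₑ = ENNReal.ofReal x := by
  rw [← ofReal_norm, Complex.norm_real, Real.norm_of_nonneg hx]

theorem isFourierAt_zero (hσ : 0 < σ) {u : ℝ} (hu : u ≤ 1) :
    IsFourierAt V δ σ u 0 ∧ levelNorm V δ σ u 0 = 0 := isFourier_zero (angleWidth_pos hσ hu)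

/-- The recursion for the norms when the term of order `m` is estimated at the level of
order `m + l`. -/
theorem chain_level_estimate (hδ : 0 < δ) (hσ : 0 < σ) {r N l : ℕ} (hr : 0 < r) (hN : N ≤ r)
    (hl : 1 ≤ l ∨ G 0 = 0) (hχ : ∀ j ≤ N, IsFourierAt V δ σ (level r j) (χ j))
    (hG : ∀ j, j + l ≤ N → IsFourierAt V δ σ (level r (j + l)) (G j)) :
    ∀ m, m + l ≤ N → IsFourierAt V δ σ (level r (m + l)) (chain χ G m) ∧
      levelNorm V δ σ (level r (m + l)) (chain χ G m) ≤
        levelNorm V δ σ (level r (m + l)) (G m) +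
        ENNReal.ofReal (12 * r * bracketConst δ σ) * ∑ i ∈ Finset.range m,
          levelNorm V δ σ (level r (i + 1)) (χ (i + 1)) *
            levelNorm V δ σ (level r (m - 1 - i + l)) (chain χ G (m - 1 - i)) := by
  have hB := bracketConst_pos hδ hσ
  intro m
  induction m using Nat.strong_induction_on with
  | _ m ih =>
  intro hm
  cases m with
  | zero => rw [chain_zero]; exact ⟨hG 0 hm, le_self_add⟩
  | succ s =>
    have hu : level r (s + 1 + l) ≤ 1 := (level_le_half (hm.trans hN)).trans (by norm_num)
    have hτ := angleWidth_pos hσ hu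
    have hbr : ∀ i ∈ Finset.range (s + 1),
        IsFourierAt V δ σ (level r (s + 1 + l)) (reducedBracket (χ (i + 1)) (chain χ G (s - i))) ∧
        ENNReal.ofReal (((i : ℝ) + 1) / (s + 1)) * levelNorm V δ σ (level r (s + 1 + l))
          (reducedBracket (χ (i + 1)) (chain χ G (s - i))) ≤
        ENNReal.ofReal (12 * r * bracketConst δ σ) *
          (levelNorm V δ σ (level r (i + 1)) (χ (i + 1)) *
            levelNorm V δ σ (level r (s - i + l)) (chain χ G (s - i))) := by
      intro i hi
      rw [Finset.mem_range] at hi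
      by_cases hil : i + 1 < s + 1 + l
      · have := isFourierAt_reducedBracket hδ hσ (hχ (i + 1) (by omega))
          (ih (s - i) (by omega) (by omega)).1 (level_lt hr (by omega) hil)
          (level_lt hr (by omega) (by omega)) hu
        refine ⟨this.1, (mul_le_mul' le_rfl this.2).trans ?_⟩
        rw [← mul_assoc, ← ENNReal.ofReal_mul (by positivity)]
        refine mul_le_mul' (ENNReal.ofReal_le_ofReal ?_) le_rfl
        have := weighted_loss_le hr hi hil hB
        rw [Nat.add_sub_cancel] at this
        exact_mod_cast this
      · have h1 : s - i = 0 := by omega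
        have h2 : G 0 = 0 := hl.resolve_left (by omega)
        rw [h1, chain_zero, h2, reducedBracket_zero_right, (isFourierAt_zero hσ hu).2, mul_zero]
        exact ⟨(isFourierAt_zero hσ hu).1, zero_le⟩
    have hterm : ∀ i ∈ Finset.range (s + 1), IsFourierAt V δ σ (level r (s + 1 + l))
        (fun z => ((((i : ℝ) + 1) / (s + 1) : ℝ) : ℂ) *
          reducedBracket (χ (i + 1)) (chain χ G (s - i)) z) := fun i hi =>
      (isFourier_const_mul hτ (hbr i hi).1 _).1
    have hsum := isFourier_finset_sum hτ _ hterm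
    have hadd := isFourier_add hτ (hG (s + 1) hm) hsum.1
    have hdiff : ∀ j ≤ s + 1, DifferentiableOn ℂ (χ j) (reducedDomain V
        (actionWidth δ (level r (s + 1 + l))) (angleWidth σ (level r (s + 1 + l)))) := fun j hj =>
      ((hχ j (by omega)).anti hδ hσ (level_mono r (by omega))).differentiableOn
    have hdiffG : ∀ j ≤ s + 1, DifferentiableOn ℂ (G j) (reducedDomain V
        (actionWidth δ (level r (s + 1 + l))) (angleWidth σ (level r (s + 1 + l)))) := fun j hj =>
      ((hG j (by omega)).anti hδ hσ (level_mono r (by omega))).differentiableOn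
    have heq := hadd.1.congr hτ (G := chain χ G (s + 1)) fun p hp => by
      rw [chain_succ (isOpen_reducedDomain _ _ _) hdiff hdiffG le_rfl hp, Finset.mul_sum]
      refine congrArg (G (s + 1) p + ·) (Finset.sum_congr rfl fun i _ => ?_)
      push_cast
      ring
    refine ⟨heq.1, heq.2.le.trans (hadd.2.trans (add_le_add le_rfl (hsum.2.trans ?_)))⟩
    rw [Finset.mul_sum, Nat.add_sub_cancel]
    refine Finset.sum_le_sum fun i hi => ?_
    refine (isFourier_const_mul hτ (hbr i hi).1 _).2.trans ?_
    rw [enorm_ofReal_complex (by positivity)]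
    exact (hbr i hi).2

end Levels

/-! ### Convolution inequalities -/

section Convolution

theorem sum_convolution_le (x a : ℕ → ℝ≥0∞) (N : ℕ) :
    ∑ m ∈ Finset.range N, ∑ i ∈ Finset.range (m + 1), x i * a (m - i) ≤
      (∑ i ∈ Finset.range N, x i) * ∑ m ∈ Finset.range N, a m := by
  rw [Finset.sum_range_diag_flip N fun i k => x i * a k, Finset.sum_mul]
  refine Finset.sum_le_sum fun i _ => ?_
  rw [← Finset.mul_sum]
  exact mul_le_mul' le_rfl (Finset.sum_le_sum_of_subset (Finset.range_mono (Nat.sub_le _ _)))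

/-- A discrete Gronwall inequality: a convolution term whose weighted kernel has mass at most `1/8`
costs a factor `8/7 = 1 / (1 - 1/8)`. -/
theorem weighted_sum_le {x a g : ℕ → ℝ≥0∞} {κ w : ℝ≥0∞} {N : ℕ}
    (h : ∀ m ≤ N, a m ≤ g m + κ * ∑ i ∈ Finset.range m, x (i + 1) * a (m - 1 - i))
    (hx : κ * ∑ i ∈ Finset.range N, w ^ (i + 1) * x (i + 1) ≤ ENNReal.ofReal (1 / 8)) :
    ∑ m ∈ Finset.range (N + 1), w ^ m * a m ≤
      ENNReal.ofReal (8 / 7) * ∑ m ∈ Finset.range (N + 1), w ^ m * g m := by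
  have h87 : (1 : ℝ≥0∞) + ENNReal.ofReal (1 / 8) * ENNReal.ofReal (8 / 7) =
      ENNReal.ofReal (8 / 7) := by
    rw [← ENNReal.ofReal_mul (by norm_num), ← ENNReal.ofReal_one,
      ← ENNReal.ofReal_add (by norm_num) (by norm_num)]
    norm_num
  have key : ∀ M ≤ N, ∑ m ∈ Finset.range (M + 1), w ^ m * a m ≤
      ENNReal.ofReal (8 / 7) * ∑ m ∈ Finset.range (M + 1), w ^ m * g m := by
    intro M
    induction M with
    | zero =>
      intro h0
      have h1 := h 0 h0
      simp only [Finset.range_zero, Finset.sum_empty, mul_zero, add_zero] at h1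
      simp only [zero_add, Finset.range_one, Finset.sum_singleton, pow_zero, one_mul]
      calc a 0 ≤ 1 * g 0 := by rwa [one_mul]
        _ ≤ _ := by
          gcongr
          rw [← ENNReal.ofReal_one]
          exact ENNReal.ofReal_le_ofReal (by norm_num)
    | succ M ih =>
      intro hM
      have h1 : ∑ m ∈ Finset.range (M + 1 + 1), w ^ m * a m ≤
          ∑ m ∈ Finset.range (M + 1 + 1), (w ^ m * g m +
            κ * ∑ i ∈ Finset.range m, (w ^ (i + 1) * x (i + 1)) *
              (w ^ (m - 1 - i) * a (m - 1 - i))) := by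
        refine Finset.sum_le_sum fun m hm => ?_
        rw [Finset.mem_range] at hm
        refine (mul_le_mul' le_rfl (h m (by omega))).trans (le_of_eq ?_)
        rw [mul_add, Finset.mul_sum, Finset.mul_sum, Finset.mul_sum]
        congr 1
        refine Finset.sum_congr rfl fun i hi => ?_
        rw [Finset.mem_range] at hi
        rw [show w ^ m = w ^ (i + 1) * w ^ (m - 1 - i) by rw [← pow_add]; congr 1; omega]
        ring
      have h2 : ∑ m ∈ Finset.range (M + 1 + 1), ∑ i ∈ Finset.range m,
          (w ^ (i + 1) * x (i + 1)) * (w ^ (m - 1 - i) * a (m - 1 - i)) ≤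
          (∑ i ∈ Finset.range (M + 1), w ^ (i + 1) * x (i + 1)) *
            ∑ m ∈ Finset.range (M + 1), w ^ m * a m := by
        rw [Finset.sum_range_succ']
        simp only [Nat.add_sub_cancel, Finset.range_zero, Finset.sum_empty, add_zero]
        exact sum_convolution_le (fun i => w ^ (i + 1) * x (i + 1)) (fun m => w ^ m * a m) (M + 1)
      have h3 : κ * ∑ i ∈ Finset.range (M + 1), w ^ (i + 1) * x (i + 1) ≤
          ENNReal.ofReal (1 / 8) :=
        (mul_le_mul' le_rfl (Finset.sum_le_sum_of_subset (Finset.range_mono hM))).trans hx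
      have h4 : ∑ m ∈ Finset.range (M + 1), w ^ m * g m ≤
          ∑ m ∈ Finset.range (M + 1 + 1), w ^ m * g m :=
        Finset.sum_le_sum_of_subset (Finset.range_mono (Nat.le_succ _))
      calc _ ≤ _ := h1
        _ ≤ ∑ m ∈ Finset.range (M + 1 + 1), w ^ m * g m +
            κ * ((∑ i ∈ Finset.range (M + 1), w ^ (i + 1) * x (i + 1)) *
            ∑ m ∈ Finset.range (M + 1), w ^ m * a m) := by
            rw [Finset.sum_add_distrib, ← Finset.mul_sum]
            gcongr
        _ ≤ ∑ m ∈ Finset.range (M + 1 + 1), w ^ m * g m +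
            ENNReal.ofReal (1 / 8) * (ENNReal.ofReal (8 / 7) *
              ∑ m ∈ Finset.range (M + 1 + 1), w ^ m * g m) := by
            rw [← mul_assoc]
            gcongr
            exact (ih (by omega)).trans (by gcongr)
        _ = _ := by rw [← mul_assoc, ← one_add_mul, h87]
  exact key N le_rfl

/-- The sizes `ψ` of the right-hand sides of the homological equations sum up to a multiple of the
size of the perturbation. -/
theorem sum_obstruction_le {x ψ q p F : ℕ → ℝ≥0∞} {e : ℕ → ℕ → ℝ≥0∞}
    {κ w ν c a T : ℝ≥0∞} {r : ℕ} (hψ0 : ψ 0 = 0) (hx0 : x 0 = 0)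
    (hx : ∀ s ≤ r, x s ≤ a * ψ s)
    (hq : ∀ m ≤ r, q m ≤ ψ m + κ * ∑ i ∈ Finset.range m, x (i + 1) * q (m - 1 - i))
    (hp : ∀ m < r, p m ≤ c * x m + κ * ∑ i ∈ Finset.range m, x (i + 1) * p (m - 1 - i))
    (he : ∀ l m, m + (l + 1) ≤ r → e l m ≤ (if m = 0 then F (l + 1) else 0) +
      κ * ∑ i ∈ Finset.range m, x (i + 1) * e l (m - 1 - i))
    (hψ : ∀ s < r, ψ (s + 1) ≤ κ * ∑ i ∈ Finset.range s, x (i + 1) * q (s - i) + ν * p s +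
      ∑ l ∈ Finset.range (s + 1), e l (s - l))
    (hT : ∑' l, w ^ l * F l ≤ T) (h1 : κ * (a * (ENNReal.ofReal (7 / 5) * T)) ≤ ENNReal.ofReal (1 / 8))
    (h2 : w * ν * (ENNReal.ofReal (8 / 7) * (c * a)) ≤ ENNReal.ofReal (3 / 100)) :
    ∑ s ∈ Finset.range (r + 1), w ^ s * ψ s ≤ ENNReal.ofReal (7 / 5) * T := by
  have key : ∀ S ≤ r, ∑ s ∈ Finset.range (S + 1), w ^ s * ψ s ≤ ENNReal.ofReal (7 / 5) * T := by
    intro S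
    induction S with
    | zero => intro _; simp [hψ0]
    | succ S ih =>
      intro hS
      have ihS := ih (by omega)
      have hxa : ∑ s ∈ Finset.range (S + 1), w ^ s * x s ≤
          a * ∑ s ∈ Finset.range (S + 1), w ^ s * ψ s := by
        rw [Finset.mul_sum]
        refine Finset.sum_le_sum fun s hs => ?_
        rw [Finset.mem_range] at hs
        calc _ ≤ w ^ s * (a * ψ s) := mul_le_mul' le_rfl (hx s (by omega))
          _ = _ := by ring
      have hxS : ∑ i ∈ Finset.range S, w ^ (i + 1) * x (i + 1) =
          ∑ s ∈ Finset.range (S + 1), w ^ s * x s := by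
        rw [Finset.sum_range_succ', hx0, mul_zero, add_zero]
      have hκ : κ * ∑ i ∈ Finset.range S, w ^ (i + 1) * x (i + 1) ≤ ENNReal.ofReal (1 / 8) := by
        rw [hxS]
        exact (mul_le_mul' le_rfl (hxa.trans (mul_le_mul' le_rfl ihS))).trans h1
      have hκ' : ∀ N ≤ S, κ * ∑ i ∈ Finset.range N, w ^ (i + 1) * x (i + 1) ≤
          ENNReal.ofReal (1 / 8) := fun N hN =>
        (mul_le_mul' le_rfl (Finset.sum_le_sum_of_subset (Finset.range_mono hN))).trans hκ
      -- the brackets of the generating functions with the terms coming from `h`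
      have t1 : ∑ s ∈ Finset.range (S + 1), w ^ (s + 1) *
          (κ * ∑ i ∈ Finset.range s, x (i + 1) * q (s - i)) ≤
          ENNReal.ofReal (1 / 7) * (ENNReal.ofReal (7 / 5) * T) := by
        have e1 : ∀ s ∈ Finset.range (S + 1), w ^ (s + 1) *
            (κ * ∑ i ∈ Finset.range s, x (i + 1) * q (s - i)) = κ *
            ∑ i ∈ Finset.range s, (w ^ (i + 1) * x (i + 1)) *
              (w ^ (s - 1 - i + 1) * q (s - 1 - i + 1)) := by
          intro s _
          rw [mul_left_comm, Finset.mul_sum]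
          congr 1
          refine Finset.sum_congr rfl fun i hi => ?_
          rw [Finset.mem_range] at hi
          rw [show s - 1 - i + 1 = s - i by omega,
            show w ^ (s + 1) = w ^ (i + 1) * w ^ (s - i) by rw [← pow_add]; congr 1; omega]
          ring
        rw [Finset.sum_congr rfl e1, ← Finset.mul_sum, Finset.sum_range_succ']
        simp only [Nat.add_sub_cancel, Finset.range_zero, Finset.sum_empty, add_zero]
        have e2 := sum_convolution_le (fun i => w ^ (i + 1) * x (i + 1))
          (fun m => w ^ (m + 1) * q (m + 1)) S
        have e3 : ∑ m ∈ Finset.range S, w ^ (m + 1) * q (m + 1) ≤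
            ENNReal.ofReal (8 / 7) * ∑ s ∈ Finset.range (S + 1), w ^ s * ψ s :=
          (by rw [Finset.sum_range_succ']; exact le_self_add : _ ≤ _).trans
            (weighted_sum_le (fun m hm => hq m (by omega)) hκ)
        calc _ ≤ κ * ((∑ i ∈ Finset.range S, w ^ (i + 1) * x (i + 1)) *
              ∑ m ∈ Finset.range S, w ^ (m + 1) * q (m + 1)) := mul_le_mul' le_rfl e2
          _ ≤ ENNReal.ofReal (1 / 8) * (ENNReal.ofReal (8 / 7) *
              (ENNReal.ofReal (7 / 5) * T)) := by
              rw [← mul_assoc]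
              exact mul_le_mul' hκ (e3.trans (mul_le_mul' le_rfl ihS))
          _ = _ := by
              rw [← mul_assoc, ← ENNReal.ofReal_mul (by norm_num)]
              norm_num
      have t2 : ∑ s ∈ Finset.range (S + 1), w ^ (s + 1) * (ν * p s) ≤
          ENNReal.ofReal (3 / 100) * (ENNReal.ofReal (7 / 5) * T) := by
        have e1 := weighted_sum_le (x := x) (a := p) (g := fun m => c * x m)
          (fun m hm => hp m (show m < r by omega)) hκ
        calc _ = w * ν * ∑ s ∈ Finset.range (S + 1), w ^ s * p s := by
              rw [Finset.mul_sum]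
              exact Finset.sum_congr rfl fun s _ => by ring
          _ ≤ w * ν * (ENNReal.ofReal (8 / 7) * (c * (a * (ENNReal.ofReal (7 / 5) * T)))) := by
              refine mul_le_mul' le_rfl (e1.trans (mul_le_mul' le_rfl ?_))
              calc _ = c * ∑ s ∈ Finset.range (S + 1), w ^ s * x s := by
                    rw [Finset.mul_sum]
                    exact Finset.sum_congr rfl fun s _ => by ring
                _ ≤ _ := mul_le_mul' le_rfl (hxa.trans (mul_le_mul' le_rfl ihS))
          _ = w * ν * (ENNReal.ofReal (8 / 7) * (c * a)) * (ENNReal.ofReal (7 / 5) * T) := by ring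
          _ ≤ _ := mul_le_mul' h2 le_rfl
      have t3 : ∑ s ∈ Finset.range (S + 1), w ^ (s + 1) * ∑ l ∈ Finset.range (s + 1), e l (s - l) ≤
          ENNReal.ofReal (8 / 7) * T := by
        have e1 : ∀ s ∈ Finset.range (S + 1), w ^ (s + 1) * ∑ l ∈ Finset.range (s + 1), e l (s - l) =
            ∑ l ∈ Finset.range (s + 1), w ^ (l + 1) * (w ^ (s - l) * e l (s - l)) := by
          intro s _
          rw [Finset.mul_sum]
          refine Finset.sum_congr rfl fun l hl => ?_
          rw [Finset.mem_range] at hl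
          rw [← mul_assoc, ← pow_add]
          congr 2
          omega
        rw [Finset.sum_congr rfl e1,
          Finset.sum_range_diag_flip (S + 1) fun l k => w ^ (l + 1) * (w ^ k * e l k)]
        calc _ ≤ ∑ l ∈ Finset.range (S + 1), w ^ (l + 1) * (ENNReal.ofReal (8 / 7) * F (l + 1)) := by
              refine Finset.sum_le_sum fun l hl => ?_
              rw [Finset.mem_range] at hl
              rw [← Finset.mul_sum, show S + 1 - l = S - l + 1 by omega]
              refine mul_le_mul' le_rfl ((weighted_sum_le
                (fun m hm => he l m (by omega)) (hκ' (S - l) (by omega))).trans ?_)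
              refine mul_le_mul' le_rfl (le_of_eq ?_)
              rw [Finset.sum_range_succ']
              simp
          _ = ENNReal.ofReal (8 / 7) * ∑ l ∈ Finset.range (S + 1), w ^ (l + 1) * F (l + 1) := by
              rw [Finset.mul_sum]
              exact Finset.sum_congr rfl fun l _ => by ring
          _ ≤ _ := by
              refine mul_le_mul' le_rfl (le_trans ?_ hT)
              refine le_trans ?_ (ENNReal.sum_le_tsum (Finset.range (S + 1 + 1)))
              rw [Finset.sum_range_succ' _ (S + 1)]
              exact le_self_add
      rw [Finset.sum_range_succ', hψ0, mul_zero, add_zero]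
      calc _ ≤ ∑ s ∈ Finset.range (S + 1), (w ^ (s + 1) *
            (κ * ∑ i ∈ Finset.range s, x (i + 1) * q (s - i)) + w ^ (s + 1) * (ν * p s) +
            w ^ (s + 1) * ∑ l ∈ Finset.range (s + 1), e l (s - l)) := by
            refine Finset.sum_le_sum fun s hs => ?_
            rw [Finset.mem_range] at hs
            rw [← mul_add, ← mul_add]
            exact mul_le_mul' le_rfl (hψ s (by omega))
        _ ≤ ENNReal.ofReal (1 / 7) * (ENNReal.ofReal (7 / 5) * T) +
            ENNReal.ofReal (3 / 100) * (ENNReal.ofReal (7 / 5) * T) +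
            ENNReal.ofReal (8 / 7) * T := by
            rw [Finset.sum_add_distrib, Finset.sum_add_distrib]
            exact add_le_add (add_le_add t1 t2) t3
        _ = ENNReal.ofReal (1 / 7 * (7 / 5) + 3 / 100 * (7 / 5) + 8 / 7) * T := by
            rw [← mul_assoc, ← mul_assoc, ← add_mul, ← add_mul,
              ← ENNReal.ofReal_mul (by norm_num), ← ENNReal.ofReal_mul (by norm_num),
              ← ENNReal.ofReal_add (by norm_num) (by norm_num),
              ← ENNReal.ofReal_add (by norm_num) (by norm_num)]
        _ ≤ _ := by
            refine mul_le_mul' (ENNReal.ofReal_le_ofReal ?_) le_rfl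
            norm_num
  exact key r le_rfl

end Convolution

/-! ### The generating functions -/

section Generators

open Metric Set Filter Topology

variable {V : Set (Fin n → ℝ)} {δ σ α : ℝ} {h : (Fin n → ℂ) → ℂ} {M : Set (Fin n → ℤ)} {μ : ℂ}
  {r K : ℕ} {χ φ : ℕ → Reduced n → ℂ}

/-- The brackets `L_{χ_j} h`. -/
def actionSource (h : (Fin n → ℂ) → ℂ) (χ : ℕ → Reduced n → ℂ) (j : ℕ) : Reduced n → ℂ :=
  reducedBracket (χ j) fun q => h q.1

/-- The brackets `L_{χ_j} η`. -/
def timeSource (χ : ℕ → Reduced n → ℂ) (j : ℕ) (p : Reduced n) : ℂ := -fderiv ℂ (χ j) p (0, 0, 1)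

/-- The terms of order `s` in the transformed Hamiltonian, when `φ_l` is counted as a term of
order `l` and the transform of order `s` of `μ η` as a term of order `s + 1`. -/
def orderTerm (h : (Fin n → ℂ) → ℂ) (μ : ℂ) (φ χ : ℕ → Reduced n → ℂ) (s : ℕ)
    (z : Reduced n) : ℂ :=
  chain χ (actionSource h χ) s z + μ * chain χ (timeSource χ) (s - 1) z +
    ∑ l ∈ Finset.range s, chain χ (Pi.single 0 (φ (l + 1))) (s - 1 - l) z

/-- The first `s` generating functions. -/
def truncate (χ : ℕ → Reduced n → ℂ) (s j : ℕ) : Reduced n → ℂ := if j < s then χ j else 0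

/-- The right-hand side of the homological equation of order `s`. -/
def obstruction (h : (Fin n → ℂ) → ℂ) (μ : ℂ) (φ χ : ℕ → Reduced n → ℂ) (s : ℕ) :
    Reduced n → ℂ :=
  orderTerm h μ φ (truncate χ s) s

theorem truncate_of_lt {s j : ℕ} (hj : j < s) : truncate χ s j = χ j := if_pos hj

theorem truncate_of_le {s j : ℕ} (hj : s ≤ j) : truncate χ s j = 0 := if_neg hj.not_gt

theorem actionSource_of_eq_zero {j : ℕ} (hj : χ j = 0) : actionSource h χ j = 0 := by
  rw [actionSource, hj, reducedBracket_zero_left]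

theorem timeSource_of_eq_zero {j : ℕ} (hj : χ j = 0) : timeSource χ j = 0 := by
  funext p
  rw [timeSource, hj]
  simp

/-- The generating functions are defined recursively: the obstruction at order `s` involves only the
`χ_j` with `j < s`. -/
theorem exists_generators (h : (Fin n → ℂ) → ℂ) (M : Set (Fin n → ℤ)) (μ : ℂ)
    (φ : ℕ → Reduced n → ℂ) (r K : ℕ) : ∃ χ : ℕ → Reduced n → ℂ, χ 0 = 0 ∧
      (∀ s, r < s → χ s = 0) ∧ ∀ s, 1 ≤ s → s ≤ r →
        χ s = multiplier (solveSymbol h M (s * K)) (obstruction h μ φ χ s) := by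
  let gen : ℕ → ℕ → Reduced n → ℂ := fun N => Nat.rec (fun _ => 0) (fun s g j =>
    if j = s + 1 then multiplier (solveSymbol h M ((s + 1) * K)) (orderTerm h μ φ g (s + 1))
      else g j) N
  have hsucc : ∀ s j, gen (s + 1) j = if j = s + 1 then
      multiplier (solveSymbol h M ((s + 1) * K)) (orderTerm h μ φ (gen s) (s + 1))
      else gen s j := fun s j => rfl
  have hzero : ∀ N j, N < j → gen N j = 0 := by
    intro N
    induction N with
    | zero => intro j _; rfl
    | succ N ih => intro j hj; rw [hsucc, if_neg (by omega), ih j (by omega)]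
  have hstable : ∀ N j, j ≤ N → gen N j = gen j j := by
    intro N
    induction N with
    | zero => intro j hj; rw [Nat.le_zero.1 hj]
    | succ N ih =>
      intro j hj
      rcases Nat.lt_succ_iff_lt_or_eq.1 (Nat.lt_succ_of_le hj) with h | rfl
      · rw [hsucc, if_neg (by omega), ih j (by omega)]
      · rfl
  refine ⟨gen r, hstable r 0 (Nat.zero_le r), fun s hs => hzero r s hs, fun s hs1 hs => ?_⟩
  obtain ⟨t, rfl⟩ : ∃ t, s = t + 1 := ⟨s - 1, by omega⟩
  have htr : truncate (gen r) (t + 1) = gen t := by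
    funext j
    by_cases hj : j < t + 1
    · rw [truncate_of_lt hj, hstable r j (by omega), hstable t j (by omega)]
    · rw [truncate_of_le (by omega), hzero t j (by omega)]
  rw [hstable r _ hs, hsucc, if_pos rfl, obstruction, htr]

theorem chain_truncate_actionSource {s m : ℕ} (hm : m < s) :
    chain (truncate χ s) (actionSource h (truncate χ s)) m = chain χ (actionSource h χ) m :=
  chain_congr m (fun j hj => truncate_of_lt (by omega))
    fun j hj => by rw [actionSource, truncate_of_lt (by omega), actionSource]

theorem chain_truncate_timeSource {s m : ℕ} (hm : m < s) :
    chain (truncate χ s) (timeSource (truncate χ s)) m = chain χ (timeSource χ) m :=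
  chain_congr m (fun j hj => truncate_of_lt (by omega))
    fun j hj => by funext p; rw [timeSource, truncate_of_lt (by omega), timeSource]

theorem chain_truncate {s m : ℕ} (hm : m < s) (G : ℕ → Reduced n → ℂ) :
    chain (truncate χ s) G m = chain χ G m :=
  chain_congr m (fun j hj => truncate_of_lt (by omega)) fun j hj => rfl

/-- The terms of order `s` involve `χ_s` only through `L_{χ_s} h`. -/
theorem orderTerm_eq (hχ0 : χ 0 = 0) {s : ℕ} (hs : 1 ≤ s) (z : Reduced n) :
    orderTerm h μ φ χ s z = obstruction h μ φ χ s z + actionSource h χ s z := by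
  have h1 := chain_sub_congr (χ := χ) (χ' := truncate χ s) (G := actionSource h χ)
    (G' := actionSource h (truncate χ s)) s (actionSource_of_eq_zero hχ0)
    (actionSource_of_eq_zero (by rw [truncate_of_lt (by omega), hχ0]))
    (fun j hj => (truncate_of_lt hj).symm)
    (fun j hj => by rw [actionSource, actionSource, truncate_of_lt hj]) z
  rw [actionSource_of_eq_zero (j := s) (χ := truncate χ s) (truncate_of_le le_rfl), Pi.zero_apply,
    sub_zero] at h1
  have h2 : ∑ l ∈ Finset.range s, chain χ (Pi.single 0 (φ (l + 1))) (s - 1 - l) z =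
      ∑ l ∈ Finset.range s, chain (truncate χ s) (Pi.single 0 (φ (l + 1))) (s - 1 - l) z :=
    Finset.sum_congr rfl fun l hl => by
      rw [Finset.mem_range] at hl
      rw [chain_truncate (by omega)]
  rw [obstruction, orderTerm, orderTerm, ← h1, chain_truncate_timeSource (by omega), h2]
  ring

/-- Trigonometric polynomials at a level of width. -/
abbrev IsTrigAt (V : Set (Fin n → ℝ)) (δ σ u : ℝ) (N : ℕ) (F : Reduced n → ℂ) : Prop :=
  IsTrigPolynomial V (actionWidth δ u) (angleWidth σ u) N F

theorem IsTrigAt.anti (hδ : 0 < δ) (hσ : 0 < σ) {u w : ℝ} {N N' : ℕ} {F : Reduced n → ℂ}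
    (hF : IsTrigAt V δ σ u N F) (h : u ≤ w) (hN : N ≤ N') : IsTrigAt V δ σ w N' F :=
  hF.mono (actionWidth_anti hδ h) (angleWidth_anti hσ h) hN

theorem level_le_one {s : ℕ} (hs : s ≤ r) : level r s ≤ 1 :=
  (level_le_half hs).trans (by norm_num)

theorem isFourierAt_timeSource (hδ : 0 < δ) (hσ : 0 < σ) (hr : 0 < r) (hχ0 : χ 0 = 0) {j : ℕ}
    (hj : j + 1 ≤ r) (hχ : IsFourierAt V δ σ (level r j) (χ j)) :
    IsFourierAt V δ σ (level r (j + 1)) (timeSource χ j) ∧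
      levelNorm V δ σ (level r (j + 1)) (timeSource χ j) ≤
        ENNReal.ofReal (80 * r / (9 * σ)) * levelNorm V δ σ (level r j) (χ j) := by
  have hr' : (0 : ℝ) < r := by exact_mod_cast hr
  have hu := level_le_one hj
  rcases Nat.eq_zero_or_pos j with rfl | hj1
  · rw [timeSource_of_eq_zero hχ0, (isFourierAt_zero hσ hu).2]
    exact ⟨(isFourierAt_zero hσ hu).1, zero_le⟩
  · obtain ⟨-, -, h1, h2⟩ := isFourierAt_fderiv hδ hσ hχ (level_lt hr hj1 (Nat.lt_succ_self j)) hu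
    have h3 := isFourier_neg (angleWidth_pos hσ hu) h1
    refine ⟨h3.1, (h3.2.trans h2).trans (mul_le_mul' (ENNReal.ofReal_le_ofReal ?_) le_rfl)⟩
    have h4 := level_succ_sub hr hj1 hj
    calc 1 / (9 / 20 * σ * (level r (j + 1) - level r j)) ≤ 1 / (9 / 20 * σ * (1 / (4 * r))) := by
          gcongr
      _ = _ := by field_simp; norm_num

theorem isFourierAt_single {l m N : ℕ} (hδ : 0 < δ) (hσ : 0 < σ) (hN : N ≤ r) (hm : m + l ≤ N)
    {F : Reduced n → ℂ} (hF : IsFourierAt V δ σ 0 F) :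
    IsFourierAt V δ σ (level r (m + l)) ((Pi.single 0 F : ℕ → Reduced n → ℂ) m) ∧
      levelNorm V δ σ (level r (m + l)) ((Pi.single 0 F : ℕ → Reduced n → ℂ) m) ≤
        if m = 0 then levelNorm V δ σ 0 F else 0 := by
  rcases Nat.eq_zero_or_pos m with rfl | hm0
  · rw [Pi.single_eq_same, if_pos rfl]
    exact ⟨hF.anti hδ hσ (level_nonneg _ _), levelNorm_anti hδ hσ (level_nonneg _ _) F⟩
  · rw [Pi.single_eq_of_ne hm0.ne', if_neg hm0.ne']
    have := isFourierAt_zero (V := V) (δ := δ) hσ (level_le_one (hm.trans hN))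
    exact ⟨this.1, this.2.le⟩

/-- The sources of the recursion for the terms of order `s`, and these terms, at the level of
order `s`. -/
theorem isFourierAt_orderTerm (hδ : 0 < δ) (hσ : 0 < σ) (hr : 0 < r)
    (hφ : ∀ l, IsFourierAt V δ σ 0 (φ l)) (hφt : ∀ l, IsTrigAt V δ σ 0 (l * K) (φ l)) {s : ℕ}
    (hs1 : 1 ≤ s) (hs : s ≤ r) (hχ0 : χ 0 = 0)
    (hχ : ∀ j ≤ s, IsFourierAt V δ σ (level r j) (χ j))
    (hχt : ∀ j ≤ s, IsTrigAt V δ σ (level r j) (j * K) (χ j))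
    (hQ : ∀ j ≤ s, IsFourierAt V δ σ (level r j) (actionSource h χ j))
    (hQt : ∀ j ≤ s, IsTrigAt V δ σ (level r j) (j * K) (actionSource h χ j)) :
    IsFourierAt V δ σ (level r s) (orderTerm h μ φ χ s) ∧
    IsTrigAt V δ σ (level r s) (s * K) (orderTerm h μ φ χ s) ∧
    levelNorm V δ σ (level r s) (orderTerm h μ φ χ s) ≤
      levelNorm V δ σ (level r s) (chain χ (actionSource h χ) s) +
      ‖μ‖ₑ * levelNorm V δ σ (level r s) (chain χ (timeSource χ) (s - 1)) +
      ∑ l ∈ Finset.range s,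
        levelNorm V δ σ (level r s) (chain χ (Pi.single 0 (φ (l + 1))) (s - 1 - l)) := by
  have hτ := angleWidth_pos hσ (level_le_one hs)
  have f1 := (chain_level_estimate hδ hσ (l := 0) hr hs
    (Or.inr (actionSource_of_eq_zero (h := h) hχ0)) hχ (fun j hj => hQ j hj) s le_rfl).1
  have f2 : IsFourierAt V δ σ (level r s) (chain χ (timeSource χ) (s - 1)) := by
    have := (chain_level_estimate hδ hσ (l := 1) hr hs (Or.inl le_rfl) hχ
      (fun j hj => (isFourierAt_timeSource hδ hσ hr hχ0 (by omega) (hχ j (by omega))).1)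
      (s - 1) (by omega)).1
    rwa [Nat.sub_add_cancel hs1] at this
  have f3 : ∀ l ∈ Finset.range s, IsFourierAt V δ σ (level r s)
      (chain χ (Pi.single 0 (φ (l + 1))) (s - 1 - l)) := by
    intro l hl
    rw [Finset.mem_range] at hl
    have := (chain_level_estimate hδ hσ (l := l + 1) (G := Pi.single 0 (φ (l + 1))) hr hs
      (Or.inl (by omega)) hχ (fun j hj => (isFourierAt_single hδ hσ hs hj (hφ (l + 1))).1)
      (s - 1 - l) (by omega)).1
    rwa [show s - 1 - l + (l + 1) = s by omega] at this
  have g2 := isFourier_const_mul hτ f2 μ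
  have g3 := isFourier_finset_sum hτ _ f3
  have g12 := isFourier_add hτ f1 g2.1
  have g := isFourier_add hτ g12.1 g3.1
  refine ⟨g.1, ?_, g.2.trans (add_le_add (g12.2.trans (add_le_add le_rfl g2.2)) g3.2)⟩
  have hχt' : ∀ j ≤ s, IsTrigAt V δ σ (level r s) (j * K) (χ j) := fun j hj =>
    (hχt j hj).anti hδ hσ (level_mono r hj) le_rfl
  have t1 := isTrigPolynomial_chain (d := 0) hχt' (G := actionSource h χ)
    (fun j hj => (hQt j hj).anti hδ hσ (level_mono r hj) le_rfl) le_rfl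
  have t2 := isTrigPolynomial_chain (d := 0) hχt' (G := timeSource χ)
    (fun j hj => ((hχt' j hj).fderiv (0, 0, 1)).neg) (Nat.sub_le s 1)
  have t3 : ∀ l ∈ Finset.range s, IsTrigAt V δ σ (level r s) (s * K)
      (chain χ (Pi.single 0 (φ (l + 1))) (s - 1 - l)) := by
    intro l hl
    rw [Finset.mem_range] at hl
    have := isTrigPolynomial_chain (d := l + 1) (G := Pi.single 0 (φ (l + 1))) hχt' (fun j hj => ?_)
      (show s - 1 - l ≤ s by omega)
    · exact this.mono le_rfl le_rfl (Nat.mul_le_mul_right K (by omega))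
    · rcases Nat.eq_zero_or_pos j with rfl | hj0
      · rw [Pi.single_eq_same]
        exact (hφt (l + 1)).anti hδ hσ (level_nonneg _ _) (Nat.mul_le_mul_right K (by omega))
      · rw [Pi.single_eq_of_ne hj0.ne']
        exact isTrigPolynomial_zero
  exact (t1.add ((t2.mono le_rfl le_rfl (Nat.mul_le_mul_right K (Nat.sub_le s 1))).const_mul
    μ)).add (IsTrigPolynomial.sum _ t3)

/-- All generating functions at their levels, with the solution of the homological equations. -/
theorem isFourierAt_generators (hδ : 0 < δ) (hσ : 0 < σ) (hα : 0 < α) (hr : 0 < r)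
    (hh : DifferentiableOn ℂ h (actionNhd V δ))
    (hres : ∀ k : Fin n → ℤ, k ∉ M → absSum k < r * K → ∀ I ∈ actionNhd V δ,
      α < ‖∑ i, frequency h I i * (k i : ℂ)‖)
    (hφ : ∀ l, IsFourierAt V δ σ 0 (φ l)) (hφt : ∀ l, IsTrigAt V δ σ 0 (l * K) (φ l))
    (hχ0 : χ 0 = 0) (hχ : ∀ s, 1 ≤ s → s ≤ r →
      χ s = multiplier (solveSymbol h M (s * K)) (obstruction h μ φ χ s)) :
    ∀ s ≤ r, (IsFourierAt V δ σ (level r s) (χ s) ∧ IsTrigAt V δ σ (level r s) (s * K) (χ s) ∧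
      IsFourierAt V δ σ (level r s) (actionSource h χ s) ∧
      IsTrigAt V δ σ (level r s) (s * K) (actionSource h χ s)) ∧ (1 ≤ s →
      IsFourierAt V δ σ (level r s) (obstruction h μ φ χ s) ∧
      levelNorm V δ σ (level r s) (χ s) ≤
        ENNReal.ofReal (1 / α) * levelNorm V δ σ (level r s) (obstruction h μ φ χ s) ∧
      levelNorm V δ σ (level r s) (actionSource h χ s) ≤
        levelNorm V δ σ (level r s) (obstruction h μ φ χ s) ∧
      levelNorm V δ σ (level r s) (obstruction h μ φ χ s) ≤
        levelNorm V δ σ (level r s) (chain (truncate χ s) (actionSource h (truncate χ s)) s) +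
        ‖μ‖ₑ * levelNorm V δ σ (level r s) (chain χ (timeSource χ) (s - 1)) +
        ∑ l ∈ Finset.range s,
          levelNorm V δ σ (level r s) (chain χ (Pi.single 0 (φ (l + 1))) (s - 1 - l)) ∧
      ∃ Z, IsFourierAt V δ σ (level r s) Z ∧ (∀ k, k ∉ M ∨ s * K ≤ absSum k →
        ∀ p ∈ actionNhd V (actionWidth δ (level r s)) ×ˢ strip (angleWidth σ (level r s)),
          fourierCoefficient Z k p = 0) ∧
        ∀ p ∈ reducedDomain V (actionWidth δ (level r s)) (angleWidth σ (level r s)),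
          orderTerm h μ φ χ s p = Z p) := by
  intro s
  induction s using Nat.strong_induction_on with
  | _ s ih =>
  intro hs
  have hu := level_le_one hs
  have hτ := angleWidth_pos hσ hu
  rcases Nat.eq_zero_or_pos s with rfl | hs1
  · rw [actionSource_of_eq_zero hχ0, hχ0]
    have h1 := (isFourierAt_zero (V := V) (δ := δ) hσ hu).1
    exact ⟨⟨h1, isTrigPolynomial_zero, h1, isTrigPolynomial_zero⟩, fun h => absurd h (by norm_num)⟩
  have htr : ∀ j ≤ s, IsFourierAt V δ σ (level r j) (truncate χ s j) ∧
      IsTrigAt V δ σ (level r j) (j * K) (truncate χ s j) ∧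
      IsFourierAt V δ σ (level r j) (actionSource h (truncate χ s) j) ∧
      IsTrigAt V δ σ (level r j) (j * K) (actionSource h (truncate χ s) j) := by
    intro j hj
    by_cases hjs : j < s
    · rw [actionSource, truncate_of_lt hjs]
      exact (ih j hjs (by omega)).1
    · have h0 := truncate_of_le (χ := χ) (not_lt.1 hjs)
      rw [actionSource_of_eq_zero h0, h0]
      have h1 := (isFourierAt_zero (V := V) (δ := δ) hσ (level_le_one (hj.trans hs))).1
      exact ⟨h1, isTrigPolynomial_zero, h1, isTrigPolynomial_zero⟩
  have hΨ := isFourierAt_orderTerm (μ := μ) hδ hσ hr hφ hφt hs1 hs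
    (by rw [truncate_of_lt (by omega), hχ0]) (fun j hj => (htr j hj).1)
    (fun j hj => (htr j hj).2.1) (fun j hj => (htr j hj).2.2.1) fun j hj => (htr j hj).2.2.2
  obtain ⟨hΨ1, hΨ2, hΨ3⟩ := hΨ
  rw [chain_truncate_timeSource (by omega)] at hΨ3
  have hsub : ∑ l ∈ Finset.range s, levelNorm V δ σ (level r s)
      (chain (truncate χ s) (Pi.single 0 (φ (l + 1))) (s - 1 - l)) =
      ∑ l ∈ Finset.range s, levelNorm V δ σ (level r s)
        (chain χ (Pi.single 0 (φ (l + 1))) (s - 1 - l)) :=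
    Finset.sum_congr rfl fun l hl => by
      rw [Finset.mem_range] at hl
      rw [chain_truncate (by omega)]
  rw [hsub] at hΨ3
  change IsFourierAt V δ σ (level r s) (obstruction h μ φ χ s) at hΨ1
  change IsTrigAt V δ σ (level r s) (s * K) (obstruction h μ φ χ s) at hΨ2
  have hw : actionWidth δ (level r s) ≤ δ := by
    have h1 := actionWidth_anti hδ (level_nonneg r s)
    have h2 : actionWidth δ 0 = δ := by simp [actionWidth]
    rwa [h2] at h1
  have hh' := hh.mono (actionNhd_mono V hw)
  have hres' : ∀ k : Fin n → ℤ, k ∉ M → absSum k < s * K →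
      ∀ I ∈ actionNhd V (actionWidth δ (level r s)),
        α < ‖∑ i, frequency h I i * (k i : ℂ)‖ := fun k hk hks I hI =>
    hres k hk (hks.trans_le (Nat.mul_le_mul_right K hs)) I (actionNhd_mono V hw hI)
  obtain ⟨x1, x2, x3⟩ := isFourier_solve hτ hα hh' hres' hΨ1
  obtain ⟨z1, -, z3⟩ := isFourier_resonant (M := M) hτ hΨ1
  obtain ⟨e1, e2, e3⟩ := homological_equation hτ hα hh' hres' hΨ1 hΨ2
  rw [← hχ s hs1 hs] at x1 x2 x3 e1 e2 e3
  have hzk : ∀ k, k ∉ M ∨ s * K ≤ absSum k →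
      ∀ p ∈ actionNhd V (actionWidth δ (level r s)) ×ˢ strip (angleWidth σ (level r s)),
        fourierCoefficient (multiplier (resonantSymbol M) (obstruction h μ φ χ s)) k p = 0 := by
    rintro k (hk | hk) p hp
    · rw [z3 k p hp, resonantSymbol, if_neg hk, zero_mul]
    · rw [z3 k p hp, hΨ2.fourierCoefficient_eq_zero hτ hk hp, mul_zero]
  refine ⟨⟨x1, x1.isTrigPolynomial fun k hk p hp => ?_, e2, ?_⟩, fun _ =>
    ⟨hΨ1, x2, e3, hΨ3, multiplier (resonantSymbol M) (obstruction h μ φ χ s), z1, hzk,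
      fun p hp => ?_⟩⟩
  · rw [x3 k p hp, solveSymbol, if_neg fun h => absurd h.2 (not_lt.2 hk), zero_mul]
  · have hz := z1.isTrigPolynomial (N := s * K) fun k hk => hzk k (Or.inr hk)
    refine (hz.add hΨ2.neg).congr fun p hp => ?_
    rw [← e1 p hp, actionSource]
    ring
  · rw [orderTerm_eq hχ0 hs1, ← e1 p hp, actionSource]

/-- The generating functions, with their sizes at the final level: `w` is the weight per order, and
`T` bounds the weighted size of the perturbation. -/
theorem exists_normalForm_generators (hδ : 0 < δ) (hσ : 0 < σ) (hα : 0 < α)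
    (hh : DifferentiableOn ℂ h (actionNhd V δ))
    (hres : ∀ k : Fin n → ℤ, k ∉ M → absSum k < r * K → ∀ I ∈ actionNhd V δ,
      α < ‖∑ i, frequency h I i * (k i : ℂ)‖)
    (hφ : ∀ l, IsFourierAt V δ σ 0 (φ l)) (hφt : ∀ l, IsTrigAt V δ σ 0 (l * K) (φ l))
    {w T : ℝ≥0∞} (hT : ∑' l, w ^ l * levelNorm V δ σ 0 (φ l) ≤ T)
    (h1 : ENNReal.ofReal (12 * r * bracketConst δ σ) * (ENNReal.ofReal (1 / α) *
      (ENNReal.ofReal (7 / 5) * T)) ≤ ENNReal.ofReal (1 / 8))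
    (h2 : w * ‖μ‖ₑ * (ENNReal.ofReal (8 / 7) * (ENNReal.ofReal (80 * r / (9 * σ)) *
      ENNReal.ofReal (1 / α))) ≤ ENNReal.ofReal (3 / 100)) :
    ∃ χ : ℕ → Reduced n → ℂ, χ 0 = 0 ∧ (∀ s, r < s → χ s = 0) ∧
      (∀ s, 1 ≤ s → s ≤ r →
        χ s = multiplier (solveSymbol h M (s * K)) (obstruction h μ φ χ s)) ∧
      (∀ s, IsFourierAt V δ σ (level r r) (χ s)) ∧
      (∀ s, IsTrigAt V δ σ (level r r) (s * K) (χ s)) ∧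
      (∀ s, IsFourierAt V δ σ (level r r) (actionSource h χ s)) ∧
      ∑' s, w ^ s * levelNorm V δ σ (level r r) (χ s) ≤
        ENNReal.ofReal (1 / α) * (ENNReal.ofReal (7 / 5) * T) ∧
      ∑' s, w ^ s * levelNorm V δ σ (level r r) (actionSource h χ s) ≤
        ENNReal.ofReal (7 / 5) * T ∧
      ∀ s, 1 ≤ s → s ≤ r → ∃ Z, IsFourierAt V δ σ (level r r) Z ∧
        (∀ k, k ∉ M ∨ s * K ≤ absSum k →
        ∀ p ∈ actionNhd V (actionWidth δ (level r r)) ×ˢ strip (angleWidth σ (level r r)),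
          fourierCoefficient Z k p = 0) ∧
        ∀ p ∈ reducedDomain V (actionWidth δ (level r r)) (angleWidth σ (level r r)),
          orderTerm h μ φ χ s p = Z p := by
  obtain ⟨χ, hχ0, hχr, hχ⟩ := exists_generators h M μ φ r K
  have hz := isFourierAt_zero (V := V) (δ := δ) hσ (level_le_one (le_refl r))
  refine ⟨χ, hχ0, hχr, hχ, ?_⟩
  rcases Nat.eq_zero_or_pos r with rfl | hr
  · have hχ' : ∀ s, χ s = 0 := fun s => by
      rcases Nat.eq_zero_or_pos s with rfl | hs
      · exact hχ0
      · exact hχr s hs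
    have hQ' : ∀ s, actionSource h χ s = 0 := fun s => actionSource_of_eq_zero (hχ' s)
    refine ⟨fun s => by rw [hχ' s]; exact hz.1, fun s => by rw [hχ' s]; exact isTrigPolynomial_zero,
      fun s => by rw [hQ' s]; exact hz.1, ?_, ?_, fun s hs1 hs => absurd hs (by omega)⟩
    · simp only [hχ', hz.2, mul_zero, tsum_zero]; exact zero_le
    · simp only [hQ', hz.2, mul_zero, tsum_zero]; exact zero_le
  have hgen := isFourierAt_generators (μ := μ) hδ hσ hα hr hh hres hφ hφt hχ0 hχ
  have hlev : ∀ {s : ℕ}, s ≤ r → level r s ≤ level r r := fun hs => level_mono r hs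
  set ψ : ℕ → ℝ≥0∞ := fun s =>
    if s = 0 then 0 else levelNorm V δ σ (level r s) (obstruction h μ φ χ s)
  have hψ : ∀ s, 1 ≤ s → ψ s = levelNorm V δ σ (level r s) (obstruction h μ φ χ s) :=
    fun s hs => if_neg (by omega)
  have hxψ : ∀ s ≤ r, levelNorm V δ σ (level r s) (χ s) ≤ ENNReal.ofReal (1 / α) * ψ s := by
    intro s hs
    rcases Nat.eq_zero_or_pos s with rfl | hs1
    · rw [hχ0, (isFourierAt_zero hσ (level_le_one hs)).2]; exact zero_le
    · rw [hψ s hs1]; exact ((hgen s hs).2 hs1).2.1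
  have hQψ : ∀ s ≤ r, levelNorm V δ σ (level r s) (actionSource h χ s) ≤ ψ s := by
    intro s hs
    rcases Nat.eq_zero_or_pos s with rfl | hs1
    · rw [actionSource_of_eq_zero hχ0, (isFourierAt_zero hσ (level_le_one hs)).2]; exact zero_le
    · rw [hψ s hs1]; exact ((hgen s hs).2 hs1).2.2.1
  have hχl : ∀ j ≤ r, IsFourierAt V δ σ (level r j) (χ j) := fun j hj => (hgen j hj).1.1
  have hsum : ∑ s ∈ Finset.range (r + 1), w ^ s * ψ s ≤ ENNReal.ofReal (7 / 5) * T := by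
    refine sum_obstruction_le (x := fun s => levelNorm V δ σ (level r s) (χ s)) (ψ := ψ)
      (q := fun m => levelNorm V δ σ (level r m) (chain χ (actionSource h χ) m))
      (p := fun m => levelNorm V δ σ (level r (m + 1)) (chain χ (timeSource χ) m))
      (e := fun l m => levelNorm V δ σ (level r (m + (l + 1)))
        (chain χ (Pi.single 0 (φ (l + 1))) m)) (F := fun l => levelNorm V δ σ 0 (φ l))
      (κ := ENNReal.ofReal (12 * r * bracketConst δ σ)) (ν := ‖μ‖ₑ)
      (c := ENNReal.ofReal (80 * r / (9 * σ))) (a := ENNReal.ofReal (1 / α))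
      (if_pos rfl) ?_ hxψ ?_ ?_ ?_ ?_ hT h1 h2
    · rw [hχ0]
      exact (isFourierAt_zero hσ (level_le_one (Nat.zero_le r))).2
    · intro m hm
      exact (chain_level_estimate hδ hσ (l := 0) hr le_rfl
        (Or.inr (actionSource_of_eq_zero hχ0)) hχl (fun j hj => (hgen j hj).1.2.2.1) m hm).2.trans
        (add_le_add (hQψ m hm) le_rfl)
    · intro m hm
      exact (chain_level_estimate hδ hσ (l := 1) hr le_rfl (Or.inl le_rfl) hχl
        (fun j hj => (isFourierAt_timeSource hδ hσ hr hχ0 hj (hχl j (by omega))).1) m hm).2.trans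
        (add_le_add (isFourierAt_timeSource hδ hσ hr hχ0 hm (hχl m hm.le)).2 le_rfl)
    · intro l m hm
      exact (chain_level_estimate hδ hσ (l := l + 1) hr le_rfl (Or.inl (by omega)) hχl
        (fun j hj => (isFourierAt_single hδ hσ le_rfl hj (hφ (l + 1))).1) m hm).2.trans
        (add_le_add (isFourierAt_single hδ hσ le_rfl hm (hφ (l + 1))).2 le_rfl)
    · intro s hs
      rw [hψ (s + 1) (by omega)]
      refine ((hgen (s + 1) hs).2 (by omega)).2.2.2.1.trans
        (add_le_add (add_le_add ?_ le_rfl) (Finset.sum_le_sum fun l hl => ?_))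
      · have htr : ∀ j ≤ s + 1, IsFourierAt V δ σ (level r j) (truncate χ (s + 1) j) ∧
            IsFourierAt V δ σ (level r j) (actionSource h (truncate χ (s + 1)) j) := by
          intro j hj
          by_cases hjs : j < s + 1
          · rw [actionSource, truncate_of_lt hjs]
            exact ⟨(hgen j (by omega)).1.1, (hgen j (by omega)).1.2.2.1⟩
          · have h0 := truncate_of_le (χ := χ) (not_lt.1 hjs)
            rw [actionSource_of_eq_zero h0, h0]
            have h1 := (isFourierAt_zero (V := V) (δ := δ) hσ (level_le_one (hj.trans hs))).1
            exact ⟨h1, h1⟩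
        have h3 := (chain_level_estimate hδ hσ (l := 0) hr hs (Or.inr (actionSource_of_eq_zero
          (by rw [truncate_of_lt (by omega), hχ0]))) (fun j hj => (htr j hj).1)
          (fun j hj => (htr j hj).2) (s + 1) le_rfl).2
        refine h3.trans ?_
        rw [actionSource_of_eq_zero (j := s + 1) (truncate_of_le le_rfl),
          (isFourierAt_zero hσ (level_le_one (show s + 1 + 0 ≤ r from hs))).2, zero_add,
          Finset.sum_range_succ]
        refine mul_le_mul' le_rfl ?_
        rw [show s + 1 - 1 - s = 0 by omega, chain_zero, actionSource_of_eq_zero (j := 0)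
          (by rw [truncate_of_lt (by omega), hχ0]),
          (isFourierAt_zero hσ (level_le_one (Nat.zero_le r))).2, mul_zero, add_zero]
        refine Finset.sum_le_sum fun i hi => ?_
        rw [Finset.mem_range] at hi
        rw [truncate_of_lt (by omega), chain_truncate_actionSource (by omega),
          show s + 1 - 1 - i = s - i by omega]
        exact le_rfl
      · rw [Finset.mem_range] at hl
        rw [show s + 1 - 1 - l = s - l by omega, show s - l + (l + 1) = s + 1 by omega]
  have htsum : ∀ N : ℕ → ℝ≥0∞, (∀ s, r < s → N s = 0) →
      ∑' s, w ^ s * N s = ∑ s ∈ Finset.range (r + 1), w ^ s * N s := fun N hN =>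
    tsum_eq_sum fun s hs => by
      rw [Finset.mem_range, not_lt] at hs
      rw [hN s (by omega), mul_zero]
  refine ⟨fun s => ?_, fun s => ?_, fun s => ?_, ?_, ?_, fun s hs1 hs => ?_⟩
  · rcases le_or_gt s r with hs | hs
    · exact (hgen s hs).1.1.anti hδ hσ (hlev hs)
    · rw [hχr s hs]; exact hz.1
  · rcases le_or_gt s r with hs | hs
    · exact (hgen s hs).1.2.1.anti hδ hσ (hlev hs) le_rfl
    · rw [hχr s hs]; exact isTrigPolynomial_zero
  · rcases le_or_gt s r with hs | hs
    · exact (hgen s hs).1.2.2.1.anti hδ hσ (hlev hs)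
    · rw [actionSource_of_eq_zero (hχr s hs)]; exact hz.1
  · rw [htsum _ fun s hs => by rw [hχr s hs]; exact hz.2]
    refine le_trans ?_ (mul_le_mul' le_rfl hsum)
    rw [Finset.mul_sum]
    refine Finset.sum_le_sum fun s hs => ?_
    rw [Finset.mem_range] at hs
    calc _ ≤ w ^ s * (ENNReal.ofReal (1 / α) * ψ s) := mul_le_mul' le_rfl
          ((levelNorm_anti hδ hσ (hlev (by omega)) _).trans (hxψ s (by omega)))
      _ = _ := by ring
  · rw [htsum _ fun s hs => by rw [actionSource_of_eq_zero (hχr s hs)]; exact hz.2]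
    refine le_trans (Finset.sum_le_sum fun s hs => ?_) hsum
    rw [Finset.mem_range] at hs
    exact mul_le_mul' le_rfl ((levelNorm_anti hδ hσ (hlev (by omega)) _).trans (hQψ s (by omega)))
  · obtain ⟨Z, z1, z2, z3⟩ := ((hgen s hs).2 hs1).2.2.2.2
    refine ⟨Z, z1.anti hδ hσ (hlev hs), fun k hk p hp => z2 k hk p ?_, fun p hp => z3 p ?_⟩
    · exact prod_mono (actionNhd_mono V (actionWidth_anti hδ (hlev hs)))
        (strip_mono (angleWidth_anti hσ (hlev hs))) hp
    · exact reducedDomain_mono V (actionWidth_anti hδ (hlev hs)) (angleWidth_anti hσ (hlev hs)) hp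

end Generators

/-! ### The flow of the generating functions -/

section Flow

open Metric Set Filter Topology

variable {V : Set (Fin n → ℝ)} {δ σ : ℝ} {χ G : ℕ → Reduced n → ℂ}

theorem IsTransported.of_inter_ball {E W : Type} [NormedAddCommGroup E] [NormedSpace ℂ E]
    [NormedAddCommGroup W] [NormedSpace ℂ W] {X : ℕ → E → E} {r : ℕ} {ρ : ℝ} {D : Set E}
    {v : ℂ × E → W} (h : ∀ R, IsTransported X r ρ (D ∩ ball 0 R) v) (hD : IsOpen D) :
    IsTransported X r ρ D v := by
  have hmem : ∀ z ∈ D, z ∈ D ∩ ball 0 (‖z‖ + 1) := fun z hz =>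
    ⟨hz, mem_ball_zero_iff.2 (lt_add_one _)⟩
  refine ⟨fun p hp => ?_, fun t ht z hz => (h (‖z‖ + 1)).equation t ht z (hmem z hz)⟩
  have h1 := (h (‖p.2‖ + 1)).differentiableOn.differentiableAt
    ((isOpen_ball.prod (hD.inter isOpen_ball)).mem_nhds ⟨hp.1, hmem _ hp.2⟩)
  exact h1.differentiableWithinAt

theorem differentiableOn_fieldOperator {E W : Type} [NormedAddCommGroup E] [NormedSpace ℂ E]
    [NormedAddCommGroup W] [NormedSpace ℂ W] [CompleteSpace W] [FiniteDimensional ℂ E]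
    {X : ℕ → E → E} {g : E → W} {D : Set E} (hD : IsOpen D)
    (hX : ∀ j, DifferentiableOn ℂ (X j) D) (hg : DifferentiableOn ℂ g D) (s : ℕ) :
    DifferentiableOn ℂ (fieldOperator X g s) D := by
  induction s using Nat.strong_induction_on with
  | _ s ih =>
  cases s with
  | zero => rwa [fieldOperator_zero]
  | succ s =>
    have h1 : ∀ z ∈ D, fieldOperator X g (s + 1) z = ((s : ℂ) + 1)⁻¹ •
        ∑ i ∈ Finset.range (s + 1),
          ((i : ℂ) + 1) • fderiv ℂ (fieldOperator X g (s - i)) z (X (i + 1) z) := fun z _ => by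
      rw [← succ_smul_fieldOperator, inv_smul_smul₀ (Nat.cast_add_one_ne_zero s)]
    refine DifferentiableOn.congr ?_ h1
    refine (DifferentiableOn.fun_sum fun i _ => ?_).const_smul _
    exact ((differentiableOn_fderiv hD (ih (s - i) (by omega))).clm_apply (hX (i + 1))).const_smul _

theorem clm_fieldOperator {E W : Type} [NormedAddCommGroup E] [NormedSpace ℂ E]
    [NormedAddCommGroup W] [NormedSpace ℂ W] [CompleteSpace W] [FiniteDimensional ℂ E]
    {X : ℕ → E → E} {g : E → W} {D : Set E} (hD : IsOpen D)
    (hX : ∀ j, DifferentiableOn ℂ (X j) D) (hg : DifferentiableOn ℂ g D) (L : W →L[ℂ] ℂ) (s : ℕ) :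
    ∀ z ∈ D, L (fieldOperator X g s z) = fieldOperator X (fun z => L (g z)) s z := by
  induction s using Nat.strong_induction_on with
  | _ s ih =>
  intro z hz
  cases s with
  | zero => rw [fieldOperator_zero, fieldOperator_zero]
  | succ s =>
    have hs : ((s : ℂ) + 1) ≠ 0 := Nat.cast_add_one_ne_zero s
    refine smul_right_injective ℂ hs ?_
    simp only
    rw [← map_smul, succ_smul_fieldOperator, succ_smul_fieldOperator, map_sum]
    refine Finset.sum_congr rfl fun i _ => ?_
    rw [map_smul]
    congr 1
    have hdiff := (differentiableOn_fieldOperator hD hX hg (s - i)).differentiableAt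
      (hD.mem_nhds hz)
    have h1 : (fun z => L (fieldOperator X g (s - i) z)) =ᶠ[𝓝 z]
        fieldOperator X (fun z => L (g z)) (s - i) := by
      filter_upwards [hD.mem_nhds hz] with w hw
      exact ih (s - i) (by omega) w hw
    rw [← h1.fderiv_eq]
    have h2 := (L.hasFDerivAt.comp z hdiff.hasFDerivAt).fderiv
    exact (congrArg (fun A : E →L[ℂ] ℂ => A (X (i + 1) z)) h2).symm

/-- The Hamiltonian fields of the generating functions. -/
def fields (χ : ℕ → Reduced n → ℂ) (j : ℕ) : Phase n → Phase n :=
  hamiltonianField fun w => χ j (reduce w)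

theorem fields_of_eq_zero {j : ℕ} (hj : χ j = 0) : fields χ j = 0 := by
  funext z
  simp only [fields, hj, Pi.zero_apply, hamiltonianField]
  simp
  rfl

theorem differentiableOn_fields {D : Set (Phase n)} {D₁ : Set (Reduced n)} (hD₁ : IsOpen D₁)
    (hmaps : ∀ z ∈ D, reduce z ∈ D₁) (hχ : ∀ j, DifferentiableOn ℂ (χ j) D₁) (j : ℕ) :
    DifferentiableOn ℂ (fields χ j) D := by
  have hv : ∀ v : Reduced n, DifferentiableOn ℂ (fun z : Phase n => fderiv ℂ (χ j) (reduce z) v) D :=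
    fun v => (differentiableOn_fderiv_apply hD₁ (hχ j) v).comp
      (reduceCLM n).differentiable.differentiableOn hmaps
  have h1 : ∀ z ∈ D, fields χ j z = (fun i => -fderiv ℂ (χ j) (reduce z) (0, Pi.single i 1, 0),
        -fderiv ℂ (χ j) (reduce z) (0, 0, 1),
        fun i => fderiv ℂ (χ j) (reduce z) (Pi.single i 1, 0, 0), 0) := fun z hz =>
    hamiltonianField_comp_reduce ((hχ j).differentiableAt (hD₁.mem_nhds (hmaps z hz)))
  refine DifferentiableOn.congr ?_ h1
  exact (differentiableOn_pi.2 fun i => (hv _).neg).prodMk ((hv _).neg.prodMk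
    ((differentiableOn_pi.2 fun i => hv _).prodMk (differentiableOn_const 0)))

/-- The Lie operators on functions whose first brackets with the generating functions do not
depend on `η`. -/
theorem fieldOperator_eq_chain {D : Set (Phase n)} (hD : IsOpen D) {D₁ : Set (Reduced n)}
    (hD₁ : IsOpen D₁) (hmaps : ∀ z ∈ D, reduce z ∈ D₁) (hχ : ∀ j, DifferentiableOn ℂ (χ j) D₁)
    (hG : ∀ j, DifferentiableOn ℂ (G j) D₁) {g : Phase n → ℂ}
    (hg : ∀ j, ∀ z ∈ D, fderiv ℂ g z (fields χ (j + 1) z) =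
      G (j + 1) (reduce z) + reducedBracket (χ (j + 1)) (G 0) (reduce z)) (s : ℕ) :
    ∀ z ∈ D, fieldOperator (fields χ) g (s + 1) z = chain χ G (s + 1) (reduce z) := by
  induction s using Nat.strong_induction_on with
  | _ s ih =>
  intro z hz
  have hs : ((s : ℂ) + 1) ≠ 0 := Nat.cast_add_one_ne_zero s
  refine mul_left_cancel₀ hs ?_
  rw [← smul_eq_mul, succ_smul_fieldOperator, chain_succ hD₁ (N := s + 1) (fun j _ => hχ j)
    (fun j _ => hG j) le_rfl (hmaps z hz), mul_add, mul_inv_cancel_left₀ hs,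
    Finset.sum_range_succ, Finset.sum_range_succ, Nat.sub_self, fieldOperator_zero, hg s z hz,
    chain_zero]
  have h1 : ∀ i ∈ Finset.range s, ((i : ℂ) + 1) •
      fderiv ℂ (fieldOperator (fields χ) g (s - i)) z (fields χ (i + 1) z) =
      ((i : ℂ) + 1) * reducedBracket (χ (i + 1)) (chain χ G (s - i)) (reduce z) := by
    intro i hi
    rw [Finset.mem_range] at hi
    have h2 : fieldOperator (fields χ) g (s - i) =ᶠ[𝓝 z] fun w => chain χ G (s - i) (reduce w) := by
      filter_upwards [hD.mem_nhds hz] with w hw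
      obtain ⟨t, ht⟩ : ∃ t, s - i = t + 1 := ⟨s - i - 1, by omega⟩
      rw [ht]
      exact ih t (by omega) w hw
    rw [h2.fderiv_eq, smul_eq_mul, fields, fderiv_hamiltonianField_reduce
      ((hχ _).differentiableAt (hD₁.mem_nhds (hmaps z hz)))
      ((differentiableOn_chain hD₁ (fun j _ => hχ j) (fun j _ => hG j)
        (le_refl (s - i))).differentiableAt (hD₁.mem_nhds (hmaps z hz)))]
  rw [Finset.sum_congr rfl h1, smul_eq_mul]
  ring

/-- The action coordinate `I_i`. -/
def actionCoord (i : Fin n) : Phase n →L[ℂ] ℂ :=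
  (ContinuousLinearMap.proj i).comp (ContinuousLinearMap.fst ℂ (Fin n → ℂ) _)

/-- The coordinate `η`. -/
def energyCoord : Phase n →L[ℂ] ℂ :=
  (ContinuousLinearMap.fst ℂ ℂ _).comp (ContinuousLinearMap.snd ℂ (Fin n → ℂ) _)

/-- The angle coordinate `φ_i`. -/
def angleCoord (i : Fin n) : Phase n →L[ℂ] ℂ :=
  (ContinuousLinearMap.proj i).comp ((ContinuousLinearMap.fst ℂ (Fin n → ℂ) ℂ).comp
    ((ContinuousLinearMap.snd ℂ ℂ _).comp (ContinuousLinearMap.snd ℂ (Fin n → ℂ) _)))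

/-- The coordinate `ξ`. -/
def timeCoord : Phase n →L[ℂ] ℂ :=
  (ContinuousLinearMap.snd ℂ (Fin n → ℂ) ℂ).comp
    ((ContinuousLinearMap.snd ℂ ℂ _).comp (ContinuousLinearMap.snd ℂ (Fin n → ℂ) _))

@[simp] theorem actionCoord_apply (i : Fin n) (z : Phase n) : actionCoord i z = z.1 i := rfl
@[simp] theorem energyCoord_apply (z : Phase n) : energyCoord z = z.2.1 := rfl
@[simp] theorem angleCoord_apply (i : Fin n) (z : Phase n) : angleCoord i z = z.2.2.1 i := rfl
@[simp] theorem timeCoord_apply (z : Phase n) : timeCoord z = z.2.2.2 := rfl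

theorem norm_phase_le (v : Phase n) :
    ‖v‖ ≤ (∑ i, ‖actionCoord i v‖) + ‖energyCoord v‖ + (∑ i, ‖angleCoord i v‖) + ‖timeCoord v‖ := by
  have h1 : ‖v.1‖ ≤ ∑ i, ‖actionCoord i v‖ := pi_norm_le_iff_of_nonneg
    (Finset.sum_nonneg fun _ _ => norm_nonneg _) |>.2 fun i =>
      Finset.single_le_sum (f := fun i => ‖actionCoord i v‖) (fun _ _ => norm_nonneg _)
        (Finset.mem_univ i)
  have h2 : ‖v.2.2.1‖ ≤ ∑ i, ‖angleCoord i v‖ := pi_norm_le_iff_of_nonneg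
    (Finset.sum_nonneg fun _ _ => norm_nonneg _) |>.2 fun i =>
      Finset.single_le_sum (f := fun i => ‖angleCoord i v‖) (fun _ _ => norm_nonneg _)
        (Finset.mem_univ i)
  have h3 := norm_nonneg (energyCoord v)
  have h4 := norm_nonneg (timeCoord v)
  have h5 := (norm_nonneg _).trans h1
  have h6 := (norm_nonneg _).trans h2
  simp only [Prod.norm_def]
  simp only [energyCoord_apply, timeCoord_apply] at *
  refine max_le (by linarith) (max_le (by linarith) (max_le (by linarith) (by linarith)))

/-- The complex domain at a level of width. -/
abbrev levelDomain (V : Set (Fin n → ℝ)) (δ σ u : ℝ) : Set (Phase n) :=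
  domain V (actionWidth δ u) (angleWidth σ u)

/-- The reduced complex domain at a level of width. -/
abbrev levelReduced (V : Set (Fin n → ℝ)) (δ σ u : ℝ) : Set (Reduced n) :=
  reducedDomain V (actionWidth δ u) (angleWidth σ u)

/-- One coordinate of the Lie series: `G` is the sequence of its first brackets. -/
theorem coord_estimate (hδ : 0 < δ) (hσ : 0 < σ) {b l T : ℝ} (hl : 0 < l) (hbl : b + l ≤ 1)
    {w : ℝ≥0∞} (hχ : ∀ j, IsFourierAt V δ σ b (χ j)) (hG : ∀ s, IsFourierAt V δ σ b (G s))
    (hG0 : G 0 = 0)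
    (hS : ENNReal.ofReal (2 * bracketConst δ σ / l ^ 2) *
      ∑' j, w ^ j * levelNorm V δ σ b (χ j) ≤ ENNReal.ofReal (5 / 24))
    (hT : ∑' j, w ^ j * levelNorm V δ σ b (G j) ≤ ENNReal.ofReal T) (L : Phase n →L[ℂ] ℂ)
    (hL : ∀ j, ∀ z ∈ levelDomain V δ σ (b + l), L (fields χ (j + 1) z) = G (j + 1) (reduce z)) :
    ∃ N : ℕ → ℝ≥0∞, ∑' s, w ^ s * N s ≤ ENNReal.ofReal (3 / 2 * T) ∧
      ∀ s, ∀ z ∈ levelDomain V δ σ (b + l),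
        ‖L (fieldOperator (fields χ) id (s + 1) z)‖ₑ ≤ N (s + 1) := by
  obtain ⟨c1, c2⟩ := chain_estimate hδ hσ hl hbl w hχ hG hS
  refine ⟨fun s => levelNorm V δ σ (b + l) (chain χ G s), c2.trans ?_, fun s z hz => ?_⟩
  · rw [ENNReal.ofReal_mul (by norm_num)]
    exact mul_le_mul' le_rfl hT
  have hD := isOpen_domain V (actionWidth δ (b + l)) (angleWidth σ (b + l))
  have hD₁ := isOpen_reducedDomain V (actionWidth δ (b + l)) (angleWidth σ (b + l))
  have hmaps : ∀ z ∈ levelDomain V δ σ (b + l), reduce z ∈ levelReduced V δ σ (b + l) :=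
    fun z hz => reduce_mem hz
  have hχ' : ∀ j, DifferentiableOn ℂ (χ j) (levelReduced V δ σ (b + l)) := fun j =>
    ((hχ j).anti hδ hσ (by linarith)).differentiableOn
  have hG' : ∀ j, DifferentiableOn ℂ (G j) (levelReduced V δ σ (b + l)) := fun j =>
    ((hG j).anti hδ hσ (by linarith)).differentiableOn
  rw [clm_fieldOperator hD (differentiableOn_fields hD₁ hmaps hχ') differentiableOn_id L _ z hz,
    fieldOperator_eq_chain hD hD₁ hmaps hχ' hG' (g := fun z => L (id z)) (fun j z hz => ?_) s z hz]
  · exact (c1 (s + 1)).enorm_le (hmaps z hz)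
  · have : fderiv ℂ (fun z => L (id z)) z = L := L.fderiv
    rw [this, hL j z hz, hG0, reducedBracket_zero_right, Pi.zero_apply, add_zero]

/-- Displacements that are small in every coordinate, measured by the widths of the domains. -/
structure IsSmall (δ σ a : ℝ) (v : Phase n) : Prop where
  action : ‖v.1‖ ≤ δ / 4 * a
  energy : ‖v.2.1‖ ≤ δ / 4 * a
  angle : ‖v.2.2.1‖ ≤ 9 / 20 * σ * a
  time : ‖v.2.2.2‖ ≤ 9 / 20 * σ * a

theorem add_mem_levelDomain {u u' : ℝ} {z v : Phase n} (hz : z ∈ levelDomain V δ σ u')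
    (hv : IsSmall δ σ (u' - u) v) : z + v ∈ levelDomain V δ σ u := by
  refine ⟨add_mem_actionNhd hz.1 ?_, add_mem_strip hz.2.1 ?_, fun j => add_mem_strip (hz.2.2.1 j) ?_,
    add_mem_strip hz.2.2.2 ?_⟩
  · rw [actionWidth_sub]; exact hv.action
  · rw [actionWidth_sub]; exact hv.energy
  · rw [angleWidth_sub]; exact (norm_le_pi_norm v.2.2.1 j).trans hv.angle
  · rw [angleWidth_sub]; exact hv.time

theorem levelDomain_anti (hδ : 0 < δ) (hσ : 0 < σ) {u w : ℝ} (h : u ≤ w) :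
    levelDomain V δ σ w ⊆ levelDomain V δ σ u :=
  prod_mono (actionNhd_mono V (actionWidth_anti hδ h)) (prod_mono (strip_mono (actionWidth_anti hδ h))
    (prod_mono (angleStrip_mono (angleWidth_anti hσ h)) (strip_mono (angleWidth_anti hσ h))))

theorem enorm_sub_le_of_hasSum {a : ℕ → ℂ} {x : ℂ} (h : HasSum a x) {w : ℝ≥0∞} {N : ℕ → ℝ≥0∞}
    (hN : ∀ s, ‖a (s + 1)‖ₑ ≤ w ^ (s + 1) * N (s + 1)) : ‖x - a 0‖ₑ ≤ ∑' s, w ^ s * N s := by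
  have h1 : HasSum (fun s => a (s + 1)) (x - a 0) := by
    simpa using (hasSum_nat_add_iff' 1).2 h
  rw [← h1.tsum_eq]
  refine enorm_tsum_le_tsum_enorm.trans ((ENNReal.tsum_le_tsum hN).trans ?_)
  rw [tsum_eq_zero_add' (f := fun s => w ^ s * N s) ENNReal.summable]
  exact le_add_self

/-- The Lie series of the coordinates, with a parameter `t`. -/
def flow (χ : ℕ → Reduced n → ℂ) (q : ℂ × Phase n) : Phase n :=
  ∑' s, q.1 ^ s • fieldOperator (fields χ) id s q.2

/-- Convergence of the Lie series of the coordinates and size of the displacement. Half of the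
available width is used for the first derivative of the generating functions. -/
theorem flow_estimate (hδ : 0 < δ) (hσ : 0 < σ) {b l S : ℝ} (hl : 0 < l) (hbl : b + 2 * l ≤ 1)
    (hS0 : 0 ≤ S) {r : ℕ} (hχ0 : χ 0 = 0) (hχr : ∀ j, r < j → χ j = 0)
    (hχ : ∀ j, IsFourierAt V δ σ b (χ j))
    (hS : ∑' j, ENNReal.ofReal (5 / 4) ^ j * levelNorm V δ σ b (χ j) ≤ ENNReal.ofReal S)
    (hS1 : 2 * bracketConst δ σ / l ^ 2 * S ≤ 5 / 24) :
    IsTransported (fields χ) r (5 / 4) (levelDomain V δ σ (b + 2 * l)) (flow χ) ∧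
    (∀ z, flow χ (0, z) = z) ∧
    ∀ t ∈ ball (0 : ℂ) (5 / 4), ∀ z ∈ levelDomain V δ σ (b + 2 * l),
      HasSum (fun s => t ^ s • fieldOperator (fields χ) id s z) (flow χ (t, z)) ∧
      IsSmall δ σ (3 / 4 * Real.exp 1 * bracketConst δ σ / l * S) (flow χ (t, z) - z) ∧
      (flow χ (t, z)).2.2.2 = z.2.2.2 := by
  set w : ℝ≥0∞ := ENNReal.ofReal (5 / 4)
  set c₁ : ℝ := 1 / (9 / 20 * σ * l)
  set c₂ : ℝ := 1 / (δ / 4 * l)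
  have hu : b + l ≤ 1 := by linarith
  have hτ := angleWidth_pos hσ hu
  have hder := fun j => isFourierAt_fderiv hδ hσ (hχ j) (show b < b + l by linarith) hu
  rw [add_sub_cancel_left] at hder
  have hχ' : ∀ j, IsFourierAt V δ σ (b + l) (χ j) := fun j => (hχ j).anti hδ hσ (by linarith)
  have hSχ : ENNReal.ofReal (2 * bracketConst δ σ / l ^ 2) *
      ∑' j, w ^ j * levelNorm V δ σ (b + l) (χ j) ≤ ENNReal.ofReal (5 / 24) := by
    refine le_trans (mul_le_mul' le_rfl ((ENNReal.tsum_le_tsum fun j => mul_le_mul' le_rfl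
      (levelNorm_anti hδ hσ (by linarith) _)).trans hS)) ?_
    rw [← ENNReal.ofReal_mul (by have := bracketConst_pos hδ hσ; positivity)]
    exact ENNReal.ofReal_le_ofReal hS1
  have hTsum : ∀ {c : ℝ} {F : ℕ → Reduced n → ℂ}, 0 ≤ c →
      (∀ j, levelNorm V δ σ (b + l) (F j) ≤ ENNReal.ofReal c * levelNorm V δ σ b (χ j)) →
      ∑' j, w ^ j * levelNorm V δ σ (b + l) (F j) ≤ ENNReal.ofReal (c * S) := by
    intro c F hc hF
    rw [ENNReal.ofReal_mul hc]
    refine le_trans ?_ (mul_le_mul' le_rfl hS)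
    rw [← ENNReal.tsum_mul_left]
    refine ENNReal.tsum_le_tsum fun j => ?_
    rw [mul_left_comm]
    exact mul_le_mul' le_rfl (hF j)
  have hbl' : b + 2 * l = b + l + l := by ring
  rw [hbl'] at hbl ⊢
  set D := levelDomain V δ σ (b + l + l)
  have hD : IsOpen D := isOpen_domain _ _ _
  have hD₁ := isOpen_reducedDomain V (actionWidth δ (b + l + l)) (angleWidth σ (b + l + l))
  have hmaps : ∀ z ∈ D, reduce z ∈ levelReduced V δ σ (b + l + l) := fun z hz => reduce_mem hz
  have hdχ : ∀ j, DifferentiableOn ℂ (χ j) (levelReduced V δ σ (b + l + l)) := fun j =>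
    ((hχ' j).anti hδ hσ (by linarith)).differentiableOn
  have hfield : ∀ j, ∀ z ∈ D, fields χ j z =
      (fun i => -fderiv ℂ (χ j) (reduce z) (0, Pi.single i 1, 0),
        -fderiv ℂ (χ j) (reduce z) (0, 0, 1),
        fun i => fderiv ℂ (χ j) (reduce z) (Pi.single i 1, 0, 0), 0) := fun j z hz =>
    hamiltonianField_comp_reduce ((hdχ j).differentiableAt (hD₁.mem_nhds (hmaps z hz)))
  have hc₁ : 0 ≤ c₁ := by positivity
  have hc₂ : 0 ≤ c₂ := by positivity
  have hz0 : ∀ v : Reduced n, (fun p => fderiv ℂ (χ 0) p v) = 0 := fun v => by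
    rw [hχ0]; funext p; simp
  have eA := fun i => coord_estimate hδ hσ hl hbl hχ'
    (G := fun j p => -fderiv ℂ (χ j) p (0, Pi.single i 1, 0))
    (fun j => (isFourier_neg hτ ((hder j).2.1 i).1).1)
    (by funext p; simpa using congrFun (hz0 (0, Pi.single i 1, 0)) p) hSχ
    (hTsum hc₁ fun j => (isFourier_neg hτ ((hder j).2.1 i).1).2.trans ((hder j).2.1 i).2)
    (actionCoord i) (fun j z hz => by rw [hfield _ z hz, actionCoord_apply])
  have eE := coord_estimate hδ hσ hl hbl hχ'
    (G := fun j p => -fderiv ℂ (χ j) p (0, 0, 1))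
    (fun j => (isFourier_neg hτ (hder j).2.2.1).1)
    (by funext p; simpa using congrFun (hz0 (0, 0, 1)) p) hSχ
    (hTsum hc₁ fun j => (isFourier_neg hτ (hder j).2.2.1).2.trans (hder j).2.2.2)
    energyCoord (fun j z hz => by rw [hfield _ z hz, energyCoord_apply])
  have eP := fun i => coord_estimate hδ hσ hl hbl hχ'
    (G := fun j p => fderiv ℂ (χ j) p (Pi.single i 1, 0, 0))
    (fun j => ((hder j).1 i).1) (hz0 (Pi.single i 1, 0, 0)) hSχ
    (hTsum hc₂ fun j => ((hder j).1 i).2)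
    (angleCoord i) (fun j z hz => by rw [hfield _ z hz, angleCoord_apply])
  have hz1 := isFourierAt_zero (V := V) (δ := δ) hσ hu
  have eT := coord_estimate hδ hσ hl hbl hχ' (G := 0) (fun j => hz1.1) rfl hSχ (T := 0)
    (by simp only [Pi.zero_apply, hz1.2, mul_zero, tsum_zero]; exact zero_le)
    timeCoord (fun j z hz => by rw [hfield _ z hz, timeCoord_apply]; rfl)
  choose NA hNA hNA' using eA
  obtain ⟨NE, hNE, hNE'⟩ := eE
  choose NP hNP hNP' using eP
  obtain ⟨NT, hNT, hNT'⟩ := eT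
  -- real summable majorants
  have hreal : ∀ {N : ℕ → ℝ≥0∞} {T : ℝ}, ∑' s, w ^ s * N s ≤ ENNReal.ofReal T →
      Summable fun s => (w ^ s * N s).toReal := fun h =>
    ENNReal.summable_toReal (ne_top_of_le_ne_top ENNReal.ofReal_ne_top h)
  have hle : ∀ {N : ℕ → ℝ≥0∞} {T : ℝ}, ∑' s, w ^ s * N s ≤ ENNReal.ofReal T →
      ∀ {x : ℂ} {s : ℕ}, ‖x‖ₑ ≤ N s → (5 / 4 : ℝ) ^ s * ‖x‖ ≤ (w ^ s * N s).toReal := by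
    intro N T hN x s hx
    have h1 : w ^ s * N s ≠ ⊤ := ENNReal.ne_top_of_tsum_ne_top
      (ne_top_of_le_ne_top ENNReal.ofReal_ne_top hN) s
    have h2 := ENNReal.toReal_mono h1 (mul_le_mul' (le_refl (w ^ s)) hx)
    rwa [ENNReal.toReal_mul, ENNReal.toReal_pow, ENNReal.toReal_ofReal (by norm_num),
      toReal_enorm] at h2
  set m : ℕ → ℝ := fun s => (∑ i, (w ^ s * NA i s).toReal) + (w ^ s * NE s).toReal +
    (∑ i, (w ^ s * NP i s).toReal) + (w ^ s * NT s).toReal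
  have hm : Summable m := (((summable_sum fun i _ => hreal (hNA i)).add (hreal hNE)).add
    (summable_sum fun i _ => hreal (hNP i))).add (hreal hNT)
  have hbound : ∀ s, ∀ z ∈ D,
      (5 / 4 : ℝ) ^ (s + 1) * ‖fieldOperator (fields χ) id (s + 1) z‖ ≤ m (s + 1) := by
    intro s z hz
    refine (mul_le_mul_of_nonneg_left (norm_phase_le _) (by positivity)).trans ?_
    simp only [mul_add, Finset.mul_sum, m]
    refine add_le_add (add_le_add (add_le_add (Finset.sum_le_sum fun i _ => ?_) ?_)
      (Finset.sum_le_sum fun i _ => ?_)) ?_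
    · exact hle (hNA i) (hNA' i s z hz)
    · exact hle hNE (hNE' s z hz)
    · exact hle (hNP i) (hNP' i s z hz)
    · exact hle hNT (hNT' s z hz)
  have hsum : ∀ t ∈ ball (0 : ℂ) (5 / 4), ∀ z ∈ D,
      HasSum (fun s => t ^ s • fieldOperator (fields χ) id s z) (flow χ (t, z)) := by
    intro t ht z hz
    refine Summable.hasSum ?_
    rw [← summable_nat_add_iff 1]
    refine Summable.of_norm_bounded ((summable_nat_add_iff 1).2 hm) fun s => ?_
    refine le_trans ?_ (hbound s z hz)
    rw [norm_smul, norm_pow]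
    have := mem_ball_zero_iff.1 ht
    gcongr
  have hX := differentiableOn_fields hD₁ hmaps hdχ
  have hd := differentiableOn_fieldOperator hD hX (differentiableOn_id (𝕜 := ℂ) (E := Phase n))
  refine ⟨IsTransported.of_inter_ball (fun R => ?_) hD, fun z => ?_, fun t ht z hz =>
    ⟨hsum t ht z hz, ?_, ?_⟩⟩
  · refine isTransported_of_hasSum (g := id) (m := fun s => m s + if s = 0 then R else 0)
      (hD.inter isOpen_ball)
      (fun j hj z _ => by rw [fields_of_eq_zero (hχr j hj)]; rfl)
      (fun s => (hd s).mono inter_subset_left) (hm.add ?_) (fun s z hz => ?_)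
      (fun t ht z hz => hsum t ht z hz.1)
    · exact summable_of_ne_finset_zero (s := {0}) fun s hs => if_neg (by simpa using hs)
    · cases s with
      | zero =>
        rw [fieldOperator_zero, if_pos rfl, pow_zero, one_mul]
        have h1 := mem_ball_zero_iff.1 hz.2
        have h2 : 0 ≤ m 0 := by
          simp only [m]
          positivity
        simp only [id]
        linarith
      | succ s =>
        rw [if_neg (by omega), add_zero]
        exact hbound s z hz.1
  · rw [flow, tsum_eq_single 0 fun s hs => by simp [hs], pow_zero, one_smul, fieldOperator_zero]
    rfl
  · have hw : ‖t‖ₑ ≤ w := by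
      rw [← ofReal_norm]
      exact ENNReal.ofReal_le_ofReal (mem_ball_zero_iff.1 ht).le
    have hcoord : ∀ (L : Phase n →L[ℂ] ℂ) {N : ℕ → ℝ≥0∞} {c T : ℝ}, 0 ≤ T →
        ∑' s, w ^ s * N s ≤ ENNReal.ofReal T → T ≤ c →
        (∀ s, ‖L (fieldOperator (fields χ) id (s + 1) z)‖ₑ ≤ N (s + 1)) →
        ‖L (flow χ (t, z) - z)‖ ≤ c := by
      intro L N c T hT0 hN hT hL
      have h1 := L.hasSum (hsum t ht z hz)
      have h2 := (enorm_sub_le_of_hasSum h1 (w := w) (N := N) fun s => by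
        rw [map_smul, smul_eq_mul, enorm_mul, enorm_pow]
        exact mul_le_mul' (pow_le_pow_left' hw _) (hL s)).trans hN
      rw [pow_zero, one_smul, fieldOperator_zero, id, ← map_sub, ← ofReal_norm,
        ENNReal.ofReal_le_ofReal_iff hT0] at h2
      exact h2.trans hT
    have hB := bracketConst_pos hδ hσ
    have hnum1 : 3 / 2 * (c₁ * S) ≤ δ / 4 * (3 / 4 * Real.exp 1 * bracketConst δ σ / l * S) :=
      le_of_eq (by simp only [c₁, bracketConst]; field_simp; ring)
    have hnum2 : 3 / 2 * (c₂ * S) ≤ 9 / 20 * σ * (3 / 4 * Real.exp 1 * bracketConst δ σ / l * S) :=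
      le_of_eq (by simp only [c₂, bracketConst]; field_simp; ring)
    have hpos1 : 0 ≤ δ / 4 * (3 / 4 * Real.exp 1 * bracketConst δ σ / l * S) := by positivity
    have hpos2 : 0 ≤ 9 / 20 * σ * (3 / 4 * Real.exp 1 * bracketConst δ σ / l * S) := by positivity
    refine ⟨(pi_norm_le_iff_of_nonneg hpos1).2 fun i => ?_, ?_,
      (pi_norm_le_iff_of_nonneg hpos2).2 fun i => ?_, ?_⟩
    · exact hcoord (actionCoord i) (by positivity) (hNA i) hnum1 fun s => hNA' i s z hz
    · exact hcoord energyCoord (by positivity) hNE hnum1 fun s => hNE' s z hz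
    · exact hcoord (angleCoord i) (by positivity) (hNP i) hnum2 fun s => hNP' i s z hz
    · exact hcoord timeCoord (by positivity) hNT (by simpa using hpos2) fun s => hNT' s z hz
  · have h1 := (timeCoord (n := n)).hasSum (hsum t ht z hz)
    have h2 : ∀ s, s ≠ 0 → timeCoord (t ^ s • fieldOperator (fields χ) id s z) = 0 := by
      intro s hs
      obtain ⟨s, rfl⟩ := Nat.exists_eq_succ_of_ne_zero hs
      have h3 : ‖timeCoord (fieldOperator (fields χ) id (s + 1) z)‖ₑ = 0 := by
        refine le_antisymm ((hNT' s z hz).trans ?_) zero_le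
        rw [mul_zero, ENNReal.ofReal_zero] at hNT
        have h4 := (ENNReal.tsum_eq_zero.1 (le_antisymm hNT zero_le)) (s + 1)
        rcases mul_eq_zero.1 h4 with h5 | h5
        · exact absurd h5 (pow_ne_zero _ (ENNReal.ofReal_pos.2 (by norm_num)).ne')
        · exact h5.le
      rw [map_smul, enorm_eq_zero.1 h3, smul_zero]
    have h5 := (h1.unique (hasSum_single 0 h2))
    rw [pow_zero, one_smul, fieldOperator_zero] at h5
    exact h5

end Flow

/-! ### Inverses of maps close to the identity -/

section Inverse

open Metric Set Filter Topology

variable {E : Type} [NormedAddCommGroup E] [NormedSpace ℂ E]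

theorem lipschitz_displacement {Ω : Set E} {a U : ℝ} (ha : 0 < a) (hUa : U ≤ a) {C : E → E}
    (hC : DifferentiableOn ℂ C Ω) (hΩ : IsOpen Ω) (hCU : ∀ z ∈ Ω, ‖C z - z‖ ≤ U) {w : E}
    (hw : ∀ v, ‖v‖ < 3 * a → w + v ∈ Ω) :
    (∀ y ∈ closedBall w a, ‖fderiv ℂ (fun y => y - C y) y‖ ≤ 1 / 2) ∧
    ∀ y ∈ closedBall w a, ∀ y' ∈ closedBall w a,
      ‖(y' - C y') - (y - C y)‖ ≤ 1 / 2 * ‖y' - y‖ := by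
  have hsub : ∀ y ∈ closedBall w a, ball y (2 * a) ⊆ Ω := by
    intro y hy x hx
    have h1 : ‖y - w‖ ≤ a := mem_closedBall_iff_norm.1 hy
    have h2 : ‖x - y‖ < 2 * a := mem_ball_iff_norm.1 hx
    have h3 : ‖x - w‖ < 3 * a := by
      calc ‖x - w‖ = ‖(x - y) + (y - w)‖ := by congr 1; abel
        _ ≤ ‖x - y‖ + ‖y - w‖ := norm_add_le _ _
        _ < _ := by linarith
    simpa using hw _ h3
  have hd : DifferentiableOn ℂ (fun y => y - C y) Ω := differentiableOn_id.sub hC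
  have hder : ∀ y ∈ closedBall w a, ‖fderiv ℂ (fun y => y - C y) y‖ ≤ 1 / 2 := by
    intro y hy
    refine (norm_fderiv_le_of_ball (M := U) (by linarith : (0 : ℝ) < 2 * a) (hd.mono (hsub y hy))
      fun x hx => ?_).trans ?_
    · rw [norm_sub_rev]
      exact hCU x (hsub y hy hx)
    · rw [div_le_iff₀ (by linarith)]
      linarith
  refine ⟨hder, fun y hy y' hy' => ?_⟩
  exact (convex_closedBall w a).norm_image_sub_le_of_norm_fderiv_le (𝕜 := ℂ)
    (fun x hx => hd.differentiableAt (hΩ.mem_nhds (hsub x hx (mem_ball_self (by linarith)))))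
    hder hy hy'

variable [FiniteDimensional ℂ E]

/-- Solution of `C y = w` by iteration of `y ↦ w + (y - C y)`, inside a closed set that the
iteration preserves. -/
theorem exists_preimage {Ω : Set E} {a U : ℝ} (ha : 0 < a) (hUa : U ≤ a) {C : E → E}
    (hC : DifferentiableOn ℂ C Ω) (hΩ : IsOpen Ω) (hCU : ∀ z ∈ Ω, ‖C z - z‖ ≤ U) {w : E}
    (hw : ∀ v, ‖v‖ < 3 * a → w + v ∈ Ω) {P : Set E} (hP : IsClosed P)
    (hPC : ∀ y ∈ P, y ∈ Ω → w + (y - C y) ∈ P) (hwP : w ∈ P) :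
    ∃ y ∈ P, ‖y - w‖ ≤ U ∧ C y = w := by
  have : CompleteSpace E := FiniteDimensional.complete ℂ E
  have hmem : ∀ y ∈ closedBall w a, y ∈ Ω := by
    intro y hy
    have h1 := hw (y - w) (by have := mem_closedBall_iff_norm.1 hy; linarith)
    simpa using h1
  have hU : ∀ y ∈ closedBall w a, ‖y - C y‖ ≤ U := fun y hy => by
    rw [norm_sub_rev]; exact hCU y (hmem y hy)
  set S : Set E := closedBall w a ∩ P
  have hmaps : MapsTo (fun y => w + (y - C y)) S S := by
    intro y hy
    refine ⟨?_, hPC y hy.2 (hmem y hy.1)⟩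
    rw [mem_closedBall_iff_norm, add_sub_cancel_left]
    exact (hU y hy.1).trans hUa
  have hlip := (lipschitz_displacement ha hUa hC hΩ hCU hw).2
  have hcontr : ContractingWith (1 / 2) (hmaps.restrict _ S S) := by
    refine ⟨by rw [← NNReal.coe_lt_coe]; norm_num, LipschitzWith.of_dist_le_mul fun x y => ?_⟩
    rw [Subtype.dist_eq, Subtype.dist_eq, dist_eq_norm, dist_eq_norm]
    have := hlip y y.2.1 x x.2.1
    simp only [MapsTo.val_restrict_apply, add_sub_add_left_eq_sub]
    simpa using this
  obtain ⟨y, hyS, hy, -⟩ := hcontr.exists_fixedPoint' (isClosed_closedBall.inter hP).isComplete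
    hmaps (x := w) ⟨mem_closedBall_self ha.le, hwP⟩ (edist_ne_top _ _)
  have hy' : w + (y - C y) = y := hy
  have hCy : C y = w := by
    have h1 : w - C y = 0 := by
      have h2 : w + (y - C y) - y = w - C y := by abel
      rw [← h2, hy', sub_self]
    exact (sub_eq_zero.1 h1).symm
  refine ⟨y, hyS.2, ?_, hCy⟩
  have h1 := hU y hyS.1
  rwa [hCy] at h1

/-- A holomorphic map `C` displacing points by at most `U < a` has an analytic inverse on a set `D`
whose `4a`-neighbourhood lies in the domain `Ω` of `C`: by the Cauchy estimate `y ↦ w + (y - C y)` has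
a fixed point close to `w`. A closed set preserved by the iteration is preserved by the inverse. -/
theorem exists_analytic_inverse {D Ω : Set E} {a U : ℝ} (ha : 0 < a) (hUa : U < a)
    (hΩ : IsOpen Ω) (hD : ∀ z ∈ D, ∀ v, ‖v‖ < 4 * a → z + v ∈ Ω) {C : E → E}
    (hC : DifferentiableOn ℂ C Ω) (hCU : ∀ z ∈ Ω, ‖C z - z‖ ≤ U) :
    ∃ C' : E → E, (∀ z ∈ D, C (C' z) = z ∧ ‖C' z - z‖ ≤ U ∧ AnalyticAt ℂ C' z) ∧
      (∀ z ∈ D, C' (C z) = z) ∧ (∀ z ∈ D, ∀ y, ‖y - z‖ ≤ a → C y = z → y = C' z) ∧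
      ∀ P : Set E, IsClosed P → (∀ w ∈ P, ∀ y ∈ P, y ∈ Ω → w + (y - C y) ∈ P) →
        ∀ z ∈ D, z ∈ P → C' z ∈ P := by
  have : CompleteSpace E := FiniteDimensional.complete ℂ E
  have hw3 : ∀ z ∈ D, ∀ w, ‖w - z‖ ≤ a → ∀ v, ‖v‖ < 3 * a → w + v ∈ Ω := by
    intro z hz w hw v hv
    have h1 : ‖(w - z) + v‖ < 4 * a := (norm_add_le _ _).trans_lt (by linarith)
    have h2 : z + (w - z + v) = w + v := by abel
    rw [← h2]
    exact hD z hz _ h1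
  have hex : ∀ w : E, ∃ y : E, (∃ z ∈ D, ‖w - z‖ ≤ a) → ‖y - w‖ ≤ U ∧ C y = w := by
    intro w
    by_cases hw : ∃ z ∈ D, ‖w - z‖ ≤ a
    · obtain ⟨z, hz, hwz⟩ := hw
      obtain ⟨y, -, hy⟩ := exists_preimage ha hUa.le hC hΩ hCU (hw3 z hz w hwz) isClosed_univ
        (fun _ _ _ => mem_univ _) (mem_univ w)
      exact ⟨y, fun _ => hy⟩
    · exact ⟨w, fun h => absurd h hw⟩
  choose C' hC' using hex
  have huniq : ∀ w : E, (∃ z ∈ D, ‖w - z‖ ≤ a) → ∀ y, ‖y - w‖ ≤ a → C y = w → y = C' w := by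
    rintro w ⟨z, hz, hwz⟩ y hy hCy
    obtain ⟨h1, h2⟩ := hC' w ⟨z, hz, hwz⟩
    have h3 := (lipschitz_displacement ha hUa.le hC hΩ hCU (hw3 z hz w hwz)).2 (C' w)
      (mem_closedBall_iff_norm.2 (h1.trans hUa.le)) y (mem_closedBall_iff_norm.2 hy)
    rw [hCy, h2, sub_sub_sub_cancel_right] at h3
    have h4 : ‖y - C' w‖ = 0 := le_antisymm (by linarith [norm_nonneg (y - C' w)]) (norm_nonneg _)
    exact sub_eq_zero.1 (norm_eq_zero.1 h4)
  have hself : ∀ z ∈ D, ∃ z' ∈ D, ‖z - z'‖ ≤ a := fun z hz => ⟨z, hz, by simpa using ha.le⟩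
  have hDΩ : ∀ z ∈ D, z ∈ Ω := fun z hz => by
    simpa using hD z hz 0 (by rw [norm_zero]; linarith)
  refine ⟨C', fun z hz => ⟨(hC' z (hself z hz)).2, (hC' z (hself z hz)).1, ?_⟩, fun z hz => ?_,
    fun z hz => huniq z (hself z hz), fun P hP hPC z hz hzP => ?_⟩
  · obtain ⟨h1, h2⟩ := hC' z (hself z hz)
    have hz3 := hw3 z hz z (by simpa using ha.le)
    have hyb : C' z ∈ closedBall z a := mem_closedBall_iff_norm.2 (h1.trans hUa.le)
    have hyΩ : C' z ∈ Ω := by simpa using hz3 (C' z - z) (by linarith)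
    have hder := (lipschitz_displacement ha hUa.le hC hΩ hCU hz3).1 (C' z) hyb
    have hCd := hC.differentiableAt (hΩ.mem_nhds hyΩ)
    have hfd : fderiv ℂ (fun y => y - C y) (C' z) = 1 - fderiv ℂ C (C' z) := by
      rw [fderiv_fun_sub differentiableAt_fun_id hCd, fderiv_fun_id]
      rfl
    rw [hfd] at hder
    -- the derivative is invertible by the Neumann series
    let u : (E →L[ℂ] E)ˣ := Units.oneSub (1 - fderiv ℂ C (C' z)) (by linarith)
    let i : E ≃L[ℂ] E := ContinuousLinearEquiv.ofUnit u
    have hi : fderiv ℂ C (C' z) = (i : E →L[ℂ] E) := by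
      ext v
      change _ = (1 - (1 - fderiv ℂ C (C' z))) v
      rw [sub_sub_cancel]
    have hana : AnalyticAt ℂ C (C' z) := analyticOnNhd_of_differentiableOn hΩ hC _ hyΩ
    have hstr : HasStrictFDerivAt C (i : E →L[ℂ] E) (C' z) := hi ▸ hana.hasStrictFDerivAt
    have hg := (hstr.toOpenPartialHomeomorph C).analyticAt_symm'
      hstr.mem_toOpenPartialHomeomorph_source hana hi
    set g := (hstr.toOpenPartialHomeomorph C).symm
    have hgz : g (C (C' z)) = C' z :=
      (hstr.toOpenPartialHomeomorph C).left_inv hstr.mem_toOpenPartialHomeomorph_source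
    change AnalyticAt ℂ g (C (C' z)) at hg
    rw [h2] at hg hgz
    refine hg.congr ?_
    have e1 : ∀ᶠ w in 𝓝 z, C (g w) = w := by
      have := hstr.eventually_right_inverse
      rwa [h2] at this
    have e2 : ∀ᶠ w in 𝓝 z, ‖g w - w‖ < a := by
      have hcont : ContinuousAt (fun w => ‖g w - w‖) z :=
        (hg.continuousAt.sub continuousAt_id).norm
      refine hcont.eventually_lt continuousAt_const ?_
      change ‖g z - z‖ < a
      rw [hgz]
      exact h1.trans_lt hUa
    filter_upwards [e1, e2, closedBall_mem_nhds z ha] with w hw1 hw2 hw3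
    exact huniq w ⟨z, hz, mem_closedBall_iff_norm.1 hw3⟩ (g w) hw2.le hw1
  · have h1 := (hCU z (hDΩ z hz)).trans hUa.le
    exact (huniq (C z) ⟨z, hz, h1⟩ z (by rwa [norm_sub_rev]) rfl).symm
  · obtain ⟨y, hyP, hy, hCy⟩ := exists_preimage ha hUa.le hC hΩ hCU
      (hw3 z hz z (by simpa using ha.le)) hP (hPC z hzP) hzP
    rwa [← huniq z (hself z hz) y (hy.trans hUa.le) hCy]

end Inverse

/-! ### Symplecticity and periodicity of the flow -/

section Symplectic

open Metric Set Filter Topology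

/-- The symplectic form as a continuous bilinear map. -/
def symplecticCLM (n : ℕ) : Phase n →L[ℂ] Phase n →L[ℂ] ℂ :=
  LinearMap.toContinuousLinearMap ((LinearMap.toContinuousLinearMap (𝕜 := ℂ) (E := Phase n)
    (F' := ℂ)).toLinearMap ∘ₗ LinearMap.mk₂ ℂ symplecticForm
      (fun u u' v => by
        simp only [symplecticForm, Prod.fst_add, Prod.snd_add, Pi.add_apply, add_mul,
          Finset.sum_add_distrib, Finset.sum_sub_distrib]
        ring)
      (fun c u v => by
        simp only [symplecticForm, Prod.smul_fst, Prod.smul_snd, Pi.smul_apply, smul_eq_mul, mul_add,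
          Finset.mul_sum]
        congr 1
        · exact Finset.sum_congr rfl fun i _ => by ring
        · ring)
      (fun u v v' => by
        simp only [symplecticForm, Prod.fst_add, Prod.snd_add, Pi.add_apply, mul_add,
          Finset.sum_add_distrib, Finset.sum_sub_distrib]
        ring)
      (fun c u v => by
        simp only [symplecticForm, Prod.smul_fst, Prod.smul_snd, Pi.smul_apply, smul_eq_mul, mul_add,
          Finset.mul_sum]
        congr 1
        · exact Finset.sum_congr rfl fun i _ => by ring
        · ring))

theorem symplecticForm_swap (u v : Phase n) : symplecticForm u v = -symplecticForm v u := by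
  simp only [symplecticForm, neg_add, ← Finset.sum_neg_distrib]
  congr 1
  · exact Finset.sum_congr rfl fun i _ => by ring
  · ring

theorem phase_eq_sum (v : Phase n) : v =
    (∑ i, v.1 i • ((Pi.single i 1, 0, 0, 0) : Phase n)) + v.2.1 • ((0, 1, 0, 0) : Phase n) +
      (∑ i, v.2.2.1 i • ((0, 0, Pi.single i 1, 0) : Phase n)) +
      v.2.2.2 • ((0, 0, 0, 1) : Phase n) := by
  have h1 : ∀ x : Fin n → ℂ, ∑ i, x i • (Pi.single i 1 : Fin n → ℂ) = x := fun x => by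
    funext j
    simp [Finset.sum_apply, Pi.single_apply]
  refine Prod.ext ?_ (Prod.ext ?_ (Prod.ext ?_ ?_))
  · simp [Prod.fst_sum, h1]
  · simp [Prod.fst_sum, Prod.snd_sum]
  · simp [Prod.fst_sum, Prod.snd_sum, h1]
  · simp [Prod.snd_sum]

/-- The Hamiltonian field represents the differential. -/
theorem symplecticForm_hamiltonianField (g : Phase n → ℂ) (z v : Phase n) :
    symplecticForm (hamiltonianField g z) v = -fderiv ℂ g z v := by
  conv_rhs => rw [phase_eq_sum v]
  simp only [map_add, map_sum, map_smul, smul_eq_mul, symplecticForm, hamiltonianField]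
  rw [Finset.sum_sub_distrib]
  simp only [neg_mul, Finset.sum_neg_distrib]
  have h1 : ∀ (a b : Fin n → ℂ), ∑ i, a i * b i = ∑ i, b i * a i := fun a b =>
    Finset.sum_congr rfl fun i _ => mul_comm _ _
  rw [h1 _ v.2.2.1, h1 _ v.1]
  ring

theorem symplecticForm_fderiv_hamiltonianField {D : Set (Phase n)} (hD : IsOpen D)
    {g : Phase n → ℂ} (hg : DifferentiableOn ℂ g D) {z : Phase n} (hz : z ∈ D)
    (hX : DifferentiableAt ℂ (hamiltonianField g) z) (u w : Phase n) :
    symplecticForm (fderiv ℂ (hamiltonianField g) z u) w +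
      symplecticForm u (fderiv ℂ (hamiltonianField g) z w) = 0 := by
  have h1 : ∀ u w : Phase n, symplecticForm (fderiv ℂ (hamiltonianField g) z u) w =
      -fderiv ℂ (fderiv ℂ g) z u w := by
    intro u w
    have e1 : (fun z => ((symplecticCLM n).flip w) (hamiltonianField g z)) =
        fun z => -(ContinuousLinearMap.apply ℂ ℂ w) (fderiv ℂ g z) := by
      funext z
      exact symplecticForm_hamiltonianField g z w
    have e2 := (((symplecticCLM n).flip w).hasFDerivAt.comp z hX.hasFDerivAt).fderiv
    have hgd := (differentiableOn_fderiv hD hg).differentiableAt (hD.mem_nhds hz)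
    have e3 := ((ContinuousLinearMap.apply ℂ ℂ w).hasFDerivAt.comp z hgd.hasFDerivAt).neg.fderiv
    have e4 : fderiv ℂ (fun z => ((symplecticCLM n).flip w) (hamiltonianField g z)) z u =
        fderiv ℂ (fun z => -(ContinuousLinearMap.apply ℂ ℂ w) (fderiv ℂ g z)) z u := by rw [e1]
    exact (congrArg (fun A : Phase n →L[ℂ] ℂ => A u) e2).symm.trans
      (e4.trans (congrArg (fun A : Phase n →L[ℂ] ℂ => A u) e3))
  rw [symplecticForm_swap u, h1, h1,
    (isSymmSndFDerivAt_of_differentiableOn hD hg hz).eq u w]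
  ring

theorem flow_symplectic {V : Set (Fin n → ℝ)} {ρ τ : ℝ} {χ : ℕ → Reduced n → ℂ} {r : ℕ}
    (hχr : ∀ j, r < j → χ j = 0) (hχ : ∀ j, DifferentiableOn ℂ (χ j) (reducedDomain V ρ τ))
    {v : ℂ × Phase n → Phase n} (hv : IsTransported (fields χ) r (5 / 4) (domain V ρ τ) v)
    (hv0 : ∀ z, v (0, z) = z) {t : ℂ} (ht : t ∈ ball (0 : ℂ) (5 / 4)) {z : Phase n}
    (hz : z ∈ domain V ρ τ) (u w : Phase n) :
    symplecticForm (fderiv ℂ (fun z => v (t, z)) z u) (fderiv ℂ (fun z => v (t, z)) z w) =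
      symplecticForm u w := by
  have hD := isOpen_domain V ρ τ
  have hD₁ := isOpen_reducedDomain V ρ τ
  have hX := differentiableOn_fields hD₁ (D := domain V ρ τ) (fun z hz => reduce_mem hz) hχ
  have h1 := fderiv_slice (hv.differentiableOn.differentiableAt
    ((isOpen_ball.prod hD).mem_nhds ⟨ht, hz⟩))
  rw [h1.fderiv]
  exact hv.preserves_bilinear hD hX (fun j hj => fields_of_eq_zero (hχr j hj)) (fun z _ => hv0 z)
    (symplecticCLM n) (fun j z hz u w => symplecticForm_fderiv_hamiltonianField hD
      ((hχ j).comp (reduceCLM n).differentiable.differentiableOn fun z hz => reduce_mem hz) hz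
      ((hX j).differentiableAt (hD.mem_nhds hz)) u w) ht hz u w

theorem fieldOperator_add_right {E W : Type} [NormedAddCommGroup E] [NormedSpace ℂ E]
    [NormedAddCommGroup W] [NormedSpace ℂ W] {X : ℕ → E → E} {a : E}
    (hX : ∀ j z, X j (z + a) = X j z) (g : E → W) (s : ℕ) (z : E) :
    fieldOperator X g s (z + a) = fieldOperator X (fun z => g (z + a)) s z := by
  induction s using Nat.strong_induction_on generalizing z with
  | _ s ih =>
  cases s with
  | zero => rw [fieldOperator_zero, fieldOperator_zero]
  | succ s =>
    refine smul_right_injective W (show ((s : ℂ) + 1) ≠ 0 from Nat.cast_add_one_ne_zero s) ?_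
    simp only
    rw [succ_smul_fieldOperator, succ_smul_fieldOperator]
    refine Finset.sum_congr rfl fun i _ => ?_
    rw [hX, ← fderiv_comp_add_right]
    simp only [ih (s - i) (by omega)]

theorem fieldOperator_add_const {E W : Type} [NormedAddCommGroup E] [NormedSpace ℂ E]
    [NormedAddCommGroup W] [NormedSpace ℂ W] {X : ℕ → E → E} (g : E → W) (a : W) (s : ℕ) (z : E) :
    fieldOperator X (fun z => g z + a) s z = fieldOperator X g s z + if s = 0 then a else 0 := by
  induction s using Nat.strong_induction_on generalizing z with
  | _ s ih =>
  cases s with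
  | zero => rw [fieldOperator_zero, fieldOperator_zero, if_pos rfl]
  | succ s =>
    rw [if_neg (by omega), add_zero]
    refine smul_right_injective W (show ((s : ℂ) + 1) ≠ 0 from Nat.cast_add_one_ne_zero s) ?_
    simp only
    rw [succ_smul_fieldOperator, succ_smul_fieldOperator]
    refine Finset.sum_congr rfl fun i _ => ?_
    have h1 : fieldOperator X (fun z => g z + a) (s - i) =
        fun z => fieldOperator X g (s - i) z + if s - i = 0 then a else 0 :=
      funext fun z => ih (s - i) (by omega) z
    rw [h1, fderiv_add_const]

/-- Functions of `(I, φ, ξ)` that are periodic in the angles. -/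
def IsAnglePeriodic (F : Reduced n → ℂ) : Prop :=
  ∀ (k : Fin n → ℤ) (p : Reduced n), F (p + reduce (angleShift k)) = F p

theorem isAnglePeriodic_fourierSum (c : (Fin n → ℤ) → (Fin n → ℂ) × ℂ → ℂ) :
    IsAnglePeriodic (fourierSum c) := by
  intro k p
  simp only [fourierSum]
  refine tsum_congr fun l => ?_
  have h1 : (p + reduce (angleShift k)).1 = p.1 := by simp [reduce, angleShift]
  have h2 : (p + reduce (angleShift k)).2.2 = p.2.2 := by simp [reduce, angleShift]
  have h3 : (p + reduce (angleShift k)).2.1 = fun j => p.2.1 j + 2 * Real.pi * k j := rfl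
  rw [h1, h2, h3, character_add_two_pi]

theorem flow_add_angleShift {χ : ℕ → Reduced n → ℂ} (hχ : ∀ j, IsAnglePeriodic (χ j)) {t : ℂ}
    {z : Phase n} (hs : Summable fun s => t ^ s • fieldOperator (fields χ) id s z)
    (k : Fin n → ℤ) : flow χ (t, z + angleShift k) = flow χ (t, z) + angleShift k := by
  have hX : ∀ j z, fields χ j (z + angleShift k) = fields χ j z := by
    intro j z
    have h1 : (fun w => χ j (reduce w)) = fun w : Phase n => χ j (reduce (w + angleShift k)) := by
      funext w
      exact (hχ j k (reduce w)).symm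
    have h2 : ∀ v, fderiv ℂ (fun w => χ j (reduce w)) (z + angleShift k) v =
        fderiv ℂ (fun w => χ j (reduce w)) z v := by
      intro v
      rw [← fderiv_comp_add_right (f := fun w => χ j (reduce w)), ← h1]
    simp only [fields, hamiltonianField, h2]
  have h3 : ∀ s, t ^ s • fieldOperator (fields χ) id s (z + angleShift k) =
      t ^ s • fieldOperator (fields χ) id s z + if s = 0 then angleShift k else 0 := by
    intro s
    rw [fieldOperator_add_right hX]
    have := fieldOperator_add_const (X := fields χ) id (angleShift k) s z
    simp only [id] at this ⊢
    rw [this, smul_add]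
    congr 1
    split_ifs with h
    · rw [h, pow_zero, one_smul]
    · rw [smul_zero]
  simp only [flow, h3]
  exact (hs.hasSum.add (hasSum_ite_eq 0 (angleShift k))).tsum_eq

end Symplectic

/-! ### Reality -/

section Reality

open Metric Set Filter Topology
open scoped ComplexConjugate

/-- A closed real-linear subspace of a complex space. -/
structure IsRealForm {E : Type} [NormedAddCommGroup E] [NormedSpace ℂ E] (P : Set E) : Prop where
  isClosed : IsClosed P
  zero_mem : (0 : E) ∈ P
  add_mem : ∀ x ∈ P, ∀ y ∈ P, x + y ∈ P
  smul_mem : ∀ (t : ℝ), ∀ x ∈ P, (t : ℂ) • x ∈ P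

namespace IsRealForm

variable {E W : Type} [NormedAddCommGroup E] [NormedSpace ℂ E] [NormedAddCommGroup W]
  [NormedSpace ℂ W] {P : Set E} {Q : Set W}

theorem sub_mem (hP : IsRealForm P) {x y : E} (hx : x ∈ P) (hy : y ∈ P) : x - y ∈ P := by
  have := hP.add_mem x hx _ (hP.smul_mem (-1) y hy)
  simpa [sub_eq_add_neg] using this

theorem sum_mem (hP : IsRealForm P) {ι : Type} (s : Finset ι) {f : ι → E} (hf : ∀ i ∈ s, f i ∈ P) :
    ∑ i ∈ s, f i ∈ P := by
  induction s using Finset.cons_induction with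
  | empty => exact hP.zero_mem
  | cons a s ha ih =>
    rw [Finset.sum_cons]
    exact hP.add_mem _ (hf a (Finset.mem_cons_self a s)) _
      (ih fun i hi => hf i (Finset.mem_cons_of_mem hi))

/-- Derivatives in real directions of a map with real values at real points. -/
theorem fderiv_mem (hP : IsRealForm P) (hQ : IsRealForm Q) {D : Set E} (hD : IsOpen D) {g : E → W}
    (hg : ∀ z ∈ D, z ∈ P → g z ∈ Q) {z v : E} (hz : z ∈ D) (hzP : z ∈ P) (hv : v ∈ P) :
    fderiv ℂ g z v ∈ Q := by
  by_cases hd : DifferentiableAt ℂ g z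
  · have h1 : HasDerivAt (fun t : ℂ => g (z + t • v)) (fderiv ℂ g z v) 0 :=
      hd.hasFDerivAt.hasLineDerivAt v
    rw [hasDerivAt_iff_tendsto_slope_zero] at h1
    have h2 : Tendsto (fun x : ℝ => (x : ℂ)) (𝓝[≠] 0) (𝓝[≠] 0) := by
      refine tendsto_nhdsWithin_of_tendsto_nhds_of_eventually_within _ ?_ ?_
      · exact (Complex.continuous_ofReal.tendsto' 0 0 Complex.ofReal_zero).mono_left
          nhdsWithin_le_nhds
      · filter_upwards [self_mem_nhdsWithin] with x hx
        simpa using hx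
    refine hQ.isClosed.mem_of_tendsto (h1.comp h2) ?_
    have h3 : Continuous fun x : ℝ => z + (x : ℂ) • v := by fun_prop
    have h4 : ∀ᶠ x : ℝ in 𝓝 0, z + (x : ℂ) • v ∈ D :=
      h3.continuousAt.eventually_mem (hD.mem_nhds (by simpa using hz))
    filter_upwards [nhdsWithin_le_nhds h4] with x hx
    simp only [Function.comp_apply, zero_add, zero_smul, add_zero]
    rw [← Complex.ofReal_inv]
    exact hQ.smul_mem _ _ (hQ.sub_mem (hg _ hx (hP.add_mem _ hzP _ (hP.smul_mem x v hv)))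
      (hg z hz hzP))
  · rw [fderiv_zero_of_not_differentiableAt hd]
    exact hQ.zero_mem

theorem fieldOperator_mem (hP : IsRealForm P) (hQ : IsRealForm Q) {D : Set E} (hD : IsOpen D)
    {X : ℕ → E → E} (hX : ∀ j, ∀ z ∈ D, z ∈ P → X j z ∈ P) {g : E → W}
    (hg : ∀ z ∈ D, z ∈ P → g z ∈ Q) (s : ℕ) :
    ∀ z ∈ D, z ∈ P → fieldOperator X g s z ∈ Q := by
  induction s using Nat.strong_induction_on with
  | _ s ih =>
  intro z hz hzP
  cases s with
  | zero => rw [fieldOperator_zero]; exact hg z hz hzP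
  | succ s =>
    have h1 : fieldOperator X g (s + 1) z = ((((s : ℝ) + 1)⁻¹ : ℝ) : ℂ) •
        ∑ i ∈ Finset.range (s + 1),
          (((i : ℝ) + 1 : ℝ) : ℂ) • fderiv ℂ (fieldOperator X g (s - i)) z (X (i + 1) z) := by
      push_cast
      rw [← succ_smul_fieldOperator, inv_smul_smul₀ (Nat.cast_add_one_ne_zero s)]
    rw [h1]
    refine hQ.smul_mem _ _ (hQ.sum_mem _ fun i _ => hQ.smul_mem _ _ ?_)
    exact hP.fderiv_mem hQ hD (ih (s - i) (by omega)) hz hzP (hX (i + 1) z hz hzP)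

end IsRealForm

theorem isRealForm_line : IsRealForm {x : ℂ | x.im = 0} where
  isClosed := isClosed_singleton.preimage Complex.continuous_im
  zero_mem := Complex.zero_im
  add_mem x hx y hy := by
    simp only [mem_ofPred_eq] at *
    rw [Complex.add_im, hx, hy, add_zero]
  smul_mem t x hx := by
    simp only [mem_ofPred_eq] at *
    rw [smul_eq_mul, Complex.mul_im, Complex.ofReal_im, hx, mul_zero, zero_mul, add_zero]

theorem isRealForm_vector : IsRealForm {x : Fin n → ℂ | ∀ i, (x i).im = 0} where
  isClosed := by
    simp only [ofPred_forall]
    exact isClosed_iInter fun i =>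
      isClosed_singleton.preimage (Complex.continuous_im.comp (continuous_apply i))
  zero_mem i := Complex.zero_im
  add_mem _ hx _ hy i := isRealForm_line.add_mem _ (hx i) _ (hy i)
  smul_mem t _ hx i := isRealForm_line.smul_mem t _ (hx i)

theorem IsRealForm.prod {E W : Type} [NormedAddCommGroup E] [NormedSpace ℂ E]
    [NormedAddCommGroup W] [NormedSpace ℂ W] {P : Set E} {Q : Set W} (hP : IsRealForm P)
    (hQ : IsRealForm Q) : IsRealForm (P ×ˢ Q) where
  isClosed := hP.isClosed.prod hQ.isClosed
  zero_mem := ⟨hP.zero_mem, hQ.zero_mem⟩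
  add_mem _ hx _ hy := ⟨hP.add_mem _ hx.1 _ hy.1, hQ.add_mem _ hx.2 _ hy.2⟩
  smul_mem t _ hx := ⟨hP.smul_mem t _ hx.1, hQ.smul_mem t _ hx.2⟩

theorem isRealForm_phase : IsRealForm {z : Phase n | IsRealPoint z} :=
  isRealForm_vector.prod (isRealForm_line.prod (isRealForm_vector.prod isRealForm_line))

/-- The real points of the reduced space. -/
def realReduced (n : ℕ) : Set (Reduced n) :=
  {x | ∀ i, (x i).im = 0} ×ˢ {x | ∀ i, (x i).im = 0} ×ˢ {x | x.im = 0}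

theorem isRealForm_reduced : IsRealForm (realReduced n) :=
  isRealForm_vector.prod (isRealForm_vector.prod isRealForm_line)

theorem single_mem_real (i : Fin n) : (Pi.single i 1 : Fin n → ℂ) ∈ {x : Fin n → ℂ | ∀ i, (x i).im = 0} := by
  intro j
  rcases eq_or_ne j i with rfl | h
  · rw [Pi.single_eq_same]; exact Complex.one_im
  · rw [Pi.single_eq_of_ne h]; exact Complex.zero_im

/-- Functions with real values at the real points of `D`. -/
def IsRealOn (D : Set (Reduced n)) (F : Reduced n → ℂ) : Prop :=
  ∀ p ∈ D, p ∈ realReduced n → (F p).im = 0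

variable {D : Set (Reduced n)} {V : Set (Fin n → ℝ)} {ρ τ : ℝ} {χ G : ℕ → Reduced n → ℂ}
  {h : (Fin n → ℂ) → ℂ} {M : Set (Fin n → ℤ)}

theorem im_mul_eq_zero {x y : ℂ} (hx : x.im = 0) (hy : y.im = 0) : (x * y).im = 0 := by
  rw [Complex.mul_im, hx, hy, mul_zero, zero_mul, add_zero]

theorem isRealOn_zero : IsRealOn D 0 := fun _ _ _ => Complex.zero_im

theorem IsRealOn.fderiv_apply {F : Reduced n → ℂ} (hF : IsRealOn D F) (hD : IsOpen D)
    {v : Reduced n} (hv : v ∈ realReduced n) : IsRealOn D fun p => fderiv ℂ F p v := fun _ hp hpr =>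
  isRealForm_reduced.fderiv_mem isRealForm_line hD hF hp hpr hv

theorem action_direction_mem (i : Fin n) : ((Pi.single i 1, 0, 0) : Reduced n) ∈ realReduced n :=
  ⟨single_mem_real i, isRealForm_vector.zero_mem, isRealForm_line.zero_mem⟩

theorem angle_direction_mem (i : Fin n) : ((0, Pi.single i 1, 0) : Reduced n) ∈ realReduced n :=
  ⟨isRealForm_vector.zero_mem, single_mem_real i, isRealForm_line.zero_mem⟩

theorem time_direction_mem : ((0, 0, 1) : Reduced n) ∈ realReduced n :=
  ⟨isRealForm_vector.zero_mem, isRealForm_vector.zero_mem, Complex.one_im⟩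

theorem IsRealOn.reducedBracket (hD : IsOpen D) {χ F : Reduced n → ℂ} (hχ : IsRealOn D χ)
    (hF : IsRealOn D F) : IsRealOn D (reducedBracket χ F) := fun p hp hpr => by
  refine isRealForm_line.sum_mem _ fun i _ => ?_
  refine isRealForm_line.add_mem _ ?_ _ ?_
  · exact im_mul_eq_zero (hF.fderiv_apply hD (angle_direction_mem i) p hp hpr)
      (hχ.fderiv_apply hD (action_direction_mem i) p hp hpr)
  · simp only [mem_ofPred_eq, Complex.neg_im, neg_eq_zero]
    exact im_mul_eq_zero (hF.fderiv_apply hD (action_direction_mem i) p hp hpr)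
      (hχ.fderiv_apply hD (angle_direction_mem i) p hp hpr)

theorem isRealOn_chainTerm (hD : IsOpen D) (hχ : ∀ j, IsRealOn D (χ j)) (hG : ∀ j, IsRealOn D (G j))
    (p : ℕ) : ∀ s, IsRealOn D (chainTerm χ G p s) := by
  induction p with
  | zero => exact hG
  | succ p ih =>
    intro s
    cases s with
    | zero => exact isRealOn_zero
    | succ s =>
      intro z hz hzr
      rw [chainTerm_succ_succ, show ((s : ℂ) + 1)⁻¹ = ((((s : ℝ) + 1)⁻¹ : ℝ) : ℂ) by push_cast; rfl]
      refine im_mul_eq_zero (Complex.ofReal_im _) (isRealForm_line.sum_mem _ fun i _ => ?_)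
      rw [show ((i : ℂ) + 1) = (((i : ℝ) + 1 : ℝ) : ℂ) by push_cast; rfl]
      exact im_mul_eq_zero (Complex.ofReal_im _)
        (IsRealOn.reducedBracket hD (hχ _) (ih _) z hz hzr)

theorem isRealOn_chain (hD : IsOpen D) (hχ : ∀ j, IsRealOn D (χ j)) (hG : ∀ j, IsRealOn D (G j))
    (s : ℕ) : IsRealOn D (chain χ G s) := fun z hz hzr =>
  isRealForm_line.sum_mem _ fun p _ => isRealOn_chainTerm hD hχ hG p s z hz hzr

theorem conj_character {φ : Fin n → ℂ} (hφ : ∀ i, (φ i).im = 0) (k : Fin n → ℤ) :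
    conj (character k φ) = character (-k) φ := by
  rw [character, character, ← Complex.exp_conj]
  congr 1
  rw [map_mul, Complex.conj_I, map_sum, neg_mul, ← mul_neg, ← Finset.sum_neg_distrib]
  congr 1
  refine Finset.sum_congr rfl fun i _ => ?_
  rw [map_mul, Complex.conj_eq_iff_im.2 (hφ i), map_intCast, Pi.neg_apply, Int.cast_neg, neg_mul]

/-- Real functions have conjugation-symmetric Fourier coefficients, and conversely. -/
theorem conj_fourierCoefficient (hτ : 0 < τ) {F : Reduced n → ℂ}
    (hF : IsRealOn (reducedDomain V ρ τ) F) (k : Fin n → ℤ) {p : (Fin n → ℂ) × ℂ}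
    (hp : p ∈ actionNhd V ρ ×ˢ strip τ) (h1 : ∀ i, (p.1 i).im = 0) (h2 : p.2.im = 0) :
    conj (fourierCoefficient F k p) = fourierCoefficient F (-k) p := by
  rw [fourierCoefficient, fourierCoefficient, map_mul, map_pow, map_inv₀, Complex.conj_ofReal,
    ← integral_conj]
  congr 1
  refine MeasureTheory.integral_congr_ae (Filter.Eventually.of_forall fun φ => ?_)
  simp only
  have hφ : ∀ i, (ofRealVec φ i).im = 0 := fun i => Complex.ofReal_im _
  have hFr := hF (p.1, ofRealVec φ, p.2) ⟨hp.1, ofRealVec_mem_angleStrip hτ φ, hp.2⟩ ⟨h1, hφ, h2⟩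
  rw [map_mul, conj_character hφ, Complex.conj_eq_iff_im.2 hFr]

theorem isRealOn_fourierSum {c : (Fin n → ℤ) → (Fin n → ℂ) × ℂ → ℂ}
    (hc : ∀ k, ∀ p ∈ actionNhd V ρ ×ˢ strip τ, (∀ i, (p.1 i).im = 0) → p.2.im = 0 →
      conj (c k p) = c (-k) p) : IsRealOn (reducedDomain V ρ τ) (fourierSum c) := by
  intro p hp hpr
  rw [← Complex.conj_eq_iff_im, fourierSum, Complex.conj_tsum,
    ← (Equiv.neg (Fin n → ℤ)).tsum_eq fun k => c k (p.1, p.2.2) * character k p.2.1]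
  refine tsum_congr fun k => ?_
  rw [map_mul, conj_character hpr.2.1, hc k (p.1, p.2.2) ⟨hp.1, hp.2.2⟩ hpr.1 hpr.2.2]
  rfl

theorem isRealOn_shell (hτ : 0 < τ) {f : Reduced n → ℂ} (hf : IsRealOn (reducedDomain V ρ τ) f)
    (K l : ℕ) : IsRealOn (reducedDomain V ρ τ) (shell K f l) := by
  refine isRealOn_fourierSum fun k p hp h1 h2 => ?_
  rw [absSum_neg]
  split_ifs
  · exact conj_fourierCoefficient hτ hf k hp h1 h2
  · exact map_zero _

/-- The denominator `i ⟨∂h/∂I, k⟩` is conjugated by `k ↦ -k` at real actions, so dividing by it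
keeps a function real. -/
theorem isRealOn_solve (hτ : 0 < τ) (hM : ∀ k, k ∈ M ↔ -k ∈ M)
    (hh : ∀ I ∈ actionNhd V ρ, (∀ i, (I i).im = 0) → (h I).im = 0) {F : Reduced n → ℂ}
    (hF : IsRealOn (reducedDomain V ρ τ) F) (N : ℕ) :
    IsRealOn (reducedDomain V ρ τ) (multiplier (solveSymbol h M N) F) := by
  refine isRealOn_fourierSum fun k p hp h1 h2 => ?_
  rw [map_mul, conj_fourierCoefficient hτ hF k hp h1 h2]
  congr 1
  by_cases hk : k ∉ M ∧ absSum k < N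
  · have hk' : -k ∉ M ∧ absSum (-k) < N := by rwa [← hM k, absSum_neg]
    rw [solveSymbol, solveSymbol, if_pos hk, if_pos hk', map_inv₀, map_mul, Complex.conj_I,
      map_sum, neg_mul, ← mul_neg, ← Finset.sum_neg_distrib]
    congr 2
    refine Finset.sum_congr rfl fun i _ => ?_
    have hω : (frequency h p.1 i).im = 0 := isRealForm_vector.fderiv_mem isRealForm_line
      (isOpen_actionNhd V ρ) hh hp.1 h1 (single_mem_real i)
    rw [map_mul, Complex.conj_eq_iff_im.2 hω, map_intCast, Pi.neg_apply, Int.cast_neg, mul_neg]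
  · have hk' : ¬(-k ∉ M ∧ absSum (-k) < N) := by rwa [← hM k, absSum_neg]
    rw [solveSymbol, solveSymbol, if_neg hk, if_neg hk', map_zero]

theorem IsResonanceModule.neg_mem_iff (hM : IsResonanceModule M) (k : Fin n → ℤ) :
    k ∈ M ↔ -k ∈ M := by
  have key : ∀ k, k ∈ M → -k ∈ M := by
    intro k hk
    rw [← hM] at hk ⊢
    change (fun i => ((k i : ℤ) : ℝ)) ∈ Submodule.span ℝ _ at hk
    change (fun i => (((-k) i : ℤ) : ℝ)) ∈ Submodule.span ℝ _
    have h2 : (fun i => (((-k) i : ℤ) : ℝ)) = -fun i => ((k i : ℤ) : ℝ) := by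
      funext i; simp
    rw [h2]
    exact Submodule.neg_mem _ hk
  exact ⟨key k, fun hk => by simpa using key (-k) hk⟩

variable {μ : ℂ} {φ : ℕ → Reduced n → ℂ} {r K : ℕ}

theorem isRealOn_orderTerm (hμ : μ.im = 0)
    (hh : ∀ I ∈ actionNhd V ρ, (∀ i, (I i).im = 0) → (h I).im = 0)
    (hφ : ∀ l, IsRealOn (reducedDomain V ρ τ) (φ l))
    (hχ : ∀ j, IsRealOn (reducedDomain V ρ τ) (χ j)) (s : ℕ) :
    IsRealOn (reducedDomain V ρ τ) (orderTerm h μ φ χ s) := by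
  intro p hp hpr
  have hD := isOpen_reducedDomain V ρ τ
  refine isRealForm_line.add_mem _ (isRealForm_line.add_mem _ ?_ _ ?_) _
    (isRealForm_line.sum_mem _ fun l _ => ?_)
  · exact isRealOn_chain hD hχ (fun j => (hχ j).reducedBracket hD fun q hq hqr =>
      hh q.1 hq.1 hqr.1) s p hp hpr
  · refine im_mul_eq_zero hμ (isRealOn_chain hD hχ (fun j q hq hqr => ?_) _ p hp hpr)
    rw [timeSource, Complex.neg_im, neg_eq_zero]
    exact (hχ j).fderiv_apply hD time_direction_mem q hq hqr
  · refine isRealOn_chain hD hχ (fun j => ?_) _ p hp hpr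
    rcases Nat.eq_zero_or_pos j with rfl | hj
    · rw [Pi.single_eq_same]; exact hφ _
    · rw [Pi.single_eq_of_ne hj.ne']; exact isRealOn_zero

theorem isRealOn_generators (hτ : 0 < τ) (hM : IsResonanceModule M) (hμ : μ.im = 0)
    (hh : ∀ I ∈ actionNhd V ρ, (∀ i, (I i).im = 0) → (h I).im = 0)
    (hφ : ∀ l, IsRealOn (reducedDomain V ρ τ) (φ l)) (hχ0 : χ 0 = 0) (hχr : ∀ s, r < s → χ s = 0)
    (hχ : ∀ s, 1 ≤ s → s ≤ r →
      χ s = multiplier (solveSymbol h M (s * K)) (obstruction h μ φ χ s)) (s : ℕ) :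
    IsRealOn (reducedDomain V ρ τ) (χ s) := by
  induction s using Nat.strong_induction_on with
  | _ s ih =>
  rcases Nat.eq_zero_or_pos s with rfl | hs1
  · rw [hχ0]; exact isRealOn_zero
  rcases lt_or_ge r s with hs | hs
  · rw [hχr s hs]; exact isRealOn_zero
  · rw [hχ s hs1 hs]
    refine isRealOn_solve hτ hM.neg_mem_iff hh (isRealOn_orderTerm hμ hh hφ (fun j => ?_) s) _
    by_cases hj : j < s
    · rw [truncate_of_lt hj]; exact ih j hj
    · rw [truncate_of_le (not_lt.1 hj)]; exact isRealOn_zero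

theorem flow_real {t : ℝ} {z : Phase n} (hχ : ∀ j, IsRealOn (reducedDomain V ρ τ) (χ j))
    (hz : z ∈ domain V ρ τ) (hzr : IsRealPoint z)
    (hs : HasSum (fun s => (t : ℂ) ^ s • fieldOperator (fields χ) id s z) (flow χ (t, z))) :
    IsRealPoint (flow χ (t, z)) := by
  have hD := isOpen_domain V ρ τ
  have hX : ∀ j, ∀ z ∈ domain V ρ τ, z ∈ {z : Phase n | IsRealPoint z} →
      fields χ j z ∈ {z : Phase n | IsRealPoint z} := by
    intro j z hz hzr
    have h1 : ∀ v ∈ {z : Phase n | IsRealPoint z},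
        (fderiv ℂ (fun w => χ j (reduce w)) z v).im = 0 := fun v hv =>
      isRealForm_phase.fderiv_mem isRealForm_line hD (fun w hw hwr =>
        hχ j (reduce w) (reduce_mem hw) ⟨hwr.1, hwr.2.2.1, hwr.2.2.2⟩) hz hzr hv
    have z1 := (isRealForm_vector (n := n)).zero_mem
    have z2 := isRealForm_line.zero_mem
    refine ⟨fun i => ?_, ?_, fun i => ?_, ?_⟩
    · simp only [fields, hamiltonianField, Complex.neg_im, neg_eq_zero]
      exact h1 _ ⟨z1, z2, single_mem_real i, z2⟩
    · simp only [fields, hamiltonianField, Complex.neg_im, neg_eq_zero]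
      exact h1 _ ⟨z1, z2, z1, Complex.one_im⟩
    · exact h1 _ ⟨single_mem_real i, z2, z1, z2⟩
    · exact h1 _ ⟨z1, Complex.one_im, z1, z2⟩
  refine isRealForm_phase.isClosed.mem_of_tendsto hs (Filter.Eventually.of_forall fun S => ?_)
  refine isRealForm_phase.sum_mem S fun s _ => ?_
  rw [← Complex.ofReal_pow]
  exact isRealForm_phase.smul_mem _ _ (isRealForm_phase.fieldOperator_mem isRealForm_phase hD hX
    (fun _ _ h => h) s z hz hzr)

/-- Reality on an open set of real points extends to the real points of the complex neighbourhood,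
by the identity theorem along lines. -/
theorem im_eq_zero_of_real {G : Set (Fin n → ℝ)} (hG : IsOpen G) (hVG : V ⊆ G)
    {F : (Fin n → ℂ) → ℂ} (hF : DifferentiableOn ℂ F (actionNhd V ρ))
    (hreal : ∀ I ∈ G, (F (ofRealVec I)).im = 0) {I : Fin n → ℂ} (hI : I ∈ actionNhd V ρ)
    (hIr : ∀ i, (I i).im = 0) : (F I).im = 0 := by
  obtain ⟨I₀, hI₀, hII₀⟩ := mem_iUnion₂.1 hI
  set x : Fin n → ℝ := fun i => (I i).re - I₀ i
  have hx : I = ofRealVec I₀ + ofRealVec x := by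
    funext i
    refine Complex.ext ?_ ?_
    · simp [ofRealVec, x]
    · simp [ofRealVec, hIr i]
  have hxρ : ‖ofRealVec x‖ < ρ := by
    have h1 := mem_ball_iff_norm.1 hII₀
    rwa [hx, add_sub_cancel_left] at h1
  rcases eq_or_ne (ofRealVec x) 0 with h0 | h0
  · rw [hx, h0, add_zero]; exact hreal I₀ (hVG hI₀)
  have hpos : 0 < ‖ofRealVec x‖ := norm_pos_iff.2 h0
  set g : ℂ → ℂ := fun t => F (ofRealVec I₀ + t • ofRealVec x)
  have hR : 1 < ρ / ‖ofRealVec x‖ := by rwa [lt_div_iff₀ hpos, one_mul]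
  have hmaps : ∀ t ∈ ball (0 : ℂ) (ρ / ‖ofRealVec x‖),
      ofRealVec I₀ + t • ofRealVec x ∈ actionNhd V ρ := by
    intro t ht
    refine mem_iUnion₂.2 ⟨I₀, hI₀, ?_⟩
    rw [mem_ball_iff_norm, add_sub_cancel_left, norm_smul]
    rw [mem_ball_zero_iff, lt_div_iff₀ hpos] at ht
    exact ht
  have hg : DifferentiableOn ℂ g (ball 0 (ρ / ‖ofRealVec x‖)) :=
    hF.comp (by fun_prop) hmaps
  have hg' : DifferentiableOn ℂ (conj ∘ g ∘ conj) (ball 0 (ρ / ‖ofRealVec x‖)) := by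
    intro t ht
    have h1 : conj t ∈ ball (0 : ℂ) (ρ / ‖ofRealVec x‖) := by
      rw [mem_ball_zero_iff, RCLike.norm_conj]
      exact mem_ball_zero_iff.1 ht
    have h2 := (hg.differentiableAt (isOpen_ball.mem_nhds h1)).conj_conj
    rw [Complex.conj_conj] at h2
    exact h2.differentiableWithinAt
  have hcont : Continuous fun t : ℝ => I₀ + t • x := by fun_prop
  have hev : ∀ᶠ t : ℝ in 𝓝 0, g t = (conj ∘ g ∘ conj) t := by
    have h1 : ∀ᶠ t : ℝ in 𝓝 0, I₀ + t • x ∈ G :=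
      hcont.continuousAt.eventually_mem (hG.mem_nhds (by simpa using hVG hI₀))
    filter_upwards [h1] with t ht
    have h2 : ofRealVec I₀ + (t : ℂ) • ofRealVec x = ofRealVec (I₀ + t • x) := by
      funext i; simp [ofRealVec]
    have h3 := hreal _ ht
    simp only [Function.comp_apply, g, Complex.conj_ofReal, h2]
    exact (Complex.conj_eq_iff_im.2 h3).symm
  have h1 := (hg.analyticOnNhd isOpen_ball).eqOn_of_preconnected_of_frequently_eq
    (hg'.analyticOnNhd isOpen_ball) (convex_ball _ _).isPreconnected
    (mem_ball_self (by positivity)) (frequently_of_eventually_real hev)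
  have h2 := h1 (show (1 : ℂ) ∈ ball 0 (ρ / ‖ofRealVec x‖) by
    rw [mem_ball_zero_iff, norm_one]; exact hR)
  simp only [Function.comp_apply, map_one, g, one_smul] at h2
  rw [hx, ← Complex.conj_eq_iff_im]
  exact h2.symm

end Reality

/-! ### The transformed Hamiltonian -/

section Transform

open Metric Set Filter Topology

theorem tsum_antidiagonal (a : ℕ → ℕ → ℝ≥0∞) :
    ∑' s, ∑ l ∈ Finset.range (s + 1), a l (s - l) = ∑' l, ∑' m, a l m := by
  rw [← ENNReal.tsum_prod (f := a),
    ← Finset.HasAntidiagonal.sigmaAntidiagonalEquivProd.tsum_eq fun q : ℕ × ℕ => a q.1 q.2,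
    ENNReal.tsum_sigma']
  refine tsum_congr fun s => ?_
  rw [tsum_fintype, ← Finset.Nat.sum_antidiagonal_eq_sum_range_succ a,
    ← Finset.sum_coe_sort (Finset.HasAntidiagonal.antidiagonal s)]
  rfl

theorem hasSum_antidiagonal {a : ℕ → ℕ → ℂ} {g : ℕ → ℂ} {G : ℂ}
    (ha : ∑' l, ∑' m, ‖a l m‖ₑ ≠ ⊤) (hg : ∀ l, HasSum (a l) (g l)) (hG : HasSum g G) :
    HasSum (fun s => ∑ l ∈ Finset.range (s + 1), a l (s - l)) G := by
  have h1 : Summable fun q : ℕ × ℕ => a q.1 q.2 := by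
    rw [← ENNReal.tsum_prod (f := fun l m => ‖a l m‖ₑ)] at ha
    refine Summable.of_norm ?_
    refine (ENNReal.summable_toReal ha).congr fun q => ?_
    rw [toReal_enorm]
  have h2 := h1.hasSum
  have h3 : ∑' q : ℕ × ℕ, a q.1 q.2 = G := (h2.prod_fiberwise hg).unique hG
  rw [h3, ← Finset.HasAntidiagonal.sigmaAntidiagonalEquivProd.hasSum_iff] at h2
  refine (h2.sigma fun s => hasSum_fintype _).congr_fun ?_
  intro s
  rw [← Finset.Nat.sum_antidiagonal_eq_sum_range_succ a,
    ← Finset.sum_coe_sort (Finset.HasAntidiagonal.antidiagonal s)]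
  rfl

variable {V : Set (Fin n → ℝ)} {δ σ : ℝ} {h : (Fin n → ℂ) → ℂ} {μ : ℂ} {φ χ : ℕ → Reduced n → ℂ}
  {b X T : ℝ} {w : ℝ≥0∞}

/-- With `X`, `T` bounding the weighted norms of the `χ_s` and of the `φ_l`, the weighted norms at the
level `1` of the terms of the transformed Hamiltonian add up to at most `8T`. The chains starting
at the shells are bounded separately, as their double series has to be rearranged. -/
theorem isFourierAt_orderTerm_one (hδ : 0 < δ) (hσ : 0 < σ) (hb : b ≤ 1 / 2)
    (hχ0 : χ 0 = 0) (hχ : ∀ s, IsFourierAt V δ σ b (χ s))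
    (hq : ∀ s, IsFourierAt V δ σ b (actionSource h χ s))
    (hφ : ∀ l, IsFourierAt V δ σ 0 (φ l)) (hT0 : 0 ≤ T)
    (hX : ∑' s, w ^ s * levelNorm V δ σ b (χ s) ≤ ENNReal.ofReal X)
    (hQ : ∑' s, w ^ s * levelNorm V δ σ b (actionSource h χ s) ≤ ENNReal.ofReal (7 / 5 * T))
    (hT : ∑' l, w ^ l * levelNorm V δ σ 0 (φ l) ≤ ENNReal.ofReal T)
    (hBX : bracketConst δ σ * X ≤ 1 / 96)
    (hμ : w * ‖μ‖ₑ * ENNReal.ofReal (200 / (9 * σ) * X) ≤ ENNReal.ofReal T) :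
    (∀ s, IsFourierAt V δ σ 1 (orderTerm h μ φ χ s)) ∧
      ∑' s, w ^ s * levelNorm V δ σ 1 (orderTerm h μ φ χ s) ≤ ENNReal.ofReal (8 * T) ∧
      ∑' l, ∑' m, w ^ (l + 1) * w ^ m *
        levelNorm V δ σ 1 (chain χ (Pi.single 0 (φ (l + 1))) m) ≤ ENNReal.ofReal (3 / 2 * T) ∧
      ∀ l m, IsFourierAt V δ σ 1 (chain χ (Pi.single 0 (φ (l + 1))) m) := by
  have hB := bracketConst_pos hδ hσ
  have hτ := angleWidth_pos hσ (le_refl (1 : ℝ))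
  have hu : (3 / 5 : ℝ) ≤ 1 := by norm_num
  have hbu : b < 3 / 5 := by linarith
  have hz := isFourierAt_zero (V := V) (δ := δ) hσ hu
  have hχ' : ∀ j, IsFourierAt V δ σ (3 / 5) (χ j) := fun j => (hχ j).anti hδ hσ hbu.le
  have hS : ENNReal.ofReal (2 * bracketConst δ σ / (2 / 5) ^ 2) *
      ∑' j, w ^ j * levelNorm V δ σ (3 / 5) (χ j) ≤ ENNReal.ofReal (5 / 24) := by
    refine (mul_le_mul' le_rfl ((ENNReal.tsum_le_tsum fun j => mul_le_mul' le_rfl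
      (levelNorm_anti hδ hσ hbu.le _)).trans hX)).trans ?_
    rw [← ENNReal.ofReal_mul (by positivity)]
    refine ENNReal.ofReal_le_ofReal ?_
    have : 2 * bracketConst δ σ / (2 / 5) ^ 2 * X = 25 / 2 * (bracketConst δ σ * X) := by ring
    rw [this]
    linarith
  have hest : ∀ {G : ℕ → Reduced n → ℂ}, (∀ s, IsFourierAt V δ σ (3 / 5) (G s)) →
      (∀ s, IsFourierAt V δ σ 1 (chain χ G s)) ∧
      ∑' s, w ^ s * levelNorm V δ σ 1 (chain χ G s) ≤
        ENNReal.ofReal (3 / 2) * ∑' s, w ^ s * levelNorm V δ σ (3 / 5) (G s) := by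
    intro G hG
    have := chain_estimate hδ hσ (show (0 : ℝ) < 2 / 5 by norm_num) (by norm_num) w hχ' hG hS
    rwa [show (3 / 5 : ℝ) + 2 / 5 = 1 by norm_num] at this
  -- the three groups of terms
  obtain ⟨a1, a2⟩ := hest fun s => (hq s).anti hδ hσ hbu.le
  have ht : ∀ s, IsFourierAt V δ σ (3 / 5) (timeSource χ s) ∧
      levelNorm V δ σ (3 / 5) (timeSource χ s) ≤
        ENNReal.ofReal (200 / (9 * σ)) * levelNorm V δ σ b (χ s) := by
    intro s
    have h1 := (isFourierAt_fderiv hδ hσ (hχ s) hbu hu).2.2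
    have h2 := isFourier_neg (angleWidth_pos hσ hu) h1.1
    refine ⟨h2.1, h2.2.trans (h1.2.trans (mul_le_mul' (ENNReal.ofReal_le_ofReal ?_) le_rfl))⟩
    rw [div_le_div_iff₀ (mul_pos (by positivity) (by linarith)) (by positivity)]
    nlinarith
  obtain ⟨t1, t2⟩ := hest fun s => (ht s).1
  have hsing : ∀ l m, IsFourierAt V δ σ (3 / 5) ((Pi.single 0 (φ l) : ℕ → Reduced n → ℂ) m) := by
    intro l m
    rcases Nat.eq_zero_or_pos m with rfl | hm
    · rw [Pi.single_eq_same]; exact (hφ l).anti hδ hσ (by norm_num)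
    · rw [Pi.single_eq_of_ne hm.ne']; exact hz.1
  have f1 := fun l => (hest (hsing l)).1
  have f2 : ∀ l, ∑' m, w ^ m * levelNorm V δ σ 1 (chain χ (Pi.single 0 (φ l)) m) ≤
      ENNReal.ofReal (3 / 2) * levelNorm V δ σ 0 (φ l) := by
    intro l
    refine (hest (hsing l)).2.trans (mul_le_mul' le_rfl ?_)
    rw [tsum_eq_single 0 fun m hm => by rw [Pi.single_eq_of_ne hm, hz.2, mul_zero],
      Pi.single_eq_same, pow_zero, one_mul]
    exact levelNorm_anti hδ hσ (by norm_num) _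
  have hdouble : ∑' l, ∑' m, w ^ (l + 1) * w ^ m *
      levelNorm V δ σ 1 (chain χ (Pi.single 0 (φ (l + 1))) m) ≤ ENNReal.ofReal (3 / 2 * T) := by
    calc _ ≤ ∑' l, ENNReal.ofReal (3 / 2) * (w ^ (l + 1) * levelNorm V δ σ 0 (φ (l + 1))) := by
          refine ENNReal.tsum_le_tsum fun l => ?_
          simp only [mul_assoc]
          rw [ENNReal.tsum_mul_left, mul_left_comm]
          exact mul_le_mul' le_rfl (f2 (l + 1))
      _ ≤ ENNReal.ofReal (3 / 2) * ∑' l, w ^ l * levelNorm V δ σ 0 (φ l) := by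
          rw [ENNReal.tsum_mul_left]
          refine mul_le_mul' le_rfl ?_
          rw [tsum_eq_zero_add' (f := fun l => w ^ l * levelNorm V δ σ 0 (φ l)) ENNReal.summable]
          exact le_add_self
      _ ≤ _ := by
          rw [ENNReal.ofReal_mul (by norm_num)]
          exact mul_le_mul' le_rfl hT
  have hterm : ∀ s, IsFourierAt V δ σ 1 (orderTerm h μ φ χ s) ∧
      levelNorm V δ σ 1 (orderTerm h μ φ χ s) ≤
        levelNorm V δ σ 1 (chain χ (actionSource h χ) s) +
        ‖μ‖ₑ * levelNorm V δ σ 1 (chain χ (timeSource χ) (s - 1)) +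
        ∑ l ∈ Finset.range s,
          levelNorm V δ σ 1 (chain χ (Pi.single 0 (φ (l + 1))) (s - 1 - l)) := by
    intro s
    have e1 := isFourier_const_mul hτ (t1 (s - 1)) μ
    have e2 := isFourier_add hτ (a1 s) e1.1
    have e3 := isFourier_finset_sum hτ (Finset.range s) fun l _ => f1 (l + 1) (s - 1 - l)
    have e4 := isFourier_add hτ e2.1 e3.1
    exact ⟨e4.1, e4.2.trans (add_le_add (e2.2.trans (add_le_add le_rfl e1.2)) e3.2)⟩
  have hzero : levelNorm V δ σ 1 (chain χ (timeSource χ) 0) = 0 := by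
    rw [chain_zero, timeSource_of_eq_zero hχ0]
    exact (isFourierAt_zero hσ le_rfl).2
  refine ⟨fun s => (hterm s).1, ?_, hdouble, fun l => f1 (l + 1)⟩
  have p1 : ∑' s, w ^ s * levelNorm V δ σ 1 (chain χ (actionSource h χ) s) ≤
      ENNReal.ofReal (3 / 2 * (7 / 5 * T)) := by
    rw [ENNReal.ofReal_mul (by norm_num)]
    exact a2.trans (mul_le_mul' le_rfl ((ENNReal.tsum_le_tsum fun s => mul_le_mul' le_rfl
      (levelNorm_anti hδ hσ hbu.le _)).trans hQ))
  have p2 : ∑' s, w ^ s * (‖μ‖ₑ * levelNorm V δ σ 1 (chain χ (timeSource χ) (s - 1))) ≤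
      ENNReal.ofReal (3 / 2 * T) := by
    rw [tsum_eq_zero_add' (f := fun s => w ^ s *
      (‖μ‖ₑ * levelNorm V δ σ 1 (chain χ (timeSource χ) (s - 1)))) ENNReal.summable,
      Nat.zero_sub, hzero, mul_zero, mul_zero, zero_add]
    calc _ = w * ‖μ‖ₑ * ∑' s, w ^ s * levelNorm V δ σ 1 (chain χ (timeSource χ) s) := by
          rw [← ENNReal.tsum_mul_left]
          refine tsum_congr fun s => ?_
          rw [Nat.add_sub_cancel, pow_succ]
          ring
      _ ≤ w * ‖μ‖ₑ * (ENNReal.ofReal (3 / 2) * ENNReal.ofReal (200 / (9 * σ) * X)) := by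
          refine mul_le_mul' le_rfl (t2.trans (mul_le_mul' le_rfl ?_))
          rw [ENNReal.ofReal_mul (by positivity)]
          refine le_trans ?_ (mul_le_mul' le_rfl hX)
          rw [← ENNReal.tsum_mul_left]
          refine ENNReal.tsum_le_tsum fun s => ?_
          rw [mul_left_comm]
          exact mul_le_mul' le_rfl (ht s).2
      _ = ENNReal.ofReal (3 / 2) * (w * ‖μ‖ₑ * ENNReal.ofReal (200 / (9 * σ) * X)) := by ring
      _ ≤ _ := by
          rw [ENNReal.ofReal_mul (p := 3 / 2) (by norm_num)]
          exact mul_le_mul' le_rfl hμ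
  have p3 : ∑' s, w ^ s * ∑ l ∈ Finset.range s,
      levelNorm V δ σ 1 (chain χ (Pi.single 0 (φ (l + 1))) (s - 1 - l)) ≤
      ENNReal.ofReal (3 / 2 * T) := by
    refine le_trans (le_of_eq ?_) hdouble
    rw [← tsum_antidiagonal fun l m => w ^ (l + 1) * w ^ m *
      levelNorm V δ σ 1 (chain χ (Pi.single 0 (φ (l + 1))) m),
      tsum_eq_zero_add' (f := fun s => w ^ s * ∑ l ∈ Finset.range s,
      levelNorm V δ σ 1 (chain χ (Pi.single 0 (φ (l + 1))) (s - 1 - l))) ENNReal.summable,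
      Finset.range_zero, Finset.sum_empty, mul_zero, zero_add]
    refine tsum_congr fun s => ?_
    rw [Finset.mul_sum]
    refine Finset.sum_congr rfl fun l hl => ?_
    rw [Finset.mem_range] at hl
    rw [← pow_add, Nat.add_sub_cancel, show l + 1 + (s - l) = s + 1 by omega]
  calc _ ≤ ∑' s, (w ^ s * levelNorm V δ σ 1 (chain χ (actionSource h χ) s) +
        w ^ s * (‖μ‖ₑ * levelNorm V δ σ 1 (chain χ (timeSource χ) (s - 1))) +
        w ^ s * ∑ l ∈ Finset.range s,
          levelNorm V δ σ 1 (chain χ (Pi.single 0 (φ (l + 1))) (s - 1 - l))) := by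
        refine ENNReal.tsum_le_tsum fun s => ?_
        rw [← mul_add, ← mul_add]
        exact mul_le_mul' le_rfl (hterm s).2
    _ ≤ ENNReal.ofReal (3 / 2 * (7 / 5 * T)) + ENNReal.ofReal (3 / 2 * T) +
        ENNReal.ofReal (3 / 2 * T) := by
        rw [ENNReal.tsum_add, ENNReal.tsum_add]
        exact add_le_add (add_le_add p1 p2) p3
    _ ≤ _ := by
        rw [← ENNReal.ofReal_add (by positivity) (by positivity),
          ← ENNReal.ofReal_add (by positivity) (by positivity)]
        refine ENNReal.ofReal_le_ofReal ?_
        linarith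

/-- A function of the transformed coordinates is the Lie series of the function. -/
theorem hasSum_flow {Ω D : Set (Phase n)} (hΩ : IsOpen Ω) (hD : IsOpen D) {D₁ : Set (Reduced n)}
    (hD₁ : IsOpen D₁) (hmaps : ∀ z ∈ D, reduce z ∈ D₁) {r : ℕ} {G : ℕ → Reduced n → ℂ}
    (hχr : ∀ j, r < j → χ j = 0)
    (hχ : ∀ j, DifferentiableOn ℂ (χ j) D₁) (hG : ∀ j, DifferentiableOn ℂ (G j) D₁)
    (hv : IsTransported (fields χ) r (5 / 4) D (flow χ)) (hv0 : ∀ z, flow χ (0, z) = z)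
    (hvΩ : ∀ t ∈ ball (0 : ℂ) (5 / 4), ∀ z ∈ D, flow χ (t, z) ∈ Ω) {g : Phase n → ℂ}
    (hgd : DifferentiableOn ℂ g Ω)
    (hg : ∀ j, ∀ z ∈ D, fderiv ℂ g z (fields χ (j + 1) z) =
      G (j + 1) (reduce z) + reducedBracket (χ (j + 1)) (G 0) (reduce z)) {z : Phase n}
    (hz : z ∈ D) :
    HasSum (fun s => chain χ G (s + 1) (reduce z)) (g (flow χ (1, z)) - g z) := by
  have h1 := (hv.comp hD hΩ hgd hvΩ).hasSum hD (t := 1)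
    (fun j hj z _ => by rw [fields_of_eq_zero (hχr j hj)]; rfl) (g := g)
    (fun z _ => by rw [hv0]) hz (by rw [mem_ball_zero_iff, norm_one]; norm_num)
  simp only [one_pow, one_smul] at h1
  have h2 := (hasSum_nat_add_iff' 1).2 h1
  simp only [Finset.range_one, Finset.sum_singleton, fieldOperator_zero] at h2
  refine h2.congr_fun fun s => ?_
  exact (fieldOperator_eq_chain hD hD₁ hmaps hχ hG hg s z hz).symm

/-- The transformed Hamiltonian, order by order. -/
theorem hasSum_orderTerm (hδ : 0 < δ) (hσ : 0 < σ) (hh : DifferentiableOn ℂ h (actionNhd V δ))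
    (hχ0 : χ 0 = 0) {r : ℕ} (hχr : ∀ j, r < j → χ j = 0)
    (hχ : ∀ j, DifferentiableOn ℂ (χ j) (levelReduced V δ σ (3 / 4)))
    (hφ0 : φ 0 = 0) (hφ : ∀ l, IsFourierAt V δ σ 0 (φ l))
    (hv : IsTransported (fields χ) r (5 / 4) (levelDomain V δ σ (3 / 4)) (flow χ))
    (hv0 : ∀ z, flow χ (0, z) = z)
    (hvs : ∀ t ∈ ball (0 : ℂ) (5 / 4), ∀ z ∈ levelDomain V δ σ (3 / 4),
      IsSmall δ σ (3 / 4) (flow χ (t, z) - z))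
    {F : Reduced n → ℂ} (hF : ∀ p ∈ levelReduced V δ σ 0, HasSum (fun l => φ l p) (F p))
    (hφχ : ∑' l, ∑' m, levelNorm V δ σ 1 (chain χ (Pi.single 0 (φ (l + 1))) m) ≠ ⊤)
    (hχ1 : ∀ l m, IsFourierAt V δ σ 1 (chain χ (Pi.single 0 (φ (l + 1))) m))
    {z : Phase n} (hz : z ∈ levelDomain V δ σ 1) :
    HasSum (fun s => orderTerm h μ φ χ (s + 1) (reduce z))
      (h (flow χ (1, z)).1 + μ * (flow χ (1, z)).2.1 + F (reduce (flow χ (1, z))) -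
        h z.1 - μ * z.2.1) := by
  set D := levelDomain V δ σ (3 / 4)
  have hD : IsOpen D := isOpen_domain _ _ _
  have hΩ : IsOpen (levelDomain V δ σ 0) := isOpen_domain _ _ _
  have hD₁ : IsOpen (levelReduced V δ σ (3 / 4)) := isOpen_reducedDomain _ _ _
  have hmaps : ∀ z ∈ D, reduce z ∈ levelReduced V δ σ (3 / 4) := fun z hz => reduce_mem hz
  have hzD : z ∈ D := levelDomain_anti hδ hσ (by norm_num) hz
  have hvΩ : ∀ t ∈ ball (0 : ℂ) (5 / 4), ∀ z ∈ D, flow χ (t, z) ∈ levelDomain V δ σ 0 := by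
    intro t ht z hz
    have := add_mem_levelDomain (u := 0) hz (by simpa using hvs t ht z hz)
    simpa using this
  have hw0 : actionWidth δ 0 = δ := by simp [actionWidth]
  have hactR : levelReduced V δ σ (3 / 4) ⊆ levelReduced V δ σ 0 :=
    reducedDomain_mono V (actionWidth_anti hδ (by norm_num)) (angleWidth_anti hσ (by norm_num))
  have hh' : DifferentiableOn ℂ (fun q : Reduced n => h q.1) (levelReduced V δ σ 0) :=
    hh.comp (by fun_prop) fun q hq => by rw [← hw0]; exact hq.1
  have key := fun {G : ℕ → Reduced n → ℂ} {g : Phase n → ℂ} hG hgd hg =>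
    hasSum_flow hΩ hD hD₁ hmaps (G := G) (g := g) hχr hχ hG hv hv0 hvΩ hgd hg hzD
  -- composition with a function that does not depend on `η`
  have hbr : ∀ {g : Reduced n → ℂ}, DifferentiableOn ℂ g (levelReduced V δ σ 0) → ∀ j, ∀ z ∈ D,
      fderiv ℂ (fun w => g (reduce w)) z (fields χ (j + 1) z) =
        reducedBracket (χ (j + 1)) g (reduce z) := fun hg j z hz =>
    fderiv_hamiltonianField_reduce ((hχ _).differentiableAt (hD₁.mem_nhds (hmaps z hz)))
      (hg.differentiableAt ((isOpen_reducedDomain _ _ _).mem_nhds (hactR (hmaps z hz))))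
  have k1 : HasSum (fun s => chain χ (actionSource h χ) (s + 1) (reduce z))
      (h (flow χ (1, z)).1 - h z.1) := by
    refine key (g := fun w => h (reduce w).1) (fun j => ?_) ?_ fun j z hz => ?_
    · exact differentiableOn_reducedBracket hD₁ (hχ j) (hh'.mono hactR)
    · exact hh'.comp (reduceCLM n).differentiable.differentiableOn fun z hz => reduce_mem hz
    · rw [hbr hh' j z hz, actionSource_of_eq_zero hχ0, reducedBracket_zero_right, Pi.zero_apply,
        add_zero, actionSource]
  have k2 : HasSum (fun s => chain χ (timeSource χ) (s + 1) (reduce z))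
      ((flow χ (1, z)).2.1 - z.2.1) := by
    refine key (g := fun w => energyCoord w) (fun j => ?_)
      energyCoord.differentiable.differentiableOn fun j z hz => ?_
    · exact (differentiableOn_fderiv_apply hD₁ (hχ j) _).neg
    · have h1 : fderiv ℂ (fun w : Phase n => energyCoord w) z = energyCoord := energyCoord.fderiv
      rw [h1, timeSource_of_eq_zero hχ0, reducedBracket_zero_right, Pi.zero_apply, add_zero,
        fields, hamiltonianField_comp_reduce
          ((hχ _).differentiableAt (hD₁.mem_nhds (hmaps z hz)))]
      rfl
  have k3 : ∀ l, HasSum (fun m => chain χ (Pi.single 0 (φ (l + 1))) m (reduce z))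
      (φ (l + 1) (reduce (flow χ (1, z)))) := by
    intro l
    have hd := (hφ (l + 1)).differentiableOn
    have h1 : HasSum (fun s => chain χ (Pi.single 0 (φ (l + 1))) (s + 1) (reduce z))
        (φ (l + 1) (reduce (flow χ (1, z))) - φ (l + 1) (reduce z)) := by
      refine key (g := fun w => φ (l + 1) (reduce w)) (fun j => ?_) ?_ fun j z hz => ?_
      · rcases Nat.eq_zero_or_pos j with rfl | hj
        · rw [Pi.single_eq_same]; exact hd.mono hactR
        · rw [Pi.single_eq_of_ne hj.ne']; exact differentiableOn_const 0
      · exact hd.comp (reduceCLM n).differentiable.differentiableOn fun z hz => reduce_mem hz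
      · rw [hbr hd j z hz, Pi.single_eq_of_ne (Nat.succ_ne_zero j), Pi.single_eq_same,
          Pi.zero_apply, zero_add]
    have h2 := (hasSum_nat_add_iff (f := fun m => chain χ (Pi.single 0 (φ (l + 1))) m (reduce z))
      1).1 h1
    simpa [chain_zero] using h2
  have hflow : reduce (flow χ (1, z)) ∈ levelReduced V δ σ 0 :=
    reduce_mem (hvΩ 1 (by rw [mem_ball_zero_iff, norm_one]; norm_num) z hzD)
  have k4 : HasSum (fun l => φ (l + 1) (reduce (flow χ (1, z)))) (F (reduce (flow χ (1, z)))) := by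
    have := (hasSum_nat_add_iff' 1).2 (hF _ hflow)
    simpa [hφ0] using this
  have k5 := hasSum_antidiagonal (ne_top_of_le_ne_top hφχ (ENNReal.tsum_le_tsum fun l =>
    ENNReal.tsum_le_tsum fun m => (hχ1 l m).enorm_le (reduce_mem hz))) k3 k4
  have k2' : HasSum (fun s => chain χ (timeSource χ) s (reduce z))
      ((flow χ (1, z)).2.1 - z.2.1) := by
    have := (hasSum_nat_add_iff (f := fun s => chain χ (timeSource χ) s (reduce z)) 1).1 k2
    simpa [chain_zero, timeSource_of_eq_zero hχ0] using this
  have h6 := (k1.add (k2'.mul_left μ)).add k5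
  have h7 : h (flow χ (1, z)).1 + μ * (flow χ (1, z)).2.1 + F (reduce (flow χ (1, z))) - h z.1 -
      μ * z.2.1 = h (flow χ (1, z)).1 - h z.1 + μ * ((flow χ (1, z)).2.1 - z.2.1) +
        F (reduce (flow χ (1, z))) := by ring
  rw [h7]
  exact h6

end Transform

/-! ### The canonical map and its inverse -/

section CanonicalMap

open Metric Set Filter Topology

variable {V : Set (Fin n → ℝ)} {δ σ : ℝ} {χ : ℕ → Reduced n → ℂ}

/-- Rescaling of the coordinates by the unit of width of the domains. -/
def rescale (hδ : 0 < δ) (hσ : 0 < σ) : Phase n ≃L[ℂ] Phase n :=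
  let a : ℂˣ := Units.mk0 (((δ / 4)⁻¹ : ℝ) : ℂ) (by
    rw [Complex.ofReal_ne_zero]; positivity)
  let c : ℂˣ := Units.mk0 (((9 / 20 * σ)⁻¹ : ℝ) : ℂ) (by
    rw [Complex.ofReal_ne_zero]; positivity)
  (ContinuousLinearEquiv.smulLeft a).prodCongr ((ContinuousLinearEquiv.smulLeft a).prodCongr
    ((ContinuousLinearEquiv.smulLeft c).prodCongr (ContinuousLinearEquiv.smulLeft c)))

theorem norm_rescale_le_iff (hδ : 0 < δ) (hσ : 0 < σ) {a : ℝ} {v : Phase n} :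
    ‖rescale hδ hσ v‖ ≤ a ↔ IsSmall δ σ a v := by
  have key : ∀ {W : Type} [NormedAddCommGroup W] [NormedSpace ℂ W] (c : ℝ) (_ : 0 < c) (x : W),
      ‖((c⁻¹ : ℝ) : ℂ) • x‖ ≤ a ↔ ‖x‖ ≤ c * a := by
    intro W _ _ c hc x
    rw [norm_smul, Complex.norm_real, Real.norm_of_nonneg (inv_nonneg.2 hc.le),
      inv_mul_le_iff₀ hc]
  have h1 : rescale hδ hσ v = ((((δ / 4)⁻¹ : ℝ) : ℂ) • v.1, (((δ / 4)⁻¹ : ℝ) : ℂ) • v.2.1,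
      (((9 / 20 * σ)⁻¹ : ℝ) : ℂ) • v.2.2.1, (((9 / 20 * σ)⁻¹ : ℝ) : ℂ) • v.2.2.2) := rfl
  rw [h1]
  simp only [norm_prod_le_iff, key (δ / 4) (by positivity), key (9 / 20 * σ) (by positivity)]
  exact ⟨fun h => ⟨h.1, h.2.1, h.2.2.1, h.2.2.2⟩, fun h => ⟨h.1, h.2, h.3, h.4⟩⟩

/-- `exists_analytic_inverse` in the coordinates in which the domains are balls of radii measured in
`δ` and `σ`; real points form the closed set that the iteration preserves. -/
theorem exists_inverse_of_isSmall (hδ : 0 < δ) (hσ : 0 < σ) {C : Phase n → Phase n}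
    (hC : DifferentiableOn ℂ C (levelDomain V δ σ (3 / 4))) {U : ℝ} (hU : U < 1 / 16)
    (hCU : ∀ z ∈ levelDomain V δ σ (3 / 4), IsSmall δ σ U (C z - z)) :
    ∃ C' : Phase n → Phase n, (∀ z ∈ levelDomain V δ σ 1,
        C (C' z) = z ∧ IsSmall δ σ U (C' z - z) ∧ AnalyticAt ℂ C' z) ∧
      (∀ z ∈ levelDomain V δ σ 1, C' (C z) = z) ∧
      (∀ z ∈ levelDomain V δ σ 1, ∀ y, IsSmall δ σ (1 / 16) (y - z) → C y = z → y = C' z) ∧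
      ((∀ z ∈ levelDomain V δ σ (3 / 4), IsRealPoint z → IsRealPoint (C z)) →
        ∀ z ∈ levelDomain V δ σ 1, IsRealPoint z → IsRealPoint (C' z)) := by
  set S : Phase n ≃L[ℂ] Phase n := rescale hδ hσ
  set Ω : Set (Phase n) := S.symm ⁻¹' levelDomain V δ σ (3 / 4)
  have hΩ : IsOpen Ω := (isOpen_domain _ _ _).preimage S.symm.continuous
  have hsm : ∀ {a : ℝ} {v : Phase n}, ‖v‖ ≤ a → IsSmall δ σ a (S.symm v) := fun {a v} hv =>
    (norm_rescale_le_iff hδ hσ).1 (by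
      change ‖S (S.symm v)‖ ≤ a
      rwa [S.apply_symm_apply])
  obtain ⟨C₁, h1, h2, h3, h4⟩ := exists_analytic_inverse (a := 1 / 16) (U := U)
    (D := S.symm ⁻¹' levelDomain V δ σ 1) (C := fun w => S (C (S.symm w))) (by norm_num) hU hΩ
    (fun z hz v hv => by
      change S.symm (z + v) ∈ levelDomain V δ σ (3 / 4)
      rw [map_add]
      refine add_mem_levelDomain hz ?_
      exact hsm (by linarith))
    ((S : Phase n →L[ℂ] Phase n).differentiable.comp_differentiableOn
      (hC.comp (S.symm : Phase n →L[ℂ] Phase n).differentiable.differentiableOn fun z hz => hz))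
    (fun z hz => by
      have := (norm_rescale_le_iff hδ hσ).2 (hCU _ hz)
      change ‖S (C (S.symm z) - S.symm z)‖ ≤ U at this
      rwa [map_sub, S.apply_symm_apply] at this)
  have hmem : ∀ {z : Phase n} {u : ℝ}, z ∈ levelDomain V δ σ u →
      S z ∈ S.symm ⁻¹' levelDomain V δ σ u := fun {z u} hz => by
    rwa [mem_preimage, S.symm_apply_apply]
  refine ⟨fun z => S.symm (C₁ (S z)), fun z hz => ?_, fun z hz => ?_, fun z hz y hy hCy => ?_,
    fun hreal z hz hzr => ?_⟩
  · obtain ⟨e1, e2, e3⟩ := h1 (S z) (hmem hz)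
    refine ⟨S.injective e1, ?_, ?_⟩
    · have := hsm e2
      rwa [map_sub, S.symm_apply_apply] at this
    · exact ((S.symm : Phase n →L[ℂ] Phase n).analyticAt _).comp
        (e3.comp ((S : Phase n →L[ℂ] Phase n).analyticAt z))
  · have := h2 (S z) (hmem hz)
    simp only [S.symm_apply_apply] at this ⊢
    rw [this, S.symm_apply_apply]
  · have := h3 (S z) (hmem hz) (S y) (by
      rw [← map_sub]
      exact (norm_rescale_le_iff hδ hσ).2 hy) (by rw [S.symm_apply_apply, hCy])
    change y = S.symm (C₁ (S z))
    rw [← this, S.symm_apply_apply]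
  · have := h4 (S.symm ⁻¹' {z | IsRealPoint z})
      (isRealForm_phase.isClosed.preimage S.symm.continuous) (fun w hw y hy hyΩ => by
        change S.symm (w + (y - S (C (S.symm y)))) ∈ {z : Phase n | IsRealPoint z}
        rw [map_add, map_sub, S.symm_apply_apply]
        exact isRealForm_phase.add_mem _ hw _ (isRealForm_phase.sub_mem hy (hreal _ hyΩ hy)))
      (S z) (hmem hz) (by
        change S.symm (S z) ∈ {z : Phase n | IsRealPoint z}
        rwa [S.symm_apply_apply])
    exact this

theorem IsSmall.norm_le (hδ : 0 < δ) (hδ' : δ ≤ 1) (hσ : 0 < σ) (hσ' : σ ≤ 1) {a : ℝ}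
    {v : Phase n} (hv : IsSmall δ σ a v) : ‖v‖ ≤ a := by
  have ha : 0 ≤ a := (norm_nonneg _).trans ((norm_rescale_le_iff hδ hσ).2 hv)
  have h1 : δ / 4 * a ≤ a := mul_le_of_le_one_left ha (by linarith)
  have h2 : 9 / 20 * σ * a ≤ a := mul_le_of_le_one_left ha (by linarith)
  simp only [norm_prod_le_iff]
  exact ⟨hv.1.trans h1, hv.2.trans h1, hv.3.trans h2, hv.4.trans h2⟩

theorem IsSmall.mono (hδ : 0 < δ) (hσ : 0 < σ) {a a' : ℝ} {v : Phase n} (hv : IsSmall δ σ a v)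
    (h : a ≤ a') : IsSmall δ σ a' v :=
  (norm_rescale_le_iff hδ hσ).1 (((norm_rescale_le_iff hδ hσ).2 hv).trans h)

theorem add_mem_domain {ρ ρ' τ τ' a : ℝ} {z v : Phase n} (hz : z ∈ domain V ρ τ)
    (hv : IsSmall δ σ a v) (hρ : δ / 4 * a ≤ ρ' - ρ) (hτ : 9 / 20 * σ * a ≤ τ' - τ) :
    z + v ∈ domain V ρ' τ' :=
  ⟨add_mem_actionNhd hz.1 (hv.action.trans hρ), add_mem_strip hz.2.1 (hv.energy.trans hρ),
    fun j => add_mem_strip (hz.2.2.1 j) ((norm_le_pi_norm v.2.2.1 j).trans (hv.angle.trans hτ)),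
    add_mem_strip hz.2.2.2 (hv.time.trans hτ)⟩

theorem image_subset_of_isSmall {ρ ρ' τ τ' a : ℝ} {C : Phase n → Phase n}
    (hC : ∀ z ∈ domain V ρ τ, IsSmall δ σ a (C z - z)) (hρ : δ / 4 * a ≤ ρ' - ρ)
    (hτ : 9 / 20 * σ * a ≤ τ' - τ) : C '' domain V ρ τ ⊆ domain V ρ' τ' := by
  rintro _ ⟨z, hz, rfl⟩
  have := add_mem_domain hz (hC z hz) hρ hτ
  rwa [add_sub_cancel] at this

theorem subset_image_of_isSmall {ρ ρ' τ τ' a : ℝ} {C C' : Phase n → Phase n} (hρρ : ρ' ≤ ρ)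
    (hττ : τ' ≤ τ) (hC' : ∀ z ∈ domain V ρ τ, IsSmall δ σ a (C' z - z))
    (hCC' : ∀ z ∈ domain V ρ τ, C (C' z) = z) (hρ : δ / 4 * a ≤ ρ - ρ')
    (hτ : 9 / 20 * σ * a ≤ τ - τ') : domain V ρ' τ' ⊆ C '' domain V ρ τ := by
  intro z hz
  have hz' : z ∈ domain V ρ τ := ⟨actionNhd_mono V hρρ hz.1, strip_mono hρρ hz.2.1,
    angleStrip_mono hττ hz.2.2.1, strip_mono hττ hz.2.2.2⟩
  refine ⟨C' z, ?_, hCC' z hz'⟩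
  have := add_mem_domain hz (hC' z hz') hρ hτ
  rwa [add_sub_cancel] at this

theorem add_angleShift_mem {ρ τ : ℝ} {z : Phase n} (hz : z ∈ domain V ρ τ) (k : Fin n → ℤ) :
    z + angleShift k ∈ domain V ρ τ := by
  refine ⟨?_, ?_, fun j => ?_, ?_⟩
  · simpa [angleShift] using hz.1
  · simpa [angleShift] using hz.2.1
  · have h1 : (2 * (Real.pi : ℂ) * (k j : ℂ)).im = 0 := by
      have : 2 * (Real.pi : ℂ) * (k j : ℂ) = ((2 * Real.pi * k j : ℝ) : ℂ) := by push_cast; rfl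
      rw [this, Complex.ofReal_im]
    have h2 := hz.2.2.1 j
    simp only [strip, mem_ofPred_eq, angleShift, Prod.snd_add, Prod.fst_add, Pi.add_apply,
      Complex.add_im, h1, add_zero] at h2 ⊢
    exact h2
  · simpa [angleShift] using hz.2.2.2

/-- The time-one map of the Lie transform, with its inverse. -/
theorem exists_canonical_inverse (hδ : 0 < δ) (hσ : 0 < σ) {r : ℕ} (hχr : ∀ j, r < j → χ j = 0)
    (hχ : ∀ j, DifferentiableOn ℂ (χ j) (levelReduced V δ σ (3 / 4)))
    (hper : ∀ j, IsAnglePeriodic (χ j))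
    (hv : IsTransported (fields χ) r (5 / 4) (levelDomain V δ σ (3 / 4)) (flow χ))
    (hv0 : ∀ z, flow χ (0, z) = z) {U : ℝ} (hU : U < 1 / 16)
    (hs : ∀ z ∈ levelDomain V δ σ (3 / 4),
      HasSum (fun s => (1 : ℂ) ^ s • fieldOperator (fields χ) id s z) (flow χ (1, z)) ∧
      IsSmall δ σ U (flow χ (1, z) - z)) :
    ∃ C' : Phase n → Phase n, IsCanonical (levelDomain V δ σ 1) (fun z => flow χ (1, z)) ∧
      IsCanonical (levelDomain V δ σ 1) C' ∧
      (∀ z ∈ levelDomain V δ σ 1, C' (flow χ (1, z)) = z) ∧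
      (∀ z ∈ levelDomain V δ σ 1, flow χ (1, C' z) = z) ∧
      (∀ z ∈ levelDomain V δ σ 1, IsSmall δ σ U (C' z - z)) ∧
      ((∀ z ∈ levelDomain V δ σ (3 / 4), IsRealPoint z → IsRealPoint (flow χ (1, z))) →
        ∀ z ∈ levelDomain V δ σ 1, IsRealPoint z → IsRealPoint (C' z)) := by
  have h1b : (1 : ℂ) ∈ ball (0 : ℂ) (5 / 4) := by rw [mem_ball_zero_iff, norm_one]; norm_num
  have hΩ : IsOpen (levelDomain V δ σ (3 / 4)) := isOpen_domain _ _ _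
  have hD : IsOpen (levelDomain V δ σ 1) := isOpen_domain _ _ _
  have hsub : levelDomain V δ σ 1 ⊆ levelDomain V δ σ (3 / 4) :=
    levelDomain_anti hδ hσ (by norm_num)
  have hC : DifferentiableOn ℂ (fun z => flow χ (1, z)) (levelDomain V δ σ (3 / 4)) :=
    hv.differentiableOn.comp (by fun_prop) fun z hz => ⟨h1b, hz⟩
  have hsymp : ∀ z ∈ levelDomain V δ σ (3 / 4), ∀ u w : Phase n,
      symplecticForm (fderiv ℂ (fun z => flow χ (1, z)) z u)
        (fderiv ℂ (fun z => flow χ (1, z)) z w) = symplecticForm u w := fun z hz u w =>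
    flow_symplectic hχr hχ hv hv0 h1b hz u w
  have hshift : ∀ z ∈ levelDomain V δ σ (3 / 4), ∀ k : Fin n → ℤ,
      flow χ (1, z + angleShift k) = flow χ (1, z) + angleShift k := fun z hz k =>
    flow_add_angleShift hper (hs z hz).1.summable k
  obtain ⟨C', h1, h2, h3, h4⟩ := exists_inverse_of_isSmall hδ hσ hC hU fun z hz => (hs z hz).2
  have hC' : ∀ z ∈ levelDomain V δ σ 1, C' z ∈ levelDomain V δ σ (3 / 4) := by
    intro z hz
    have := add_mem_levelDomain (u := 3 / 4) hz
      ((h1 z hz).2.1.mono hδ hσ (show U ≤ 1 - 3 / 4 by linarith))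
    rwa [add_sub_cancel] at this
  refine ⟨C', ⟨?_, fun z hz => hsymp z (hsub hz), fun z hz => hshift z (hsub hz)⟩,
    ⟨fun z hz => (h1 z hz).2.2, fun z hz u w => ?_, fun z hz k => ?_⟩, h2, fun z hz => (h1 z hz).1,
    fun z hz => (h1 z hz).2.1, h4⟩
  · exact (analyticOnNhd_of_differentiableOn hΩ hC).mono hsub
  · -- differentiate `C ∘ C' = id`
    have e1 : (fun z => flow χ (1, C' z)) =ᶠ[𝓝 z] id := by
      filter_upwards [hD.mem_nhds hz] with y hy
      exact (h1 y hy).1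
    have e2 : HasFDerivAt (fun z => flow χ (1, C' z)) ((fderiv ℂ (fun z => flow χ (1, z)) (C' z)).comp
        (fderiv ℂ C' z)) z :=
      (hC.differentiableAt (hΩ.mem_nhds (hC' z hz))).hasFDerivAt.comp z
        (h1 z hz).2.2.differentiableAt.hasFDerivAt
    have e3 : ∀ u, fderiv ℂ (fun z => flow χ (1, z)) (C' z) (fderiv ℂ C' z u) = u := by
      intro u
      have := e2.fderiv.symm.trans (e1.fderiv_eq.trans fderiv_id)
      exact congrArg (fun A : Phase n →L[ℂ] Phase n => A u) this
    have e4 := hsymp (C' z) (hC' z hz) (fderiv ℂ C' z u) (fderiv ℂ C' z w)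
    rw [e3, e3] at e4
    exact e4.symm
  · refine (h3 (z + angleShift k) (add_angleShift_mem hz k) _ ?_ ?_).symm
    · rw [add_sub_add_right_eq_sub]
      exact (h1 z hz).2.1.mono hδ hσ hU.le
    · rw [hshift _ (hC' z hz), (h1 z hz).1]

end CanonicalMap

/-! ### Choice of the weights -/

section Weights

/-- The weight per order is the inverse of the small parameter. It is large, it is compensated by
the exponential decay of the Fourier coefficients over `K` harmonics, and it leaves the
perturbation small. -/
theorem weight_bounds {r K : ℕ} {α δ σ L : ℝ} (hα : 0 < α) (hδ : 0 < δ) (hσ : 0 < σ) (hL : 0 ≤ L)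
    (hK : (8 + 3 * Real.exp 1 ^ 2)⁻¹ ≤ Real.exp (-(K * (σ / 2))))
    (hΔ : deltaParam r K α δ σ L ≤ 1 / 2) :
    0 < K ∧ 0 < deltaParam r K α δ σ L ∧ 2 ≤ (deltaParam r K α δ σ L)⁻¹ ∧
      (deltaParam r K α δ σ L)⁻¹ ≤ 8 ∧
      (deltaParam r K α δ σ L)⁻¹ ≤ Real.exp (3 / 10 * K * σ) ∧
      256 * (r * L * (deltaParam r K α δ σ L)⁻¹ / (α * δ * σ)) ≤ 3 / 4 := by
  set q := Real.exp (-(K * (σ / 2)))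
  set Δ := deltaParam r K α δ σ L
  have he : Real.exp 1 ^ 2 ≤ 8 := by
    have h1 := Real.exp_one_lt_d9
    have h0 := Real.exp_pos 1
    nlinarith
  have hq : 1 / 32 ≤ q := by
    refine le_trans ?_ hK
    rw [one_div]
    refine inv_anti₀ (by positivity) (by linarith)
  have hP0 : 0 ≤ 256 * (r * L / (α * δ * σ)) := by positivity
  have hPq : Δ = 256 * (r * L / (α * δ * σ)) + 4 * q := by
    simp only [Δ, q, deltaParam]
    ring
  have hΔ0 : 0 < Δ := by linarith
  have hK0 : 0 < K := by
    rcases Nat.eq_zero_or_pos K with h | h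
    · have : q = 1 := by simp [q, h]
      linarith
    · exact h
  have hθ := mul_inv_cancel₀ hΔ0.ne'
  have hθ0 : 0 < Δ⁻¹ := inv_pos.2 hΔ0
  have hθ2 : 2 ≤ Δ⁻¹ := by nlinarith
  refine ⟨hK0, hΔ0, hθ2, ?_, ?_, ?_⟩
  · nlinarith
  · -- `exp (K σ / 5) ≤ 4`, as `exp (K σ) = q⁻² ≤ 4 ^ 5`
    have h1 : Real.exp (1 / 5 * K * σ) ≤ 4 := by
      refine le_of_pow_le_pow_left₀ (n := 5) (by norm_num) (by norm_num) ?_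
      have h2 : Real.exp (1 / 5 * K * σ) ^ 5 * q ^ 2 = 1 := by
        rw [← Real.exp_nat_mul, ← Real.exp_nat_mul, ← Real.exp_add, Real.exp_eq_one_iff]
        push_cast
        ring
      have h3 : (1 / 32) ^ 2 ≤ q ^ 2 := pow_le_pow_left₀ (by norm_num) hq 2
      have h4 : 0 ≤ Real.exp (1 / 5 * K * σ) ^ 5 := by positivity
      nlinarith
    have h2 : Real.exp (3 / 10 * K * σ) * Real.exp (1 / 5 * K * σ) * q = 1 := by
      rw [← Real.exp_add, ← Real.exp_add, Real.exp_eq_one_iff]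
      ring
    have h3 : 0 < Real.exp (3 / 10 * K * σ) := Real.exp_pos _
    have hq0 : 0 < q := Real.exp_pos _
    have h4 : 1 ≤ Real.exp (3 / 10 * K * σ) * Δ := by
      calc 1 = Real.exp (3 / 10 * K * σ) * (Real.exp (1 / 5 * K * σ) * q) := by
            rw [← mul_assoc, h2]
        _ ≤ Real.exp (3 / 10 * K * σ) * (4 * q) := by gcongr
        _ ≤ _ := by gcongr; linarith
    rwa [inv_le_iff_one_le_mul₀ hΔ0]
  · have h1 : 256 * (r * L * Δ⁻¹ / (α * δ * σ)) = (Δ - 4 * q) * Δ⁻¹ := by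
      rw [hPq]
      ring
    rw [h1]
    nlinarith

/-- The size of the generating functions, in units of the widths of the domains. -/
theorem generator_bounds {r : ℕ} {α δ σ A θ μ : ℝ} (hα : 0 < α) (hδ : 0 < δ) (hδ' : δ ≤ 1)
    (hσ : 0 < σ) (hA : 0 ≤ A) (hθ : 0 ≤ θ) (hμ : 0 ≤ μ)
    (h : 256 * (r * (μ + Real.exp 1 * A) * θ / (α * δ * σ)) ≤ 3 / 4) :
    12 * r * bracketConst δ σ * (1 / α * (7 / 5 * (A * θ))) ≤ 1 / 8 ∧
    θ * μ * (8 / 7 * (80 * r / (9 * σ) * (1 / α))) ≤ 3 / 100 := by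
  have he := Real.exp_one_gt_d9
  have he0 := Real.exp_pos 1
  have hr : (0 : ℝ) ≤ r := Nat.cast_nonneg r
  have hsplit : r * (μ + Real.exp 1 * A) * θ / (α * δ * σ) =
      r * μ * θ / (α * δ * σ) + Real.exp 1 * (r * A * θ / (α * δ * σ)) := by ring
  rw [hsplit] at h
  have p1 : 0 ≤ r * μ * θ / (α * δ * σ) := by positivity
  have p2 : 0 ≤ r * A * θ / (α * δ * σ) := by positivity
  constructor
  · have e1 : 12 * r * bracketConst δ σ * (1 / α * (7 / 5 * (A * θ))) * (3 * Real.exp 1 ^ 2) =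
        896 * (Real.exp 1 * (r * A * θ / (α * δ * σ))) := by
      unfold bracketConst
      field_simp
      ring
    have e2 : 896 * (Real.exp 1 * (r * A * θ / (α * δ * σ))) ≤ 896 * (3 / 1024) := by
      linarith
    have e3 : (7 : ℝ) ≤ Real.exp 1 ^ 2 := by nlinarith
    have e4 : 0 ≤ 12 * r * bracketConst δ σ * (1 / α * (7 / 5 * (A * θ))) := by
      have := bracketConst_pos hδ hσ
      positivity
    nlinarith
  · have e1 : θ * μ * (8 / 7 * (80 * r / (9 * σ) * (1 / α))) =
        640 / 63 * δ * (r * μ * θ / (α * δ * σ)) := by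
      field_simp
      ring
    have e2 : Real.exp 1 * (r * A * θ / (α * δ * σ)) ≥ 0 := by positivity
    rw [e1]
    have e3 : r * μ * θ / (α * δ * σ) ≤ 3 / 1024 := by linarith
    have e4 : 640 / 63 * δ * (r * μ * θ / (α * δ * σ)) ≤ 640 / 63 * (3 / 1024) :=
      mul_le_mul (by linarith) e3 p1 (by norm_num)
    linarith

/-- Smallness of the displacement: the available width `L` exceeds the minimal one by an amount of
the order `1 / r`. -/
theorem displacement_bounds {r : ℕ} (hr : 0 < r) {B X L : ℝ}
    (hBX : 12 * r * B * X ≤ 1 / 8) (hL : 1 / 4 + 1 / (4 * r) ≤ L) :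
    B * X ≤ 1 / 96 ∧ B * X ≤ L ^ 2 / 24 ∧ B * X ≤ L / 48 := by
  have hr' : (1 : ℝ) ≤ r := by exact_mod_cast hr
  set x : ℝ := 1 / r
  have hx0 : 0 < x := by positivity
  have hx1 : r * x = 1 := by simp only [x]; field_simp
  have hL' : 1 / 4 + x / 4 ≤ L := by
    refine le_trans (le_of_eq ?_) hL
    simp only [x]
    field_simp
  have h0 : B * X ≤ x / 96 := by
    have h1 : 12 * (B * X) = (12 * r * B * X) * x := by
      calc _ = 12 * B * X * (r * x) := by rw [hx1]; ring
        _ = _ := by ring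
    nlinarith
  have hx2 : x ≤ 1 := by nlinarith
  have hL0 : 0 ≤ L := by linarith
  have hLs : (1 / 4 + x / 4) ^ 2 ≤ L ^ 2 := pow_le_pow_left₀ (by linarith) hL' 2
  exact ⟨by linarith, by nlinarith [sq_nonneg (1 - x)], by linarith⟩

end Weights

/-! ### The normal form -/

section NormalForm

open Metric Set Filter Topology

variable {V : Set (Fin n → ℝ)} {δ σ α : ℝ} {h : (Fin n → ℂ) → ℂ} {M : Set (Fin n → ℤ)}
  {φ : ℕ → Reduced n → ℂ} {r K : ℕ} {A θ μ : ℝ}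

/-- As `χ_0 = 0`, passing from the weight `θ ≥ 2` to the weight `5/4` gains a factor `5/8`.
A weight larger than `1` makes the Lie series converge in a disc of times containing `1`. -/
theorem bound_zero_order {χ : ℕ → Reduced n → ℂ} {b : ℝ} (hσ : 0 < σ) (hb : b ≤ 1)
    (hχ0 : χ 0 = 0) (hθ : 2 ≤ θ) :
    ∑' s, ENNReal.ofReal (5 / 4) ^ s * levelNorm V δ σ b (χ s) ≤
      ENNReal.ofReal (5 / 8) * ∑' s, ENNReal.ofReal θ ^ s * levelNorm V δ σ b (χ s) := by
  rw [← ENNReal.tsum_mul_left]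
  refine ENNReal.tsum_le_tsum fun s => ?_
  cases s with
  | zero => rw [hχ0, (isFourierAt_zero hσ hb).2]; simp
  | succ s =>
    rw [← mul_assoc, ← ENNReal.ofReal_pow (by norm_num), ← ENNReal.ofReal_pow (by linarith),
      ← ENNReal.ofReal_mul (by norm_num)]
    refine mul_le_mul' (ENNReal.ofReal_le_ofReal ?_) le_rfl
    have h1 : (5 / 4 : ℝ) ^ s ≤ θ ^ s := pow_le_pow_left₀ (by norm_num) (by linarith) s
    rw [pow_succ, pow_succ]
    have h2 : 0 ≤ θ ^ s := by positivity
    nlinarith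

/-- The generating functions, the flow they define, and the terms of the transformed Hamiltonian. -/
theorem exists_normalForm_flow (hδ : 0 < δ) (hσ : 0 < σ) (hα : 0 < α)
    (hh : DifferentiableOn ℂ h (actionNhd V δ))
    (hres : ∀ k : Fin n → ℤ, k ∉ M → absSum k < r * K → ∀ I ∈ actionNhd V δ,
      α < ‖∑ i, frequency h I i * (k i : ℂ)‖)
    (hφ0 : φ 0 = 0) (hφ : ∀ l, IsFourierAt V δ σ 0 (φ l))
    (hφt : ∀ l, IsTrigAt V δ σ 0 (l * K) (φ l)) (hA : 0 ≤ A) (hθ : 2 ≤ θ) (hμ : 0 ≤ μ)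
    (hT : ∑' l, ENNReal.ofReal θ ^ l * levelNorm V δ σ 0 (φ l) ≤ ENNReal.ofReal (A * θ))
    (hn1 : 12 * r * bracketConst δ σ * (1 / α * (7 / 5 * (A * θ))) ≤ 1 / 8)
    (hn2 : θ * μ * (8 / 7 * (80 * r / (9 * σ) * (1 / α))) ≤ 3 / 100)
    {F : Reduced n → ℂ} (hF : ∀ p ∈ levelReduced V δ σ 0, HasSum (fun l => φ l p) (F p)) :
    ∃ χ : ℕ → Reduced n → ℂ, χ 0 = 0 ∧ (∀ s, r < s → χ s = 0) ∧
      (∀ s, 1 ≤ s → s ≤ r →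
        χ s = multiplier (solveSymbol h M (s * K)) (obstruction h μ φ χ s)) ∧
      (∀ s, IsFourierAt V δ σ (3 / 4) (χ s)) ∧ (∀ s, IsTrigAt V δ σ (3 / 4) (s * K) (χ s)) ∧
      IsTransported (fields χ) r (5 / 4) (levelDomain V δ σ (3 / 4)) (flow χ) ∧
      (∀ z, flow χ (0, z) = z) ∧
      (∃ U, U < 1 / 16 ∧ U ≤ 21 / 4 * Real.exp 1 * bracketConst δ σ * (1 / α) * (A * θ) ∧
        ∀ z ∈ levelDomain V δ σ (3 / 4),
          HasSum (fun s => (1 : ℂ) ^ s • fieldOperator (fields χ) id s z) (flow χ (1, z)) ∧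
          IsSmall δ σ U (flow χ (1, z) - z)) ∧
      (∀ s, IsFourierAt V δ σ 1 (orderTerm h μ φ χ s)) ∧
      ∑' s, ENNReal.ofReal θ ^ s * levelNorm V δ σ 1 (orderTerm h μ φ χ s) ≤
        ENNReal.ofReal (8 * (A * θ)) ∧
      (∀ s, 1 ≤ s → s ≤ r → HasHarmonicsIn {k | k ∈ M ∧ absSum k ≤ r * K} V (actionWidth δ 1)
        (angleWidth σ 1) (orderTerm h μ φ χ s)) ∧
      ∀ z ∈ levelDomain V δ σ 1, HasSum (fun s => orderTerm h μ φ χ (s + 1) (reduce z))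
        (h (flow χ (1, z)).1 + μ * (flow χ (1, z)).2.1 + F (reduce (flow χ (1, z))) -
          h z.1 - μ * z.2.1) := by
  have hB := bracketConst_pos hδ hσ
  have he := Real.exp_pos 1
  have hθ0 : (0 : ℝ) ≤ θ := by linarith
  have hr0 : (0 : ℝ) ≤ r := Nat.cast_nonneg r
  set w : ℝ≥0∞ := ENNReal.ofReal θ
  have hw1 : 1 ≤ w := by
    rw [← ENNReal.ofReal_one]
    exact ENNReal.ofReal_le_ofReal (by linarith)
  have hμe : ‖(μ : ℂ)‖ₑ = ENNReal.ofReal μ := enorm_ofReal_complex hμ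
  set Y : ℝ := 1 / α * (7 / 5 * (A * θ))
  have hY : 0 ≤ Y := by positivity
  have hYe : ENNReal.ofReal (1 / α) * (ENNReal.ofReal (7 / 5) * ENNReal.ofReal (A * θ)) =
      ENNReal.ofReal Y := by
    rw [← ENNReal.ofReal_mul (by norm_num), ← ENNReal.ofReal_mul (by positivity)]
  obtain ⟨χ, hχ0, hχr, hχ, hχF, hχt, hqF, hχs, hqs, hZ⟩ := exists_normalForm_generators
    (w := w) (μ := (μ : ℂ)) hδ hσ hα hh hres hφ hφt hT
    (by
      rw [hYe, ← ENNReal.ofReal_mul (by positivity)]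
      exact ENNReal.ofReal_le_ofReal hn1)
    (by
      rw [hμe, ← ENNReal.ofReal_mul hθ0, ← ENNReal.ofReal_mul (p := 80 * r / (9 * σ)) (by positivity),
        ← ENNReal.ofReal_mul (p := 8 / 7) (by norm_num), ← ENNReal.ofReal_mul (by positivity)]
      exact ENNReal.ofReal_le_ofReal hn2)
  rw [hYe] at hχs
  rw [← ENNReal.ofReal_mul (by norm_num)] at hqs
  set b := level r r
  have hb0 : 0 ≤ b := level_nonneg r r
  have hb : b ≤ 1 / 2 := level_le_half le_rfl
  -- without generating functions nothing is displaced
  obtain ⟨X, hX0, hXY, hX, hXB, hXL, hXU, hXμ⟩ : ∃ X : ℝ, 0 ≤ X ∧ X ≤ Y ∧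
      ∑' s, w ^ s * levelNorm V δ σ b (χ s) ≤ ENNReal.ofReal X ∧
      bracketConst δ σ * X ≤ 1 / 96 ∧ bracketConst δ σ * X ≤ (3 / 4 - b) ^ 2 / 24 ∧
      bracketConst δ σ * X ≤ (3 / 4 - b) / 48 ∧ θ * μ * (200 / (9 * σ) * X) ≤ A * θ := by
    rcases Nat.eq_zero_or_pos r with hr | hr
    · refine ⟨0, le_rfl, hY, ?_, by simp, ?_, ?_, by rw [mul_zero, mul_zero]; positivity⟩
      · have hz : ∀ s, χ s = 0 := fun s => by
          rcases Nat.eq_zero_or_pos s with rfl | hs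
          · exact hχ0
          · exact hχr s (by omega)
        simp only [hz, (isFourierAt_zero (V := V) (δ := δ) hσ (show b ≤ 1 by linarith)).2, mul_zero,
          tsum_zero]
        exact zero_le
      · rw [mul_zero]; positivity
      · rw [mul_zero]; linarith
    · have hlev := level_self_le hr
      have hr1 : (1 : ℝ) ≤ r := by exact_mod_cast hr
      obtain ⟨d1, d2, d3⟩ := displacement_bounds (L := 3 / 4 - b) hr hn1 (by linarith)
      refine ⟨Y, hY, le_rfl, hχs, d1, d2, d3, ?_⟩
      have e1 : θ * μ * (200 / (9 * σ) * Y) =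
          (θ * μ * (1 / σ) * (1 / α)) * (280 / 9 * (A * θ)) := by
        simp only [Y]
        field_simp
        ring
      have e2 : θ * μ * (8 / 7 * (80 * r / (9 * σ) * (1 / α))) =
          (θ * μ * (1 / σ) * (1 / α)) * (640 / 63 * r) := by
        field_simp
        ring
      rw [e2] at hn2
      have e3 : 0 ≤ θ * μ * (1 / σ) * (1 / α) := by positivity
      have e4 : θ * μ * (1 / σ) * (1 / α) * (640 / 63 * 1) ≤
          θ * μ * (1 / σ) * (1 / α) * (640 / 63 * r) := by gcongr
      have e5 : θ * μ * (1 / σ) * (1 / α) ≤ 9 / 280 := by linarith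
      rw [e1]
      calc _ ≤ 9 / 280 * (280 / 9 * (A * θ)) := by gcongr
        _ = _ := by ring
  obtain ⟨o1, o2, o3, o4⟩ := isFourierAt_orderTerm_one (φ := φ) (μ := (μ : ℂ)) (w := w) (h := h)
    hδ hσ hb hχ0 hχF hqF hφ (by positivity) hX hqs hT hXB (by
      rw [hμe, ← ENNReal.ofReal_mul hθ0, ← ENNReal.ofReal_mul (by positivity)]
      exact ENNReal.ofReal_le_ofReal hXμ)
  set L := 3 / 4 - b
  have hL : 1 / 4 ≤ L := by simp only [L]; linarith
  have hL0 : 0 < L := by linarith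
  obtain ⟨f1, f2, f3⟩ := flow_estimate (b := b) (l := L / 2) (S := 5 / 8 * X) hδ hσ (by linarith)
    (by simp only [L]; linarith) (by positivity) hχ0 hχr hχF
    (by
      rw [ENNReal.ofReal_mul (by norm_num)]
      exact (bound_zero_order hσ (by linarith) hχ0 hθ).trans (mul_le_mul' le_rfl hX))
    (by
      have : 2 * bracketConst δ σ / (L / 2) ^ 2 * (5 / 8 * X) =
          5 * (bracketConst δ σ * X) / L ^ 2 := by field_simp; ring
      rw [this, div_le_iff₀ (by positivity)]
      linarith)
  rw [show b + 2 * (L / 2) = 3 / 4 by simp only [L]; ring] at f1 f3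
  set U := 3 / 4 * Real.exp 1 * bracketConst δ σ / (L / 2) * (5 / 8 * X)
  have hUe : U * L = 15 / 16 * Real.exp 1 * (bracketConst δ σ * X) := by
    simp only [U]
    field_simp
    ring
  have hU : U < 1 / 16 := by
    have h1 := Real.exp_one_lt_d9
    have h2 : 15 / 16 * Real.exp 1 * (bracketConst δ σ * X) ≤ 15 / 16 * Real.exp 1 * (L / 48) := by
      gcongr
    nlinarith
  have hχ' : ∀ s, IsFourierAt V δ σ (3 / 4) (χ s) := fun s => (hχF s).anti hδ hσ (by linarith)
  refine ⟨χ, hχ0, hχr, hχ, hχ', fun s => (hχt s).anti hδ hσ (by linarith) le_rfl, f1, f2,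
    ⟨U, hU, ?_, fun z hz => ?_⟩, o1, o2, fun s hs1 hs => ?_, fun z hz => ?_⟩
  · have h1 : U * (1 / 4) ≤ U * L := by
      have : 0 ≤ U := by positivity
      gcongr
    have h2 : 15 / 16 * Real.exp 1 * (bracketConst δ σ * X) ≤
        15 / 16 * Real.exp 1 * (bracketConst δ σ * Y) := by gcongr
    have h3 : 21 / 4 * Real.exp 1 * bracketConst δ σ * (1 / α) * (A * θ) =
        4 * (15 / 16 * Real.exp 1 * (bracketConst δ σ * Y)) := by simp only [Y]; ring
    linarith
  · have h1 := f3 1 (by rw [mem_ball_zero_iff, norm_one]; norm_num) z hz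
    exact ⟨h1.1, h1.2.1⟩
  · obtain ⟨Z, z1, z2, z3⟩ := hZ s hs1 hs
    obtain ⟨c, c1, c2⟩ := (z1.anti hδ hσ (show b ≤ 1 by linarith)).hasHarmonicsIn
      (S := {k | k ∈ M ∧ absSum k ≤ r * K}) fun k hk p hp => z2 k (by
        by_contra! hcon
        exact hk ⟨hcon.1, hcon.2.le.trans (Nat.mul_le_mul_right K hs)⟩) p
        (prod_mono (actionNhd_mono V (actionWidth_anti hδ (by linarith)))
          (strip_mono (angleWidth_anti hσ (by linarith))) hp)
    refine ⟨c, c1, fun p hp => ?_⟩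
    rw [z3 p (reducedDomain_mono V (actionWidth_anti hδ (by linarith))
      (angleWidth_anti hσ (by linarith)) hp)]
    exact c2 p hp
  · refine hasSum_orderTerm hδ hσ hh hχ0 hχr (fun j => (hχ' j).differentiableOn) hφ0 hφ f1 f2
      (fun t ht z hz => (f3 t ht z hz).2.1.mono hδ hσ (by linarith)) hF ?_ o4 hz
    refine ne_top_of_le_ne_top ENNReal.ofReal_ne_top (le_trans ?_ o3)
    refine ENNReal.tsum_le_tsum fun l => ENNReal.tsum_le_tsum fun m => ?_
    exact le_mul_of_one_le_left' (one_le_mul (one_le_pow₀ hw1) (one_le_pow₀ hw1))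

theorem hasHarmonicsIn_finset_sum {ρ τ : ℝ} {S : Set (Fin n → ℤ)} {ι : Type} (s : Finset ι)
    {F : ι → Reduced n → ℂ} (hF : ∀ i ∈ s, HasHarmonicsIn S V ρ τ (F i)) :
    HasHarmonicsIn S V ρ τ fun p => ∑ i ∈ s, F i p := by
  choose! c hc hs using hF
  refine ⟨fun k p => ∑ i ∈ s, c i k p, fun k hk => ?_, fun p hp => ?_⟩
  · exact Finset.analyticOnNhd_fun_sum s fun i hi => hc i hi k hk
  · simp only [Finset.sum_mul]
    exact hasSum_sum fun i hi => hs i hi p hp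

/-- Terms of order larger than `r` are small. -/
theorem exists_remainder (hσ : 0 < σ) {W : ℕ → Reduced n → ℂ} {N : ℝ}
    (hW : ∀ s, IsFourierAt V δ σ 1 (W s)) (hθ : 1 ≤ θ)
    (hs : ∑' s, ENNReal.ofReal θ ^ s * levelNorm V δ σ 1 (W s) ≤ ENNReal.ofReal N) (r : ℕ) :
    ∃ R, IsFourierAt V δ σ 1 R ∧ levelNorm V δ σ 1 R ≤ ENNReal.ofReal (N * θ⁻¹ ^ (r + 1)) ∧
      ∀ p ∈ levelReduced V δ σ 1, HasSum (fun s => W (s + r + 1) p) (R p) := by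
  have hθ0 : 0 < θ := by linarith
  have hsum : ∑' s, levelNorm V δ σ 1 (W (s + r + 1)) ≤ ENNReal.ofReal (N * θ⁻¹ ^ (r + 1)) := by
    have h1 : ∀ s, levelNorm V δ σ 1 (W (s + r + 1)) ≤ ENNReal.ofReal (θ⁻¹ ^ (r + 1)) *
        (ENNReal.ofReal θ ^ (s + r + 1) * levelNorm V δ σ 1 (W (s + r + 1))) := by
      intro s
      rw [← mul_assoc, ← ENNReal.ofReal_pow hθ0.le, ← ENNReal.ofReal_mul (by positivity)]
      refine le_mul_of_one_le_left' ?_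
      rw [← ENNReal.ofReal_one]
      refine ENNReal.ofReal_le_ofReal ?_
      have h2 : θ⁻¹ ^ (r + 1) * θ ^ (s + r + 1) = θ ^ s := by
        rw [show s + r + 1 = (r + 1) + s by omega, pow_add θ, ← mul_assoc, ← mul_pow,
          inv_mul_cancel₀ hθ0.ne', one_pow, one_mul]
      rw [h2]
      exact one_le_pow₀ hθ
    refine (ENNReal.tsum_le_tsum h1).trans ?_
    rw [ENNReal.tsum_mul_left, mul_comm N, ENNReal.ofReal_mul (by positivity)]
    refine mul_le_mul' le_rfl (le_trans ?_ hs)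
    exact ENNReal.tsum_comp_le_tsum_of_injective
      (f := fun s => s + r + 1) (fun a b hab => by simpa using hab)
      fun s => ENNReal.ofReal θ ^ s * levelNorm V δ σ 1 (W s)
  have hne := ne_top_of_le_ne_top ENNReal.ofReal_ne_top hsum
  have hR : ∀ p ∈ levelReduced V δ σ 1,
      HasSum (fun s => W (s + r + 1) p) (∑' s, W (s + r + 1) p) := by
    intro p hp
    refine Summable.hasSum (Summable.of_norm ?_)
    refine Summable.of_nonneg_of_le (fun _ => norm_nonneg _) (fun s => ?_)
      (ENNReal.summable_toReal hne)
    exact (hW _).norm_le hp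
  obtain ⟨h1, h2⟩ := isFourier_of_hasSum (angleWidth_pos hσ le_rfl) (fun s => hW (s + r + 1)) hne hR
  exact ⟨_, h1, h2.trans hsum, hR⟩

/-- The perturbation is real at all real points of the complex domain. -/
theorem isRealOn_of_isRegular {G : Set (Fin n → ℝ)} (hG : IsOpen G) (hVG : V ⊆ G) (hσ : 0 < σ)
    {f : Reduced n → ℂ} (hreg : IsRegular G δ σ h f)
    (hf : ∀ I ∈ G, ∀ (φ : Fin n → ℝ) (ξ : ℝ), (f (ofRealVec I, ofRealVec φ, ξ)).im = 0) {τ : ℝ} :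
    IsRealOn (reducedDomain V δ τ) f := by
  rintro ⟨I, ψ, ξ⟩ hp ⟨hI, hψ, hξ⟩
  have e1 : ψ = ofRealVec fun i => (ψ i).re := by
    funext i
    exact Complex.ext rfl (hψ i)
  have e2 : ξ = (ξ.re : ℂ) := Complex.ext rfl hξ
  have h2 : (0 : ℝ) < 2 * σ := by positivity
  rw [e1, e2]
  refine im_eq_zero_of_real (F := fun I => f (I, ofRealVec fun i => (ψ i).re, (ξ.re : ℂ)))
    hG hVG ?_ (fun I hI => hf I hI _ _) hp.1 hI
  refine hreg.analytic_f.differentiableOn.comp (by fun_prop) fun J hJ => ?_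
  exact ⟨actionNhd_subset hVG δ hJ, ofRealVec_mem_angleStrip h2 _, ofReal_mem_strip h2 _⟩

end NormalForm

end AperiodicNormalForm

end

open AperiodicNormalForm in
theorem theorem3p1 (n : ℕ) (G : Set (Fin n → ℝ)) (hG : IsOpen G)
    (δ σ : ℝ) (hδ : 0 < δ) (hδ' : δ ≤ 1) (hσ : 0 < σ) (hσ' : σ ≤ 1)
    (h : (Fin n → ℂ) → ℂ) (f : Reduced n → ℂ) (hreg : IsRegular G δ σ h f)
    (M : Set (Fin n → ℤ)) (hM : IsResonanceModule M)
    (r K : ℕ) (α : ℝ) (hα : 0 < α)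
    (V : Set (Fin n → ℝ)) (hVG : V ⊆ G) (hV : IsNonResonanceDomain h V M α δ (r * K))
    (hK : (8 + 3 * Real.exp 1 ^ 2)⁻¹ ≤ Real.exp (-(K * (σ / 2)))) :
    -- the constant of near-identity does not depend on `ε` and `μ`
    ∃ c : ℝ, ∀ ε μ : ℝ, 0 ≤ ε → 0 ≤ μ →
      deltaParam r K α δ σ (lambdaParam (fTilde G δ σ f) ε μ) ≤ 1 / 2 →
      ∃ (C C' : Phase n → Phase n) (χ : ℕ → Reduced n → ℂ) (Z R : Reduced n → ℂ),
        -- `C` and its inverse `C'` are analytic symplectic maps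
        IsCanonical (domain V (3 / 4 * δ) (3 / 4 * σ)) C ∧
        IsCanonical (domain V (3 / 4 * δ) (3 / 4 * σ)) C' ∧
        (∀ z ∈ domain V (3 / 4 * δ) (3 / 4 * σ), C' (C z) = z) ∧
        (∀ z ∈ domain V (3 / 4 * δ) (3 / 4 * σ), C (C' z) = z) ∧
        -- real Hamiltonians are transformed by real maps
        ((∀ I ∈ G, (h (ofRealVec I)).im = 0) →
          (∀ I ∈ G, ∀ (φ : Fin n → ℝ) (ξ : ℝ), (f (ofRealVec I, ofRealVec φ, ξ)).im = 0) →
          ∀ z ∈ domain V (3 / 4 * δ) (3 / 4 * σ), IsRealPoint z →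
            IsRealPoint (C z) ∧ IsRealPoint (C' z)) ∧
        -- closeness to the identity
        (∀ z ∈ domain V (3 / 4 * δ) (3 / 4 * σ), ‖C z - z‖ ≤ c * ε ∧ ‖C' z - z‖ ≤ c * ε) ∧
        -- nested domains, for `C` and for its inverse
        domain V (5 / 8 * δ) (5 / 8 * σ) ⊆ C '' domain V (3 / 4 * δ) (3 / 4 * σ) ∧
        C '' domain V (3 / 4 * δ) (3 / 4 * σ) ⊆ domain V (7 / 8 * δ) (7 / 8 * σ) ∧
        domain V (5 / 8 * δ) (5 / 8 * σ) ⊆ C' '' domain V (3 / 4 * δ) (3 / 4 * σ) ∧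
        C' '' domain V (3 / 4 * δ) (3 / 4 * σ) ⊆ domain V (7 / 8 * δ) (7 / 8 * σ) ∧
        -- `C` is the Lie transform of a finite generating sequence
        (∀ s, 1 ≤ s → s ≤ r →
          HasHarmonicsIn {k | absSum k < s * K} V (3 / 4 * δ) (3 / 4 * σ) (χ s)) ∧
        (∀ s, r < s → χ s = 0) ∧
        IsLieTransform (domain V (3 / 4 * δ) (3 / 4 * σ)) χ C ∧
        -- the normal form
        (∀ z ∈ domain V (3 / 4 * δ) (3 / 4 * σ),
          hamiltonian h f ε μ (C z) = h z.1 + μ * z.2.1 + Z (reduce z) + R (reduce z)) ∧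
        HasHarmonicsIn {k | k ∈ M ∧ absSum k ≤ r * K} V (3 / 4 * δ) (3 / 4 * σ) Z ∧
        AnalyticOnNhd ℂ R (reducedDomain V (3 / 4 * δ) (3 / 4 * σ)) ∧
        fourierNorm V (3 / 4 * δ) (3 / 4 * σ) R ≤
          ENNReal.ofReal (8 * ε * fTilde G δ σ f *
            deltaParam r K α δ σ (lambdaParam (fTilde G δ σ f) ε μ) ^ r) := by
  set F := fTilde G δ σ f
  have hF0 : 0 ≤ F := fTilde_nonneg G δ hσ f
  have hB := bracketConst_pos hδ hσ
  have he := Real.exp_pos 1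
  refine ⟨42 * Real.exp 1 * bracketConst δ σ * (1 / α) * F, fun ε μ hε hμ hΔ => ?_⟩
  have hA : 0 ≤ ε * F := mul_nonneg hε hF0
  have hlam : lambdaParam F ε μ = μ + Real.exp 1 * (ε * F) := by
    rw [lambdaParam]; ring
  have hlam0 : 0 ≤ lambdaParam F ε μ := by rw [hlam]; positivity
  obtain ⟨hK0, hΔ0, hθ2, hθ8, hθK, hθP⟩ := weight_bounds hα hδ hσ hlam0 hK hΔ
  set Δ := deltaParam r K α δ σ (lambdaParam F ε μ)
  set θ := Δ⁻¹
  have hθ0 : 0 ≤ θ := by linarith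
  rw [hlam] at hθP
  obtain ⟨hn1, hn2⟩ := generator_bounds hα hδ hδ' hσ hA hθ0 hμ hθP
  -- the perturbation, decomposed into shells of harmonics
  obtain ⟨s1, s2, s3, s4⟩ := shell_estimate hσ hreg hVG hK0 (by linarith) hθK
  have hτ0 := angleWidth_pos hσ (zero_le_one (α := ℝ))
  have hw0 : actionWidth δ 0 = δ := by simp [actionWidth]
  have hV0 : actionNhd V δ ⊆ actionNhd G δ := actionNhd_subset hVG δ
  have hh : DifferentiableOn ℂ h (actionNhd V δ) :=
    (hreg.analytic_h.mono hV0).differentiableOn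
  have hshell0 : shell K f 0 = 0 := by
    funext p
    simp [shell, fourierSum]
  have hεe : ‖(ε : ℂ)‖ₑ = ENNReal.ofReal ε := enorm_ofReal_complex hε
  obtain ⟨χ, hχ0, hχr, hχ, hχF, hχt, hv, hv0, ⟨U, hU, hUc, hs⟩, o1, o2, o3, o4⟩ :=
    exists_normalForm_flow (φ := fun l p => (ε : ℂ) * shell K f l p) (F := fun p => ε * f p)
      (A := ε * F) hδ hσ hα hh hV (by funext p; simp [hshell0])
      (fun l => (isFourier_const_mul hτ0 (s1 l) (ε : ℂ)).1) (fun l => (s2 l).const_mul (ε : ℂ))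
      hA hθ2 hμ (by
        calc _ ≤ ∑' l, ENNReal.ofReal ε * (ENNReal.ofReal (θ ^ l) *
              levelNorm V δ σ 0 (shell K f l)) := by
              refine ENNReal.tsum_le_tsum fun l => ?_
              rw [ENNReal.ofReal_pow hθ0, mul_left_comm, ← hεe]
              exact mul_le_mul' le_rfl (isFourier_const_mul hτ0 (s1 l) (ε : ℂ)).2
          _ ≤ _ := by
              rw [ENNReal.tsum_mul_left, mul_assoc, mul_comm F, ENNReal.ofReal_mul hε]
              exact mul_le_mul' le_rfl s3)
      hn1 hn2 (fun p hp => (s4 p hp).mul_left (ε : ℂ))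
  have hdom : domain V (3 / 4 * δ) (3 / 4 * σ) = levelDomain V δ σ 1 := by
    rw [levelDomain, actionWidth, angleWidth]
    congr 1 <;> ring
  have hred : reducedDomain V (3 / 4 * δ) (3 / 4 * σ) = levelReduced V δ σ 1 := by
    rw [levelReduced, actionWidth, angleWidth]
    congr 1 <;> ring
  have hw1 : actionWidth δ 1 = 3 / 4 * δ := by rw [actionWidth]; ring
  have ha1 : angleWidth σ 1 = 3 / 4 * σ := by rw [angleWidth]; ring
  have hτ1 := angleWidth_pos hσ (le_refl (1 : ℝ))
  have hsub : levelDomain V δ σ 1 ⊆ levelDomain V δ σ (3 / 4) :=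
    levelDomain_anti hδ hσ (by norm_num)
  have hper : ∀ s, IsAnglePeriodic (χ s) := by
    intro s
    have hz : IsAnglePeriodic (0 : Reduced n → ℂ) := fun _ _ => rfl
    rcases Nat.eq_zero_or_pos s with rfl | hs1
    · rw [hχ0]; exact hz
    · rcases le_or_gt s r with hsr | hsr
      · rw [hχ s hs1 hsr]; exact isAnglePeriodic_fourierSum _
      · rw [hχr s hsr]; exact hz
  obtain ⟨C', c1, c2, c3, c4, c5, c6⟩ := exists_canonical_inverse hδ hσ hχr
    (fun j => (hχF j).differentiableOn) hper hv hv0 hU hs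
  obtain ⟨R, r1, r2, r3⟩ := exists_remainder hσ o1 (by linarith) o2 r
  have hclose : ∀ v : Phase n, IsSmall δ σ U v →
      ‖v‖ ≤ 42 * Real.exp 1 * bracketConst δ σ * (1 / α) * F * ε := by
    intro v hv
    refine (hv.norm_le hδ hδ' hσ hσ').trans (hUc.trans ?_)
    calc _ ≤ 21 / 4 * Real.exp 1 * bracketConst δ σ * (1 / α) * (ε * F * 8) := by gcongr
      _ = _ := by ring
  have hδU : δ / 4 * U ≤ δ / 8 := by nlinarith
  have hσU : 9 / 20 * σ * U ≤ σ / 8 := by nlinarith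
  have hCU : ∀ z ∈ levelDomain V δ σ 1, IsSmall δ σ U (flow χ (1, z) - z) := fun z hz =>
    (hs z (hsub hz)).2
  have hτ' := angleWidth_pos hσ (show (3 / 4 : ℝ) ≤ 1 by norm_num)
  have hwδ : actionWidth δ (3 / 4) ≤ δ := by rw [actionWidth]; linarith
  rw [← hdom] at c1 c2 c3 c4 c5 c6 hCU o4
  rw [hw1, ha1] at o3
  rw [← hred] at r3
  refine ⟨fun z => flow χ (1, z), C', χ, fun p => ∑ s ∈ Finset.range r,
    orderTerm h μ (fun l p => (ε : ℂ) * shell K f l p) χ (s + 1) p, R, c1, c2, c3, c4,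
    fun hhr hfr z hz hzr => ?_, fun z hz => ⟨hclose _ (hCU z hz), hclose _ (c5 z hz)⟩,
    subset_image_of_isSmall (by linarith) (by linarith) c5 c4 (by linarith) (by linarith),
    image_subset_of_isSmall hCU (by linarith) (by linarith),
    subset_image_of_isSmall (by linarith) (by linarith) hCU c3 (by linarith) (by linarith),
    image_subset_of_isSmall c5 (by linarith) (by linarith), fun s _ _ => ?_, hχr, fun z hz => ?_,
    fun z hz => ?_, ?_, ?_, ?_⟩
  · have e1 : ∀ I ∈ actionNhd V (actionWidth δ (3 / 4)), (∀ i, (I i).im = 0) → (h I).im = 0 :=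
      fun I hI hIr => im_eq_zero_of_real hG hVG hh hhr (actionNhd_mono V hwδ hI) hIr
    have e2 : IsRealOn (levelReduced V δ σ (3 / 4)) f := fun p hp =>
      isRealOn_of_isRegular hG hVG hσ hreg hfr p (reducedDomain_mono V hwδ le_rfl hp)
    have e3 := isRealOn_generators hτ' hM (Complex.ofReal_im μ) e1
      (fun l p hp hpr => im_mul_eq_zero (Complex.ofReal_im ε) (isRealOn_shell hτ' e2 K l p hp hpr))
      hχ0 hχr hχ
    have e4 : ∀ z ∈ levelDomain V δ σ (3 / 4), IsRealPoint z → IsRealPoint (flow χ (1, z)) := by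
      intro z hz hzr
      have := flow_real (t := 1) e3 hz hzr (by simpa using (hs z hz).1)
      simpa using this
    rw [hdom] at hz
    exact ⟨e4 z (hsub hz) hzr, c6 e4 z (by rwa [hdom]) hzr⟩
  · rw [← hw1, ← ha1]
    exact ((hχF s).anti hδ hσ (by norm_num)).hasHarmonicsIn fun k hk p hp =>
      ((hχt s).anti hδ hσ (by norm_num) le_rfl).fourierCoefficient_eq_zero hτ1 (not_lt.1 hk) hp
  · rw [hdom] at hz
    have := (hs z (hsub hz)).1
    simp only [one_pow, one_smul] at this
    simp only [lieOperator_eq_fieldOperator]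
    exact this
  · have e1 := o4 z hz
    have e2 := r3 (reduce z) (reduce_mem hz)
    have e3 := ((hasSum_nat_add_iff' r).2 e1).unique e2
    simp only [hamiltonian]
    rw [← e3]
    ring
  · exact hasHarmonicsIn_finset_sum _ fun s hsr => o3 (s + 1) (by omega) (Finset.mem_range.1 hsr)
  · rw [hred]
    exact analyticOnNhd_of_differentiableOn (isOpen_reducedDomain _ _ _) r1.differentiableOn
  · rw [← hw1, ← ha1]
    refine r2.trans (ENNReal.ofReal_le_ofReal (le_of_eq ?_))
    have e1 : θ⁻¹ = Δ := inv_inv Δ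
    have e2 : θ * Δ = 1 := inv_mul_cancel₀ hΔ0.ne'
    rw [e1, pow_succ]
    calc _ = 8 * ε * F * Δ ^ r * (θ * Δ) := by ring
      _ = _ := by rw [e2, mul_one]
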